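/- Let $M$ be a smooth manifold and $\mathcal F$ a singular foliation on $M$, i.e. a locally finitely generated, involutive $C^\infty_M$-submodule of the sheaf of smooth vector fields on $M$. For a $C^\infty_M$-module $\mathcal G$ of vector fields, a time-dependent element of $\mathcal G$ is a map $X\colon[0,1]\to\mathcal G(M)$ which is smooth for the coefficient diffeology: near every $(t_0,x_0)\in[0,1]\times M$ it has the form $X(t)_y=\sum_{i=1}^m c^i(t,y)\,(X_i)_y$ with smooth functions $c^i$ and sections $X_i$ of $\mathcal G$. Its flow is denoted by $\Phi_X^t$ (where it exists). An $\mathcal F$-path is a pair $(X,p)$ of a time-dependent element $X$ of $\mathcal F$ and an integral curve $p\colon[0,1]\to M$ of $X$; let $\mathcal P(\mathcal F)$ be the set of $\mathcal F$-paths. For $x\in M$ let $I_x\mathcal F$ be the module generated by the products $fY$, with $f$ a smooth function vanishing at $x$ and $Y$ in $\mathcal F$. A slice through $x$ is an embedded submanifold $S\ni x$ of $M$ such that $T_yM=T_yS+T_yL_y$ for all $y\in S$, and $T_xS\cap T_xL_x=0$, where $L_y$ is the leaf through $y$, so that $T_yL_y=\{Y_y: Y\in\mathcal F(M)\}$. Choose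 a slice $S_x$ through every $x\in M$, and let $\mathcal F_{S_x}$ be the restriction of $\mathcal F$ to $S_x$, i.e. the vector fields on $S_x$ which locally extend to sections of $\mathcal F$. Let $\mathrm{Diff}_{\mathcal F}(S_x,S_y)$ be the set of germs at $x$ of foliation preserving diffeomorphisms $S_x\to S_y$ mapping $x$ to $y$, let $\exp(I_y\mathcal F_{S_y})$ be the group of germs at $y$ of diffeomorphisms of $S_y$ generated by the time-one flows of time-dependent elements of $I_y\mathcal F_{S_y}$, acting by composition, and let $$\mathrm{HT}:=\bigsqcup_{x,y\in M}\mathrm{Diff}_{\mathcal F}(S_x,S_y)/\exp(I_y\mathcal F_{S_y}).$$ Then the holonomy map $\mathrm{Hol}\colon\mathcal P(\mathcal F)\to\mathrm{HT}$ is well defined. That is, for every $\mathcal F$-path $(X,p)$: 1. there is a time-dependent element $Z$ of $I_{p(1)}\mathcal F$ such that $\Phi_Z^1\circ\Phi_X^1|_{S_{p(0)}}$ is well defined as a map into $S_{p(1)}$ in a neighbourhood of $p(0)$ in $S_{p(0)}$; 2. for every such $Z$, the germ of $\Phi_Z^1\circ\Phi_X^1|_{S_{p(0)}}$ at $p(0)$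 is an element of $\mathrm{Diff}_{\mathcal F}(S_{p(0)},S_{p(1)})$; 3. the class of this germ in $\mathrm{Diff}_{\mathcal F}(S_{p(0)},S_{p(1)})/\exp(I_{p(1)}\mathcal F_{S_{p(1)}})\subset\mathrm{HT}$ does not depend on the choice of $Z$. Consequently there is exactly one map $\mathrm{Hol}\colon\mathcal P(\mathcal F)\to\mathrm{HT}$ which sends every $(X,p)$ to the class of $\Phi_Z^1\circ\Phi_X^1|_{S_{p(0)}}$ for all $Z$ as in 1. -/

import Mathlib

open Set Filter Topology TopologicalSpace Manifold
open scoped ContDiff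

noncomputable section

/-- A (not necessarily continuous) vector field on a manifold of dimension `n`. -/
abbrev VField (n : ℕ) (M : Type*) [TopologicalSpace M]
    [ChartedSpace (EuclideanSpace ℝ (Fin n)) M] : Type _ :=
  ∀ x : M, TangentSpace (𝓡 n) x

/-- `X` is a smooth vector field on the set `U`. -/
def SmoothVFieldOn {n : ℕ} {M : Type*} [TopologicalSpace M]
    [ChartedSpace (EuclideanSpace ℝ (Fin n)) M] [IsManifold (𝓡 n) ∞ M]
    (X : VField n M) (U : Set M) : Prop :=
  ContMDiffOn (𝓡 n) (𝓡 n).tangent ∞ (fun x => (⟨x, X x⟩ : TangentBundle (𝓡 n) M)) U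

/-- `f` is a smooth real function on the set `U`. -/
def SmoothFunOn (n : ℕ) {M : Type*} [TopologicalSpace M]
    [ChartedSpace (EuclideanSpace ℝ (Fin n)) M] (f : M → ℝ) (U : Set M) : Prop :=
  ContMDiffOn (𝓡 n) 𝓘(ℝ, ℝ) ∞ f U

/-- A sheaf of `C^∞`-submodules of the sheaf of smooth vector fields on `M`. A section over an open
set `U` is represented by a vector field on `M` whose values outside `U` are irrelevant (`congr`). -/
structure VFSheaf (n : ℕ) (M : Type*) [TopologicalSpace M]
    [ChartedSpace (EuclideanSpace ℝ (Fin n)) M] [IsManifold (𝓡 n) ∞ M] where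
  /-- the sections over an open set -/
  sections : Opens M → Set (VField n M)
  smooth : ∀ U : Opens M, ∀ X ∈ sections U, SmoothVFieldOn X (U : Set M)
  congr : ∀ U : Opens M, ∀ X ∈ sections U, ∀ Y : VField n M, (∀ x ∈ U, Y x = X x) → Y ∈ sections U
  zero_mem : ∀ U : Opens M, (0 : VField n M) ∈ sections U
  add_mem : ∀ U : Opens M, ∀ X ∈ sections U, ∀ Y ∈ sections U, X + Y ∈ sections U
  smul_mem : ∀ U : Opens M, ∀ f : M → ℝ, SmoothFunOn n f (U : Set M) → ∀ X ∈ sections U,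
    (fun x => f x • X x) ∈ sections U
  restrict : ∀ U V : Opens M, V ≤ U → sections U ⊆ sections V
  glue : ∀ (U : Opens M) (X : VField n M),
    (∀ x ∈ U, ∃ V : Opens M, x ∈ V ∧ V ≤ U ∧ X ∈ sections V) → X ∈ sections U

/-- A singular foliation: a locally finitely generated, involutive submodule of the sheaf of
vector fields. -/
structure SingularFoliation (n : ℕ) (M : Type*) [TopologicalSpace M]
    [ChartedSpace (EuclideanSpace ℝ (Fin n)) M] [IsManifold (𝓡 n) ∞ M] extends VFSheaf n M where
  locally_fg : ∀ x : M, ∃ U : Opens M, x ∈ U ∧ ∃ (m : ℕ) (X : Fin m → VField n M),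
    (∀ i, X i ∈ sections U) ∧
    ∀ Y ∈ sections U, ∃ c : Fin m → M → ℝ, (∀ i, SmoothFunOn n (c i) (U : Set M)) ∧
      ∀ y ∈ U, Y y = ∑ i, c i y • X i y
  involutive : ∀ U : Opens M, ∀ X ∈ sections U, ∀ Y ∈ sections U,
    VectorField.mlieBracket (𝓡 n) X Y ∈ sections U

section Sheaves

variable {n : ℕ} {M : Type*} [TopologicalSpace M]
    [ChartedSpace (EuclideanSpace ℝ (Fin n)) M] [IsManifold (𝓡 n) ∞ M]

theorem VFSheaf.sum_mem (F : VFSheaf n M) (U : Opens M) {m : ℕ} (f : Fin m → M → ℝ)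
    (X : Fin m → VField n M) (hf : ∀ i, SmoothFunOn n (f i) (U : Set M))
    (hX : ∀ i, X i ∈ F.sections U) : (fun x => ∑ i, f i x • X i x) ∈ F.sections U := by
  induction m with
  | zero => exact F.congr U 0 (F.zero_mem U) _ (by simp)
  | succ m ih =>
    have h1 := ih (fun i => f i.castSucc) (fun i => X i.castSucc) (fun i => hf _) (fun i => hX _)
    have h2 := F.smul_mem U _ (hf (Fin.last m)) _ (hX (Fin.last m))
    refine F.congr U _ (F.add_mem U _ h1 _ h2) _ ?_
    intro x _
    rw [Fin.sum_univ_castSucc]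
    rfl

/-- The sheaf `I_x F`: vector fields which are locally finite sums `∑ fᵢ Yᵢ`, with `fᵢ` smooth
functions vanishing at `x` and `Yᵢ` sections of `F`. -/
def VFSheaf.vanishing (F : VFSheaf n M) (x : M) : VFSheaf n M where
  sections U := {X | ∀ y ∈ U, ∃ V : Opens M, y ∈ V ∧ V ≤ U ∧
    ∃ (m : ℕ) (f : Fin m → M → ℝ) (Y : Fin m → VField n M),
      (∀ i, SmoothFunOn n (f i) (V : Set M) ∧ (x ∈ V → f i x = 0) ∧ Y i ∈ F.sections V) ∧
      ∀ z ∈ V, X z = ∑ i, f i z • Y i z}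
  smooth U X hX := by
    refine F.smooth U X (F.glue U X fun y hy => ?_)
    obtain ⟨V, hyV, hVU, m, f, Y, h, hs⟩ := hX y hy
    exact ⟨V, hyV, hVU, F.congr V _ (F.sum_mem V f Y (fun i => (h i).1) fun i => (h i).2.2) _ hs⟩
  congr U X hX Y hYX y hy := by
    obtain ⟨V, hyV, hVU, m, f, Z, h, hs⟩ := hX y hy
    exact ⟨V, hyV, hVU, m, f, Z, h, fun z hz => (hYX z (hVU hz)).trans (hs z hz)⟩
  zero_mem U y hy := ⟨U, hy, le_rfl, 0, Fin.elim0, Fin.elim0, fun i => i.elim0, by simp⟩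
  add_mem U X hX X' hX' y hy := by
    obtain ⟨V, hyV, hVU, m, f, Y, h, hs⟩ := hX y hy
    obtain ⟨V', hyV', hVU', m', f', Y', h', hs'⟩ := hX' y hy
    refine ⟨V ⊓ V', ⟨hyV, hyV'⟩, inf_le_left.trans hVU, m + m', Fin.addCases f f',
      Fin.addCases Y Y', ?_, ?_⟩
    · intro i
      refine Fin.addCases (fun i => ?_) (fun i => ?_) i
      · simp only [Fin.addCases_left]
        exact ⟨(h i).1.mono fun _ hz => hz.1, fun hx => (h i).2.1 hx.1,
          F.restrict V _ inf_le_left (h i).2.2⟩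
      · simp only [Fin.addCases_right]
        exact ⟨(h' i).1.mono fun _ hz => hz.2, fun hx => (h' i).2.1 hx.2,
          F.restrict V' _ inf_le_right (h' i).2.2⟩
    · intro z hz
      simp only [Fin.sum_univ_add, Fin.addCases_left, Fin.addCases_right]
      rw [← hs z hz.1, ← hs' z hz.2]
      rfl
  smul_mem U g hg X hX y hy := by
    obtain ⟨V, hyV, hVU, m, f, Y, h, hs⟩ := hX y hy
    refine ⟨V, hyV, hVU, m, fun i z => g z * f i z, Y, fun i => ⟨?_, ?_, (h i).2.2⟩, ?_⟩
    · exact ContMDiffOn.mul (ContMDiffOn.mono hg hVU) (h i).1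
    · intro hx
      simp [(h i).2.1 hx]
    · intro z hz
      simp only [hs z hz, Finset.smul_sum, mul_smul]
  restrict U V hVU X hX y hy := by
    obtain ⟨W, hyW, hWU, m, f, Y, h, hs⟩ := hX y (hVU hy)
    exact ⟨W ⊓ V, ⟨hyW, hy⟩, inf_le_right, m, f, Y, fun i => ⟨(h i).1.mono fun _ hz => hz.1,
      fun hx => (h i).2.1 hx.1, F.restrict W _ inf_le_left (h i).2.2⟩, fun z hz => hs z hz.1⟩
  glue U X hX y hy := by
    obtain ⟨V, hyV, hVU, h⟩ := hX y hy
    obtain ⟨W, hyW, hWV, h'⟩ := h y hyV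
    exact ⟨W, hyW, hWV.trans hVU, h'⟩

/-- The pullback of `F` along `ι : N → M`: the vector fields `Y` on `N` such that `dι ∘ Y` is
locally a finite sum `∑ gᵢ • (Xᵢ ∘ ι)` with `gᵢ` smooth on `N` and `Xᵢ` sections of `F`. When `ι` is
the inclusion of an embedded submanifold this is the restriction of `F` to the submanifold: the
vector fields on it which locally extend to sections of `F`. -/
def VFSheaf.pullback (F : VFSheaf n M) (k : ℕ) {N : Type*} [TopologicalSpace N]
    [ChartedSpace (EuclideanSpace ℝ (Fin k)) N] [IsManifold (𝓡 k) ∞ N] (ι : N → M) :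
    VFSheaf k N where
  sections U := {Y | SmoothVFieldOn Y (U : Set N) ∧ ∀ y ∈ U, ∃ W : Opens N, y ∈ W ∧ W ≤ U ∧
    ∃ V : Opens M, MapsTo ι (W : Set N) (V : Set M) ∧
    ∃ (m : ℕ) (g : Fin m → N → ℝ) (X : Fin m → VField n M),
      (∀ i, SmoothFunOn k (g i) (W : Set N) ∧ X i ∈ F.sections V) ∧
      ∀ z ∈ W, mfderiv (𝓡 k) (𝓡 n) ι z (Y z) = ∑ i, g i z • X i (ι z)}
  smooth U X hX := hX.1
  congr U X hX Y hYX := by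
    refine ⟨hX.1.congr fun z hz => by simp [hYX z hz], fun y hy => ?_⟩
    obtain ⟨W, hyW, hWU, V, hV, m, g, Z, h, hs⟩ := hX.2 y hy
    exact ⟨W, hyW, hWU, V, hV, m, g, Z, h, fun z hz => by rw [hYX z (hWU hz), hs z hz]⟩
  zero_mem U := by
    refine ⟨(Bundle.contMDiff_zeroSection ℝ (TangentSpace (𝓡 k) : N → Type _)).contMDiffOn,
      fun y hy => ⟨U, hy, le_rfl, ⊤, fun _ _ => trivial, 0, Fin.elim0, Fin.elim0,
        fun i => i.elim0, by simp⟩⟩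
  add_mem U X hX X' hX' := by
    refine ⟨ContMDiffOn.add_section hX.1 hX'.1, fun y hy => ?_⟩
    obtain ⟨W, hyW, hWU, V, hV, m, g, Z, h, hs⟩ := hX.2 y hy
    obtain ⟨W', hyW', hWU', V', hV', m', g', Z', h', hs'⟩ := hX'.2 y hy
    refine ⟨W ⊓ W', ⟨hyW, hyW'⟩, inf_le_left.trans hWU, V ⊓ V',
      fun z hz => ⟨hV hz.1, hV' hz.2⟩, m + m', Fin.addCases g g', Fin.addCases Z Z', ?_, ?_⟩
    · intro i
      refine Fin.addCases (fun i => ?_) (fun i => ?_) i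
      · simp only [Fin.addCases_left]
        exact ⟨(h i).1.mono fun _ hz => hz.1, F.restrict V _ inf_le_left (h i).2⟩
      · simp only [Fin.addCases_right]
        exact ⟨(h' i).1.mono fun _ hz => hz.2, F.restrict V' _ inf_le_right (h' i).2⟩
    · intro z hz
      simp only [Fin.sum_univ_add, Fin.addCases_left, Fin.addCases_right]
      rw [← hs z hz.1, ← hs' z hz.2]
      exact map_add _ _ _
  smul_mem U f hf X hX := by
    refine ⟨ContMDiffOn.smul_section hf hX.1, fun y hy => ?_⟩
    obtain ⟨W, hyW, hWU, V, hV, m, g, Z, h, hs⟩ := hX.2 y hy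
    refine ⟨W, hyW, hWU, V, hV, m, fun i z => f z * g i z, Z, fun i => ⟨?_, (h i).2⟩, ?_⟩
    · exact ContMDiffOn.mul (ContMDiffOn.mono hf hWU) (h i).1
    · intro z hz
      have := hs z hz
      simp only [map_smul, this, Finset.smul_sum, mul_smul]
  restrict U V hVU X hX := by
    refine ⟨hX.1.mono hVU, fun y hy => ?_⟩
    obtain ⟨W, hyW, hWU, V', hV', m, g, Z, h, hs⟩ := hX.2 y (hVU hy)
    exact ⟨W ⊓ V, ⟨hyW, hy⟩, inf_le_right, V', fun z hz => hV' hz.1, m, g, Z,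
      fun i => ⟨(h i).1.mono fun _ hz => hz.1, (h i).2⟩, fun z hz => hs z hz.1⟩
  glue U X hX := by
    refine ⟨fun y hy => ?_, fun y hy => ?_⟩
    · obtain ⟨V, hyV, hVU, h⟩ := hX y hy
      exact ((h.1 y hyV).contMDiffAt (V.isOpen.mem_nhds hyV)).contMDiffWithinAt
    · obtain ⟨V, hyV, hVU, h⟩ := hX y hy
      obtain ⟨W, hyW, hWV, h'⟩ := h.2 y hyV
      exact ⟨W, hyW, hWV.trans hVU, h'⟩

/-- The tangent space at `x` of the leaf through `x`: the values at `x` of the elements of `F`. -/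
def VFSheaf.leafTangent (F : VFSheaf n M) (x : M) : Submodule ℝ (TangentSpace (𝓡 n) x) where
  carrier := {v | ∃ X ∈ F.sections ⊤, X x = v}
  zero_mem' := ⟨0, F.zero_mem ⊤, rfl⟩
  add_mem' := by
    rintro _ _ ⟨X, hX, rfl⟩ ⟨Y, hY, rfl⟩
    exact ⟨X + Y, F.add_mem ⊤ X hX Y hY, rfl⟩
  smul_mem' := by
    rintro c _ ⟨X, hX, rfl⟩
    exact ⟨fun y => c • X y, F.smul_mem ⊤ (fun _ => c) contMDiffOn_const X hX, rfl⟩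

/-- A time-dependent element of `F`: a map `[0,1] → F(M)` which is smooth for the coefficient
diffeology, i.e. which locally in time and space is a finite sum `∑ cᵢ(t, y) Xᵢ(y)` with smooth
coefficients `cᵢ` and sections `Xᵢ` of `F`. -/
structure TimeDep (F : VFSheaf n M) where
  /-- the underlying time-dependent vector field -/
  toFun : unitInterval → VField n M
  mem : ∀ t, toFun t ∈ F.sections ⊤
  plot : ∀ (t₀ : unitInterval) (x₀ : M), ∃ J : Set ℝ, IsOpen J ∧ (t₀ : ℝ) ∈ J ∧
    ∃ V : Opens M, x₀ ∈ V ∧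
    ∃ (m : ℕ) (c : Fin m → ℝ × M → ℝ) (X : Fin m → VField n M),
      (∀ i, ContMDiffOn (𝓘(ℝ, ℝ).prod (𝓡 n)) 𝓘(ℝ, ℝ) ∞ (c i)
        ((J ∩ Icc 0 1) ×ˢ (V : Set M)) ∧ X i ∈ F.sections V) ∧
      ∀ t : unitInterval, (t : ℝ) ∈ J → ∀ y ∈ V, toFun t y = ∑ i, c i ((t : ℝ), y) • X i y

/-- `p : [0,1] → M` is an integral curve of the time-dependent vector field `X`:
`p'(t) = X(t)(p(t))` for all `t ∈ [0,1]` (one-sided derivatives at the end points). -/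
def IsIntegralCurveOf (X : unitInterval → VField n M) (p : unitInterval → M) : Prop :=
  ∀ t : unitInterval, HasMFDerivWithinAt 𝓘(ℝ, ℝ) (𝓡 n) (IccExtend zero_le_one p) (Icc 0 1) (t : ℝ)
    ((1 : ℝ →L[ℝ] ℝ).smulRight (X t (IccExtend zero_le_one p (t : ℝ))))

/-- The graph of the time-one flow `Φ¹_X` (a partial map): `y` is in its domain, and is mapped
to `z`. -/
def TimeOneFlow (X : unitInterval → VField n M) (y z : M) : Prop :=
  ∃ p : unitInterval → M, IsIntegralCurveOf X p ∧ p 0 = y ∧ p 1 = z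

/-- An `F`-path: a time-dependent element of `F` together with an integral curve of it. -/
structure FPath (F : VFSheaf n M) where
  /-- the time-dependent element -/
  X : TimeDep F
  /-- the integral curve -/
  p : unitInterval → M
  integral : IsIntegralCurveOf X.toFun p

/-- The source `p(0)` of an `F`-path. -/
def FPath.source {F : VFSheaf n M} (P : FPath F) : M := P.p 0

/-- The target `p(1)` of an `F`-path. -/
def FPath.target {F : VFSheaf n M} (P : FPath F) : M := P.p 1

end Sheaves

section Germs

/-- A map `M → N` which sends `x` to `y` and is a diffeomorphism from a neighbourhood of `x` onto a
neighbourhood of `y`. -/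
structure LocalDiffeo (m n : ℕ) {M N : Type*} [TopologicalSpace M]
    [ChartedSpace (EuclideanSpace ℝ (Fin m)) M] [TopologicalSpace N]
    [ChartedSpace (EuclideanSpace ℝ (Fin n)) N] (x : M) (y : N) where
  /-- the underlying map -/
  toFun : M → N
  isLocalDiffeo : IsLocalDiffeomorphAt (𝓡 m) (𝓡 n) ∞ toFun x
  map_base : toFun x = y

variable {l m n : ℕ} {L M N : Type*}
  [TopologicalSpace L] [ChartedSpace (EuclideanSpace ℝ (Fin l)) L]
  [TopologicalSpace M] [ChartedSpace (EuclideanSpace ℝ (Fin m)) M]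
  [TopologicalSpace N] [ChartedSpace (EuclideanSpace ℝ (Fin n)) N]

/-- Two local diffeomorphisms are equivalent when they agree near the base point. -/
def LocalDiffeo.germSetoid (m n : ℕ) {M N : Type*} [TopologicalSpace M]
    [ChartedSpace (EuclideanSpace ℝ (Fin m)) M] [TopologicalSpace N]
    [ChartedSpace (EuclideanSpace ℝ (Fin n)) N] (x : M) (y : N) :
    Setoid (LocalDiffeo m n x y) where
  r f g := f.toFun =ᶠ[𝓝 x] g.toFun
  iseqv := ⟨fun _ => EventuallyEq.rfl, EventuallyEq.symm, EventuallyEq.trans⟩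

/-- `Diff((M,x),(N,y))`: germs at `x` of diffeomorphisms `M → N` which map `x` to `y`. -/
def DiffGerm (m n : ℕ) {M N : Type*} [TopologicalSpace M]
    [ChartedSpace (EuclideanSpace ℝ (Fin m)) M] [TopologicalSpace N]
    [ChartedSpace (EuclideanSpace ℝ (Fin n)) N] (x : M) (y : N) : Type _ :=
  Quotient (LocalDiffeo.germSetoid m n x y)

/-- The germ of a local diffeomorphism. -/
def LocalDiffeo.germ {x : M} {y : N} (f : LocalDiffeo m n x y) : DiffGerm m n x y :=
  Quotient.mk _ f

/-- Composition of local diffeomorphisms. -/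
def LocalDiffeo.comp {x : L} {y : M} {z : N} (g : LocalDiffeo m n y z) (f : LocalDiffeo l m x y) :
    LocalDiffeo l n x z where
  toFun := g.toFun ∘ f.toFun
  isLocalDiffeo := f.isLocalDiffeo.comp (𝓡 n) N (by rw [f.map_base]; exact g.isLocalDiffeo)
  map_base := by simp [f.map_base, g.map_base]

theorem LocalDiffeo.tendsto {x : M} {y : N} (f : LocalDiffeo m n x y) :
    Tendsto f.toFun (𝓝 x) (𝓝 y) := by
  have := f.isLocalDiffeo.contMDiffAt.continuousAt
  rwa [ContinuousAt, f.map_base] at this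

/-- A local inverse of a local diffeomorphism. -/
def LocalDiffeo.inv {x : M} {y : N} (f : LocalDiffeo m n x y) : LocalDiffeo n m y x where
  toFun := f.isLocalDiffeo.localInverse
  isLocalDiffeo := by
    have := f.isLocalDiffeo.localInverse_isLocalDiffeomorphAt
    rwa [f.map_base] at this
  map_base := by
    have := f.isLocalDiffeo.localInverse_left_inv f.isLocalDiffeo.localInverse_mem_target
    rwa [f.map_base] at this

/-- The identity as a local diffeomorphism. -/
def LocalDiffeo.refl (x : M) : LocalDiffeo m m x x where
  toFun := id
  isLocalDiffeo := (Diffeomorph.refl (𝓡 m) M ∞).isLocalDiffeomorph x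
  map_base := rfl

/-- Composition of germs of diffeomorphisms. -/
def DiffGerm.comp {x : L} {y : M} {z : N} :
    DiffGerm m n y z → DiffGerm l m x y → DiffGerm l n x z :=
  Quotient.map₂ LocalDiffeo.comp (by
    intro g g' hg f f' hf
    have h1 : ∀ᶠ u in 𝓝 x, g.toFun (f.toFun u) = g'.toFun (f.toFun u) := f.tendsto.eventually hg
    have h2 : ∀ᶠ u in 𝓝 x, f.toFun u = f'.toFun u := hf
    show ∀ᶠ u in 𝓝 x, g.toFun (f.toFun u) = g'.toFun (f'.toFun u)
    filter_upwards [h1, h2] with u hu hu'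
    rw [hu, hu'])

theorem LocalDiffeo.inv_left {x : M} {y : N} (f : LocalDiffeo m n x y) :
    ∀ᶠ u in 𝓝 x, f.inv.toFun (f.toFun u) = u :=
  f.isLocalDiffeo.localInverse_eventuallyEq_left

theorem LocalDiffeo.inv_right {x : M} {y : N} (f : LocalDiffeo m n x y) :
    ∀ᶠ u in 𝓝 y, f.toFun (f.inv.toFun u) = u := by
  have := f.isLocalDiffeo.localInverse_eventuallyEq_right
  rw [f.map_base] at this
  exact this

/-- The group of germs at `x` of diffeomorphisms of `M` fixing `x`. -/
instance DiffGerm.instGroup (x : M) : Group (DiffGerm m m x x) where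
  mul := DiffGerm.comp
  one := (LocalDiffeo.refl x).germ
  inv := Quotient.map LocalDiffeo.inv (by
    intro f g hfg
    have h0 : ∀ᶠ u in 𝓝 x, f.toFun u = g.toFun u := hfg
    have h1 := f.inv.tendsto.eventually h0
    have h2 := f.inv.tendsto.eventually g.inv_left
    show ∀ᶠ u in 𝓝 x, f.inv.toFun u = g.inv.toFun u
    filter_upwards [h1, h2, f.inv_right] with u hu hu' hu''
    rw [← hu', ← hu, hu''])
  mul_assoc a b c := by
    induction a using Quotient.inductionOn
    induction b using Quotient.inductionOn
    induction c using Quotient.inductionOn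
    rfl
  one_mul a := by
    induction a using Quotient.inductionOn
    rfl
  mul_one a := by
    induction a using Quotient.inductionOn
    rfl
  inv_mul_cancel a := by
    induction a using Quotient.inductionOn
    rename_i f
    exact Quotient.sound f.inv_left

/-- The group of germs at `y` acts by composition on germs of diffeomorphisms with target `y`. -/
instance DiffGerm.instMulAction (x : M) (y : N) :
    MulAction (DiffGerm n n y y) (DiffGerm m n x y) where
  smul := DiffGerm.comp
  one_smul a := by
    induction a using Quotient.inductionOn
    rfl
  mul_smul a b c := by
    induction a using Quotient.inductionOn
    induction b using Quotient.inductionOn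
    induction c using Quotient.inductionOn
    rfl

variable [IsManifold (𝓡 m) ∞ M] [IsManifold (𝓡 n) ∞ N]

/-- The germ `g` preserves the given sheaves of vector fields: it has a representative, a
diffeomorphism `Φ` between open neighbourhoods of `x` and `y`, such that the sections of `G` over
the open subsets of the target of `Φ` are exactly the vector fields whose `Φ`-pullbacks are sections
of `F`. -/
def DiffGerm.Preserves (F : VFSheaf m M) (G : VFSheaf n N) {x : M} {y : N}
    (g : DiffGerm m n x y) : Prop :=
  ∃ (f : LocalDiffeo m n x y) (Φ : PartialDiffeomorph (𝓡 m) (𝓡 n) M N ∞),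
    f.germ = g ∧ x ∈ Φ.source ∧ EqOn f.toFun Φ Φ.source ∧
    ∀ (U : Opens M) (V : Opens N), (V : Set N) ⊆ Φ.target →
      (U : Set M) = Φ.source ∩ Φ ⁻¹' (V : Set N) →
      ∀ Y : VField n N, Y ∈ G.sections V ↔
        VectorField.mpullback (𝓡 m) (𝓡 n) Φ Y ∈ F.sections U

/-- `exp(I_x F)`: the subgroup of germs of diffeomorphisms generated by the time-one flows of
time-dependent elements of `I_x F`. -/
def expGroup (F : VFSheaf m M) (x : M) : Subgroup (DiffGerm m m x x) :=
  Subgroup.closure {g | ∃ (Y : TimeDep (F.vanishing x)) (f : LocalDiffeo m m x x),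
    f.germ = g ∧ ∀ᶠ u in 𝓝 x, TimeOneFlow Y.toFun u (f.toFun u)}

end Germs

section Holonomy

variable {n : ℕ} {M : Type*} [TopologicalSpace M]
    [ChartedSpace (EuclideanSpace ℝ (Fin n)) M] [IsManifold (𝓡 n) ∞ M]

/-- A slice through `x`: an embedded submanifold containing `x`, transverse at all of its points `y`
to the leaf through `y`, and of complementary dimension to the leaf at `x`. -/
structure Slice (F : SingularFoliation n M) (x : M) where
  /-- the underlying set -/
  carrier : Set M
  /-- the dimension -/
  dim : ℕ
  /-- the atlas -/
  charted : ChartedSpace (EuclideanSpace ℝ (Fin dim)) carrier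
  isManifold : IsManifold (𝓡 dim) ∞ carrier
  embedded : IsSmoothEmbedding (𝓡 dim) (𝓡 n) ∞ (Subtype.val : carrier → M)
  mem : x ∈ carrier
  transverse : ∀ y : carrier,
    (mfderiv (𝓡 dim) (𝓡 n) (Subtype.val : carrier → M) y).range ⊔ F.leafTangent (y : M) = ⊤
  complementary :
    (mfderiv (𝓡 dim) (𝓡 n) (Subtype.val : carrier → M) ⟨x, mem⟩).range ⊓ F.leafTangent x = ⊥

variable {F : SingularFoliation n M}

instance Slice.instChartedSpace {x : M} (S : Slice F x) :
    ChartedSpace (EuclideanSpace ℝ (Fin S.dim)) S.carrier := S.charted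

instance Slice.instIsManifold {x : M} (S : Slice F x) :
    IsManifold (𝓡 S.dim) ∞ S.carrier := S.isManifold

/-- The point `x` of a slice through `x`. -/
def Slice.base {x : M} (S : Slice F x) : S.carrier := ⟨x, S.mem⟩

/-- The foliation induced on a slice. -/
def Slice.foliation {x : M} (S : Slice F x) : VFSheaf S.dim S.carrier :=
  F.toVFSheaf.pullback S.dim (Subtype.val : S.carrier → M)

/-- `Diff_F(S_x, S_y)`: the germs of foliation preserving diffeomorphisms `S_x → S_y` which map `x`
to `y`. -/
def FolDiff {x y : M} (S : Slice F x) (S' : Slice F y) : Type _ :=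
  {g : DiffGerm S.dim S'.dim S.base S'.base // g.Preserves S.foliation S'.foliation}

/-- The orbit relation on `Diff_F(S_x, S_y)` of the action of `exp(I_y F_{S_y})` by composition. -/
def FolDiff.setoid {x y : M} (S : Slice F x) (S' : Slice F y) : Setoid (FolDiff S S') :=
  (MulAction.orbitRel (expGroup S'.foliation S'.base)
    (DiffGerm S.dim S'.dim S.base S'.base)).comap Subtype.val

/-- The holonomy transformation groupoid, as a set: the disjoint union over `x, y` of the quotients
`Diff_F(S_x, S_y) / exp(I_y F_{S_y})`. -/
def HT (S : ∀ x : M, Slice F x) : Type _ :=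
  Σ x y : M, Quotient (FolDiff.setoid (S x) (S y))

/-- The holonomy transformation represented by a germ. -/
def FolDiff.toHT (S : ∀ x : M, Slice F x) {x y : M} (g : FolDiff (S x) (S y)) : HT S :=
  ⟨x, y, Quotient.mk _ g⟩

/-- `Φ¹_Z ∘ Φ¹_X` is well defined as a map `S_{p(0)} → S_{p(1)}` in a neighbourhood of `p(0)`
in `S_{p(0)}`. -/
def Corrects (S : ∀ x : M, Slice F x) (P : FPath F.toVFSheaf)
    (Z : TimeDep (F.vanishing P.target)) : Prop :=
  ∀ᶠ s : (S P.source).carrier in 𝓝 (S P.source).base, ∃ y z : M,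
    TimeOneFlow P.X.toFun (s : M) y ∧ TimeOneFlow Z.toFun y z ∧ z ∈ (S P.target).carrier

/-- `g` is the germ at `p(0)` of `Φ¹_Z ∘ Φ¹_X` restricted to the slice `S_{p(0)}`. -/
def Represents (S : ∀ x : M, Slice F x) (P : FPath F.toVFSheaf)
    (Z : TimeDep (F.vanishing P.target)) (g : FolDiff (S P.source) (S P.target)) : Prop :=
  ∃ f : LocalDiffeo (S P.source).dim (S P.target).dim (S P.source).base (S P.target).base,
    f.germ = g.val ∧ ∀ᶠ s : (S P.source).carrier in 𝓝 (S P.source).base, ∃ y : M,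
      TimeOneFlow P.X.toFun (s : M) y ∧ TimeOneFlow Z.toFun y (f.toFun s : M)

end Holonomy

end

/-! The flow of `X` along `p` is, near `p(0)`, a local diffeomorphism `θ` preserving `F`, but it
carries the slice at `p(0)` to a submanifold which is only transverse to the leaf at `y = p(1)`. The
tool for comparing this image with the slice `S` at `y` is a projection `pr` onto `S` along the
leaves, defined near `y` (`Slice.exists_sliceProjection`). It inverts the map `(s, a) ↦ exp(∑ aᵢ
Xᵢ)(s)`, with `s` in the slice and `a` running through coefficients which represent the leaf tangent
at `y`. Flows of elements of `F` preserve `F`, so the generators project to combinations of vector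
fields `Y k` in `F_S`. The kernel of the derivative of `pr` at `y` is the leaf tangent, hence `pr ∘
θ` restricts to a local diffeomorphism between the slices.

Existence of `Z`: a point `z` near `y` is joined to `pr z` by an integral curve of a combination of
generators whose coefficients depend on `z` and vanish for `z = y`. Along the curve `pr` is
constant, and for `z = θ s` the point `s` is recovered from `pr z`; so all these curves are integral
curves of a single autonomous field in `I_y F` (`SliceProjection.exists_correction`).

The germ: if the flow `η` of `Z` brings `θ(S_{p(0)})` into `S`, then `η ∘ θ` agrees on the slice
with `pr ∘ η ∘ θ`, a local diffeomorphism. It preserves the induced foliations because it is the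
restriction of a map preserving `F` (`existsUnique_represents`).

Independence: with `η t` the flow of `Z` up to time `t`, the germs `f t = pr ∘ η t ∘ θ` join `pr ∘
θ`, which does not involve `Z`, to the germ in question. For `t` near `t₀` the germ `f t ∘ (f t₀)⁻¹`
is the time-one flow of a time-dependent element of `I_y F_S`: the projected curves have velocity `∑
C k • Y k` with `C k` vanishing at `y`, and Hadamard's lemma turns `C k` into a combination of slice
coordinates centred at the base point (`SliceProjection.exists_timeDep`). Connectedness of `[0,1]`
puts `f 0` and `f 1` into one orbit (`SliceProjection.germ_mem_orbit`).

The analysis underneath consists of the smooth dependence of flows on time and initial point,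
obtained from the inverse function theorem on a space of curves (`exists_smooth_local_flow`), and
the invariance of `F` under its flows, which reduces to uniqueness for a linear differential
equation (`exists_flow_transport`). -/

/-! ### Smooth inverse function theorem in Banach spaces. -/

section InverseFunction

/-- The inverse function theorem for smooth maps, with a smooth inverse on the whole target. -/
theorem ContDiffOn.exists_openPartialHomeomorph {E F : Type*} [NormedAddCommGroup E]
    [NormedSpace ℝ E] [NormedAddCommGroup F] [NormedSpace ℝ F] [CompleteSpace E]
    {f : E → F} {U : Set E} (hU : IsOpen U) (hf : ContDiffOn ℝ ∞ f U) {a : E} (ha : a ∈ U)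
    (f' : E ≃L[ℝ] F) (hf' : HasFDerivAt f (f' : E →L[ℝ] F) a) :
    ∃ e : OpenPartialHomeomorph E F, a ∈ e.source ∧ e.source ⊆ U ∧ (e : E → F) = f ∧
      ContDiffOn ℝ ∞ e.symm e.target := by
  have hfa : ContDiffAt ℝ ∞ f a := hf.contDiffAt (hU.mem_nhds ha)
  -- The local inverse is smooth at images of points where the derivative is invertible. This is an
  -- open condition; `W` consists of such points and the homeomorphism is cut down to it.
  have hop : ∃ W : Set E, IsOpen W ∧ a ∈ W ∧ W ⊆ U ∧
      ∀ x ∈ W, ∃ g : E ≃L[ℝ] F, HasFDerivAt f (g : E →L[ℝ] F) x := by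
    have h1 : ∀ᶠ x in 𝓝 a, fderiv ℝ f x ∈ range ((↑) : (E ≃L[ℝ] F) → E →L[ℝ] F) := by
      have hc : ContinuousAt (fderiv ℝ f) a :=
        (hfa.fderiv_right (m := 0) (by simp)).continuousAt
      apply hc
      rw [hf'.fderiv]
      exact ContinuousLinearEquiv.nhds f'
    have h2 : ∀ᶠ x in 𝓝 a, x ∈ U := hU.mem_nhds ha
    obtain ⟨W, hW, hWo, haW⟩ := eventually_nhds_iff.1 (h1.and h2)
    refine ⟨W, hWo, haW, fun x hx => (hW x hx).2, fun x hx => ?_⟩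
    obtain ⟨g, hg⟩ := (hW x hx).1
    refine ⟨g, ?_⟩
    rw [hg]
    exact ((hf.contDiffAt (hU.mem_nhds (hW x hx).2)).differentiableAt (by simp)).hasFDerivAt
  obtain ⟨W, hWo, haW, hWU, hW⟩ := hop
  set e := hfa.toOpenPartialHomeomorph f hf' (by simp) with he
  refine ⟨e.restrOpen W hWo, ⟨hfa.mem_toOpenPartialHomeomorph_source hf' (by simp), haW⟩,
    fun x hx => hWU hx.2, rfl, ?_⟩
  intro y hy
  have hy' := (e.restrOpen W hWo).map_target hy
  obtain ⟨g, hg⟩ := hW _ hy'.2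
  exact ((e.restrOpen W hWo).contDiffAt_symm hy hg
    (hf.contDiffAt (hU.mem_nhds (hWU hy'.2)))).contDiffWithinAt

end InverseFunction

/-! ### Smoothness of superposition operators on spaces of continuous maps. -/

section Nemytskii

universe u

variable {K : Type*} [TopologicalSpace K] [CompactSpace K]
  {E F : Type u} [NormedAddCommGroup E] [NormedSpace ℝ E] [NormedAddCommGroup F] [NormedSpace ℝ F]

/-- Pointwise application of a continuous bilinear map, as a bilinear map. -/
noncomputable def pointwiseApplyₗ {E F G : Type u} [NormedAddCommGroup E] [NormedSpace ℝ E]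
    [NormedAddCommGroup F] [NormedSpace ℝ F] [NormedAddCommGroup G] [NormedSpace ℝ G]
    (K : Type*) [TopologicalSpace K] [CompactSpace K] (b : G →L[ℝ] E →L[ℝ] F) :
    C(K, G) →ₗ[ℝ] C(K, E) →ₗ[ℝ] C(K, F) where
  toFun φ :=
    { toFun := fun η => ⟨fun t => b (φ t) (η t),
        (b.continuous.comp φ.continuous).clm_apply η.continuous⟩
      map_add' := fun η η' => by ext t; simp
      map_smul' := fun c η => by ext t; simp }
  map_add' φ ψ := by ext η t; simp
  map_smul' c φ := by ext η t; simp

/-- Pointwise application of a continuous bilinear map. -/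
noncomputable def pointwiseApply {E F G : Type u} [NormedAddCommGroup E] [NormedSpace ℝ E]
    [NormedAddCommGroup F] [NormedSpace ℝ F] [NormedAddCommGroup G] [NormedSpace ℝ G]
    (K : Type*) [TopologicalSpace K] [CompactSpace K] (b : G →L[ℝ] E →L[ℝ] F) :
    C(K, G) →L[ℝ] C(K, E) →L[ℝ] C(K, F) :=
  (pointwiseApplyₗ K b).mkContinuous₂ ‖b‖ fun φ η => by
    rw [ContinuousMap.norm_le _ (by positivity)]
    intro t
    calc ‖b (φ t) (η t)‖ ≤ ‖b‖ * ‖φ t‖ * ‖η t‖ := b.le_opNorm₂ _ _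
      _ ≤ ‖b‖ * ‖φ‖ * ‖η‖ := by
        gcongr
        · exact φ.norm_coe_le_norm t
        · exact η.norm_coe_le_norm t

/-- The superposition operator `γ ↦ f ∘ γ` on spaces of continuous maps. -/
def superposition (K : Type*) [TopologicalSpace K] {E F : Type u} [NormedAddCommGroup E]
    [NormedAddCommGroup F] (f : E → F) (hf : Continuous f) (γ : C(K, E)) : C(K, F) :=
  (⟨f, hf⟩ : C(E, F)).comp γ

@[simp] theorem superposition_apply {K : Type*} [TopologicalSpace K] {E F : Type u}
    [NormedAddCommGroup E] [NormedAddCommGroup F] (f : E → F) (hf : Continuous f) (γ : C(K, E)) (t : K) :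
    superposition K f hf γ t = f (γ t) := rfl

/-- The mean value inequality bounds the remainder at each `t`. The range of `γ` is compact, so
`fderiv ℝ f` is uniformly continuous near it and one `δ` serves all `t`. -/
theorem hasFDerivAt_superposition {f : E → F} (hf : ContDiff ℝ 1 f) (γ : C(K, E)) :
    HasFDerivAt (superposition K f hf.continuous)
      (pointwiseApply K (ContinuousLinearMap.id ℝ (E →L[ℝ] F)) (superposition K (fderiv ℝ f) (hf.continuous_fderiv (by simp)) γ))
      γ := by
  rw [hasFDerivAt_iff_isLittleO_nhds_zero, Asymptotics.isLittleO_iff]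
  intro c hc
  have hcomp : IsCompact (range γ) := isCompact_range γ.continuous
  have hcont : Continuous (fderiv ℝ f) := hf.continuous_fderiv (by simp)
  have hu := hcomp.uniformContinuousAt_of_continuousAt (fderiv ℝ f)
    (fun x _ => hcont.continuousAt) (Metric.dist_mem_uniformity hc)
  obtain ⟨δ, hδ, hδ'⟩ := Metric.mem_uniformity_dist.1 hu
  filter_upwards [Metric.ball_mem_nhds (0 : C(K, E)) hδ] with η hη
  rw [ContinuousMap.norm_le _ (by positivity)]
  intro t
  have hηt : ‖η t‖ < δ := lt_of_le_of_lt (η.norm_coe_le_norm t) (by simpa using hη)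
  have key : ‖f (γ t + η t) - f (γ t) - fderiv ℝ f (γ t) (γ t + η t - γ t)‖
      ≤ c * ‖γ t + η t - γ t‖ := by
    refine (convex_ball (γ t) δ).norm_image_sub_le_of_norm_hasFDerivWithin_le'
      (f' := fderiv ℝ f) (fun x _ => ((hf.differentiable (by simp)) x).hasFDerivAt.hasFDerivWithinAt)
      (fun x hx => ?_) (Metric.mem_ball_self hδ) (by simpa using hηt)
    have := @hδ' (γ t) x (by simpa [dist_comm] using hx) (mem_range_self t)
    rw [← dist_eq_norm, dist_comm]
    exact le_of_lt this
  simp only [add_sub_cancel_left] at key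
  calc _ = ‖f (γ t + η t) - f (γ t) - fderiv ℝ f (γ t) (η t)‖ := rfl
    _ ≤ c * ‖η t‖ := key
    _ ≤ c * ‖η‖ := by gcongr; exact η.norm_coe_le_norm t

/-- The derivative is the superposition operator of `fderiv ℝ f` followed by pointwise application,
which is linear. The induction therefore runs over all targets `F`, as `F` is replaced by `E →L[ℝ]
F`; this is why `E` and `F` share a universe. -/
theorem contDiff_superposition_nat (n : ℕ) : ∀ (F : Type u) [NormedAddCommGroup F] [NormedSpace ℝ F]
    (f : E → F) (hf : ContDiff ℝ n f), ContDiff ℝ n (superposition K f hf.continuous) := by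
  induction n with
  | zero =>
    intro F _ _ f hf
    exact contDiff_zero.2 (ContinuousMap.continuous_postcomp _)
  | succ n ih =>
    intro F _ _ f hf
    have h1 : ContDiff ℝ 1 f := hf.of_le (by exact_mod_cast Nat.le_add_left 1 n)
    have h2 : ContDiff ℝ n (fderiv ℝ f) := hf.fderiv_right (by push_cast; rfl)
    push_cast
    refine contDiff_succ_iff_hasFDerivAt (n := n) |>.2 ⟨_, ?_, fun γ => hasFDerivAt_superposition h1 γ⟩
    exact (pointwiseApply K (ContinuousLinearMap.id ℝ (E →L[ℝ] F))).contDiff.comp (ih (E →L[ℝ] F) (fderiv ℝ f) h2)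

theorem contDiff_superposition {f : E → F} (hf : ContDiff ℝ ∞ f) :
    ContDiff ℝ ∞ (superposition K f hf.continuous) :=
  contDiff_infty.2 fun n => contDiff_superposition_nat n F f (hf.of_le (by exact_mod_cast le_top))

end Nemytskii

/-! ### Local flows through the inverse function theorem on a space of curves. -/

section LocalFlow

universe u

variable {E : Type u} [NormedAddCommGroup E] [NormedSpace ℝ E]

/-- A smooth map on an open set agrees near a given point with a globally smooth map. -/
theorem ContDiffOn.exists_contDiff_eqOn_ball {F : Type*} [NormedAddCommGroup F] [NormedSpace ℝ F]
    [FiniteDimensional ℝ E]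
    {f : E → F} {U : Set E} (hU : IsOpen U) (hf : ContDiffOn ℝ ∞ f U) {x₀ : E} (hx₀ : x₀ ∈ U) :
    ∃ (g : E → F) (r : ℝ), 0 < r ∧ Metric.ball x₀ r ⊆ U ∧ ContDiff ℝ ∞ g ∧
      EqOn g f (Metric.ball x₀ r) := by
  obtain ⟨r, hr, hrU⟩ := Metric.nhds_basis_closedBall.mem_iff.1 (hU.mem_nhds hx₀)
  let b : ContDiffBump x₀ := ⟨r / 2, r, by positivity, by linarith⟩
  refine ⟨fun x => b x • f x, r / 2, by positivity,
    (Metric.ball_subset_closedBall.trans (Metric.closedBall_subset_closedBall (by linarith))).trans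
      hrU, ?_, ?_⟩
  · rw [contDiff_iff_contDiffAt]
    intro x
    by_cases hx : x ∈ U
    · exact b.contDiffAt.smul (hf.contDiffAt (hU.mem_nhds hx))
    · have hx' : x ∉ tsupport b := by
        rw [b.tsupport_eq]
        exact fun h => hx (hrU h)
      have h0 : (fun x => b x • f x) =ᶠ[𝓝 x] fun _ => 0 := by
        filter_upwards [(isClosed_tsupport b).isOpen_compl.mem_nhds hx'] with y hy
        rw [image_eq_zero_of_notMem_tsupport hy, zero_smul]
      exact contDiffAt_const.congr_of_eventuallyEq h0
  · intro x hx
    have : b x = 1 := b.one_of_mem_closedBall (Metric.ball_subset_closedBall hx)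
    simp [this]

local notation "𝕀" => Icc (-1 : ℝ) 1

theorem neg_one_le_one_real : (-1 : ℝ) ≤ 1 := by norm_num

/-- The primitive `t ↦ ∫ s in 0..t, γ s` of a continuous curve on `[-1, 1]`. -/
noncomputable def primitiveOp (E : Type u) [NormedAddCommGroup E] [NormedSpace ℝ E]
    [CompleteSpace E] : C(𝕀, E) →L[ℝ] C(𝕀, E) :=
  LinearMap.mkContinuous
    { toFun := fun γ => ⟨fun t => ∫ s in (0 : ℝ)..t, IccExtend neg_one_le_one_real γ s,
        (intervalIntegral.continuous_primitive (fun a b =>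
          (γ.continuous.Icc_extend' (h := neg_one_le_one_real)).intervalIntegrable a b) 0).comp
          continuous_subtype_val⟩
      map_add' := fun γ η => by
        ext t
        exact intervalIntegral.integral_add
          ((γ.continuous.Icc_extend' (h := neg_one_le_one_real)).intervalIntegrable _ _)
          ((η.continuous.Icc_extend' (h := neg_one_le_one_real)).intervalIntegrable _ _)
      map_smul' := fun c γ => by
        ext t
        exact intervalIntegral.integral_smul c _ } 1 (by
    intro γ
    rw [ContinuousMap.norm_le _ (by positivity)]
    intro t
    have h := intervalIntegral.norm_integral_le_of_norm_le_const (a := (0 : ℝ)) (b := t)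
      (f := IccExtend neg_one_le_one_real γ) (C := ‖γ‖)
      (fun s _ => γ.norm_coe_le_norm (projIcc _ _ neg_one_le_one_real s))
    have ht : |(t : ℝ) - 0| ≤ 1 := by rw [sub_zero]; exact abs_le.2 t.2
    calc _ ≤ ‖γ‖ * |(t : ℝ) - 0| := h
      _ ≤ ‖γ‖ * 1 := by gcongr
      _ = 1 * ‖γ‖ := by ring)

theorem primitiveOp_apply [CompleteSpace E] (γ : C(𝕀, E)) (t : 𝕀) :
    primitiveOp E γ t = ∫ s in (0 : ℝ)..t, IccExtend neg_one_le_one_real γ s := rfl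

/-- Constant curves. -/
noncomputable def constCurve (E : Type u) [NormedAddCommGroup E] [NormedSpace ℝ E] :
    E →L[ℝ] C(𝕀, E) :=
  LinearMap.mkContinuous
    { toFun := fun x => ContinuousMap.const 𝕀 x
      map_add' := fun _ _ => rfl
      map_smul' := fun _ _ => rfl } 1 (by
    intro x
    rw [ContinuousMap.norm_le _ (by positivity)]
    intro t
    exact (one_mul ‖x‖).symm.le)

@[simp] theorem constCurve_apply (x : E) (t : 𝕀) : constCurve E x t = x := rfl

/-- The shear equivalence `(p, η) ↦ (p, η - A p)`. -/
noncomputable def shearEquiv {P Q : Type*} [NormedAddCommGroup P] [NormedSpace ℝ P]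
    [NormedAddCommGroup Q] [NormedSpace ℝ Q] (A : P →L[ℝ] Q) : (P × Q) ≃L[ℝ] (P × Q) :=
  ContinuousLinearEquiv.equivOfInverse
    ((ContinuousLinearMap.fst ℝ P Q).prod
      (ContinuousLinearMap.snd ℝ P Q - A.comp (ContinuousLinearMap.fst ℝ P Q)))
    ((ContinuousLinearMap.fst ℝ P Q).prod
      (ContinuousLinearMap.snd ℝ P Q + A.comp (ContinuousLinearMap.fst ℝ P Q)))
    (fun x => by ext <;> simp) (fun x => by ext <;> simp)

/-- Solutions of `γ = k x + τ • Q γ`, for small `τ`, depend smoothly on `(τ, x)`. -/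
theorem exists_openPartialHomeomorph_defect {X : Type*} [NormedAddCommGroup X] [NormedSpace ℝ X]
    [CompleteSpace X] [CompleteSpace E] (k : E →L[ℝ] X) {Q : X → X} (hQ : ContDiff ℝ ∞ Q) (x₀ : E) :
    ∃ e : OpenPartialHomeomorph ((ℝ × E) × X) ((ℝ × E) × X),
      ((0, x₀), k x₀) ∈ e.source ∧ (∀ p, e p = (p.1, p.2 - k p.1.2 - p.1.1 • Q p.2)) ∧
      ContDiffOn ℝ ∞ e.symm e.target := by
  have hc : ContDiff ℝ ∞ fun p : (ℝ × E) × X => (p.1, p.2 - k p.1.2 - p.1.1 • Q p.2) := by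
    refine contDiff_fst.prodMk ((contDiff_snd.sub (k.contDiff.comp
      (contDiff_snd.comp contDiff_fst))).sub ?_)
    exact (contDiff_fst.comp contDiff_fst).smul (hQ.comp contDiff_snd)
  have h1 : HasFDerivAt (fun p : (ℝ × E) × X => Q p.2) _ ((0, x₀), k x₀) :=
    ((hQ.comp contDiff_snd).differentiable (by simp) _).hasFDerivAt
  have h2 : HasFDerivAt (fun p : (ℝ × E) × X => p.1.1) _ ((0, x₀), k x₀) :=
    ((ContinuousLinearMap.fst ℝ ℝ E).comp (ContinuousLinearMap.fst ℝ (ℝ × E) X)).hasFDerivAt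
  have h3 : HasFDerivAt (fun p : (ℝ × E) × X => k p.1.2) _ ((0, x₀), k x₀) :=
    (k.comp ((ContinuousLinearMap.snd ℝ ℝ E).comp
      (ContinuousLinearMap.fst ℝ (ℝ × E) X))).hasFDerivAt
  have h4 := hasFDerivAt_fst.prodMk ((hasFDerivAt_snd.sub h3).sub (h2.smul h1))
  -- At `τ = 0` the term `τ • Q γ` contributes only `dτ • Q (k x₀)`, so the derivative is a shear,
  -- hence invertible.
  have h5 : HasFDerivAt (fun p : (ℝ × E) × X => (p.1, p.2 - k p.1.2 - p.1.1 • Q p.2))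
      (shearEquiv (k.comp (ContinuousLinearMap.snd ℝ ℝ E) +
        (ContinuousLinearMap.fst ℝ ℝ E).smulRight (Q (k x₀))) :
        ((ℝ × E) × X) →L[ℝ] ((ℝ × E) × X)) ((0, x₀), k x₀) := by
    refine h4.congr_fderiv ?_
    ext p <;> simp [shearEquiv, sub_eq_add_neg, add_comm]
  obtain ⟨e, he, -, hef, hes⟩ :=
    hc.contDiffOn.exists_openPartialHomeomorph isOpen_univ (mem_univ _) _ h5
  exact ⟨e, he, fun p => by rw [hef], hes⟩

end LocalFlow

section LocalFlow

universe u

variable {E : Type u} [NormedAddCommGroup E] [NormedSpace ℝ E]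

local notation "𝕀" => Icc (-1 : ℝ) 1

/-- Evaluation of curves. -/
noncomputable def evalCurve (E : Type u) [NormedAddCommGroup E] [NormedSpace ℝ E] (t : 𝕀) :
    C(𝕀, E) →L[ℝ] E :=
  LinearMap.mkContinuous
    { toFun := fun γ => γ t
      map_add' := fun _ _ => rfl
      map_smul' := fun _ _ => rfl } 1 (fun γ => by
    rw [one_mul]
    exact γ.norm_coe_le_norm t)

/-- The curve `t ↦ γ (s t)`. -/
def rescaleCurve (γ : C(𝕀, E)) (s : 𝕀) : C(𝕀, E) :=
  ⟨fun t => γ ⟨s * t, abs_le.1 (by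
    rw [abs_mul]
    exact mul_le_one₀ (abs_le.2 s.2) (abs_nonneg _) (abs_le.2 t.2))⟩, by fun_prop⟩

/-- Substitution in the integral: slowing a solution down by the factor `s` multiplies the parameter
`τ` by `s`. Combined with uniqueness, this converts smooth dependence on the parameter into smooth
dependence on time. -/
theorem rescaleCurve_defect [CompleteSpace E] {f : E → E} (hf : Continuous f) {γ : C(𝕀, E)} {τ : ℝ}
    {x : E} (h : γ - constCurve E x - τ • primitiveOp E (superposition 𝕀 f hf γ) = 0) (s : 𝕀) :
    rescaleCurve γ s - constCurve E x -
      ((s : ℝ) * τ) • primitiveOp E (superposition 𝕀 f hf (rescaleCurve γ s)) = 0 := by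
  ext t
  have hst : (s : ℝ) * t ∈ 𝕀 := abs_le.1 (by
    rw [abs_mul]
    exact mul_le_one₀ (abs_le.2 s.2) (abs_nonneg _) (abs_le.2 t.2))
  have h1 := congrArg (fun η : C(𝕀, E) => η ⟨(s : ℝ) * t, hst⟩) h
  simp only [ContinuousMap.sub_apply, ContinuousMap.smul_apply, constCurve_apply,
    primitiveOp_apply, ContinuousMap.zero_apply] at h1 ⊢
  have h2 : ∫ u in (0 : ℝ)..(s * t), IccExtend neg_one_le_one_real (superposition 𝕀 f hf γ) u
      = (s : ℝ) • ∫ u in (0 : ℝ)..t, IccExtend neg_one_le_one_real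
          (superposition 𝕀 f hf (rescaleCurve γ s)) u := by
    have := intervalIntegral.smul_integral_comp_mul_left (a := 0) (b := (t : ℝ))
      (IccExtend neg_one_le_one_real (superposition 𝕀 f hf γ)) (s : ℝ)
    rw [mul_zero] at this
    rw [← this]
    congr 1
    apply intervalIntegral.integral_congr
    intro u hu
    have hu' : u ∈ 𝕀 := by
      have : uIcc (0 : ℝ) t ⊆ 𝕀 := uIcc_subset_Icc (by norm_num) t.2
      exact this hu
    have hsu : (s : ℝ) * u ∈ 𝕀 := abs_le.1 (by
      rw [abs_mul]
      exact mul_le_one₀ (abs_le.2 s.2) (abs_nonneg _) (abs_le.2 hu'))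
    simp only
    rw [IccExtend_of_mem _ _ hsu, IccExtend_of_mem _ _ hu']
    rfl
  rw [h2, smul_smul, mul_comm τ] at h1
  exact h1

theorem dist_rescaleCurve_le (γ : C(𝕀, E)) (s : 𝕀) (x : E) :
    dist (rescaleCurve γ s) (constCurve E x) ≤ dist γ (constCurve E x) := by
  rw [ContinuousMap.dist_le dist_nonneg]
  intro t
  exact ContinuousMap.dist_apply_le_dist (f := γ) (g := constCurve E x) _

theorem hasDerivAt_of_defect [CompleteSpace E] {f : E → E} (hf : Continuous f) {γ : C(𝕀, E)} {τ : ℝ}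
    {x : E} (h : γ - constCurve E x - τ • primitiveOp E (superposition 𝕀 f hf γ) = 0) {s : ℝ}
    (hs : s ∈ Ioo (-1 : ℝ) 1) :
    HasDerivAt (IccExtend neg_one_le_one_real γ)
      (τ • f (IccExtend neg_one_le_one_real γ s)) s := by
  have hc : Continuous (IccExtend neg_one_le_one_real (superposition 𝕀 f hf γ)) :=
    ContinuousMap.continuous _ |>.Icc_extend'
  have h1 : HasDerivAt (fun t => x + τ • ∫ u in (0 : ℝ)..t,
      IccExtend neg_one_le_one_real (superposition 𝕀 f hf γ) u)
      (τ • IccExtend neg_one_le_one_real (superposition 𝕀 f hf γ) s) s :=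
    ((hc.integral_hasStrictDerivAt 0 s).hasDerivAt.const_smul τ).const_add x
  refine h1.congr_of_eventuallyEq ?_
  filter_upwards [Ioo_mem_nhds hs.1 hs.2] with t ht
  have ht' : t ∈ 𝕀 := ⟨ht.1.le, ht.2.le⟩
  have h2 := congrArg (fun η : C(𝕀, E) => η ⟨t, ht'⟩) h
  simp only [ContinuousMap.sub_apply, ContinuousMap.smul_apply, constCurve_apply,
    primitiveOp_apply, ContinuousMap.zero_apply] at h2
  rw [IccExtend_of_mem _ _ ht', ← sub_eq_zero, ← h2]
  abel

/-- Existence of local flows of smooth vector fields, depending smoothly on time and on the initial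
point. -/
theorem exists_smooth_local_flow [FiniteDimensional ℝ E] {f : E → E} {U : Set E}
    (hU : IsOpen U) (hf : ContDiffOn ℝ ∞ f U) {x₀ : E} (hx₀ : x₀ ∈ U) :
    ∃ ε > 0, ∃ Φ : ℝ → E → E,
      ContDiffOn ℝ ∞ (fun p : ℝ × E => Φ p.1 p.2) (Metric.ball 0 ε ×ˢ Metric.ball x₀ ε) ∧
      (∀ x ∈ Metric.ball x₀ ε, Φ 0 x = x) ∧
      ∀ t ∈ Metric.ball (0 : ℝ) ε, ∀ x ∈ Metric.ball x₀ ε,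
        Φ t x ∈ U ∧ HasDerivAt (fun t => Φ t x) (f (Φ t x)) t := by
  have : CompleteSpace E := FiniteDimensional.complete ℝ E
  obtain ⟨g, r, hr, hrU, hg, hgf⟩ := hf.exists_contDiff_eqOn_ball hU hx₀
  have hQ : ContDiff ℝ ∞ fun γ : C(𝕀, E) => primitiveOp E (superposition 𝕀 g hg.continuous γ) :=
    (primitiveOp E).contDiff.comp (contDiff_superposition hg)
  obtain ⟨e, hes, he, hsymm⟩ := exists_openPartialHomeomorph_defect (constCurve E) hQ x₀
  -- a box inside the source
  obtain ⟨δ, hδ, hδs⟩ := Metric.isOpen_iff.1 e.open_source _ hes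
  -- `δ` keeps curves in the source of `e`, where solutions are unique; `r` keeps their values where
  -- `g` agrees with `f`.
  set η := min δ r with hη
  have hη0 : 0 < η := lt_min hδ hr
  have he0 : e ((0, x₀), constCurve E x₀) = ((0, x₀), 0) := by rw [he]; simp
  have ht0 : (((0, x₀), 0) : (ℝ × E) × C(𝕀, E)) ∈ e.target := he0 ▸ e.map_source hes
  have hs0 : e.symm ((0, x₀), 0) = ((0, x₀), constCurve E x₀) := by
    rw [← he0]; exact e.left_inv hes
  have hev : ∀ᶠ p : ℝ × E in 𝓝 (0, x₀), (p, (0 : C(𝕀, E))) ∈ e.target ∧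
      dist (e.symm (p, 0)).2 (constCurve E x₀) < η ∧ dist p.1 0 < η ∧ dist p.2 x₀ < η := by
    have hc : ContinuousAt (fun p : ℝ × E => (p, (0 : C(𝕀, E)))) (0, x₀) := by fun_prop
    have hc2 : ContinuousAt (fun p : ℝ × E => e.symm (p, (0 : C(𝕀, E)))) (0, x₀) :=
      ContinuousAt.comp (f := fun p : ℝ × E => (p, (0 : C(𝕀, E)))) (e.continuousAt_symm ht0) hc
    have hc3 : Tendsto (fun p : ℝ × E => (e.symm (p, (0 : C(𝕀, E)))).2) (𝓝 (0, x₀))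
        (𝓝 (constCurve E x₀)) := by
      have h := (continuous_snd.tendsto _).comp hc2.tendsto
      rw [hs0] at h
      exact h
    refine (hc.eventually (e.open_target.mem_nhds ht0)).and
      ((hc3.eventually (Metric.ball_mem_nhds _ hη0)).and ?_)
    exact ((continuous_fst.tendsto ((0 : ℝ), x₀)).eventually (Metric.ball_mem_nhds _ hη0)).and
      ((continuous_snd.tendsto ((0 : ℝ), x₀)).eventually (Metric.ball_mem_nhds _ hη0))
  obtain ⟨ε, hε, hεb⟩ := Metric.eventually_nhds_iff_ball.1 hev
  have hbox : ∀ t ∈ Metric.ball (0 : ℝ) ε, ∀ x ∈ Metric.ball x₀ ε,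
      ((t, x) : ℝ × E) ∈ Metric.ball ((0 : ℝ), x₀) ε := fun t ht x hx => by
    rw [← ball_prod_same]; exact ⟨ht, hx⟩
  set Γ : ℝ × E → C(𝕀, E) := fun p => (e.symm (p, 0)).2 with hΓ
  have hΓeq : ∀ p ∈ Metric.ball ((0 : ℝ), x₀) ε, Γ p - constCurve E p.2 -
      p.1 • primitiveOp E (superposition 𝕀 g hg.continuous (Γ p)) = 0 := by
    intro p hp
    have h := e.right_inv (hεb p hp).1
    rw [he] at h
    have h1 := congrArg Prod.fst h
    have h2 := congrArg Prod.snd h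
    simp only at h1 h2
    rw [h1] at h2
    exact h2
  have hΓuniq : ∀ p ∈ Metric.ball ((0 : ℝ), x₀) ε, ∀ γ : C(𝕀, E),
      dist γ (constCurve E x₀) < η → γ - constCurve E p.2 -
      p.1 • primitiveOp E (superposition 𝕀 g hg.continuous γ) = 0 → γ = Γ p := by
    intro p hp γ hγ hd
    have hmem : (p, γ) ∈ e.source := by
      apply hδs
      rw [← ball_prod_same, ← ball_prod_same]
      obtain ⟨-, -, h1, h2⟩ := hεb p hp
      exact ⟨⟨lt_of_lt_of_le h1 (min_le_left _ _), lt_of_lt_of_le h2 (min_le_left _ _)⟩,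
        lt_of_lt_of_le hγ (min_le_left _ _)⟩
    have h := e.left_inv hmem
    rw [he] at h
    simp only [hd] at h
    rw [hΓ]
    simp only [h]
  -- By uniqueness the rescaled solution is the solution with parameter `s * τ`. Thus the values at
  -- time `1`, for varying parameter, recover the whole curve, and `(t, x) ↦ Γ (t, x) 1` is the
  -- flow.
  have hscale : ∀ τ ∈ Metric.ball (0 : ℝ) ε, ∀ x ∈ Metric.ball x₀ ε, ∀ s : 𝕀,
      Γ ((s : ℝ) * τ, x) ⟨1, by norm_num⟩ = Γ (τ, x) s := by
    intro τ hτ x hx s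
    have hs' : (s : ℝ) * τ ∈ Metric.ball (0 : ℝ) ε := by
      rw [mem_ball_zero_iff, Real.norm_eq_abs, abs_mul] at *
      calc |(s : ℝ)| * |τ| ≤ 1 * |τ| := by gcongr; exact abs_le.2 s.2
        _ < ε := by rwa [one_mul]
    have h := hΓuniq _ (hbox _ hs' x hx) (rescaleCurve (Γ (τ, x)) s)
      (lt_of_le_of_lt (dist_rescaleCurve_le _ _ _) (hεb _ (hbox τ hτ x hx)).2.1)
      (rescaleCurve_defect hg.continuous (hΓeq _ (hbox τ hτ x hx)) s)
    rw [← h]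
    change Γ (τ, x) _ = _
    congr 1
    ext
    simp
  refine ⟨ε, hε, fun t x => Γ (t, x) ⟨1, by norm_num⟩, ?_, ?_, ?_⟩
  · have h1 : ContDiffOn ℝ ∞ (fun p : ℝ × E => e.symm (p, (0 : C(𝕀, E))))
        (Metric.ball 0 ε ×ˢ Metric.ball x₀ ε) :=
      hsymm.comp (contDiff_id.prodMk contDiff_const).contDiffOn fun p hp =>
        (hεb p (by rw [← ball_prod_same]; exact hp)).1
    exact (evalCurve E _).contDiff.comp_contDiffOn (contDiff_snd.comp_contDiffOn h1)
  · intro x hx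
    have h := hΓeq (0, x) (hbox 0 (Metric.mem_ball_self hε) x hx)
    rw [zero_smul, sub_zero, sub_eq_zero] at h
    exact congrArg (fun η : C(𝕀, E) => η ⟨1, by norm_num⟩) h
  · intro t ht x hx
    have hval : ∀ τ ∈ Metric.ball (0 : ℝ) ε, Γ (τ, x) ⟨1, by norm_num⟩ ∈ Metric.ball x₀ r :=
      fun τ hτ => lt_of_le_of_lt (ContinuousMap.dist_apply_le_dist (g := constCurve E x₀)
        (⟨1, by norm_num⟩ : 𝕀)) (lt_of_lt_of_le (hεb _ (hbox τ hτ x hx)).2.1 (min_le_right _ _))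
    refine ⟨hrU (hval t ht), ?_⟩
    rw [mem_ball_zero_iff, Real.norm_eq_abs] at ht
    -- With a fixed parameter `τ` slightly larger than `|t|`, the flow line near `t` is the single
    -- curve `Γ (τ, x)` read at `t / τ`, an interior point of `[-1, 1]` where it can be
    -- differentiated.
    obtain ⟨τ, htτ, hτε⟩ := exists_between ht
    have hτ0 : 0 < τ := lt_of_le_of_lt (abs_nonneg _) htτ
    have hτ : τ ∈ Metric.ball (0 : ℝ) ε := by
      rwa [mem_ball_zero_iff, Real.norm_eq_abs, abs_of_pos hτ0]
    have hin : ∀ t' ∈ Ioo (-τ) τ, t' / τ ∈ Ioo (-1 : ℝ) 1 := fun t' ht' =>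
      ⟨by rw [lt_div_iff₀ hτ0]; linarith [ht'.1], by rw [div_lt_iff₀ hτ0]; linarith [ht'.2]⟩
    have heq : ∀ t' ∈ Ioo (-τ) τ, Γ (t', x) ⟨1, by norm_num⟩ =
        IccExtend neg_one_le_one_real (Γ (τ, x)) (t' / τ) := by
      intro t' ht'
      have hm : t' / τ ∈ 𝕀 := ⟨(hin t' ht').1.le, (hin t' ht').2.le⟩
      rw [IccExtend_of_mem _ _ hm, ← hscale τ hτ x hx]
      simp only
      rw [div_mul_cancel₀ _ hτ0.ne']
    have htm : t ∈ Ioo (-τ) τ := abs_lt.1 htτ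
    have hd := hasDerivAt_of_defect hg.continuous (hΓeq _ (hbox τ hτ x hx)) (hin t htm)
    have hd2 := hd.scomp t ((hasDerivAt_id t).div_const τ)
    rw [← hgf (hval t (by rwa [mem_ball_zero_iff, Real.norm_eq_abs]))]
    have hd3 := hd2.congr_of_eventuallyEq (f₁ := fun t' => Γ (t', x) ⟨1, by norm_num⟩) (by
      filter_upwards [Ioo_mem_nhds htm.1 htm.2] with t' ht'
      exact heq t' ht')
    convert hd3 using 1
    rw [smul_smul, heq t htm, one_div, inv_mul_cancel₀ hτ0.ne', one_smul]

end LocalFlow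

/-! ### Variational equation and transport of an anchor along a flow. -/

section Transport

universe u

variable {E : Type u} [NormedAddCommGroup E] [NormedSpace ℝ E]

theorem two_le_infty : (2 : WithTop ℕ∞) ≤ ∞ := by
  have h : ((2 : ℕ∞) : WithTop ℕ∞) ≤ ((⊤ : ℕ∞) : WithTop ℕ∞) := WithTop.coe_le_coe.2 le_top
  exact h

theorem fderiv_slice_eq {F : Type*} [NormedAddCommGroup F] [NormedSpace ℝ F]
    {P : Type*} [NormedAddCommGroup P] [NormedSpace ℝ P] {Φ : P → E → F} {t : P} {x : E}
    (h : DifferentiableAt ℝ (fun p : P × E => Φ p.1 p.2) (t, x)) :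
    fderiv ℝ (Φ t) x =
      (fderiv ℝ (fun p : P × E => Φ p.1 p.2) (t, x)).comp (ContinuousLinearMap.inr ℝ P E) := by
  have h1 : HasFDerivAt (fun y : E => ((t, y) : P × E)) (ContinuousLinearMap.inr ℝ P E) x :=
    hasFDerivAt_prodMk_right t x
  exact (HasFDerivAt.comp x h.hasFDerivAt h1).fderiv

theorem fderiv_slice_left_eq {F : Type*} [NormedAddCommGroup F] [NormedSpace ℝ F]
    {P : Type*} [NormedAddCommGroup P] [NormedSpace ℝ P] {Φ : P → E → F} {t : P} {x : E}
    (h : DifferentiableAt ℝ (fun p : P × E => Φ p.1 p.2) (t, x)) :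
    fderiv ℝ (fun s => Φ s x) t =
      (fderiv ℝ (fun p : P × E => Φ p.1 p.2) (t, x)).comp (ContinuousLinearMap.inl ℝ P E) := by
  have h1 : HasFDerivAt (fun s : P => ((s, x) : P × E)) (ContinuousLinearMap.inl ℝ P E) t :=
    hasFDerivAt_prodMk_left t x
  exact (HasFDerivAt.comp t h.hasFDerivAt h1).fderiv

/-- The variational equation of a smooth flow. -/
theorem hasDerivAt_fderiv_flow {Φ : ℝ → E → E} {v : E → E} {O : Set (ℝ × E)} (hO : IsOpen O)
    (hΦ : ContDiffOn ℝ ∞ (fun p : ℝ × E => Φ p.1 p.2) O)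
    (hder : ∀ p ∈ O, HasDerivAt (fun t => Φ t p.2) (v (Φ p.1 p.2)) p.1)
    {t : ℝ} {x : E} (htx : (t, x) ∈ O) (hv : DifferentiableAt ℝ v (Φ t x)) :
    HasDerivAt (fun s => fderiv ℝ (Φ s) x)
      ((fderiv ℝ v (Φ t x)).comp (fderiv ℝ (Φ t) x)) t := by
  set P : ℝ × E → E := fun p => Φ p.1 p.2 with hP
  have hPd : ∀ p ∈ O, ContDiffAt ℝ ∞ P p := fun p hp => hΦ.contDiffAt (hO.mem_nhds hp)
  have hdiff : ∀ p ∈ O, DifferentiableAt ℝ P p := fun p hp => (hPd p hp).differentiableAt (by simp)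
  have h1 : (fun s => fderiv ℝ (Φ s) x) =ᶠ[𝓝 t]
      fun s => (fderiv ℝ P (s, x)).comp (ContinuousLinearMap.inr ℝ ℝ E) := by
    have hc : ContinuousAt (fun s : ℝ => (s, x)) t := by fun_prop
    filter_upwards [hc.preimage_mem_nhds (hO.mem_nhds htx)] with s hs
    exact fderiv_slice_eq (hdiff _ hs)
  have hD : HasFDerivAt (fderiv ℝ P) (fderiv ℝ (fderiv ℝ P) (t, x)) (t, x) :=
    (((hPd _ htx).fderiv_right (m := 1) (one_add_one_eq_two.trans_le two_le_infty)).differentiableAt (by simp)).hasFDerivAt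
  have h2 : HasDerivAt (fun s => fderiv ℝ P (s, x)) (fderiv ℝ (fderiv ℝ P) (t, x) (1, 0)) t := by
    have : HasDerivAt (fun s : ℝ => (s, x)) ((1, 0) : ℝ × E) t :=
      (hasDerivAt_id t).prodMk (hasDerivAt_const t x)
    exact hD.comp_hasDerivAt t this
  have h3 : HasDerivAt (fun s => (fderiv ℝ P (s, x)).comp (ContinuousLinearMap.inr ℝ ℝ E))
      ((fderiv ℝ (fderiv ℝ P) (t, x) (1, 0)).comp (ContinuousLinearMap.inr ℝ ℝ E)) t :=
    (h2.clm_comp (hasDerivAt_const t _)).congr_deriv (by simp)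
  refine (h3.congr_of_eventuallyEq h1).congr_deriv ?_
  ext w
  -- Symmetry of the second derivative exchanges the time and space derivatives; what remains is the
  -- space derivative of `∂ₜ Φ = v ∘ Φ`.
  have hsym : fderiv ℝ (fderiv ℝ P) (t, x) (1, 0) (0, w) =
      fderiv ℝ (fderiv ℝ P) (t, x) (0, w) (1, 0) :=
    (hPd _ htx).isSymmSndFDerivAt (by simpa using two_le_infty) (1, 0) (0, w)
  have h4 : HasFDerivAt (fun q => fderiv ℝ P q (1, 0))
      ((fderiv ℝ (fderiv ℝ P) (t, x)).flip (1, 0)) (t, x) :=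
    (hD.clm_apply (hasFDerivAt_const _ _)).congr_fderiv (by simp)
  have h5 : (fun q => fderiv ℝ P q (1, 0)) =ᶠ[𝓝 (t, x)] fun q => v (P q) := by
    filter_upwards [hO.mem_nhds htx] with q hq
    have := (hder q hq).hasFDerivAt.fderiv
    rw [fderiv_slice_left_eq (hdiff q hq)] at this
    have := congrArg (fun L : ℝ →L[ℝ] E => L 1) this
    simpa using this
  have h6 := (h4.congr_of_eventuallyEq h5.symm).unique
    (HasFDerivAt.comp (t, x) (show HasFDerivAt v (fderiv ℝ v (P (t, x))) (P (t, x)) from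
      hv.hasFDerivAt) (hdiff _ htx).hasFDerivAt)
  have h7 := congrArg (fun L : ℝ × E →L[ℝ] E => L (0, w)) h6
  simp only [ContinuousLinearMap.comp_apply, ContinuousLinearMap.flip_apply] at h7
  rw [fderiv_slice_eq (hdiff _ htx)]
  simpa [hsym] using h7

/-- A smooth local flow stays near the initial point for small times. -/
theorem exists_ball_mapsTo {E F : Type*} [NormedAddCommGroup E] [NormedAddCommGroup F]
    {Φ : ℝ → E → F} {ε : ℝ} (hε : 0 < ε) {x₀ : E} {N : Set F}
    (hΦ : ContinuousOn (fun p : ℝ × E => Φ p.1 p.2) (Metric.ball 0 ε ×ˢ Metric.ball x₀ ε))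
    (hN : N ∈ 𝓝 (Φ 0 x₀)) :
    ∃ δ, 0 < δ ∧ δ ≤ ε ∧ ∀ t ∈ Metric.ball (0 : ℝ) δ, ∀ x ∈ Metric.ball x₀ δ, Φ t x ∈ N := by
  have hc : ContinuousAt (fun p : ℝ × E => Φ p.1 p.2) (0, x₀) :=
    hΦ.continuousAt (prod_mem_nhds (Metric.ball_mem_nhds _ hε) (Metric.ball_mem_nhds _ hε))
  obtain ⟨δ, hδ, h⟩ := Metric.eventually_nhds_iff_ball.1 (hc.eventually hN)
  refine ⟨min δ ε, lt_min hδ hε, min_le_right _ _, fun t ht x hx => h (t, x) ?_⟩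
  rw [← ball_prod_same]
  exact ⟨Metric.ball_subset_ball (min_le_left _ _) ht, Metric.ball_subset_ball (min_le_left _ _) hx⟩

/-- The group law of a local flow, for small times. -/
theorem exists_flow_add {Φ : ℝ → E → E} {v : E → E} {ε : ℝ} (hε : 0 < ε) {x₀ : E}
    (hv : ContDiffAt ℝ 1 v x₀)
    (hΦ : ContinuousOn (fun p : ℝ × E => Φ p.1 p.2) (Metric.ball 0 ε ×ˢ Metric.ball x₀ ε))
    (h0 : ∀ x ∈ Metric.ball x₀ ε, Φ 0 x = x)
    (hder : ∀ t ∈ Metric.ball (0 : ℝ) ε, ∀ x ∈ Metric.ball x₀ ε,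
      HasDerivAt (fun t => Φ t x) (v (Φ t x)) t) :
    ∃ δ, 0 < δ ∧ δ ≤ ε ∧ ∀ s ∈ Metric.ball (0 : ℝ) δ, ∀ t ∈ Metric.ball (0 : ℝ) δ,
      ∀ x ∈ Metric.ball x₀ δ, Φ s x ∈ Metric.ball x₀ ε ∧ Φ t (Φ s x) = Φ (s + t) x := by
  obtain ⟨K, S, hS, hK⟩ := hv.exists_lipschitzOnWith
  have hx₀ : Φ 0 x₀ = x₀ := h0 x₀ (Metric.mem_ball_self hε)
  obtain ⟨δ₁, hδ₁, hδ₁ε, h1⟩ := exists_ball_mapsTo hε hΦ (hx₀.symm ▸ hS)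
  obtain ⟨δ₂, hδ₂, hδ₂ε, h2⟩ := exists_ball_mapsTo hε hΦ
    (hx₀.symm ▸ Metric.ball_mem_nhds x₀ hδ₁)
  set δ := min (δ₁ / 2) δ₂ with hδ
  have hδ0 : 0 < δ := lt_min (by positivity) hδ₂
  refine ⟨δ, hδ0, (min_le_right _ _).trans hδ₂ε, fun s hs t ht x hx => ?_⟩
  have hs2 : Φ s x ∈ Metric.ball x₀ δ₁ := by
    have := h2 s (Metric.ball_subset_ball (min_le_right _ _) hs) x
      (Metric.ball_subset_ball (min_le_right _ _) hx)
    rwa [hx₀] at this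
  refine ⟨Metric.ball_subset_ball hδ₁ε hs2, ?_⟩
  rw [mem_ball_zero_iff, Real.norm_eq_abs, abs_lt] at hs ht
  have hδh : δ ≤ δ₁ / 2 := min_le_left _ _
  have hin : ∀ τ ∈ Ioo (-δ) δ, s + τ ∈ Metric.ball (0 : ℝ) δ₁ := fun τ hτ => by
    rw [mem_ball_zero_iff, Real.norm_eq_abs, abs_lt]
    constructor <;> linarith [hτ.1, hτ.2, hs.1, hs.2]
  have hin' : ∀ τ ∈ Ioo (-δ) δ, τ ∈ Metric.ball (0 : ℝ) δ₁ := fun τ hτ => by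
    rw [mem_ball_zero_iff, Real.norm_eq_abs, abs_lt]
    constructor <;> linarith [hτ.1, hτ.2]
  have hx1 : x ∈ Metric.ball x₀ δ₁ := Metric.ball_subset_ball (by linarith) hx
  have h := ODE_solution_unique_of_mem_Ioo (v := fun _ => v) (s := fun _ => S) (K := K)
    (f := fun τ => Φ τ (Φ s x)) (g := fun τ => Φ (s + τ) x) (a := -δ) (b := δ) (t₀ := 0)
    (fun _ _ => hK) ⟨by linarith, by linarith⟩
    (fun τ hτ => ⟨hder τ (Metric.ball_subset_ball hδ₁ε (hin' τ hτ)) _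
      (Metric.ball_subset_ball hδ₁ε hs2), h1 τ (hin' τ hτ) _ hs2⟩)
    (fun τ hτ => ⟨(hder (s + τ) (Metric.ball_subset_ball hδ₁ε (hin τ hτ)) x
      (Metric.ball_subset_ball hδ₁ε hx1)).comp_const_add s τ, h1 _ (hin τ hτ) x hx1⟩)
    (by simp only [add_zero]; exact h0 _ (Metric.ball_subset_ball hδ₁ε hs2))
  exact h ht

theorem linear_ode_lipschitz {B : Type*} [NormedAddCommGroup B] [NormedSpace ℝ B]
    {C₁ C₂ : NNReal} {P : E →L[ℝ] E} {Q : B →L[ℝ] B} (hP : ‖P‖ ≤ C₁) (hQ : ‖Q‖ ≤ C₂) :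
    LipschitzWith (C₁ + C₂) fun R : B →L[ℝ] E => P.comp R + R.comp Q := by
  refine LipschitzWith.of_dist_le_mul fun R S => ?_
  rw [dist_eq_norm, dist_eq_norm]
  have : P.comp R + R.comp Q - (P.comp S + S.comp Q) = P.comp (R - S) + (R - S).comp Q := by
    ext b; simp; abel
  rw [this]
  calc _ ≤ ‖P‖ * ‖R - S‖ + ‖R - S‖ * ‖Q‖ := norm_add_le_of_le
        (ContinuousLinearMap.opNorm_comp_le _ _) (ContinuousLinearMap.opNorm_comp_le _ _)
    _ ≤ C₁ * ‖R - S‖ + ‖R - S‖ * C₂ := by gcongr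
    _ = _ := by push_cast; ring

/-- The flow of `v` transports an anchor `ρ` which is normalised by `v`. -/
theorem exists_flow_transport [FiniteDimensional ℝ E] {B : Type*} [NormedAddCommGroup B]
    [NormedSpace ℝ B] [FiniteDimensional ℝ B] {v : E → E} {ρ : E → B →L[ℝ] E}
    {lam : E → B →L[ℝ] B} {U : Set E} (hU : IsOpen U) (hv : ContDiffOn ℝ ∞ v U)
    (hρ : ContDiffOn ℝ ∞ ρ U) (hlam : ContDiffOn ℝ ∞ lam U)
    (hbr : ∀ z ∈ U, ∀ b, fderiv ℝ ρ z (v z) b - fderiv ℝ v z (ρ z b) = ρ z (lam z b))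
    {z₀ : E} (hz₀ : z₀ ∈ U) :
    ∃ ε > 0, ∃ (Φ : ℝ → E → E) (A : ℝ → E → B →L[ℝ] B),
      ContDiffOn ℝ ∞ (fun p : ℝ × E => Φ p.1 p.2) (Metric.ball 0 ε ×ˢ Metric.ball z₀ ε) ∧
      ContDiffOn ℝ ∞ (fun p : ℝ × E => A p.1 p.2) (Metric.ball 0 ε ×ˢ Metric.ball z₀ ε) ∧
      (∀ x ∈ Metric.ball z₀ ε, Φ 0 x = x) ∧
      ∀ t ∈ Metric.ball (0 : ℝ) ε, ∀ x ∈ Metric.ball z₀ ε,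
        Φ t x ∈ U ∧ HasDerivAt (fun t => Φ t x) (v (Φ t x)) t ∧
        ρ (Φ t x) = (fderiv ℝ (Φ t) x).comp ((ρ x).comp (A t x)) := by
  -- The matrices `A t x` solve `A' = A ∘ lam(Φ)` with `A 0 = id`. Adjoining them to the state makes
  -- them part of a flow, so their smoothness needs no separate argument.
  have haug : ContDiffOn ℝ ∞ (fun p : E × (B →L[ℝ] B) => (v p.1, p.2.comp (lam p.1)))
      (U ×ˢ univ) :=
    (hv.comp contDiffOn_fst fun p hp => hp.1).prodMk
      (contDiffOn_snd.clm_comp (hlam.comp contDiffOn_fst fun p hp => hp.1))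
  obtain ⟨ε₀, hε₀, Ψ, hΨ, hΨ0, hΨd⟩ := exists_smooth_local_flow (hU.prod isOpen_univ) haug
    (x₀ := (z₀, ContinuousLinearMap.id ℝ B)) ⟨hz₀, mem_univ _⟩
  have hmem : ∀ x ∈ Metric.ball z₀ ε₀, (x, ContinuousLinearMap.id ℝ B) ∈
      Metric.ball (z₀, ContinuousLinearMap.id ℝ B) ε₀ := fun x hx => by
    rw [← ball_prod_same]; exact ⟨hx, Metric.mem_ball_self hε₀⟩
  set Φ : ℝ → E → E := fun t x => (Ψ t (x, ContinuousLinearMap.id ℝ B)).1 with hΦ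
  set A : ℝ → E → B →L[ℝ] B := fun t x => (Ψ t (x, ContinuousLinearMap.id ℝ B)).2 with hA
  have hΨ' : ContDiffOn ℝ ∞ (fun p : ℝ × E => Ψ p.1 (p.2, ContinuousLinearMap.id ℝ B))
      (Metric.ball 0 ε₀ ×ˢ Metric.ball z₀ ε₀) :=
    hΨ.comp (f := fun p : ℝ × E => (p.1, (p.2, ContinuousLinearMap.id ℝ B)))
      (contDiff_fst.prodMk (contDiff_snd.prodMk contDiff_const)).contDiffOn
      fun p hp => ⟨hp.1, hmem _ hp.2⟩
  have hΦs : ContDiffOn ℝ ∞ (fun p : ℝ × E => Φ p.1 p.2)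
      (Metric.ball 0 ε₀ ×ˢ Metric.ball z₀ ε₀) := contDiff_fst.comp_contDiffOn hΨ'
  have hAs : ContDiffOn ℝ ∞ (fun p : ℝ × E => A p.1 p.2)
      (Metric.ball 0 ε₀ ×ˢ Metric.ball z₀ ε₀) := contDiff_snd.comp_contDiffOn hΨ'
  have hΦ0 : ∀ x ∈ Metric.ball z₀ ε₀, Φ 0 x = x := fun x hx => by
    simp only [hΦ, hΨ0 _ (hmem x hx)]
  have hA0 : ∀ x ∈ Metric.ball z₀ ε₀, A 0 x = ContinuousLinearMap.id ℝ B := fun x hx => by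
    simp only [hA, hΨ0 _ (hmem x hx)]
  have hΦU : ∀ t ∈ Metric.ball (0 : ℝ) ε₀, ∀ x ∈ Metric.ball z₀ ε₀, Φ t x ∈ U :=
    fun t ht x hx => (hΨd t ht _ (hmem x hx)).1.1
  have hΦd : ∀ t ∈ Metric.ball (0 : ℝ) ε₀, ∀ x ∈ Metric.ball z₀ ε₀,
      HasDerivAt (fun t => Φ t x) (v (Φ t x)) t := fun t ht x hx =>
    (ContinuousLinearMap.fst ℝ E (B →L[ℝ] B)).hasFDerivAt.comp_hasDerivAt t
      (hΨd t ht _ (hmem x hx)).2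
  have hAd : ∀ t ∈ Metric.ball (0 : ℝ) ε₀, ∀ x ∈ Metric.ball z₀ ε₀,
      HasDerivAt (fun t => A t x) ((A t x).comp (lam (Φ t x))) t := fun t ht x hx =>
    (ContinuousLinearMap.snd ℝ E (B →L[ℝ] B)).hasFDerivAt.comp_hasDerivAt t
      (hΨd t ht _ (hmem x hx)).2
  -- bounds for the coefficients of the linear equation
  have hvz : ContDiffAt ℝ ∞ v z₀ := hv.contDiffAt (hU.mem_nhds hz₀)
  have hb1 : ∀ᶠ z in 𝓝 z₀, ‖fderiv ℝ v z‖₊ < ‖fderiv ℝ v z₀‖₊ + 1 :=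
    ((hvz.fderiv_right (m := 0) (by simp)).continuousAt.nnnorm).eventually_lt_const (by simp)
  have hb2 : ∀ᶠ z in 𝓝 z₀, ‖lam z‖₊ < ‖lam z₀‖₊ + 1 :=
    ((hlam.contDiffAt (hU.mem_nhds hz₀)).continuousAt.nnnorm).eventually_lt_const (by simp)
  obtain ⟨ε, hε, hεε₀, hbd⟩ := exists_ball_mapsTo hε₀ hΦs.continuousOn
    (N := {z | ‖fderiv ℝ v z‖₊ < ‖fderiv ℝ v z₀‖₊ + 1 ∧ ‖lam z‖₊ < ‖lam z₀‖₊ + 1})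
    (by rw [hΦ0 z₀ (Metric.mem_ball_self hε₀)]; exact hb1.and hb2)
  have hbt : Metric.ball (0 : ℝ) ε ⊆ Metric.ball 0 ε₀ := Metric.ball_subset_ball hεε₀
  have hbx : Metric.ball z₀ ε ⊆ Metric.ball z₀ ε₀ := Metric.ball_subset_ball hεε₀
  refine ⟨ε, hε, Φ, A, hΦs.mono (prod_mono hbt hbx), hAs.mono (prod_mono hbt hbx),
    fun x hx => hΦ0 x (hbx hx), fun t ht x hx => ⟨hΦU t (hbt ht) x (hbx hx),
      hΦd t (hbt ht) x (hbx hx), ?_⟩⟩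
  have hI : Metric.ball (0 : ℝ) ε = Ioo (-ε) ε := by rw [Real.ball_eq_Ioo]; simp
  have hO : IsOpen (Metric.ball (0 : ℝ) ε₀ ×ˢ Metric.ball z₀ ε₀) :=
    Metric.isOpen_ball.prod Metric.isOpen_ball
  -- Both sides solve `R' = Dv ∘ R + R ∘ lam` along `Φ t x` with `R 0 = ρ x`: the left side by the
  -- bracket hypothesis `hbr`, the right side by the variational equation and the equation for `A`.
  have huniq := ODE_solution_unique_of_mem_Ioo
    (v := fun t (R : B →L[ℝ] E) => (fderiv ℝ v (Φ t x)).comp R + R.comp (lam (Φ t x)))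
    (s := fun _ => univ) (K := (‖fderiv ℝ v z₀‖₊ + 1) + (‖lam z₀‖₊ + 1))
    (f := fun t => ρ (Φ t x)) (g := fun t => (fderiv ℝ (Φ t) x).comp ((ρ x).comp (A t x)))
    (a := -ε) (b := ε) (t₀ := 0) ?_ ⟨by linarith, hε⟩ ?_ ?_ ?_
  · exact huniq (hI ▸ ht)
  · intro τ hτ
    have h := hbd τ (hI ▸ hτ) x hx
    exact (linear_ode_lipschitz (by exact_mod_cast h.1.le) (by exact_mod_cast h.2.le)).lipschitzOnWith
  · intro τ hτ
    have hτ' := hbt (hI ▸ hτ)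
    refine ⟨?_, mem_univ _⟩
    have hzU := hΦU τ hτ' x (hbx hx)
    have hρd := ((hρ.contDiffAt (hU.mem_nhds hzU)).differentiableAt (by simp)).hasFDerivAt
    refine (HasFDerivAt.comp_hasDerivAt τ hρd (hΦd τ hτ' x (hbx hx))).congr_deriv ?_
    ext b
    have := hbr _ hzU b
    rw [sub_eq_iff_eq_add] at this
    simp [this, add_comm]
  · intro τ hτ
    have hτ' := hbt (hI ▸ hτ)
    refine ⟨?_, mem_univ _⟩
    have hzU := hΦU τ hτ' x (hbx hx)
    have h1 := hasDerivAt_fderiv_flow hO hΦs (fun p hp => hΦd p.1 hp.1 p.2 hp.2)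
      (t := τ) (x := x) ⟨hτ', hbx hx⟩ ((hv.contDiffAt (hU.mem_nhds hzU)).differentiableAt (by simp))
    have h2 := (hasDerivAt_const τ (ρ x)).clm_comp (hAd τ hτ' x (hbx hx))
    refine (h1.clm_comp h2).congr_deriv ?_
    ext b
    simp
  · have hid : fderiv ℝ (Φ 0) x = ContinuousLinearMap.id ℝ E := by
      have : Φ 0 =ᶠ[𝓝 x] id := by
        filter_upwards [Metric.isOpen_ball.mem_nhds (hbx hx)] with y hy using hΦ0 y hy
      rw [this.fderiv_eq, fderiv_id]
    simp only [hid, hA0 x (hbx hx), hΦ0 x (hbx hx)]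
    rfl

end Transport

/-! ### Involutive anchors and their suspension by parameters. -/

section Anchor

/-- An anchor `ρ : V × B → E` whose image is closed under brackets of vector fields, with smooth
structure functions `κ`. -/
structure IsInvolutiveAnchor {E B : Type*} [NormedAddCommGroup E] [NormedSpace ℝ E]
    [NormedAddCommGroup B] [NormedSpace ℝ B] (V : Set E) (ρ : E → B →L[ℝ] E)
    (κ : E → B →L[ℝ] B →L[ℝ] B) : Prop where
  isOpen : IsOpen V
  anchor : ContDiffOn ℝ ∞ ρ V
  structure_functions : ContDiffOn ℝ ∞ κ V
  bracket : ∀ z ∈ V, ∀ b b', fderiv ℝ ρ z (ρ z b) b' - fderiv ℝ ρ z (ρ z b') b = ρ z (κ z b b')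

variable {E A B : Type*} [NormedAddCommGroup E] [NormedSpace ℝ E]
  [NormedAddCommGroup A] [NormedSpace ℝ A] [NormedAddCommGroup B] [NormedSpace ℝ B]

/-- Differentiating the coefficient `c` produces `ρ` applied to a vector of `B`, so `(ρ c, w)` still
normalises the anchor `ρ × id`. This is the bracket hypothesis of `exists_flow_transport`. The space
`A` will be the time axis with `w = 1`, or a space of constant coefficients with `w = 0`. -/
theorem IsInvolutiveAnchor.bracket_suspension {V : Set E} {ρ : E → B →L[ℝ] E}
    {κ : E → B →L[ℝ] B →L[ℝ] B} (h : IsInvolutiveAnchor V ρ κ) {O : Set (E × A)} (hO : IsOpen O)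
    (hOV : ∀ p ∈ O, p.1 ∈ V) {c : E × A → B} (hc : ContDiffOn ℝ ∞ c O) (w : A) {p : E × A}
    (hp : p ∈ O) (β : B × A) :
    fderiv ℝ (fun p : E × A => (ρ p.1).prodMap (ContinuousLinearMap.id ℝ A)) p
        (ρ p.1 (c p), w) β -
      fderiv ℝ (fun p : E × A => (ρ p.1 (c p), w)) p
        ((ρ p.1).prodMap (ContinuousLinearMap.id ℝ A) β) =
      (ρ p.1).prodMap (ContinuousLinearMap.id ℝ A)
        ((ContinuousLinearMap.inl ℝ B A).comp ((κ p.1 (c p)).comp (ContinuousLinearMap.fst ℝ B A) -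
          (fderiv ℝ c p).comp ((ρ p.1).prodMap (ContinuousLinearMap.id ℝ A))) β) := by
  have hρ : HasFDerivAt ρ (fderiv ℝ ρ p.1) p.1 :=
    ((h.anchor.contDiffAt (h.isOpen.mem_nhds (hOV p hp))).differentiableAt (by simp)).hasFDerivAt
  have hρ' : HasFDerivAt (fun p : E × A => ρ p.1)
      ((fderiv ℝ ρ p.1).comp (ContinuousLinearMap.fst ℝ E A)) p :=
    HasFDerivAt.comp p hρ hasFDerivAt_fst
  have hc' : HasFDerivAt c (fderiv ℝ c p) p :=
    ((hc.contDiffAt (hO.mem_nhds hp)).differentiableAt (by simp)).hasFDerivAt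
  have h1 : HasFDerivAt (fun p : E × A => (ρ p.1).prodMap (ContinuousLinearMap.id ℝ A))
      ((ContinuousLinearMap.prodMapL ℝ B E A A).comp
        (((fderiv ℝ ρ p.1).comp (ContinuousLinearMap.fst ℝ E A)).prod 0)) p :=
    HasFDerivAt.comp p (ContinuousLinearMap.prodMapL ℝ B E A A).hasFDerivAt
      (hρ'.prodMk (hasFDerivAt_const (ContinuousLinearMap.id ℝ A) p))
  have h2 := (hρ'.clm_apply hc').prodMk (hasFDerivAt_const w p)
  rw [h1.fderiv, h2.fderiv]
  have hb := h.bracket p.1 (hOV p hp) (c p) β.1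
  ext
  · simp [← hb]
    abel
  · simp

/-- Transport along the flow of `(ρ(x) c(x, a), w)` on `E × A`. -/
theorem IsInvolutiveAnchor.exists_suspension_flow [FiniteDimensional ℝ E] [FiniteDimensional ℝ A]
    [FiniteDimensional ℝ B] {V : Set E} {ρ : E → B →L[ℝ] E}
    {κ : E → B →L[ℝ] B →L[ℝ] B} (h : IsInvolutiveAnchor V ρ κ) {O : Set (E × A)} (hO : IsOpen O)
    (hOV : ∀ p ∈ O, p.1 ∈ V) {c : E × A → B} (hc : ContDiffOn ℝ ∞ c O) (w : A) {p₀ : E × A}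
    (hp₀ : p₀ ∈ O) :
    ContDiffOn ℝ ∞ (fun p : E × A => (ρ p.1 (c p), w)) O ∧
    ∃ ε > 0, ∃ (Φ : ℝ → E × A → E × A) (𝒜 : ℝ → E × A → (B × A) →L[ℝ] (B × A)),
      ContDiffOn ℝ ∞ (fun q : ℝ × (E × A) => Φ q.1 q.2) (Metric.ball 0 ε ×ˢ Metric.ball p₀ ε) ∧
      ContDiffOn ℝ ∞ (fun q : ℝ × (E × A) => 𝒜 q.1 q.2) (Metric.ball 0 ε ×ˢ Metric.ball p₀ ε) ∧
      (∀ p ∈ Metric.ball p₀ ε, Φ 0 p = p) ∧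
      ∀ t ∈ Metric.ball (0 : ℝ) ε, ∀ p ∈ Metric.ball p₀ ε,
        Φ t p ∈ O ∧ HasDerivAt (fun t => Φ t p) (ρ (Φ t p).1 (c (Φ t p)), w) t ∧
        (Φ t p).2 = p.2 + t • w ∧
        ∀ b a, (𝒜 t p (b, a)).2 = a ∧
          (ρ (Φ t p).1 b, a) = fderiv ℝ (Φ t) p (ρ p.1 (𝒜 t p (b, a)).1, a) := by
  have hρO : ContDiffOn ℝ ∞ (fun p : E × A => ρ p.1) O :=
    h.anchor.comp contDiffOn_fst fun p hp => hOV p hp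
  have hκO : ContDiffOn ℝ ∞ (fun p : E × A => κ p.1) O :=
    h.structure_functions.comp contDiffOn_fst fun p hp => hOV p hp
  have hv : ContDiffOn ℝ ∞ (fun p : E × A => (ρ p.1 (c p), w)) O :=
    (hρO.clm_apply hc).prodMk contDiffOn_const
  have hρ' : ContDiffOn ℝ ∞ (fun p : E × A => (ρ p.1).prodMap (ContinuousLinearMap.id ℝ A)) O :=
    (ContinuousLinearMap.prodMapL ℝ B E A A).contDiff.comp_contDiffOn
      (hρO.prodMk (contDiffOn_const (c := ContinuousLinearMap.id ℝ A)))
  have hlam : ContDiffOn ℝ ∞ (fun p : E × A => (ContinuousLinearMap.inl ℝ B A).comp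
      ((κ p.1 (c p)).comp (ContinuousLinearMap.fst ℝ B A) -
        (fderiv ℝ c p).comp ((ρ p.1).prodMap (ContinuousLinearMap.id ℝ A)))) O := by
    refine contDiffOn_const.clm_comp (((hκO.clm_apply hc).clm_comp contDiffOn_const).sub
      (ContDiffOn.clm_comp ?_ hρ'))
    exact hc.fderiv_of_isOpen hO (by simp)
  refine ⟨hv, ?_⟩
  obtain ⟨ε, hε, Φ, 𝒜, hΦ, h𝒜, h0, hd⟩ := exists_flow_transport hO hv hρ' hlam
    (fun p hp β => h.bracket_suspension hO hOV hc w hp β) hp₀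
  have hI : Metric.ball (0 : ℝ) ε = Ioo (-ε) ε := by rw [Real.ball_eq_Ioo]; simp
  have hsnd : ∀ t ∈ Metric.ball (0 : ℝ) ε, ∀ p ∈ Metric.ball p₀ ε, (Φ t p).2 = p.2 + t • w := by
    intro t ht p hp
    have hu := ODE_solution_unique_of_mem_Ioo (v := fun _ (_ : A) => w) (s := fun _ => univ)
      (K := 0) (f := fun t => (Φ t p).2) (g := fun t => p.2 + t • w) (a := -ε) (b := ε) (t₀ := 0)
      (fun _ _ => (LipschitzWith.const w).lipschitzOnWith) ⟨by linarith, hε⟩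
      (fun τ hτ => ⟨(ContinuousLinearMap.snd ℝ E A).hasFDerivAt.comp_hasDerivAt τ
        (hd τ (hI ▸ hτ) p hp).2.1, mem_univ _⟩)
      (fun τ _ => ⟨by simpa using ((hasDerivAt_id τ).smul_const w).const_add p.2, mem_univ _⟩)
      (by simp [h0 p hp])
    exact hu (hI ▸ ht)
  refine ⟨ε, hε, Φ, 𝒜, hΦ, h𝒜, h0, fun t ht p hp => ⟨(hd t ht p hp).1, (hd t ht p hp).2.1,
    hsnd t ht p hp, fun b a => ?_⟩⟩
  have heq : (ρ (Φ t p).1 b, a) =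
      fderiv ℝ (Φ t) p (ρ p.1 (𝒜 t p (b, a)).1, (𝒜 t p (b, a)).2) :=
    congrArg (fun L : B × A →L[ℝ] E × A => L (b, a)) (hd t ht p hp).2.2
  have hdiff : DifferentiableAt ℝ (Φ t) p := by
    have h1 : DifferentiableAt ℝ (fun q : ℝ × (E × A) => Φ q.1 q.2) (t, p) :=
      (hΦ.contDiffAt (prod_mem_nhds (Metric.isOpen_ball.mem_nhds ht)
        (Metric.isOpen_ball.mem_nhds hp))).differentiableAt (by simp)
    exact h1.comp (f := fun p => (t, p)) p (by fun_prop)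
  -- The flow is a translation in the `A` direction, so its derivative fixes `A` components;
  -- comparing second components in `heq` then shows that `𝒜` fixes them too.
  have hsd : ∀ q : E × A, (fderiv ℝ (Φ t) p q).2 = q.2 := by
    have h2 : HasFDerivAt (fun p => (Φ t p).2)
        ((ContinuousLinearMap.snd ℝ E A).comp (fderiv ℝ (Φ t) p)) p :=
      HasFDerivAt.comp p (ContinuousLinearMap.snd ℝ E A).hasFDerivAt hdiff.hasFDerivAt
    have h3 : HasFDerivAt (fun p : E × A => p.2 + t • w) (ContinuousLinearMap.snd ℝ E A) p :=
      (ContinuousLinearMap.snd ℝ E A).hasFDerivAt.add_const _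
    have h4 := h2.unique (h3.congr_of_eventuallyEq (by
      filter_upwards [Metric.isOpen_ball.mem_nhds hp] with q hq using hsnd t ht q hq))
    intro q
    exact congrArg (fun L : E × A →L[ℝ] A => L q) h4
  have ha : (𝒜 t p (b, a)).2 = a := by
    have := congrArg Prod.snd heq
    rw [hsd] at this
    exact this.symm
  refine ⟨ha, ?_⟩
  rw [ha] at heq
  exact heq

end Anchor

/-! ### Evolution operators of time-dependent fields. -/

section TimeDepFlow

variable {E B : Type*} [NormedAddCommGroup E] [NormedSpace ℝ E]
  [NormedAddCommGroup B] [NormedSpace ℝ B]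

/-- The local evolution operators `Ψ s t` of the time-dependent vector field `ρ(x) c(x, t)`, and
transport of the anchor by them. -/
theorem IsInvolutiveAnchor.exists_evolution [FiniteDimensional ℝ E] [FiniteDimensional ℝ B]
    {V : Set E} {ρ : E → B →L[ℝ] E} {κ : E → B →L[ℝ] B →L[ℝ] B} (h : IsInvolutiveAnchor V ρ κ)
    {O : Set (E × ℝ)} (hO : IsOpen O) (hOV : ∀ p ∈ O, p.1 ∈ V) {c : E × ℝ → B}
    (hc : ContDiffOn ℝ ∞ c O) {x₀ : E} {t₀ : ℝ} (hp₀ : (x₀, t₀) ∈ O) :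
    ∃ δ > 0, ∃ (Ψ : ℝ → ℝ → E → E) (𝒜 : ℝ → ℝ → E → B →L[ℝ] B),
      ContDiffOn ℝ ∞ (fun q : ℝ × ℝ × E => Ψ q.1 q.2.1 q.2.2)
        (Metric.ball t₀ δ ×ˢ Metric.ball t₀ δ ×ˢ Metric.ball x₀ δ) ∧
      (∀ s ∈ Metric.ball t₀ δ, ∀ t ∈ Metric.ball t₀ δ,
        ContDiffOn ℝ ∞ (𝒜 s t) (Metric.ball x₀ δ)) ∧
      (∀ s ∈ Metric.ball t₀ δ, ∀ t ∈ Metric.ball t₀ δ, ∀ x ∈ Metric.ball x₀ δ,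
        Ψ s s x = x ∧ (Ψ s t x, t) ∈ O ∧
        HasDerivAt (fun t => Ψ s t x) (ρ (Ψ s t x) (c (Ψ s t x, t))) t ∧
        ∀ b, ρ (Ψ s t x) b = fderiv ℝ (Ψ s t) x (ρ x (𝒜 s t x b))) ∧
      ∃ δ' > 0, δ' ≤ δ ∧ ∀ s ∈ Metric.ball t₀ δ', ∀ t ∈ Metric.ball t₀ δ',
        ∀ x ∈ Metric.ball x₀ δ', Ψ s t x ∈ Metric.ball x₀ δ ∧ Ψ t s (Ψ s t x) = x := by
  obtain ⟨hv, ε, hε, Φ, 𝒜, hΦ, h𝒜, h0, hd⟩ := h.exists_suspension_flow hO hOV hc (1 : ℝ) hp₀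
  obtain ⟨δg, hδg, hδgε, hgrp⟩ := exists_flow_add hε
    ((hv.contDiffAt (hO.mem_nhds hp₀)).of_le (by simp)) hΦ.continuousOn h0
    (fun t ht p hp => (hd t ht p hp).2.1)
  have hdiff : ∀ {r : ℝ}, ∀ s ∈ Metric.ball t₀ (r / 2), ∀ t ∈ Metric.ball t₀ (r / 2),
      t - s ∈ Metric.ball (0 : ℝ) r := by
    intro r s hs t ht
    rw [Metric.mem_ball, Real.dist_eq, abs_lt] at *
    constructor <;> linarith [hs.1, hs.2, ht.1, ht.2]
  have hmem : ∀ {r : ℝ}, 0 < r → ∀ s ∈ Metric.ball t₀ (r / 2), ∀ x ∈ Metric.ball x₀ (r / 2),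
      (x, s) ∈ Metric.ball (x₀, t₀) r := by
    intro r hr s hs x hx
    rw [← ball_prod_same]
    exact ⟨Metric.ball_subset_ball (by linarith) hx, Metric.ball_subset_ball (by linarith) hs⟩
  have hsub : ∀ s ∈ Metric.ball t₀ (ε / 2), ∀ t ∈ Metric.ball t₀ (ε / 2),
      ∀ x ∈ Metric.ball x₀ (ε / 2), Φ (t - s) (x, s) = ((Φ (t - s) (x, s)).1, t) := by
    intro s hs t ht x hx
    have := (hd _ (hdiff s hs t ht) _ (hmem hε s hs x hx)).2.2.1
    ext
    · rfl
    · rw [this]; simp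
  -- Evolution from `s` to `t` is the suspended flow for time `t - s` started at `(x, s)`. The
  -- radius is halved because `t - s` must stay within `ε` of zero.
  refine ⟨ε / 2, by positivity, fun s t x => (Φ (t - s) (x, s)).1,
    fun s t x => (ContinuousLinearMap.fst ℝ B ℝ).comp
      ((𝒜 (t - s) (x, s)).comp (ContinuousLinearMap.inl ℝ B ℝ)), ?_, ?_, ?_, ?_⟩
  · refine contDiff_fst.comp_contDiffOn (hΦ.comp
      (f := fun q : ℝ × ℝ × E => (q.2.1 - q.1, (q.2.2, q.1))) ?_ ?_)
    · exact ContDiff.contDiffOn (by fun_prop)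
    · rintro ⟨s, t, x⟩ ⟨hs, ht, hx⟩
      exact ⟨hdiff s hs t ht, hmem hε s hs x hx⟩
  · intro s hs t ht
    refine contDiffOn_const.clm_comp (ContDiffOn.clm_comp (h𝒜.comp
      (f := fun x : E => (t - s, (x, s))) ?_ ?_) contDiffOn_const)
    · exact ContDiff.contDiffOn (by fun_prop)
    · intro x hx
      exact ⟨hdiff s hs t ht, hmem hε s hs x hx⟩
  · intro s hs t ht x hx
    obtain ⟨h1, h2, -, h4⟩ := hd _ (hdiff s hs t ht) _ (hmem hε s hs x hx)
    refine ⟨?_, ?_, ?_, ?_⟩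
    · simp only [sub_self]
      rw [h0 _ (hmem hε s hs x hx)]
    · rw [← hsub s hs t ht x hx]
      exact h1
    · have h5 := (ContinuousLinearMap.fst ℝ E ℝ).hasFDerivAt.comp_hasDerivAt _ h2
      have h6 := HasDerivAt.comp_sub_const t s h5
      rw [hsub s hs t ht x hx] at h6
      exact h6
    · intro b
      obtain ⟨h5, h6⟩ := h4 b 0
      have hΦd : DifferentiableAt ℝ (Φ (t - s)) (x, s) := by
        have h7 : DifferentiableAt ℝ (fun q : ℝ × (E × ℝ) => Φ q.1 q.2) (t - s, (x, s)) :=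
          (hΦ.contDiffAt (prod_mem_nhds (Metric.isOpen_ball.mem_nhds (hdiff s hs t ht))
            (Metric.isOpen_ball.mem_nhds (hmem hε s hs x hx)))).differentiableAt (by simp)
        exact h7.comp (f := fun p => (t - s, p)) (x, s) (by fun_prop)
      have h8 : HasFDerivAt (fun x => (Φ (t - s) (x, s)).1)
          ((ContinuousLinearMap.fst ℝ E ℝ).comp ((fderiv ℝ (Φ (t - s)) (x, s)).comp
            (ContinuousLinearMap.inl ℝ E ℝ))) x :=
        (ContinuousLinearMap.fst ℝ E ℝ).hasFDerivAt.comp x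
          (hΦd.hasFDerivAt.comp x (hasFDerivAt_prodMk_left x s))
      rw [h8.fderiv]
      exact congrArg Prod.fst h6
  · obtain ⟨δm, hδm, -, hmap⟩ := exists_ball_mapsTo hε hΦ.continuousOn
      (N := Metric.ball (x₀, t₀) (ε / 2)) (by
        rw [h0 _ (Metric.mem_ball_self hε)]
        exact Metric.ball_mem_nhds _ (by positivity))
    set δ := min δg δm with hδ
    have hδ0 : 0 < δ := lt_min hδg hδm
    have hδδg : δ ≤ δg := min_le_left _ _
    have hδδm : δ ≤ δm := min_le_right _ _
    refine ⟨δ / 2, by positivity, by linarith, fun s hs t ht x hx => ?_⟩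
    have hle : Metric.ball t₀ (δ / 2) ⊆ Metric.ball t₀ (ε / 2) :=
      Metric.ball_subset_ball (by linarith)
    have hlex : Metric.ball x₀ (δ / 2) ⊆ Metric.ball x₀ (ε / 2) :=
      Metric.ball_subset_ball (by linarith)
    have h1 := hmap (t - s) (Metric.ball_subset_ball hδδm (hdiff s hs t ht)) (x, s)
      (Metric.ball_subset_ball hδδm (hmem hδ0 s hs x hx))
    rw [← ball_prod_same] at h1
    obtain ⟨-, h2⟩ := hgrp (t - s) (Metric.ball_subset_ball hδδg (hdiff s hs t ht)) (s - t)
      (Metric.ball_subset_ball hδδg (hdiff t ht s hs)) (x, s)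
      (Metric.ball_subset_ball hδδg (hmem hδ0 s hs x hx))
    refine ⟨h1.1, ?_⟩
    rw [hsub s (hle hs) t (hle ht) x (hlex hx), sub_add_sub_cancel, sub_self,
      h0 _ (hmem hε s (hle hs) x (hlex hx))] at h2
    exact congrArg Prod.fst h2

end TimeDepFlow

/-! ### Local splitting of an anchor along a transversal. -/

section Splitting

/-- Uniqueness for the local flow: short integral curves near the base point are flow lines. -/
theorem exists_flow_unique {E : Type*} [NormedAddCommGroup E] [NormedSpace ℝ E]
    {Φ : ℝ → E → E} {v : E → E} {ε : ℝ} (hε : 0 < ε) {x₀ : E} (hv : ContDiffAt ℝ 1 v x₀)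
    (hΦ : ContinuousOn (fun p : ℝ × E => Φ p.1 p.2) (Metric.ball 0 ε ×ˢ Metric.ball x₀ ε))
    (h0 : ∀ x ∈ Metric.ball x₀ ε, Φ 0 x = x)
    (hder : ∀ t ∈ Metric.ball (0 : ℝ) ε, ∀ x ∈ Metric.ball x₀ ε,
      HasDerivAt (fun t => Φ t x) (v (Φ t x)) t) :
    ∃ δ, 0 < δ ∧ δ ≤ ε ∧ ∃ S ∈ 𝓝 x₀, ∀ x ∈ Metric.ball x₀ δ, ∀ T, 0 ≤ T → T < δ → ∀ η : ℝ → E,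
      η 0 = x → (∀ τ ∈ Icc 0 T, HasDerivAt η (v (η τ)) τ ∧ η τ ∈ S) → η T = Φ T x := by
  obtain ⟨K, S, hS, hK⟩ := hv.exists_lipschitzOnWith
  have hx₀ : Φ 0 x₀ = x₀ := h0 x₀ (Metric.mem_ball_self hε)
  obtain ⟨δ, hδ, hδε, h1⟩ := exists_ball_mapsTo hε hΦ (hx₀.symm ▸ hS)
  refine ⟨δ, hδ, hδε, S, hS, fun x hx T hT hTδ η hη0 hη => ?_⟩
  have hτ : ∀ τ ∈ Icc 0 T, τ ∈ Metric.ball (0 : ℝ) δ := fun τ hτ => by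
    rw [mem_ball_zero_iff, Real.norm_eq_abs, abs_lt]
    constructor <;> linarith [hτ.1, hτ.2]
  have hd : ∀ τ ∈ Icc 0 T, HasDerivAt (fun t => Φ t x) (v (Φ τ x)) τ := fun τ h =>
    hder τ (Metric.ball_subset_ball hδε (hτ τ h)) x (Metric.ball_subset_ball hδε hx)
  exact ODE_solution_unique_of_mem_Icc_right (v := fun _ => v) (s := fun _ => S) (K := K)
    (f := η) (g := fun τ => Φ τ x) (a := 0) (b := T) (fun _ _ => hK)
    (fun τ h => (hη τ h).1.continuousAt.continuousWithinAt)
    (fun τ h => (hη τ (Ico_subset_Icc_self h)).1.hasDerivWithinAt)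
    (fun τ h => (hη τ (Ico_subset_Icc_self h)).2)
    (fun τ h => (hd τ h).continuousAt.continuousWithinAt)
    (fun τ h => (hd τ (Ico_subset_Icc_self h)).hasDerivWithinAt)
    (fun τ h => h1 τ (hτ τ (Ico_subset_Icc_self h)) x hx)
    (by rw [hη0, h0 x (Metric.ball_subset_ball hδε hx)]) ⟨hT, le_rfl⟩

theorem ContDiffOn.exists_inverse {X P Q : Type*} [NormedAddCommGroup X] [NormedSpace ℝ X]
    [NormedAddCommGroup P] [NormedSpace ℝ P] [CompleteSpace P] [NormedAddCommGroup Q]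
    [NormedSpace ℝ Q] {M : X → P →L[ℝ] Q} {U : Set X} (hU : IsOpen U) (hM : ContDiffOn ℝ ∞ M U)
    {x₀ : X} (hx₀ : x₀ ∈ U) (h : (M x₀).IsInvertible) :
    ∃ U' : Set X, IsOpen U' ∧ x₀ ∈ U' ∧ U' ⊆ U ∧ (∀ x ∈ U', (M x).IsInvertible) ∧
      ContDiffOn ℝ ∞ (fun x => (M x).inverse) U' := by
  obtain ⟨e, he⟩ := h
  have h1 : ∀ᶠ x in 𝓝 x₀, M x ∈ range ((↑) : (P ≃L[ℝ] Q) → P →L[ℝ] Q) := by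
    apply (hM.contDiffAt (hU.mem_nhds hx₀)).continuousAt
    rw [← he]
    exact ContinuousLinearEquiv.nhds e
  obtain ⟨W, hW, hWo, hxW⟩ := eventually_nhds_iff.1 (h1.and (hU.mem_nhds hx₀))
  refine ⟨W, hWo, hxW, fun x hx => (hW x hx).2, fun x hx => (hW x hx).1, fun x hx => ?_⟩
  obtain ⟨⟨e', he'⟩, hxU⟩ := hW x hx
  have h2 : ContDiffAt ℝ ∞ (fun T : P →L[ℝ] Q => T.inverse) (M x) := by
    rw [← he']
    exact contDiffAt_map_inverse e'
  exact (h2.comp x (hM.contDiffAt (hU.mem_nhds hxU))).contDiffWithinAt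

/-- The linear splitting determined by two complementary subspaces, one of them rescaled. -/
theorem exists_splitting_equiv {D E : Type*} [NormedAddCommGroup D] [NormedSpace ℝ D]
    [FiniteDimensional ℝ D] [NormedAddCommGroup E] [NormedSpace ℝ E] [FiniteDimensional ℝ E]
    {j : D →L[ℝ] E} (hj : Function.Injective j) {L : Submodule ℝ E}
    (hc : IsCompl (LinearMap.range (j : D →ₗ[ℝ] E)) L) {T : ℝ} (hT : T ≠ 0) :
    ∃ e : (D × L) ≃L[ℝ] E, ∀ u a, e (u, a) = j u + T • (a : E) := by
  let f : (D × L) →ₗ[ℝ] E := (j : D →ₗ[ℝ] E).coprod (T • L.subtype)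
  have hinj : Function.Injective f := by
    rw [← LinearMap.ker_eq_bot, LinearMap.ker_eq_bot']
    rintro ⟨u, a⟩ h
    have h' : j u + T • (a : E) = 0 := h
    have h1 : j u ∈ LinearMap.range (j : D →ₗ[ℝ] E) ⊓ L := by
      refine ⟨⟨u, rfl⟩, ?_⟩
      rw [eq_neg_of_add_eq_zero_left h']
      exact L.neg_mem (L.smul_mem _ a.2)
    rw [hc.inf_eq_bot, Submodule.mem_bot] at h1
    rw [h1, zero_add] at h'
    have h2 : (a : E) = 0 := (smul_eq_zero.1 h').resolve_left hT
    have h3 : u = 0 := hj (by rw [h1, map_zero])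
    ext
    · rw [h3]; rfl
    · simpa using h2
  have hsurj : Function.Surjective f := by
    intro x
    have hx : x ∈ LinearMap.range (j : D →ₗ[ℝ] E) ⊔ L := by
      rw [hc.sup_eq_top]; trivial
    obtain ⟨_, ⟨u, rfl⟩, a, ha, rfl⟩ := Submodule.mem_sup.1 hx
    refine ⟨(u, T⁻¹ • ⟨a, ha⟩), ?_⟩
    change j u + T • (T⁻¹ • a) = _
    rw [smul_smul, mul_inv_cancel₀ hT, one_smul]
    rfl
  exact ⟨(LinearEquiv.ofBijective f ⟨hinj, hsurj⟩).toContinuousLinearEquiv, fun u a => rfl⟩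

end Splitting

section Splitting

variable {E B D : Type*} [NormedAddCommGroup E] [NormedSpace ℝ E] [FiniteDimensional ℝ E]
  [NormedAddCommGroup B] [NormedSpace ℝ B] [FiniteDimensional ℝ B]
  [NormedAddCommGroup D] [NormedSpace ℝ D] [FiniteDimensional ℝ D]

/-- The exponential of the constant combinations of the generators, together with the transport of
the generators along it. -/
theorem IsInvolutiveAnchor.exists_exponential {V : Set E} {ρ : E → B →L[ℝ] E}
    {κ : E → B →L[ℝ] B →L[ℝ] B} (h : IsInvolutiveAnchor V ρ κ) {y : E} (hy : y ∈ V)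
    {L : Submodule ℝ E} (c₀ : L →L[ℝ] B) :
    ∃ r > 0, ∃ T > (0 : ℝ), ∃ (Θ : ℝ → E × L → E) (P : E × L → B →L[ℝ] B) (Q : E × L → L →L[ℝ] B),
      ContDiffOn ℝ ∞ (Θ 1) (Metric.ball y r ×ˢ Metric.ball 0 r) ∧
      ContDiffOn ℝ ∞ P (Metric.ball y r ×ˢ Metric.ball 0 r) ∧
      ContDiffOn ℝ ∞ Q (Metric.ball y r ×ˢ Metric.ball 0 r) ∧
      ∀ x ∈ Metric.ball y r, ∀ a ∈ Metric.ball (0 : L) r,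
        Θ 0 (x, a) = x ∧ (∀ t ∈ Icc (0 : ℝ) 1, Θ t (x, a) ∈ V ∧ Θ 1 (x, t • a) = Θ t (x, a) ∧
          HasDerivAt (fun t => Θ t (x, a)) (ρ (Θ t (x, a)) (T • c₀ a)) t) ∧
        ∀ b a', ρ (Θ 1 (x, a)) b = fderiv ℝ (Θ 1) (x, a) (ρ x (P (x, a) b + Q (x, a) a'), a') := by
  -- The coefficient vector is adjoined as a coordinate with velocity `0`, so one flow treats all
  -- constant combinations at once and smoothly.
  obtain ⟨hv, ε, hε, Φ, 𝒜, hΦ, h𝒜, h0, hd⟩ := h.exists_suspension_flow (A := L)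
    (O := V ×ˢ univ) (h.isOpen.prod isOpen_univ) (fun p hp => hp.1) (c := fun p => c₀ p.2)
    (c₀.contDiff.comp contDiff_snd).contDiffOn 0 (p₀ := (y, 0)) ⟨hy, trivial⟩
  have hopen : IsOpen (V ×ˢ (univ : Set L)) := h.isOpen.prod isOpen_univ
  obtain ⟨δ, hδ, hδε, S, hS, hun⟩ := exists_flow_unique hε
    ((hv.contDiffAt (hopen.mem_nhds ⟨hy, trivial⟩)).of_le (by simp)) hΦ.continuousOn h0
    (fun t ht p hp => (hd t ht p hp).2.1)
  obtain ⟨r', hr', hrS⟩ := Metric.mem_nhds_iff.1 hS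
  have hΦ0 : Φ 0 (y, 0) = (y, 0) := h0 _ (Metric.mem_ball_self hε)
  obtain ⟨δ₂, hδ₂, hδ₂ε, hmap⟩ := exists_ball_mapsTo hε hΦ.continuousOn
    (N := Metric.ball (y, 0) r') (by rw [hΦ0]; exact Metric.ball_mem_nhds _ hr')
  obtain ⟨r, hr, hrδ, hrδ₂, hrr'⟩ : ∃ r > 0, r ≤ δ ∧ r ≤ δ₂ ∧ r ≤ r' :=
    ⟨min δ (min δ₂ r'), by positivity, min_le_left _ _, (min_le_right _ _).trans (min_le_left _ _),
      (min_le_right _ _).trans (min_le_right _ _)⟩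
  have hTr : r / 2 < r := by linarith
  have hball : ∀ s ≥ r, Metric.ball y r ×ˢ Metric.ball (0 : L) r ⊆ Metric.ball (y, (0 : L)) s := by
    intro s hs
    rw [ball_prod_same]
    exact Metric.ball_subset_ball hs
  have htime : ∀ t ∈ Icc (0 : ℝ) 1, t * (r / 2) ∈ Icc 0 (r / 2) := fun t ht =>
    ⟨by have := ht.1; positivity, by nlinarith [ht.2]⟩
  have htimeb : ∀ t ∈ Icc (0 : ℝ) (r / 2), t ∈ Metric.ball (0 : ℝ) r := fun t ht => by
    rw [mem_ball_zero_iff, Real.norm_eq_abs, abs_lt]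
    constructor <;> linarith [ht.1, ht.2]
  have hT1 : 1 * (r / 2) ∈ Metric.ball (0 : ℝ) ε :=
    Metric.ball_subset_ball (hrδ.trans hδε) (htimeb _ (htime 1 ⟨zero_le_one, le_rfl⟩))
  have hslice : MapsTo (fun p : E × L => ((1 * (r / 2), p) : ℝ × (E × L)))
      (Metric.ball y r ×ˢ Metric.ball 0 r) (Metric.ball 0 ε ×ˢ Metric.ball (y, 0) ε) :=
    fun p hp => ⟨hT1, hball _ (hrδ.trans hδε) hp⟩
  have h𝒜1 : ContDiffOn ℝ ∞ (fun p => 𝒜 (1 * (r / 2)) p)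
      (Metric.ball y r ×ˢ Metric.ball (0 : L) r) :=
    h𝒜.comp (contDiff_prodMk_right _).contDiffOn hslice
  have hΦ1 : ContDiffOn ℝ ∞ (fun p => Φ (1 * (r / 2)) p)
      (Metric.ball y r ×ˢ Metric.ball (0 : L) r) :=
    hΦ.comp (contDiff_prodMk_right _).contDiffOn hslice
  -- Unit time of `Θ` is time `r / 2` of the local flow, hence the factor `T = r / 2` in the
  -- velocities. `P` and `Q` are the parts of the transport matrix acting on `B` and on the
  -- parameters.
  refine ⟨r, hr, r / 2, by positivity, fun t p => (Φ (t * (r / 2)) p).1,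
    fun p => (ContinuousLinearMap.fst ℝ B L).comp
      ((𝒜 (1 * (r / 2)) p).comp (ContinuousLinearMap.inl ℝ B L)),
    fun p => (ContinuousLinearMap.fst ℝ B L).comp
      ((𝒜 (1 * (r / 2)) p).comp (ContinuousLinearMap.inr ℝ B L)),
    contDiff_fst.comp_contDiffOn hΦ1,
    contDiffOn_const.clm_comp (h𝒜1.clm_comp contDiffOn_const),
    contDiffOn_const.clm_comp (h𝒜1.clm_comp contDiffOn_const), ?_⟩
  intro x hx a ha
  have hpε : (x, a) ∈ Metric.ball (y, (0 : L)) ε := hball _ (hrδ.trans hδε) ⟨hx, ha⟩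
  have hder : ∀ t ∈ Icc (0 : ℝ) (r / 2),
      HasDerivAt (fun t => (Φ t (x, a)).1) (ρ (Φ t (x, a)).1 (c₀ a)) t := by
    intro t ht
    have hd' := hd t (Metric.ball_subset_ball (hrδ.trans hδε) (htimeb t ht)) _ hpε
    have h1 := (ContinuousLinearMap.fst ℝ E L).hasFDerivAt.comp_hasDerivAt t hd'.2.1
    have h2 : (Φ t (x, a)).2 = a := by rw [hd'.2.2.1]; simp
    rw [h2] at h1
    exact h1
  refine ⟨by simp [h0 _ hpε], fun t ht => ⟨?_, ?_, ?_⟩, fun b a' => ?_⟩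
  · exact (hd _ (Metric.ball_subset_ball (hrδ.trans hδε) (htimeb _ (htime t ht))) _ hpε).1.1
  · have hta : t • a ∈ Metric.ball (0 : L) r := by
      rw [mem_ball_zero_iff] at ha ⊢
      rw [norm_smul, Real.norm_eq_abs, abs_of_nonneg ht.1]
      exact (mul_le_of_le_one_left (norm_nonneg a) ht.2).trans_lt ha
    -- Scaling the coefficients by `t` amounts to slowing time down by `t`: the slowed curve is an
    -- integral curve for `t • a`, so uniqueness applies.
    have key := hun (x, t • a) (hball _ hrδ ⟨hx, hta⟩) (r / 2) (by positivity) (by linarith)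
      (fun τ => ((Φ (t * τ) (x, a)).1, t • a)) (by simp [h0 _ hpε]) (fun τ hτ => ?_)
    · have h3 := congrArg Prod.fst key
      simp only [one_mul]
      exact h3.symm
    · have hτ' : t * τ ∈ Icc 0 (r / 2) :=
        ⟨mul_nonneg ht.1 hτ.1, (mul_le_of_le_one_left hτ.1 ht.2).trans hτ.2⟩
      refine ⟨?_, hrS ?_⟩
      · have h4 := (hder _ hτ').scomp τ ((hasDerivAt_id τ).const_mul t)
        have h5 : HasDerivAt (fun τ => (Φ (t * τ) (x, a)).1)
            (ρ (Φ (t * τ) (x, a)).1 (c₀ (t • a))) τ := by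
          rw [map_smul, map_smul]
          rwa [mul_one] at h4
        exact h5.prodMk (hasDerivAt_const τ (t • a))
      · have h6 := hmap _ (Metric.ball_subset_ball hrδ₂ (htimeb _ hτ')) _
          (hball _ hrδ₂ (mk_mem_prod hx ha))
        rw [← ball_prod_same] at h6 ⊢
        exact ⟨h6.1, Metric.ball_subset_ball hrr' hta⟩
  · have h4 := (hder _ (htime t ht)).scomp t ((hasDerivAt_id t).mul_const (r / 2))
    rw [one_mul] at h4
    rw [map_smul]
    exact h4
  · obtain ⟨-, h7⟩ := (hd _ hT1 _ hpε).2.2.2 b a'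
    have hdiff : DifferentiableAt ℝ (Φ (1 * (r / 2))) (x, a) :=
      (hΦ1.contDiffAt ((Metric.isOpen_ball.prod Metric.isOpen_ball).mem_nhds
        ⟨hx, ha⟩)).differentiableAt (by simp)
    have h8 : HasFDerivAt (fun p => (Φ (1 * (r / 2)) p).1)
        ((ContinuousLinearMap.fst ℝ E L).comp (fderiv ℝ (Φ (1 * (r / 2))) (x, a))) (x, a) :=
      HasFDerivAt.comp (x, a) (ContinuousLinearMap.fst ℝ E L).hasFDerivAt hdiff.hasFDerivAt
    rw [h8.fderiv]
    have h9 : (𝒜 (1 * (r / 2)) (x, a) (b, a')).1 =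
        (𝒜 (1 * (r / 2)) (x, a) (b, 0)).1 + (𝒜 (1 * (r / 2)) (x, a) (0, a')).1 := by
      rw [← Prod.fst_add, ← map_add]
      simp
    have h10 := congrArg Prod.fst h7
    rw [h9] at h10
    exact h10

omit [FiniteDimensional ℝ E] in
/-- The derivative of the exponential at the zero section. -/
theorem fderiv_exponential {L : Submodule ℝ E} {Θ : ℝ → E × L → E} {y : E} {r T : ℝ} (hr : 0 < r)
    (hΘ : ContDiffOn ℝ ∞ (Θ 1) (Metric.ball y r ×ˢ Metric.ball 0 r))
    (h0 : ∀ x ∈ Metric.ball y r, Θ 1 (x, 0) = x)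
    (hsc : ∀ a ∈ Metric.ball (0 : L) r, ∀ t ∈ Icc (0 : ℝ) 1, Θ 1 (y, t • a) = Θ t (y, a))
    (hder : ∀ a ∈ Metric.ball (0 : L) r, HasDerivAt (fun t => Θ t (y, a)) (T • (a : E)) 0)
    (v : E) (a : L) : fderiv ℝ (Θ 1) (y, 0) (v, a) = v + T • (a : E) := by
  have hdiff : HasFDerivAt (Θ 1) (fderiv ℝ (Θ 1) (y, 0)) (y, (0 : L)) :=
    ((hΘ.contDiffAt ((Metric.isOpen_ball.prod Metric.isOpen_ball).mem_nhds
      ⟨Metric.mem_ball_self hr, Metric.mem_ball_self hr⟩)).differentiableAt (by simp)).hasFDerivAt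
  have h1 : fderiv ℝ (Θ 1) (y, 0) (v, 0) = v := by
    have h2 : HasFDerivAt (fun x : E => (x, (0 : L))) (ContinuousLinearMap.inl ℝ E L) y :=
      hasFDerivAt_prodMk_left y 0
    have h3 := HasFDerivAt.comp y hdiff h2
    have h4 : HasFDerivAt (Θ 1 ∘ fun x : E => (x, (0 : L))) (ContinuousLinearMap.id ℝ E) y :=
      (hasFDerivAt_id y).congr_of_eventuallyEq (by
        filter_upwards [Metric.ball_mem_nhds y hr] with x hx using h0 x hx)
    exact congrArg (fun f : E →L[ℝ] E => f v) (h3.unique h4)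
  have h2 : ∀ a ∈ Metric.ball (0 : L) r, fderiv ℝ (Θ 1) (y, 0) (0, a) = T • (a : E) := by
    intro a ha
    have h3 : HasDerivAt (fun t : ℝ => ((y, t • a) : E × L)) (0, a) 0 := by
      simpa using (hasDerivAt_const (0 : ℝ) y).prodMk ((hasDerivAt_id (0 : ℝ)).smul_const a)
    have h4 : HasFDerivAt (Θ 1) (fderiv ℝ (Θ 1) (y, 0)) ((fun t : ℝ => ((y, t • a) : E × L)) 0) := by
      simpa using hdiff
    have h5 := (h4.comp_hasDerivAt 0 h3).hasDerivWithinAt (s := Icc (0 : ℝ) 1)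
    -- The scaling relation holds only for `t ∈ [0,1]`, so derivatives at `0` are compared within
    -- this interval.
    have h6 : HasDerivWithinAt (Θ 1 ∘ fun t : ℝ => ((y, t • a) : E × L)) (T • (a : E))
        (Icc 0 1) 0 :=
      (hder a ha).hasDerivWithinAt.congr (fun t ht => hsc a ha t ht)
        (hsc a ha 0 ⟨le_rfl, zero_le_one⟩)
    exact (uniqueDiffOn_Icc zero_lt_one 0 ⟨le_rfl, zero_le_one⟩).eq_deriv _ h5 h6
  have h3 : fderiv ℝ (Θ 1) (y, 0) (0, a) = T • (a : E) := by
    by_cases ha : a = 0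
    · subst ha
      rw [← Prod.zero_eq_mk, map_zero]
      simp
    have hn : 0 < ‖a‖ := norm_pos_iff.2 ha
    set k : ℝ := r / 2 / ‖a‖ with hk
    have hk0 : 0 < k := by positivity
    have h4 := h2 (k • a) (by
      rw [mem_ball_zero_iff, norm_smul, Real.norm_eq_abs, abs_of_pos hk0, hk,
        div_mul_cancel₀ _ hn.ne']
      linarith)
    have h5 : ((0 : E), k • a) = k • ((0 : E), a) := by simp
    rw [h5, map_smul, Submodule.coe_smul, smul_comm] at h4
    exact smul_right_injective E hk0.ne' h4
  have h4 : (v, a) = (v, 0) + (0, a) := by simp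
  rw [h4, map_add, h1, h3]

end Splitting

section Splitting

variable {E B D : Type*} [NormedAddCommGroup E] [NormedSpace ℝ E] [FiniteDimensional ℝ E]
  [NormedAddCommGroup B] [NormedSpace ℝ B] [FiniteDimensional ℝ B]
  [NormedAddCommGroup D] [NormedSpace ℝ D] [FiniteDimensional ℝ D]

omit [FiniteDimensional ℝ B] in
/-- Decomposition of the generators along a transversal `ι` into a tangential part `Y` and a part
`l` in the directions of `L`. -/
theorem exists_transversal_decomposition {ρ : E → B →L[ℝ] E} {V : Set E}
    (hρ : ContDiffOn ℝ ∞ ρ V) {ι : D → E} {O : Set D} (hO : IsOpen O) (hι : ContDiffOn ℝ ∞ ι O)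
    (hιV : MapsTo ι O V) {s₀ : D} (hs₀ : s₀ ∈ O) {L : Submodule ℝ E}
    (hL : L = LinearMap.range (ρ (ι s₀) : B →ₗ[ℝ] E)) (hinj : Function.Injective (fderiv ℝ ι s₀))
    (hcompl : IsCompl (LinearMap.range (fderiv ℝ ι s₀ : D →ₗ[ℝ] E)) L)
    (c₀ : L →L[ℝ] B) (hc₀ : ∀ l, ρ (ι s₀) (c₀ l) = l) :
    ∃ O' : Set D, IsOpen O' ∧ s₀ ∈ O' ∧ O' ⊆ O ∧ ∃ (Y : D → B →L[ℝ] D) (l : D → B →L[ℝ] L),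
      ContDiffOn ℝ ∞ Y O' ∧ ContDiffOn ℝ ∞ l O' ∧
      (∀ s ∈ O', ∀ b, fderiv ℝ ι s (Y s b) + ρ (ι s) (c₀ (l s b)) = ρ (ι s) b) ∧
      ∀ b, (l s₀ b : E) = ρ (ι s₀) b := by
  have hρι : ContDiffOn ℝ ∞ (fun s => ρ (ι s)) O := hρ.comp hι hιV
  have hDι : ContDiffOn ℝ ∞ (fun s => fderiv ℝ ι s) O := hι.fderiv_of_isOpen hO (by simp)
  -- `M s` adds a tangent vector of the transversal to a combination of generators. It is an
  -- isomorphism at `s₀`, hence nearby, and `Y`, `l` are the components of its inverse applied to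
  -- the generators.
  set M : D → (D × L) →L[ℝ] E := fun s =>
    (fderiv ℝ ι s).comp (ContinuousLinearMap.fst ℝ D L) +
      ((ρ (ι s)).comp c₀).comp (ContinuousLinearMap.snd ℝ D L) with hM
  have hMs : ContDiffOn ℝ ∞ M O :=
    (hDι.clm_comp contDiffOn_const).add ((hρι.clm_comp contDiffOn_const).clm_comp contDiffOn_const)
  obtain ⟨e, he⟩ := exists_splitting_equiv hinj hcompl (one_ne_zero : (1 : ℝ) ≠ 0)
  have hMe : M s₀ = e := by
    refine ContinuousLinearMap.ext fun ⟨u, a⟩ => ?_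
    simp [hM, he, hc₀]
  obtain ⟨O', hO', hsO', hO'O, hinv, hsm⟩ := hMs.exists_inverse hO hs₀ ⟨e, hMe.symm⟩
  refine ⟨O', hO', hsO', hO'O,
    fun s => (ContinuousLinearMap.fst ℝ D L).comp ((M s).inverse.comp (ρ (ι s))),
    fun s => (ContinuousLinearMap.snd ℝ D L).comp ((M s).inverse.comp (ρ (ι s))),
    contDiffOn_const.clm_comp (hsm.clm_comp (hρι.mono hO'O)),
    contDiffOn_const.clm_comp (hsm.clm_comp (hρι.mono hO'O)), fun s hs b => ?_, fun b => ?_⟩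
  · have h1 : M s ((M s).inverse (ρ (ι s) b)) = ρ (ι s) b := (hinv s hs).self_apply_inverse _
    exact h1
  · have hb : ρ (ι s₀) b ∈ L := by rw [hL]; exact ⟨b, rfl⟩
    have h1 : (M s₀).inverse (ρ (ι s₀) b) = (0, ⟨ρ (ι s₀) b, hb⟩) := by
      rw [hMe, ContinuousLinearMap.inverse_equiv]
      change e.symm _ = _
      rw [ContinuousLinearEquiv.symm_apply_eq, he]
      simp
    change (((M s₀).inverse (ρ (ι s₀) b)).2 : E) = _
    rw [h1]

/-- The local splitting of an involutive anchor along a transversal of complementary dimension. -/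
theorem IsInvolutiveAnchor.exists_splitting {V : Set E} {ρ : E → B →L[ℝ] E}
    {κ : E → B →L[ℝ] B →L[ℝ] B} (h : IsInvolutiveAnchor V ρ κ) {ι : D → E} {O : Set D}
    (hO : IsOpen O) (hι : ContDiffOn ℝ ∞ ι O) (hιV : MapsTo ι O V) {s₀ : D} (hs₀ : s₀ ∈ O)
    (hinj : Function.Injective (fderiv ℝ ι s₀))
    (hcompl : IsCompl (LinearMap.range (fderiv ℝ ι s₀ : D →ₗ[ℝ] E))
      (LinearMap.range (ρ (ι s₀) : B →ₗ[ℝ] E))) :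
    ∃ (W : Set E) (O' : Set D) (pr : E → D) (a : E → B) (g : E → B →L[ℝ] B) (Y : D → B →L[ℝ] D)
      (θ : D → B →L[ℝ] B),
      IsOpen W ∧ ι s₀ ∈ W ∧ W ⊆ V ∧ IsOpen O' ∧ s₀ ∈ O' ∧ O' ⊆ O ∧
      ContDiffOn ℝ ∞ pr W ∧ MapsTo pr W O' ∧ (∀ s ∈ O', ι s ∈ W ∧ pr (ι s) = s) ∧
      ContDiffOn ℝ ∞ a W ∧ a (ι s₀) = 0 ∧
      ContDiffOn ℝ ∞ Y O' ∧ ContDiffOn ℝ ∞ θ O' ∧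
      (∀ s ∈ O', ∀ b, fderiv ℝ ι s (Y s b) = ρ (ι s) (θ s b)) ∧
      ContDiffOn ℝ ∞ g W ∧ (∀ z ∈ W, ∀ b, fderiv ℝ pr z (ρ z b) = Y (pr z) (g z b)) ∧
      ∀ N ∈ 𝓝 (ι s₀), ∀ᶠ z in 𝓝 (ι s₀), ∃ γ : ℝ → E, γ 0 = z ∧ γ 1 = ι (pr z) ∧
        ∀ t ∈ Icc (0 : ℝ) 1, γ t ∈ N ∧ γ t ∈ W ∧ pr (γ t) = pr z ∧
          HasDerivAt γ (-ρ (γ t) (a z)) t := by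
  obtain ⟨L, hL⟩ : ∃ L, L = LinearMap.range (ρ (ι s₀) : B →ₗ[ℝ] E) := ⟨_, rfl⟩
  obtain ⟨c₀, hc₀⟩ : ∃ c₀ : L →L[ℝ] B, ∀ l, ρ (ι s₀) (c₀ l) = l := by
    subst hL
    obtain ⟨c, hc⟩ := (ρ (ι s₀) : B →ₗ[ℝ] E).rangeRestrict.exists_rightInverse_of_surjective
      (LinearMap.range_rangeRestrict _)
    refine ⟨LinearMap.toContinuousLinearMap c, fun l => ?_⟩
    exact congrArg Subtype.val (LinearMap.congr_fun hc l)
  rw [← hL] at hcompl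
  obtain ⟨O₂, hO₂, hsO₂, hO₂O, Y, l, hY, hl, hYl, hl₀⟩ := exists_transversal_decomposition
    h.anchor hO hι hιV hs₀ hL hinj hcompl c₀ hc₀
  obtain ⟨r, hr, T, hT, Θ, P, Q, hΘ, hP, hQ, hx⟩ := h.exists_exponential (hιV hs₀) c₀
  have hyr : ι s₀ ∈ Metric.ball (ι s₀) r := Metric.mem_ball_self hr
  have h0r : (0 : L) ∈ Metric.ball (0 : L) r := Metric.mem_ball_self hr
  have hzero : ∀ x ∈ Metric.ball (ι s₀) r, Θ 1 (x, 0) = x := fun x hxr => by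
    have := ((hx x hxr 0 h0r).2.1 0 ⟨le_rfl, zero_le_one⟩).2.1
    rw [smul_zero] at this
    rw [this, (hx x hxr 0 h0r).1]
  have hfd := fderiv_exponential hr hΘ hzero
    (fun a ha t ht => ((hx _ hyr a ha).2.1 t ht).2.1) (T := T)
    (fun a ha => by
      have := ((hx _ hyr a ha).2.1 0 ⟨le_rfl, zero_le_one⟩).2.2
      rwa [(hx _ hyr a ha).1, map_smul, hc₀] at this)
  have hbox : IsOpen (Metric.ball (ι s₀) r ×ˢ Metric.ball (0 : L) r) :=
    Metric.isOpen_ball.prod Metric.isOpen_ball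
  set O₃ : Set D := O₂ ∩ ι ⁻¹' Metric.ball (ι s₀) r with hO₃
  have hO₃o : IsOpen O₃ :=
    (hι.mono hO₂O).continuousOn.isOpen_inter_preimage hO₂ Metric.isOpen_ball
  set Ω : Set (D × L) := O₃ ×ˢ Metric.ball 0 r with hΩ
  have hΩo : IsOpen Ω := hO₃o.prod Metric.isOpen_ball
  have hsΩ : (s₀, (0 : L)) ∈ Ω := ⟨⟨hsO₂, hyr⟩, h0r⟩
  have hιΩ : ContDiffOn ℝ ∞ (fun q : D × L => (ι q.1, q.2)) Ω :=
    (hι.comp contDiffOn_fst fun q hq => hO₂O hq.1.1).prodMk contDiffOn_snd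
  have hmapΩ : MapsTo (fun q : D × L => (ι q.1, q.2)) Ω
      (Metric.ball (ι s₀) r ×ˢ Metric.ball (0 : L) r) := fun q hq => ⟨hq.1.2, hq.2⟩
  -- `𝓔 (s, a)` moves the point `ι s` of the transversal along its leaf with coefficients `a`. It is
  -- a local diffeomorphism at `(s₀, 0)`, and `pr` will be the first component of its inverse.
  set 𝓔 : D × L → E := fun q => Θ 1 (ι q.1, q.2) with h𝓔
  have h𝓔s : ContDiffOn ℝ ∞ 𝓔 Ω := hΘ.comp hιΩ hmapΩ
  have hιd : ∀ s ∈ O, HasFDerivAt ι (fderiv ℝ ι s) s := fun s hs =>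
    ((hι.contDiffAt (hO.mem_nhds hs)).differentiableAt (by simp)).hasFDerivAt
  have h𝓔d : ∀ q ∈ Ω, HasFDerivAt 𝓔 ((fderiv ℝ (Θ 1) (ι q.1, q.2)).comp
      (((fderiv ℝ ι q.1).comp (ContinuousLinearMap.fst ℝ D L)).prod
        (ContinuousLinearMap.snd ℝ D L))) q := by
    intro q hq
    have h1 : HasFDerivAt (Θ 1) (fderiv ℝ (Θ 1) (ι q.1, q.2)) (ι q.1, q.2) :=
      ((hΘ.contDiffAt (hbox.mem_nhds (hmapΩ hq))).differentiableAt (by simp)).hasFDerivAt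
    have h2 : HasFDerivAt (fun q : D × L => ι q.1)
        ((fderiv ℝ ι q.1).comp (ContinuousLinearMap.fst ℝ D L)) q :=
      HasFDerivAt.comp q (hιd q.1 (hO₂O hq.1.1)) hasFDerivAt_fst
    exact HasFDerivAt.comp q h1 (h2.prodMk hasFDerivAt_snd)
  obtain ⟨e, he⟩ := exists_splitting_equiv hinj hcompl hT.ne'
  have he' : HasFDerivAt 𝓔 (e : (D × L) →L[ℝ] E) (s₀, 0) := by
    convert h𝓔d _ hsΩ using 1
    refine ContinuousLinearMap.ext fun ⟨u, a⟩ => ?_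
    simp [he, hfd]
  -- Transport expresses `ρ(𝓔 q) b` through `ρ (P b + Q a')` for any `a'`. To be tangent to the
  -- transversal this vector needs `l (P b + Q a') = 0`, an equation for `a'` with matrix `Λ = l ∘
  -- Q`. At the base point transport with `b = 0` gives `Λ = -T • id`, so it is solvable nearby.
  set Λ : D × L → L →L[ℝ] L := fun q => (l q.1).comp (Q (ι q.1, q.2)) with hΛ
  have hPΩ : ContDiffOn ℝ ∞ (fun q : D × L => P (ι q.1, q.2)) Ω := hP.comp hιΩ hmapΩ
  have hQΩ : ContDiffOn ℝ ∞ (fun q : D × L => Q (ι q.1, q.2)) Ω := hQ.comp hιΩ hmapΩ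
  have hlΩ : ContDiffOn ℝ ∞ (fun q : D × L => l q.1) Ω :=
    hl.comp contDiffOn_fst fun q hq => hq.1.1
  have hΛs : ContDiffOn ℝ ∞ Λ Ω := hlΩ.clm_comp hQΩ
  have hΛ₀ : (Λ (s₀, 0)).IsInvertible := by
    have h1 : Λ (s₀, 0) = (-T) • ContinuousLinearMap.id ℝ L := by
      ext a
      have h2 := (hx _ hyr 0 h0r).2.2 0 a
      rw [map_zero, map_zero, zero_add, hfd] at h2
      change (l s₀ (Q (ι s₀, 0) a) : E) = (((-T) • a : L) : E)
      rw [hl₀, Submodule.coe_smul, neg_smul]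
      exact eq_neg_of_add_eq_zero_left h2.symm
    rw [h1]
    exact ⟨ContinuousLinearEquiv.smulLeft (Units.mk0 (-T) (neg_ne_zero.2 hT.ne')) |>.trans
      (ContinuousLinearEquiv.refl ℝ L), by ext; rfl⟩
  obtain ⟨Ω', hΩ', hsΩ', hΩ'Ω, hΛinv, hΛis⟩ := hΛs.exists_inverse hΩo hsΩ hΛ₀
  -- `G q b` is `P b + Q a'` for the solution `a'` of that equation.
  set G : D × L → B →L[ℝ] B := fun q => P (ι q.1, q.2) -
    (Q (ι q.1, q.2)).comp ((Λ q).inverse.comp ((l q.1).comp (P (ι q.1, q.2)))) with hG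
  have hGs : ContDiffOn ℝ ∞ G Ω' := (hPΩ.mono hΩ'Ω).sub ((hQΩ.mono hΩ'Ω).clm_comp
    (hΛis.clm_comp ((hlΩ.mono hΩ'Ω).clm_comp (hPΩ.mono hΩ'Ω))))
  have hGρ : ∀ q ∈ Ω', ∀ b, ∃ a' : L, ρ (𝓔 q) b = fderiv ℝ 𝓔 q (Y q.1 (G q b), a') := by
    intro q hq b
    have hqΩ := hΩ'Ω hq
    refine ⟨-(Λ q).inverse (l q.1 (P (ι q.1, q.2) b)), ?_⟩
    have h1 := (hx (ι q.1) hqΩ.1.2 q.2 hqΩ.2).2.2 b (-(Λ q).inverse (l q.1 (P (ι q.1, q.2) b)))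
    have h2 : P (ι q.1, q.2) b + Q (ι q.1, q.2) (-(Λ q).inverse (l q.1 (P (ι q.1, q.2) b))) =
        G q b := by
      rw [map_neg, ← sub_eq_add_neg]
      rfl
    have h3 : l q.1 (G q b) = 0 := by
      rw [← h2, map_add, map_neg, map_neg]
      have h4 : l q.1 (Q (ι q.1, q.2) ((Λ q).inverse (l q.1 (P (ι q.1, q.2) b)))) =
          l q.1 (P (ι q.1, q.2) b) := (hΛinv q hq).self_apply_inverse _
      rw [h4, add_neg_cancel]
    have h5 := hYl q.1 hqΩ.1.1 (G q b)
    rw [h3, map_zero, map_zero, add_zero] at h5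
    rw [h2, ← h5] at h1
    rw [(h𝓔d q hqΩ).fderiv]
    exact h1
  obtain ⟨ee, hsee, heeΩ, hee𝓔, hees⟩ :=
    (h𝓔s.mono hΩ'Ω).exists_openPartialHomeomorph hΩ' hsΩ' e he'
  obtain ⟨O', r', hO', hsO', hr', hbox'⟩ : ∃ (O' : Set D) (r' : ℝ), IsOpen O' ∧ s₀ ∈ O' ∧ 0 < r' ∧
      O' ×ˢ Metric.ball (0 : L) r' ⊆ ee.source := by
    obtain ⟨u, hu, v, hv, huv⟩ := mem_nhds_prod_iff.1 (ee.open_source.mem_nhds hsee)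
    obtain ⟨u', hu'u, hu'o, hsu'⟩ := mem_nhds_iff.1 hu
    obtain ⟨r', hr', hr'v⟩ := Metric.mem_nhds_iff.1 hv
    exact ⟨u', r', hu'o, hsu', hr', (prod_mono hu'u hr'v).trans huv⟩
  have hbox'o : IsOpen (O' ×ˢ Metric.ball (0 : L) r') := hO'.prod Metric.isOpen_ball
  set W : Set E := ee.target ∩ ee.symm ⁻¹' (O' ×ˢ Metric.ball (0 : L) r') with hW
  have hWo : IsOpen W := ee.symm.isOpen_inter_preimage hbox'o
  have hmemW : ∀ q ∈ O' ×ˢ Metric.ball (0 : L) r', 𝓔 q ∈ W ∧ ee.symm (𝓔 q) = q := by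
    intro q hq
    have h1 : ee.symm (𝓔 q) = q := by rw [← hee𝓔, ee.left_inv (hbox' hq)]
    refine ⟨⟨?_, ?_⟩, h1⟩
    · rw [← hee𝓔]; exact ee.map_source (hbox' hq)
    · rw [mem_preimage, h1]; exact hq
  have hrW : ∀ z ∈ W, 𝓔 (ee.symm z) = z := fun z hz => by rw [← hee𝓔, ee.right_inv hz.1]
  have hO'Ω : ∀ q ∈ O' ×ˢ Metric.ball (0 : L) r', q ∈ Ω := fun q hq => hΩ'Ω (heeΩ (hbox' hq))
  have hO'3 : ∀ s ∈ O', s ∈ O₃ := fun s hs =>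
    (hO'Ω (s, 0) ⟨hs, Metric.mem_ball_self hr'⟩).1
  have h𝓔0 : ∀ s ∈ O', 𝓔 (s, 0) = ι s := fun s hs => hzero _ (hO'3 s hs).2
  have hscal : ∀ q ∈ O' ×ˢ Metric.ball (0 : L) r', ∀ t ∈ Icc (0 : ℝ) 1,
      ((q.1, t • q.2) : D × L) ∈ O' ×ˢ Metric.ball (0 : L) r' := by
    intro q hq t ht
    refine ⟨hq.1, ?_⟩
    have h1 := hq.2
    rw [mem_ball_zero_iff] at h1 ⊢
    rw [norm_smul, Real.norm_eq_abs, abs_of_nonneg ht.1]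
    exact (mul_le_of_le_one_left (norm_nonneg _) ht.2).trans_lt h1
  have hWs : ContDiffOn ℝ ∞ ee.symm W := hees.mono inter_subset_left
  have hιW : ∀ s ∈ O', ι s ∈ W ∧ ee.symm (ι s) = (s, 0) := fun s hs => by
    have := hmemW (s, 0) ⟨hs, Metric.mem_ball_self hr'⟩
    rwa [h𝓔0 s hs] at this
  -- The coefficients `T • c₀ (ee.symm z).2` are those of the exponential that produced `z`, and `id
  -- - c₀ ∘ l` removes from a generator its part along `L`, leaving a tangent vector of the
  -- transversal.
  refine ⟨W, O', fun z => (ee.symm z).1, fun z => T • c₀ (ee.symm z).2, fun z => G (ee.symm z), Y,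
    fun s => ContinuousLinearMap.id ℝ B - c₀.comp (l s), hWo, (hιW s₀ hsO').1, ?_, hO', hsO',
    fun s hs => hO₂O (hO'3 s hs).1, contDiff_fst.comp_contDiffOn hWs, fun z hz => hz.2.1,
    fun s hs => ⟨(hιW s hs).1, congrArg Prod.fst (hιW s hs).2⟩, ?_, ?_, hY.mono fun s hs => (hO'3 s hs).1,
    ?_, ?_, ?_, ?_, ?_⟩
  · intro z hz
    have h1 := hO'Ω _ hz.2
    have h2 := ((hx _ h1.1.2 _ h1.2).2.1 1 ⟨zero_le_one, le_rfl⟩).1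
    rw [← hrW z hz]
    exact h2
  · exact contDiffOn_const.smul
      (c₀.contDiff.comp_contDiffOn (contDiff_snd.comp_contDiffOn hWs))
  · simp [(hιW s₀ hsO').2]
  · exact contDiffOn_const.sub (contDiffOn_const.clm_comp (hl.mono fun s hs => (hO'3 s hs).1))
  · intro s hs b
    have h1 := hYl s (hO'3 s hs).1 b
    change _ = ρ (ι s) (b - c₀ (l s b))
    rw [map_sub, ← h1, add_sub_cancel_right]
  · exact hGs.comp hWs fun z hz => heeΩ (hbox' hz.2)
  · intro z hz b
    obtain ⟨a', ha'⟩ := hGρ _ (heeΩ (hbox' hz.2)) b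
    have h1 : HasFDerivAt ee.symm (fderiv ℝ ee.symm z) z :=
      ((hWs.contDiffAt (hWo.mem_nhds hz)).differentiableAt (by simp)).hasFDerivAt
    have h2 : HasFDerivAt (fun z => (ee.symm z).1)
        ((ContinuousLinearMap.fst ℝ D L).comp (fderiv ℝ ee.symm z)) z :=
      HasFDerivAt.comp z (ContinuousLinearMap.fst ℝ D L).hasFDerivAt h1
    have h3 : HasFDerivAt 𝓔 (fderiv ℝ 𝓔 (ee.symm z)) (ee.symm z) :=
      (h𝓔d _ (hO'Ω _ hz.2)).differentiableAt.hasFDerivAt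
    have h4 : HasFDerivAt ee.symm (fderiv ℝ ee.symm z) (𝓔 (ee.symm z)) := by
      rwa [hrW z hz]
    have h5 := HasFDerivAt.comp _ h4 h3
    have h6 : HasFDerivAt (ee.symm ∘ 𝓔) (ContinuousLinearMap.id ℝ (D × L)) (ee.symm z) :=
      (hasFDerivAt_id _).congr_of_eventuallyEq (by
        filter_upwards [hbox'o.mem_nhds hz.2] with q hq using (hmemW q hq).2)
    have h7 := congrArg (fun f : (D × L) →L[ℝ] (D × L) => f (Y (ee.symm z).1 (G (ee.symm z) b), a'))
      (h5.unique h6)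
    rw [hrW z hz] at ha'
    rw [h2.fderiv, ha']
    exact congrArg Prod.fst h7
  · intro N hN
    have hcont : ContinuousAt 𝓔 (s₀, 0) :=
      (h𝓔s.contDiffAt (hΩo.mem_nhds hsΩ)).continuousAt
    have hN' : 𝓔 ⁻¹' N ∈ 𝓝 (s₀, (0 : L)) := hcont (by rw [h𝓔0 s₀ hsO']; exact hN)
    obtain ⟨u, hu, v, hv, huv⟩ := mem_nhds_prod_iff.1 hN'
    obtain ⟨r₂, hr₂, hr₂v⟩ := Metric.mem_nhds_iff.1 hv
    have hsymm : ContinuousAt ee.symm (ι s₀) :=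
      (hWs.contDiffAt (hWo.mem_nhds (hιW s₀ hsO').1)).continuousAt
    have h1 : ∀ᶠ z in 𝓝 (ι s₀), ee.symm z ∈ u ×ˢ Metric.ball (0 : L) r₂ :=
      hsymm (by
        rw [(hιW s₀ hsO').2]
        exact prod_mem_nhds hu (Metric.ball_mem_nhds _ hr₂))
    filter_upwards [h1, hWo.mem_nhds (hιW s₀ hsO').1] with z hzu hzW
    have hzΩ := hO'Ω _ hzW.2
    have hflow := hx _ hzΩ.1.2 _ hzΩ.2
    have hrev : ∀ t ∈ Icc (0 : ℝ) 1, 1 - t ∈ Icc (0 : ℝ) 1 := fun t ht =>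
      ⟨by linarith [ht.2], by linarith [ht.1]⟩
    have hγ : ∀ t ∈ Icc (0 : ℝ) 1, Θ (1 - t) (ι (ee.symm z).1, (ee.symm z).2) =
        𝓔 ((ee.symm z).1, (1 - t) • (ee.symm z).2) := fun t ht =>
      ((hflow.2.1 _ (hrev t ht)).2.1).symm
    -- The exponential curve through `z` run backwards. It stays over the same point of the
    -- transversal, so `pr` is constant on it.
    refine ⟨fun t => Θ (1 - t) (ι (ee.symm z).1, (ee.symm z).2), ?_, ?_, fun t ht => ?_⟩
    · simp only [sub_zero]
      exact hrW z hzW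
    · simp only [sub_self]
      exact hflow.1
    · have h2 := hmemW _ (hscal _ hzW.2 _ (hrev t ht))
      simp only [hγ t ht]
      refine ⟨huv ⟨hzu.1, hr₂v ?_⟩, h2.1, by rw [h2.2], ?_⟩
      · have h3 := hzu.2
        rw [mem_ball_zero_iff] at h3 ⊢
        rw [norm_smul, Real.norm_eq_abs, abs_of_nonneg (hrev t ht).1]
        exact (mul_le_of_le_one_left (norm_nonneg _) (hrev t ht).2).trans_lt h3
      · rw [← hγ t ht]
        have h4 := (hflow.2.1 _ (hrev t ht)).2.2.scomp t ((hasDerivAt_id t).const_sub 1)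
        rw [neg_smul, one_smul] at h4
        exact h4

end Splitting

/-! ### Derivatives and vector fields in charts. -/

section Tools

variable {n k : ℕ} {M N : Type*} [TopologicalSpace M]
  [ChartedSpace (EuclideanSpace ℝ (Fin n)) M] [TopologicalSpace N]
  [ChartedSpace (EuclideanSpace ℝ (Fin k)) N]

theorem mfderiv_apply_of_leftInverse {f : M → N} {g : N → M} {x : M}
    (hg : MDifferentiableAt (𝓡 k) (𝓡 n) g (f x)) (hf : MDifferentiableAt (𝓡 n) (𝓡 k) f x)
    (h : ∀ᶠ z in 𝓝 x, g (f z) = z) (v : TangentSpace (𝓡 n) x) :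
    mfderiv (𝓡 k) (𝓡 n) g (f x) (mfderiv (𝓡 n) (𝓡 k) f x v) = v := by
  have h1 := mfderiv_comp x hg hf
  have h2 : mfderiv (𝓡 n) (𝓡 n) (g ∘ f) x = mfderiv (𝓡 n) (𝓡 n) id x :=
    Filter.EventuallyEq.mfderiv_eq h
  rw [h2, mfderiv_id] at h1
  exact (congrArg (fun L : EuclideanSpace ℝ (Fin n) →L[ℝ] EuclideanSpace ℝ (Fin n) => L v) h1).symm

/-- Mutually inverse smooth maps have mutually inverse derivatives. -/
theorem mfderiv_isInvertible_of_inverse {f : M → N} {g : N → M} {x : M}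
    (hg : MDifferentiableAt (𝓡 k) (𝓡 n) g (f x)) (hf : MDifferentiableAt (𝓡 n) (𝓡 k) f x)
    (hgf : ∀ᶠ z in 𝓝 x, g (f z) = z) (hfg : ∀ᶠ z in 𝓝 (f x), f (g z) = z) :
    (mfderiv (𝓡 n) (𝓡 k) f x).IsInvertible ∧
      (mfderiv (𝓡 n) (𝓡 k) f x).inverse = mfderiv (𝓡 k) (𝓡 n) g (f x) := by
  have hx : g (f x) = x := hgf.self_of_nhds
  have h1 := mfderiv_apply_of_leftInverse hg hf hgf
  have h2 := mfderiv_apply_of_leftInverse (f := g) (g := f) (x := f x)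
    (by rw [hx]; exact hf) hg hfg
  rw [hx] at h2
  let e : EuclideanSpace ℝ (Fin n) ≃L[ℝ] EuclideanSpace ℝ (Fin k) :=
    ContinuousLinearEquiv.equivOfInverse (mfderiv (𝓡 n) (𝓡 k) f x) (mfderiv (𝓡 k) (𝓡 n) g (f x))
      h1 h2
  have he : mfderiv (𝓡 n) (𝓡 k) f x =
    (e : EuclideanSpace ℝ (Fin n) →L[ℝ] EuclideanSpace ℝ (Fin k)) := rfl
  refine ⟨⟨e, he.symm⟩, ?_⟩
  have h3 : (mfderiv (𝓡 n) (𝓡 k) f x).inverse =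
      (e.symm : EuclideanSpace ℝ (Fin k) →L[ℝ] EuclideanSpace ℝ (Fin n)) := by
    rw [he]
    exact ContinuousLinearMap.inverse_equiv e
  rw [h3]
  rfl

variable [IsManifold (𝓡 n) ∞ M] [IsManifold (𝓡 k) ∞ N]

theorem SmoothVFieldOn.mpullback {f : M → N} {X : VField k N} {U : Set M} {V : Set N}
    (hU : IsOpen U) (hV : IsOpen V)
    (hX : SmoothVFieldOn X V) (hf : ContMDiffOn (𝓡 n) (𝓡 k) ∞ f U) (hUV : MapsTo f U V)
    (hinv : ∀ x ∈ U, (mfderiv (𝓡 n) (𝓡 k) f x).IsInvertible) :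
    SmoothVFieldOn (VectorField.mpullback (𝓡 n) (𝓡 k) f X) U := by
  intro x hx
  exact (ContMDiffAt.mpullback_vectorField_preimage (n := ∞)
    ((hX (f x) (hUV hx)).contMDiffAt (hV.mem_nhds (hUV hx)))
    ((hf x hx).contMDiffAt (hU.mem_nhds hx)) (hinv x hx) (by simp)).contMDiffWithinAt

theorem chart_mdifferentiableAt (y : M) {z : M}
    (hz : z ∈ (chartAt (EuclideanSpace ℝ (Fin n)) y).source) :
    MDifferentiableAt (𝓡 n) (𝓡 n) (chartAt (EuclideanSpace ℝ (Fin n)) y) z :=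
  ((contMDiffOn_chart (n := ∞) z hz).contMDiffAt
    ((chartAt (EuclideanSpace ℝ (Fin n)) y).open_source.mem_nhds hz)).mdifferentiableAt (by simp)

theorem chart_symm_mdifferentiableAt (y : M) {u : EuclideanSpace ℝ (Fin n)}
    (hu : u ∈ (chartAt (EuclideanSpace ℝ (Fin n)) y).target) :
    MDifferentiableAt (𝓡 n) (𝓡 n) (chartAt (EuclideanSpace ℝ (Fin n)) y).symm u :=
  ((contMDiffOn_chart_symm (n := ∞) u hu).contMDiffAt
    ((chartAt (EuclideanSpace ℝ (Fin n)) y).open_target.mem_nhds hu)).mdifferentiableAt (by simp)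

theorem chart_mfderiv_symm_apply (y : M) {z : M}
    (hz : z ∈ (chartAt (EuclideanSpace ℝ (Fin n)) y).source) (v : TangentSpace (𝓡 n) z) :
    mfderiv (𝓡 n) (𝓡 n) (chartAt (EuclideanSpace ℝ (Fin n)) y).symm
      (chartAt (EuclideanSpace ℝ (Fin n)) y z)
      (mfderiv (𝓡 n) (𝓡 n) (chartAt (EuclideanSpace ℝ (Fin n)) y) z v) = v :=
  mfderiv_apply_of_leftInverse
    (chart_symm_mdifferentiableAt y ((chartAt (EuclideanSpace ℝ (Fin n)) y).map_source hz))
    (chart_mdifferentiableAt y hz)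
    ((chartAt (EuclideanSpace ℝ (Fin n)) y).eventually_left_inverse hz) v

/-- The coordinate representation of a vector field in the preferred chart at `y`. -/
noncomputable def coordField (y : M) (X : VField n M) :
    EuclideanSpace ℝ (Fin n) → EuclideanSpace ℝ (Fin n) :=
  VectorField.mpullback (𝓡 n) (𝓡 n) (chartAt (EuclideanSpace ℝ (Fin n)) y).symm X

theorem chart_symm_mfderiv_isInvertible (y : M) {u : EuclideanSpace ℝ (Fin n)}
    (hu : u ∈ (chartAt (EuclideanSpace ℝ (Fin n)) y).target) :
    (mfderiv (𝓡 n) (𝓡 n) (chartAt (EuclideanSpace ℝ (Fin n)) y).symm u).IsInvertible ∧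
    (mfderiv (𝓡 n) (𝓡 n) (chartAt (EuclideanSpace ℝ (Fin n)) y).symm u).inverse =
      mfderiv (𝓡 n) (𝓡 n) (chartAt (EuclideanSpace ℝ (Fin n)) y)
        ((chartAt (EuclideanSpace ℝ (Fin n)) y).symm u) :=
  mfderiv_isInvertible_of_inverse
    (chart_mdifferentiableAt y ((chartAt (EuclideanSpace ℝ (Fin n)) y).map_target hu))
    (chart_symm_mdifferentiableAt y hu)
    ((chartAt (EuclideanSpace ℝ (Fin n)) y).eventually_right_inverse hu)
    ((chartAt (EuclideanSpace ℝ (Fin n)) y).eventually_left_inverse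
      ((chartAt (EuclideanSpace ℝ (Fin n)) y).map_target hu))

theorem coordField_chart (y : M) (X : VField n M) {z : M}
    (hz : z ∈ (chartAt (EuclideanSpace ℝ (Fin n)) y).source) :
    coordField y X (chartAt (EuclideanSpace ℝ (Fin n)) y z) =
      mfderiv (𝓡 n) (𝓡 n) (chartAt (EuclideanSpace ℝ (Fin n)) y) z (X z) := by
  have hu := (chartAt (EuclideanSpace ℝ (Fin n)) y).map_source hz
  rw [coordField, VectorField.mpullback_apply, (chart_symm_mfderiv_isInvertible y hu).2,
    (chartAt (EuclideanSpace ℝ (Fin n)) y).left_inv hz]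

theorem contDiffOn_coordField (y : M) {X : VField n M} {V : Set M} (hV : IsOpen V)
    (hX : SmoothVFieldOn X V) :
    ContDiffOn ℝ ∞ (coordField y X) ((chartAt (EuclideanSpace ℝ (Fin n)) y).target ∩
      (chartAt (EuclideanSpace ℝ (Fin n)) y).symm ⁻¹' V) := by
  have h := SmoothVFieldOn.mpullback
    ((chartAt (EuclideanSpace ℝ (Fin n)) y).symm.isOpen_inter_preimage hV) hV hX
    (contMDiffOn_chart_symm.mono inter_subset_left) (fun u hu => hu.2)
    (fun u hu => (chart_symm_mfderiv_isInvertible y hu.1).1)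
  exact contMDiffOn_vectorSpace_iff_contDiffOn.1 h

end Tools

/-! ### Cut-off functions and extension of local sections. -/

section SheafTools

variable {n : ℕ} {M : Type*} [TopologicalSpace M] [T2Space M]
  [ChartedSpace (EuclideanSpace ℝ (Fin n)) M] [IsManifold (𝓡 n) ∞ M]

/-- A smooth cut-off function. -/
theorem exists_cutoff {x : M} {U : Set M} (hU : U ∈ 𝓝 x) :
    ∃ f : M → ℝ, ContMDiff (𝓡 n) 𝓘(ℝ, ℝ) ∞ f ∧ tsupport f ⊆ U ∧ ∀ᶠ z in 𝓝 x, f z = 1 := by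
  obtain ⟨f, -, hf⟩ := (SmoothBumpFunction.nhds_basis_tsupport (I := 𝓡 n) x).mem_iff.1 hU
  exact ⟨f, f.contMDiff, hf, f.eventuallyEq_one⟩

omit [T2Space M] in
theorem VFSheaf.smul_mem_top (F : VFSheaf n M) {U : Opens M} {X : VField n M}
    (hX : X ∈ F.sections U) {f : M → ℝ} (hf : ContMDiff (𝓡 n) 𝓘(ℝ, ℝ) ∞ f)
    (hfU : tsupport f ⊆ U) : (fun x => f x • X x) ∈ F.sections ⊤ := by
  refine F.glue ⊤ _ fun x _ => ?_
  by_cases hx : x ∈ tsupport f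
  · exact ⟨U, hfU hx, le_top, F.smul_mem U f hf.contMDiffOn X hX⟩
  · refine ⟨⟨(tsupport f)ᶜ, (isClosed_tsupport f).isOpen_compl⟩, hx, le_top,
      F.congr _ 0 (F.zero_mem _) _ fun z hz => ?_⟩
    have : f z = 0 := image_eq_zero_of_notMem_tsupport hz
    simp [this]

/-- Local sections extend to global ones after shrinking. -/
theorem VFSheaf.exists_extension (F : VFSheaf n M) {U : Opens M} {X : VField n M}
    (hX : X ∈ F.sections U) {x : M} (hx : x ∈ U) :
    ∃ X' ∈ F.sections ⊤, ∀ᶠ z in 𝓝 x, X' z = X z := by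
  obtain ⟨f, hf, hfU, h1⟩ := exists_cutoff (n := n) (U.isOpen.mem_nhds hx)
  refine ⟨_, F.smul_mem_top hX hf hfU, ?_⟩
  filter_upwards [h1] with z hz
  rw [hz, one_smul]

theorem VFSheaf.mem_leafTangent (F : VFSheaf n M) {U : Opens M} {X : VField n M}
    (hX : X ∈ F.sections U) {x : M} (hx : x ∈ U) : X x ∈ F.leafTangent x := by
  obtain ⟨X', hX', h⟩ := F.exists_extension hX hx
  exact ⟨X', hX', h.self_of_nhds⟩

omit [T2Space M] in
theorem VFSheaf.vanishing_le (F : VFSheaf n M) (x : M) (U : Opens M) :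
    (F.vanishing x).sections U ⊆ F.sections U := by
  intro X hX
  refine F.glue U X fun y hy => ?_
  obtain ⟨V, hyV, hVU, m, f, Y, h, hs⟩ := hX y hy
  exact ⟨V, hyV, hVU, F.congr V _ (F.sum_mem V f Y (fun i => (h i).1) fun i => (h i).2.2) _ hs⟩

omit [T2Space M] in
theorem VFSheaf.vanishing_apply (F : VFSheaf n M) {x : M} {U : Opens M} {X : VField n M}
    (hX : X ∈ (F.vanishing x).sections U) (hx : x ∈ U) : X x = 0 := by
  obtain ⟨V, hyV, hVU, m, f, Y, h, hs⟩ := hX x hx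
  rw [hs x hyV]
  exact Finset.sum_eq_zero fun i _ => by rw [(h i).2.1 hyV, zero_smul]

end SheafTools

/-! ### Generators of a singular foliation as an involutive anchor in a chart. -/

section AnchorChart

variable {n : ℕ} {M : Type*} [TopologicalSpace M]
  [ChartedSpace (EuclideanSpace ℝ (Fin n)) M] [IsManifold (𝓡 n) ∞ M]

/-- Generators of a singular foliation near `y`, with their representation in the chart at `y`. -/
structure AnchorChart (F : SingularFoliation n M) (y : M) where
  /-- the domain -/
  V : Opens M
  mem : y ∈ V
  subset_source : (V : Set M) ⊆ (chartAt (EuclideanSpace ℝ (Fin n)) y).source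
  /-- the number of generators -/
  m : ℕ
  /-- the generators -/
  G : Fin m → VField n M
  G_mem : ∀ i, G i ∈ F.sections V
  gen : ∀ U ≤ V, ∀ X ∈ F.sections U, ∀ u ∈ U, ∃ U' : Opens M, u ∈ U' ∧ U' ≤ U ∧
    ∃ c : Fin m → M → ℝ, (∀ i, SmoothFunOn n (c i) (U' : Set M)) ∧
      ∀ z ∈ U', X z = ∑ i, c i z • G i z
  /-- the anchor in the chart -/
  ρ : EuclideanSpace ℝ (Fin n) → (Fin m → ℝ) →L[ℝ] EuclideanSpace ℝ (Fin n)
  /-- the structure functions in the chart -/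
  κ : EuclideanSpace ℝ (Fin n) → (Fin m → ℝ) →L[ℝ] (Fin m → ℝ) →L[ℝ] (Fin m → ℝ)
  anchor : IsInvolutiveAnchor ((chartAt (EuclideanSpace ℝ (Fin n)) y).target ∩
    (chartAt (EuclideanSpace ℝ (Fin n)) y).symm ⁻¹' V) ρ κ
  ρ_apply : ∀ z ∈ V, ∀ b, ρ (chartAt (EuclideanSpace ℝ (Fin n)) y z) b =
    mfderiv (𝓡 n) (𝓡 n) (chartAt (EuclideanSpace ℝ (Fin n)) y) z (∑ i, b i • G i z)

omit [IsManifold (𝓡 n) ∞ M] in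
theorem SmoothFunOn.comp_chart_symm (y : M) {f : M → ℝ} {V : Set M} [IsManifold (𝓡 n) ∞ M]
    (hf : SmoothFunOn n f V) :
    ContDiffOn ℝ ∞ (fun u => f ((chartAt (EuclideanSpace ℝ (Fin n)) y).symm u))
      ((chartAt (EuclideanSpace ℝ (Fin n)) y).target ∩
        (chartAt (EuclideanSpace ℝ (Fin n)) y).symm ⁻¹' V) :=
  contMDiffOn_iff_contDiffOn.1 (ContMDiffOn.comp hf
    (contMDiffOn_chart_symm.mono inter_subset_left) fun _ hu => hu.2)

theorem three_le_infty : (3 : WithTop ℕ∞) ≤ ∞ := by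
  exact WithTop.coe_le_coe.2 le_top

omit [IsManifold (𝓡 n) ∞ M] in
theorem coordField_eq_sum (y : M) {m : ℕ} {X : VField n M} {G : Fin m → VField n M} {c : Fin m → ℝ}
    {u : EuclideanSpace ℝ (Fin n)}
    (h : X ((chartAt (EuclideanSpace ℝ (Fin n)) y).symm u) =
      ∑ i, c i • G i ((chartAt (EuclideanSpace ℝ (Fin n)) y).symm u)) :
    coordField y X u = ∑ i, c i • coordField y (G i) u := by
  simp only [coordField, VectorField.mpullback_apply, h, map_sum, map_smul]
  rfl

/-- Brackets of generators in coordinates. -/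
theorem lieBracket_coordField {y : M} {V : Opens M} {X Y : VField n M}
    (hX : SmoothVFieldOn X (V : Set M)) (hY : SmoothVFieldOn Y (V : Set M))
    {u : EuclideanSpace ℝ (Fin n)} (hu : u ∈ (chartAt (EuclideanSpace ℝ (Fin n)) y).target)
    (huV : (chartAt (EuclideanSpace ℝ (Fin n)) y).symm u ∈ V) :
    fderiv ℝ (coordField y Y) u (coordField y X u) - fderiv ℝ (coordField y X) u (coordField y Y u) =
      coordField y (VectorField.mlieBracket (𝓡 n) X Y) u := by
  have h1 : ∀ {X : VField n M}, SmoothVFieldOn X (V : Set M) →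
      MDifferentiableAt (𝓡 n) (𝓡 n).tangent (fun x => (⟨x, X x⟩ : TangentBundle (𝓡 n) M))
        ((chartAt (EuclideanSpace ℝ (Fin n)) y).symm u) := fun {X} hX =>
    ((hX _ huV).contMDiffAt (V.isOpen.mem_nhds huV)).mdifferentiableAt (by simp)
  have h2 : ContMDiffAt (𝓡 n) (𝓡 n) ∞ (chartAt (EuclideanSpace ℝ (Fin n)) y).symm u :=
    (contMDiffOn_chart_symm u hu).contMDiffAt
      ((chartAt (EuclideanSpace ℝ (Fin n)) y).open_target.mem_nhds hu)
  have : IsManifold (𝓡 n) (minSmoothness ℝ 2) M := .of_le (n := ∞) (by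
    rw [minSmoothness_of_isRCLikeNormedField]; exact two_le_infty)
  have : IsManifold (𝓡 n) (minSmoothness ℝ 3) M := .of_le (n := ∞) (by
    rw [minSmoothness_of_isRCLikeNormedField]; exact three_le_infty)
  have h3 := VectorField.mpullback_mlieBracket (h1 hX) (h1 hY) h2 (by
    rw [minSmoothness_of_isRCLikeNormedField]; exact two_le_infty)
  have h4 : VectorField.mlieBracket (𝓡 n) (coordField y X) (coordField y Y) u =
      VectorField.lieBracket ℝ (coordField y X) (coordField y Y) u :=
    congrFun (VectorField.mlieBracketWithin_univ.symm.trans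
      (VectorField.mlieBracketWithin_eq_lieBracketWithin.trans
        VectorField.lieBracketWithin_univ)) u
  exact (h3.trans h4).symm

/-- Involutivity makes each bracket of two generators a section; its coefficients in the generators
are the structure functions. To obtain `gen` over smaller open sets, a local section is first
replaced near a point by a global one, since finite generation is only assumed over one fixed open
set. -/
theorem SingularFoliation.exists_anchorChart [T2Space M] (F : SingularFoliation n M) (y : M) :
    Nonempty (AnchorChart F y) := by
  obtain ⟨U₀, hyU₀, m, G, hG, hgen⟩ := F.locally_fg y
  set φ := chartAt (EuclideanSpace ℝ (Fin n)) y with hφ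
  set V : Opens M := U₀ ⊓ ⟨φ.source, φ.open_source⟩ with hV
  have hyV : y ∈ V := ⟨hyU₀, mem_chart_source _ y⟩
  choose κ hκs hκ using fun i j => hgen _ (F.involutive U₀ (G i) (hG i) (G j) (hG j))
  have hGV : ∀ i, SmoothVFieldOn (G i) (V : Set M) := fun i =>
    F.smooth V _ (F.restrict U₀ V inf_le_left (hG i))
  set ρ : EuclideanSpace ℝ (Fin n) → (Fin m → ℝ) →L[ℝ] EuclideanSpace ℝ (Fin n) := fun u =>
    ∑ i, (ContinuousLinearMap.proj i : (Fin m → ℝ) →L[ℝ] ℝ).smulRight (coordField y (G i) u) with hρ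
  set κ' : EuclideanSpace ℝ (Fin n) → (Fin m → ℝ) →L[ℝ] (Fin m → ℝ) →L[ℝ] (Fin m → ℝ) := fun u =>
    ∑ i, ∑ j, (ContinuousLinearMap.proj i : (Fin m → ℝ) →L[ℝ] ℝ).smulRight
      ((ContinuousLinearMap.proj j : (Fin m → ℝ) →L[ℝ] ℝ).smulRight
        (fun k => κ i j k (φ.symm u))) with hκ'
  have hρa : ∀ u b, ρ u b = ∑ i, b i • coordField y (G i) u := fun u b => by
    simp [hρ]
  have hVo : IsOpen (φ.target ∩ φ.symm ⁻¹' V) := φ.symm.isOpen_inter_preimage V.isOpen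
  have hρs : ContDiffOn ℝ ∞ ρ (φ.target ∩ φ.symm ⁻¹' V) := by
    refine ContDiffOn.sum fun i _ => ?_
    exact ((ContinuousLinearMap.smulRightL ℝ (Fin m → ℝ) (EuclideanSpace ℝ (Fin n))
      (ContinuousLinearMap.proj i)).contDiff).comp_contDiffOn
      (contDiffOn_coordField y V.isOpen (hGV i))
  refine ⟨⟨V, hyV, fun z hz => hz.2, m, G, fun i => F.restrict U₀ V inf_le_left (hG i), ?_, ρ, κ',
    ⟨hVo, hρs, ?_, ?_⟩, ?_⟩⟩
  · intro U hUV X hX u hu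
    obtain ⟨X', hX', h⟩ := F.exists_extension hX hu
    obtain ⟨c, hc, hXc⟩ := hgen X' (F.restrict ⊤ U₀ le_top hX')
    obtain ⟨W, hWh, hWo, huW⟩ := eventually_nhds_iff.1 h
    refine ⟨U ⊓ ⟨W, hWo⟩, ⟨hu, huW⟩, inf_le_left, c,
      fun i => (hc i).mono fun z hz => (hUV hz.1).1, fun z hz => ?_⟩
    rw [← hWh z hz.2, hXc z (hUV hz.1).1]
  · refine ContDiffOn.sum fun i _ => ContDiffOn.sum fun j _ => ?_
    refine contDiffOn_const.smulRight (contDiffOn_const.smulRight (contDiffOn_pi.2 fun k => ?_))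
    exact SmoothFunOn.comp_chart_symm y ((hκs i j k).mono fun z hz => hz.1)
  · intro u hu b b'
    have hgd : ∀ i, HasFDerivAt (coordField y (G i)) (fderiv ℝ (coordField y (G i)) u) u := fun i =>
      (((contDiffOn_coordField y V.isOpen (hGV i)).contDiffAt
        (hVo.mem_nhds hu)).differentiableAt (by simp)).hasFDerivAt
    have hρd : ∀ w b, fderiv ℝ ρ u w b = ∑ i, b i • fderiv ℝ (coordField y (G i)) u w := by
      intro w b
      have h1 : HasFDerivAt ρ (fderiv ℝ ρ u) u :=
        ((hρs.contDiffAt (hVo.mem_nhds hu)).differentiableAt (by simp)).hasFDerivAt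
      have h2 : HasFDerivAt (fun u => ρ u b) (∑ i, b i • fderiv ℝ (coordField y (G i)) u) u := by
        simp only [hρa]
        exact HasFDerivAt.fun_sum fun i _ => (hgd i).const_smul (b i)
      have h3 := h1.clm_apply (hasFDerivAt_const b u)
      have h4 := congrArg (fun L : EuclideanSpace ℝ (Fin n) →L[ℝ] EuclideanSpace ℝ (Fin n) => L w)
        (h3.unique h2)
      simpa using h4
    have hbr : ∀ i j, fderiv ℝ (coordField y (G j)) u (coordField y (G i) u) -
        fderiv ℝ (coordField y (G i)) u (coordField y (G j) u) =
        ∑ k, κ i j k (φ.symm u) • coordField y (G k) u := by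
      intro i j
      rw [lieBracket_coordField (hGV i) (hGV j) hu.1 hu.2]
      exact coordField_eq_sum y (hκ i j _ hu.2.1)
    have hR : ρ u (κ' u b b') = ∑ i, ∑ j, (b i * b' j) •
        ∑ k, κ i j k (φ.symm u) • coordField y (G k) u := by
      have h1 : κ' u b b' = ∑ i, ∑ j, (b i * b' j) • fun k => κ i j k (φ.symm u) := by
        simp only [hκ', _root_.sum_apply, ContinuousLinearMap.smulRight_apply,
          _root_.smul_apply, ContinuousLinearMap.proj_apply, smul_smul]
      rw [h1]
      simp only [map_sum, map_smul]
      simp only [hρa]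
    rw [hR, hρd, hρd, hρa, hρa]
    simp only [map_sum, map_smul, Finset.smul_sum, smul_smul, ← hbr]
    rw [Finset.sum_comm]
    conv_lhs => rw [← Finset.sum_sub_distrib]
    refine Finset.sum_congr rfl fun i _ => ?_
    rw [← Finset.sum_sub_distrib]
    refine Finset.sum_congr rfl fun j _ => ?_
    rw [smul_sub, mul_comm (b' j)]
  · intro z hz b
    rw [hρa, ← coordField_chart y (fun z => ∑ i, b i • G i z) hz.2]
    exact (coordField_eq_sum y rfl).symm

end AnchorChart

/-! ### Velocities of curves in manifolds and in charts. -/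

section Velocity

variable {n k : ℕ} {M N : Type*} [TopologicalSpace M]
  [ChartedSpace (EuclideanSpace ℝ (Fin n)) M] [TopologicalSpace N]
  [ChartedSpace (EuclideanSpace ℝ (Fin k)) N]

/-- The curve `q` has velocity `v` at time `τ`, within `J`. -/
abbrev HasVelocityWithinAt (n : ℕ) {M : Type*} [TopologicalSpace M]
    [ChartedSpace (EuclideanSpace ℝ (Fin n)) M] (q : ℝ → M) (J : Set ℝ) (τ : ℝ)
    (v : TangentSpace (𝓡 n) (q τ)) : Prop :=
  HasMFDerivWithinAt 𝓘(ℝ, ℝ) (𝓡 n) q J τ ((1 : ℝ →L[ℝ] ℝ).smulRight v)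

theorem HasVelocityWithinAt.comp {q : ℝ → M} {J : Set ℝ} {τ : ℝ} {v : TangentSpace (𝓡 n) (q τ)}
    (hq : HasVelocityWithinAt n q J τ v) {f : M → N}
    (hf : MDifferentiableAt (𝓡 n) (𝓡 k) f (q τ)) :
    HasVelocityWithinAt k (f ∘ q) J τ (mfderiv (𝓡 n) (𝓡 k) f (q τ) v) := by
  have h := hf.hasMFDerivAt.comp_hasMFDerivWithinAt τ hq
  have hL : ∀ (L : EuclideanSpace ℝ (Fin n) →L[ℝ] EuclideanSpace ℝ (Fin k))
      (v : EuclideanSpace ℝ (Fin n)),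
      L.comp ((1 : ℝ →L[ℝ] ℝ).smulRight v) = (1 : ℝ →L[ℝ] ℝ).smulRight (L v) := fun L v => by
    ext; simp
  have h2 := hL (mfderiv (𝓡 n) (𝓡 k) f (q τ)) v
  exact h.congr_mfderiv h2

theorem hasVelocityWithinAt_iff {q : ℝ → EuclideanSpace ℝ (Fin n)} {J : Set ℝ} {τ : ℝ}
    {v : EuclideanSpace ℝ (Fin n)} :
    HasVelocityWithinAt n q J τ v ↔ HasDerivWithinAt q v J τ := by
  have h1 : (ContinuousLinearMap.toSpanSingleton ℝ v : ℝ →L[ℝ] EuclideanSpace ℝ (Fin n)) =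
      (1 : ℝ →L[ℝ] ℝ).smulRight v := by
    ext; simp
  have h2 : HasDerivWithinAt q v J τ ↔ HasFDerivWithinAt q ((1 : ℝ →L[ℝ] ℝ).smulRight v) J τ := by
    rw [hasDerivWithinAt_iff_hasFDerivWithinAt, h1]
  exact hasMFDerivWithinAt_iff_hasFDerivWithinAt.trans h2.symm

theorem chart_symm_mfderiv_apply [IsManifold (𝓡 n) ∞ M] (y : M) {u : EuclideanSpace ℝ (Fin n)}
    (hu : u ∈ (chartAt (EuclideanSpace ℝ (Fin n)) y).target)
    (v : TangentSpace (𝓡 n) ((chartAt (EuclideanSpace ℝ (Fin n)) y).symm u)) :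
    mfderiv (𝓡 n) (𝓡 n) (chartAt (EuclideanSpace ℝ (Fin n)) y).symm u
      (mfderiv (𝓡 n) (𝓡 n) (chartAt (EuclideanSpace ℝ (Fin n)) y)
        ((chartAt (EuclideanSpace ℝ (Fin n)) y).symm u) v) = v := by
  have h := chart_symm_mfderiv_isInvertible y hu
  exact (congrArg (fun L : EuclideanSpace ℝ (Fin n) →L[ℝ] EuclideanSpace ℝ (Fin n) =>
    mfderiv (𝓡 n) (𝓡 n) (chartAt (EuclideanSpace ℝ (Fin n)) y).symm u (L v)) h.2).symm.trans
    (h.1.self_apply_inverse v)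

theorem HasVelocityWithinAt.chart [IsManifold (𝓡 n) ∞ M] {y : M} {q : ℝ → M} {J : Set ℝ} {τ : ℝ}
    {v : TangentSpace (𝓡 n) (q τ)} (hq : HasVelocityWithinAt n q J τ v)
    (hz : q τ ∈ (chartAt (EuclideanSpace ℝ (Fin n)) y).source) :
    HasDerivWithinAt (fun τ => chartAt (EuclideanSpace ℝ (Fin n)) y (q τ))
      (mfderiv (𝓡 n) (𝓡 n) (chartAt (EuclideanSpace ℝ (Fin n)) y) (q τ) v) J τ :=
  hasVelocityWithinAt_iff.1 (hq.comp (chart_mdifferentiableAt y hz))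

/-- A curve given in the chart at `y`. -/
theorem HasDerivWithinAt.hasVelocityWithinAt [IsManifold (𝓡 n) ∞ M] (y : M)
    {u : ℝ → EuclideanSpace ℝ (Fin n)} {J : Set ℝ} {τ : ℝ} {w : EuclideanSpace ℝ (Fin n)}
    (hu : HasDerivWithinAt u w J τ)
    (hτ : u τ ∈ (chartAt (EuclideanSpace ℝ (Fin n)) y).target)
    {v : TangentSpace (𝓡 n) ((chartAt (EuclideanSpace ℝ (Fin n)) y).symm (u τ))}
    (hw : w = mfderiv (𝓡 n) (𝓡 n) (chartAt (EuclideanSpace ℝ (Fin n)) y)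
      ((chartAt (EuclideanSpace ℝ (Fin n)) y).symm (u τ)) v) :
    HasVelocityWithinAt n (fun τ => (chartAt (EuclideanSpace ℝ (Fin n)) y).symm (u τ)) J τ v := by
  have h := (hasVelocityWithinAt_iff.2 hu).comp (chart_symm_mdifferentiableAt y hτ)
  have h2 := chart_symm_mfderiv_apply y hτ v
  subst hw
  exact h2 ▸ h

end Velocity

/-! ### Smooth families for the coefficient diffeology. -/

section Plots

variable {n : ℕ} {M : Type*} [TopologicalSpace M]
  [ChartedSpace (EuclideanSpace ℝ (Fin n)) M] [IsManifold (𝓡 n) ∞ M]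

/-- A smooth family of elements of `F` parametrized by `ℝ`, for the coefficient diffeology. -/
def IsPlot (F : VFSheaf n M) (X : ℝ → VField n M) : Prop :=
  ∀ (t₀ : ℝ) (x₀ : M), ∃ J : Set ℝ, IsOpen J ∧ t₀ ∈ J ∧ ∃ V : Opens M, x₀ ∈ V ∧
    ∃ (m : ℕ) (c : Fin m → ℝ × M → ℝ) (Y : Fin m → VField n M),
      (∀ i, ContMDiffOn (𝓘(ℝ, ℝ).prod (𝓡 n)) 𝓘(ℝ, ℝ) ∞ (c i) (J ×ˢ (V : Set M)) ∧
        Y i ∈ F.sections V) ∧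
      ∀ t ∈ J, ∀ y ∈ V, X t y = ∑ i, c i (t, y) • Y i y

/-- Every section of `F'` is near `y` a combination of the generators of `F`; the coefficients
vanish at `y` when `P` holds. -/
def AnchorChart.Generates {F : SingularFoliation n M} {y : M} (A : AnchorChart F y)
    (F' : VFSheaf n M) (P : Prop) : Prop :=
  ∀ U : Opens M, y ∈ U → ∀ X ∈ F'.sections U, ∃ U' : Opens M, y ∈ U' ∧ U' ≤ A.V ∧
    ∃ d : Fin A.m → M → ℝ, (∀ k, SmoothFunOn n (d k) (U' : Set M)) ∧ (P → ∀ k, d k y = 0) ∧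
      ∀ z ∈ U', X z = ∑ k, d k z • A.G k z

theorem AnchorChart.generates_self {F : SingularFoliation n M} {y : M} (A : AnchorChart F y) :
    A.Generates F.toVFSheaf False := by
  intro U hyU X hX
  obtain ⟨U', hy, hU', c, hc, h⟩ := A.gen (U ⊓ A.V) inf_le_right X
    (F.restrict U _ inf_le_left hX) y ⟨hyU, A.mem⟩
  exact ⟨U', hy, hU'.trans inf_le_right, c, hc, False.elim, h⟩

/-- Expanding each `Y i` in the generators multiplies its coefficients by `f i`, so vanishing at `y`
is inherited. The proposition `P` in `Generates` lets `F` and `I_y F` share the construction of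
coefficients. -/
theorem AnchorChart.generates_vanishing {F : SingularFoliation n M} {y : M} (A : AnchorChart F y) :
    A.Generates (F.vanishing y) True := by
  intro U hyU X hX
  obtain ⟨V, hyV, hVU, m, f, Y, h, hs⟩ := hX y hyU
  choose U' hy hU' c hc hcs using fun i => A.gen (V ⊓ A.V) inf_le_right (Y i)
    (F.restrict V _ inf_le_left (h i).2.2) y ⟨hyV, A.mem⟩
  let W : Opens M := ⟨V ∩ A.V ∩ ⋂ i, (U' i : Set M),
    (V.isOpen.inter A.V.isOpen).inter (isOpen_iInter_of_finite fun i => (U' i).isOpen)⟩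
  refine ⟨W, ⟨⟨hyV, A.mem⟩, mem_iInter.2 hy⟩, fun z hz => hz.1.2,
    fun k z => ∑ i, f i z * c i k z, fun k => ?_, fun _ k => ?_, fun z hz => ?_⟩
  · refine contMDiffOn_finsetSum fun i _ => ContMDiffOn.mul ((h i).1.mono fun z hz => hz.1.1)
      ((hc i k).mono fun z hz => mem_iInter.1 hz.2 i)
  · exact Finset.sum_eq_zero fun i _ => by rw [(h i).2.1 hyV, zero_mul]
  · rw [hs z hz.1.1]
    simp only [Finset.sum_smul]
    rw [Finset.sum_comm]
    refine Finset.sum_congr rfl fun i _ => ?_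
    rw [hcs i z (mem_iInter.1 hz.2 i), Finset.smul_sum]
    simp only [mul_smul]

/-- The coefficients of a smooth family in the chart at `y`. -/
theorem AnchorChart.exists_coefficients {F : SingularFoliation n M} {y : M} (A : AnchorChart F y)
    {F' : VFSheaf n M} {P : Prop} (hA : A.Generates F' P) {X : ℝ → VField n M}
    (hX : IsPlot F' X) (t₀ : ℝ) :
    ∃ (O : Set (EuclideanSpace ℝ (Fin n) × ℝ)) (c : EuclideanSpace ℝ (Fin n) × ℝ → Fin A.m → ℝ),
      IsOpen O ∧ (chartAt (EuclideanSpace ℝ (Fin n)) y y, t₀) ∈ O ∧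
      (∀ p ∈ O, p.1 ∈ (chartAt (EuclideanSpace ℝ (Fin n)) y).target ∩
        (chartAt (EuclideanSpace ℝ (Fin n)) y).symm ⁻¹' A.V) ∧
      ContDiffOn ℝ ∞ c O ∧
      (∀ p ∈ O, X p.2 ((chartAt (EuclideanSpace ℝ (Fin n)) y).symm p.1) =
        ∑ i, c p i • A.G i ((chartAt (EuclideanSpace ℝ (Fin n)) y).symm p.1)) ∧
      (P → ∀ t, c (chartAt (EuclideanSpace ℝ (Fin n)) y y, t) = 0) := by
  set φ := chartAt (EuclideanSpace ℝ (Fin n)) y with hφ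
  have hyφ : y ∈ φ.source := mem_chart_source _ y
  obtain ⟨J, hJ, htJ, V, hyV, m, c, Y, hc, hXc⟩ := hX t₀ y
  choose U' hy hU' d hd hdP hds using fun i => hA V hyV (Y i) (hc i).2
  let W : Opens M := ⟨V ∩ A.V ∩ ⋂ i, (U' i : Set M),
    (V.isOpen.inter A.V.isOpen).inter (isOpen_iInter_of_finite fun i => (U' i).isOpen)⟩
  have hyW : y ∈ W := ⟨⟨hyV, A.mem⟩, mem_iInter.2 hy⟩
  have hWo : IsOpen (φ.target ∩ φ.symm ⁻¹' W) := φ.symm.isOpen_inter_preimage W.isOpen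
  refine ⟨(φ.target ∩ φ.symm ⁻¹' W) ×ˢ J,
    fun p k => ∑ i, c i (p.2, φ.symm p.1) * d i k (φ.symm p.1), hWo.prod hJ, ?_, ?_, ?_, ?_, ?_⟩
  · refine ⟨⟨φ.map_source hyφ, ?_⟩, htJ⟩
    rw [mem_preimage, φ.left_inv hyφ]
    exact hyW
  · exact fun p hp => ⟨hp.1.1, hp.1.2.1.2⟩
  · refine contDiffOn_pi.2 fun k => ContDiffOn.sum fun i _ => ContDiffOn.mul ?_ ?_
    · refine contMDiffOn_iff_contDiffOn.1 ?_
      refine ContMDiffOn.comp (hc i).1 (t := J ×ˢ (V : Set M)) ?_ fun p hp => ⟨hp.2, hp.1.2.1.1⟩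
      refine ContMDiffOn.prodMk contDiff_snd.contMDiff.contMDiffOn ?_
      exact ContMDiffOn.comp (contMDiffOn_chart_symm (x := y)) contDiff_fst.contMDiff.contMDiffOn
        fun p hp => hp.1.1
    · exact (SmoothFunOn.comp_chart_symm y (hd i k)).comp contDiffOn_fst
        fun p hp => ⟨hp.1.1, mem_iInter.1 hp.1.2.2 i⟩
  · intro p hp
    rw [hXc p.2 hp.2 _ hp.1.2.1.1]
    simp only [Finset.sum_smul]
    rw [Finset.sum_comm]
    refine Finset.sum_congr rfl fun i _ => ?_
    rw [hds i _ (mem_iInter.1 hp.1.2.2 i), Finset.smul_sum]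
    simp only [mul_smul]
  · intro hP t
    funext k
    refine Finset.sum_eq_zero fun i _ => ?_
    simp only [φ.left_inv hyφ, hdP i hP k, mul_zero]

end Plots

/-! ### Local evolution of families in a singular foliation. -/

section Evolution

variable {n k : ℕ} {M N : Type*} [TopologicalSpace M]
  [ChartedSpace (EuclideanSpace ℝ (Fin n)) M] [IsManifold (𝓡 n) ∞ M] [TopologicalSpace N]
  [ChartedSpace (EuclideanSpace ℝ (Fin k)) N] [IsManifold (𝓡 k) ∞ N]

/-- The derivative of a map given in charts. -/
theorem mfderiv_of_charts (y : M) (y' : N)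
    {f : EuclideanSpace ℝ (Fin n) → EuclideanSpace ℝ (Fin k)} {z : M}
    (hz : z ∈ (chartAt (EuclideanSpace ℝ (Fin n)) y).source)
    (hf : DifferentiableAt ℝ f (chartAt (EuclideanSpace ℝ (Fin n)) y z))
    (hfz : f (chartAt (EuclideanSpace ℝ (Fin n)) y z) ∈
      (chartAt (EuclideanSpace ℝ (Fin k)) y').target) (v : TangentSpace (𝓡 n) z) :
    mfderiv (𝓡 n) (𝓡 k) (fun z => (chartAt (EuclideanSpace ℝ (Fin k)) y').symm
      (f (chartAt (EuclideanSpace ℝ (Fin n)) y z))) z v =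
    mfderiv (𝓡 k) (𝓡 k) (chartAt (EuclideanSpace ℝ (Fin k)) y').symm
      (f (chartAt (EuclideanSpace ℝ (Fin n)) y z))
      (fderiv ℝ f (chartAt (EuclideanSpace ℝ (Fin n)) y z)
        (mfderiv (𝓡 n) (𝓡 n) (chartAt (EuclideanSpace ℝ (Fin n)) y) z v)) := by
  have h1 := (chart_mdifferentiableAt y hz).hasMFDerivAt
  have h2 := hf.hasFDerivAt.hasMFDerivAt
  have h3 := (chart_symm_mdifferentiableAt y' hfz).hasMFDerivAt
  have h4 := h3.comp z (h2.comp z h1)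
  exact congrArg (fun L : EuclideanSpace ℝ (Fin n) →L[ℝ] EuclideanSpace ℝ (Fin k) => L v) h4.mfderiv

theorem AnchorChart.ρ_eq {F : SingularFoliation n M} {y : M} (A : AnchorChart F y)
    {u : EuclideanSpace ℝ (Fin n)} (hu : u ∈ (chartAt (EuclideanSpace ℝ (Fin n)) y).target)
    (huV : (chartAt (EuclideanSpace ℝ (Fin n)) y).symm u ∈ A.V) (b : Fin A.m → ℝ) :
    A.ρ u b = mfderiv (𝓡 n) (𝓡 n) (chartAt (EuclideanSpace ℝ (Fin n)) y)
      ((chartAt (EuclideanSpace ℝ (Fin n)) y).symm u)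
      (∑ i, b i • A.G i ((chartAt (EuclideanSpace ℝ (Fin n)) y).symm u)) := by
  have h := A.ρ_apply _ huV b
  have h2 : A.ρ u b = A.ρ (chartAt (EuclideanSpace ℝ (Fin n)) y
      ((chartAt (EuclideanSpace ℝ (Fin n)) y).symm u)) b := by
    rw [(chartAt (EuclideanSpace ℝ (Fin n)) y).right_inv hu]
  exact h2.trans h

theorem AnchorChart.mfderiv_symm_ρ {F : SingularFoliation n M} {y : M} (A : AnchorChart F y)
    {u : EuclideanSpace ℝ (Fin n)} (hu : u ∈ (chartAt (EuclideanSpace ℝ (Fin n)) y).target)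
    (huV : (chartAt (EuclideanSpace ℝ (Fin n)) y).symm u ∈ A.V) (b : Fin A.m → ℝ) :
    mfderiv (𝓡 n) (𝓡 n) (chartAt (EuclideanSpace ℝ (Fin n)) y).symm u (A.ρ u b) =
      ∑ i, b i • A.G i ((chartAt (EuclideanSpace ℝ (Fin n)) y).symm u) := by
  have h := A.ρ_eq hu huV b
  rw [h]
  exact chart_symm_mfderiv_apply y hu _

omit [IsManifold (𝓡 n) ∞ M] in
theorem isOpen_chart_preimage (y : M) {O : Set (EuclideanSpace ℝ (Fin n))} (hO : IsOpen O) :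
    IsOpen ((chartAt (EuclideanSpace ℝ (Fin n)) y).source ∩
      chartAt (EuclideanSpace ℝ (Fin n)) y ⁻¹' O) :=
  (chartAt (EuclideanSpace ℝ (Fin n)) y).isOpen_inter_preimage hO

/-- Uniqueness of short integral curves of a smooth time-dependent vector field. -/
theorem exists_evolution_unique {E : Type*} [NormedAddCommGroup E] [NormedSpace ℝ E]
    {v : E × ℝ → E} {O : Set (E × ℝ)} (hO : IsOpen O) (hv : ContDiffOn ℝ ∞ v O) {x₀ : E} {t₀ : ℝ}
    (hp₀ : (x₀, t₀) ∈ O) {δ : ℝ} (hδ : 0 < δ) {Ψ : ℝ → ℝ → E → E}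
    (hΨ : ContinuousOn (fun q : ℝ × ℝ × E => Ψ q.1 q.2.1 q.2.2)
        (Metric.ball t₀ δ ×ˢ Metric.ball t₀ δ ×ˢ Metric.ball x₀ δ))
    (h : ∀ s ∈ Metric.ball t₀ δ, ∀ t ∈ Metric.ball t₀ δ, ∀ x ∈ Metric.ball x₀ δ,
        Ψ s s x = x ∧ HasDerivAt (fun t => Ψ s t x) (v (Ψ s t x, t)) t) :
    ∃ δ' > 0, δ' ≤ δ ∧ ∀ s ∈ Metric.ball t₀ δ', ∀ t ∈ Metric.ball t₀ δ', s ≤ t → ∀ q : ℝ → E,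
      (∀ τ ∈ Icc s t, q τ ∈ Metric.ball x₀ δ' ∧ HasDerivWithinAt q (v (q τ, τ)) (Icc s t) τ) →
      q t = Ψ s t (q s) := by
  obtain ⟨K, S, hS, hK⟩ := ((hv.contDiffAt (hO.mem_nhds hp₀)).of_le
    (by simp : (1 : WithTop ℕ∞) ≤ ∞)).exists_lipschitzOnWith
  obtain ⟨r, hr, hrS⟩ := Metric.mem_nhds_iff.1 hS
  have ht₀ : t₀ ∈ Metric.ball t₀ δ := Metric.mem_ball_self hδ
  have hx₀ : x₀ ∈ Metric.ball x₀ δ := Metric.mem_ball_self hδ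
  have hc : ContinuousAt (fun q : ℝ × ℝ × E => Ψ q.1 q.2.1 q.2.2) (t₀, t₀, x₀) :=
    hΨ.continuousAt ((Metric.isOpen_ball.prod (Metric.isOpen_ball.prod
      Metric.isOpen_ball)).mem_nhds ⟨ht₀, ht₀, hx₀⟩)
  have hN : ∀ᶠ q : ℝ × ℝ × E in 𝓝 (t₀, t₀, x₀), Ψ q.1 q.2.1 q.2.2 ∈ Metric.ball x₀ r :=
    hc (by
      change Metric.ball x₀ r ∈ 𝓝 (Ψ t₀ t₀ x₀)
      rw [(h t₀ ht₀ t₀ ht₀ x₀ hx₀).1]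
      exact Metric.ball_mem_nhds _ hr)
  obtain ⟨ε, hε, hεN⟩ := Metric.eventually_nhds_iff_ball.1 hN
  obtain ⟨δ', hδ', h1, h2, h3⟩ : ∃ δ' > 0, δ' ≤ δ ∧ δ' ≤ ε ∧ δ' ≤ r :=
    ⟨min δ (min ε r), by positivity, min_le_left _ _, (min_le_right _ _).trans (min_le_left _ _),
      (min_le_right _ _).trans (min_le_right _ _)⟩
  refine ⟨δ', hδ', h1, fun s hs t ht hst q hq => ?_⟩
  have hτ : ∀ τ ∈ Icc s t, τ ∈ Metric.ball t₀ δ' := fun τ hτ => by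
    rw [Metric.mem_ball, Real.dist_eq, abs_lt] at *
    constructor <;> linarith [hτ.1, hτ.2, hs.1, hs.2, ht.1, ht.2]
  have hqs := (hq s ⟨le_rfl, hst⟩).1
  have hΨd : ∀ τ ∈ Icc s t, HasDerivAt (fun t => Ψ s t (q s)) (v (Ψ s τ (q s), τ)) τ := fun τ h' =>
    (h s (Metric.ball_subset_ball h1 hs) τ (Metric.ball_subset_ball h1 (hτ τ h')) _
      (Metric.ball_subset_ball h1 hqs)).2
  refine ODE_solution_unique_of_mem_Icc_right (v := fun τ x => v (x, τ))
    (s := fun _ => Metric.ball x₀ r) (K := K) (f := q) (g := fun τ => Ψ s τ (q s)) (a := s) (b := t)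
    (fun τ h' => ?_) (fun τ h' => (hq τ h').2.continuousWithinAt)
    (fun τ h' => ?_)
    (fun τ h' => Metric.ball_subset_ball h3 (hq τ (Ico_subset_Icc_self h')).1)
    (fun τ h' => (hΨd τ h').continuousAt.continuousWithinAt)
    (fun τ h' => (hΨd τ (Ico_subset_Icc_self h')).hasDerivWithinAt)
    (fun τ h' => ?_) ?_ ⟨hst, le_rfl⟩
  -- A Lipschitz bound in `(x, τ)` restricts to one in `x`, the product carrying the maximum metric.
  · refine LipschitzOnWith.of_dist_le_mul fun x hx y hy => ?_
    have hτr := Metric.ball_subset_ball h3 (hτ τ (Ico_subset_Icc_self h'))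
    have := hK.dist_le_mul (x, τ) (hrS (by rw [← ball_prod_same]; exact ⟨hx, hτr⟩))
      (y, τ) (hrS (by rw [← ball_prod_same]; exact ⟨hy, hτr⟩))
    rwa [Prod.dist_eq, dist_self, max_eq_left dist_nonneg] at this
  · exact (hq τ (Ico_subset_Icc_self h')).2.mono_of_mem_nhdsWithin (Icc_mem_nhdsGE_of_mem h')
  · refine hεN (s, τ, q s) ?_
    rw [← ball_prod_same, ← ball_prod_same]
    exact ⟨Metric.ball_subset_ball h2 hs,
      Metric.ball_subset_ball h2 (hτ τ (Ico_subset_Icc_self h')), Metric.ball_subset_ball h2 hqs⟩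
  · exact (h s (Metric.ball_subset_ball h1 hs) s (Metric.ball_subset_ball h1 hs) _
      (Metric.ball_subset_ball h1 hqs)).1.symm

/-- The local evolution of a smooth family of elements of a singular foliation. -/
theorem SingularFoliation.exists_evolution [T2Space M] (F : SingularFoliation n M)
    {X : ℝ → VField n M} (hX : IsPlot F.toVFSheaf X) (t₀ : ℝ) (x₀ : M) :
    ∃ δ > 0, ∃ V : Opens M, x₀ ∈ V ∧ ∃ Ψ : ℝ → ℝ → M → M,
      (∀ s ∈ Metric.ball t₀ δ, ContMDiffOn (𝓘(ℝ, ℝ).prod (𝓡 n)) (𝓡 n) ∞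
        (fun q : ℝ × M => Ψ s q.1 q.2) (Metric.ball t₀ δ ×ˢ (V : Set M))) ∧
      (∀ s ∈ Metric.ball t₀ δ, ∀ t ∈ Metric.ball t₀ δ, ∀ x ∈ V, Ψ s s x = x ∧
        HasVelocityWithinAt n (fun t => Ψ s t x) univ t (X t (Ψ s t x)) ∧
        ∀ U : Opens M, Ψ s t x ∈ U → ∀ Y ∈ F.sections U, ∃ U' : Opens M, x ∈ U' ∧
          ∃ Y' ∈ F.sections U', ∀ z ∈ U', Ψ s t z ∈ U ∧
            mfderiv (𝓡 n) (𝓡 n) (Ψ s t) z (Y' z) = Y (Ψ s t z)) ∧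
      ∃ δ' > 0, δ' ≤ δ ∧ ∃ V' ≤ V, x₀ ∈ V' ∧
        (∀ s ∈ Metric.ball t₀ δ', ∀ t ∈ Metric.ball t₀ δ', ∀ x ∈ V',
          Ψ s t x ∈ V ∧ Ψ t s (Ψ s t x) = x) ∧
        ∀ s ∈ Metric.ball t₀ δ', ∀ t ∈ Metric.ball t₀ δ', s ≤ t → ∀ q : ℝ → M,
          (∀ τ ∈ Icc s t, q τ ∈ V' ∧ HasVelocityWithinAt n q (Icc s t) τ (X τ (q τ))) →
          q t = Ψ s t (q s) := by
  obtain ⟨A⟩ := F.exists_anchorChart x₀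
  obtain ⟨O, c, hO, hp₀, hOV, hc, hXc, -⟩ := A.exists_coefficients A.generates_self hX t₀
  obtain ⟨δ, hδ, Ψ, 𝒜, hΨ, h𝒜, hflow, δ₁, hδ₁, hδ₁δ, hinv⟩ := A.anchor.exists_evolution hO hOV hc hp₀
  set φ := chartAt (EuclideanSpace ℝ (Fin n)) x₀ with hφ
  have hv : ContDiffOn ℝ ∞ (fun p : EuclideanSpace ℝ (Fin n) × ℝ => A.ρ p.1 (c p)) O :=
    (A.anchor.anchor.comp contDiffOn_fst hOV).clm_apply hc
  obtain ⟨δ₂, hδ₂, hδ₂δ, huniq⟩ := exists_evolution_unique hO hv hp₀ hδ hΨ.continuousOn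
    (fun s hs t ht x hx => ⟨(hflow s hs t ht x hx).1, (hflow s hs t ht x hx).2.2.1⟩)
  have hxφ : x₀ ∈ φ.source := mem_chart_source _ x₀
  set V : Opens M := ⟨φ.source ∩ φ ⁻¹' Metric.ball (φ x₀) δ,
    isOpen_chart_preimage x₀ Metric.isOpen_ball⟩ with hV
  have hcur : ∀ s ∈ Metric.ball t₀ δ, ∀ t ∈ Metric.ball t₀ δ, ∀ x ∈ V,
      Ψ s t (φ x) ∈ φ.target ∧ φ.symm (Ψ s t (φ x)) ∈ A.V := fun s hs t ht x hx =>
    hOV _ (hflow s hs t ht _ hx.2).2.1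
  have hVA : ∀ x ∈ V, x ∈ A.V := fun x hx => by
    have h1 := (hcur t₀ (Metric.mem_ball_self hδ) t₀ (Metric.mem_ball_self hδ) x hx).2
    rwa [(hflow t₀ (Metric.mem_ball_self hδ) t₀ (Metric.mem_ball_self hδ) _ hx.2).1,
      φ.left_inv hx.1] at h1
  have hsmooth : ∀ s ∈ Metric.ball t₀ δ, ContMDiffOn (𝓘(ℝ, ℝ).prod (𝓡 n)) (𝓡 n) ∞
      (fun q : ℝ × M => φ.symm (Ψ s q.1 (φ q.2))) (Metric.ball t₀ δ ×ˢ (V : Set M)) := by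
    intro s hs
    have h1 : ContMDiffOn (𝓘(ℝ, ℝ).prod (𝓡 n)) 𝓘(ℝ, ℝ × EuclideanSpace ℝ (Fin n)) ∞
        (fun q : ℝ × M => (q.1, φ q.2)) (Metric.ball t₀ δ ×ˢ (V : Set M)) :=
      contMDiffOn_fst.prodMk_space
        (ContMDiffOn.comp (contMDiffOn_chart (x := x₀)) contMDiffOn_snd fun q hq => hq.2.1)
    have h2 : ContDiffOn ℝ ∞ (fun q : ℝ × EuclideanSpace ℝ (Fin n) => Ψ s q.1 q.2)
        (Metric.ball t₀ δ ×ˢ Metric.ball (φ x₀) δ) :=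
      hΨ.comp (contDiff_prodMk_right s).contDiffOn fun q hq => ⟨hs, hq.1, hq.2⟩
    have h3 := ContMDiffOn.comp h2.contMDiffOn h1 fun q hq => ⟨hq.1, hq.2.2⟩
    exact ContMDiffOn.comp (contMDiffOn_chart_symm (x := x₀)) h3
      fun q hq => (hcur s hs q.1 hq.1 q.2 hq.2).1
  have hsl : ∀ s ∈ Metric.ball t₀ δ, ∀ t ∈ Metric.ball t₀ δ,
      ContDiffOn ℝ ∞ (Ψ s t) (Metric.ball (φ x₀) δ) := fun s hs t ht =>
    hΨ.comp ((contDiff_prodMk_right s).comp (contDiff_prodMk_right t)).contDiffOn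
      fun q hq => ⟨hs, ht, hq⟩
  refine ⟨δ, hδ, V, ⟨hxφ, Metric.mem_ball_self hδ⟩, fun s t z => φ.symm (Ψ s t (φ z)), hsmooth,
    fun s hs t ht x hx => ⟨?_, ?_, fun U hU Y hY => ?_⟩, min δ₁ δ₂, lt_min hδ₁ hδ₂,
    (min_le_left _ _).trans hδ₁δ, ⟨φ.source ∩ φ ⁻¹' Metric.ball (φ x₀) (min δ₁ δ₂),
      isOpen_chart_preimage x₀ Metric.isOpen_ball⟩, ?_, ?_, ?_, ?_⟩
  · simp only [(hflow s hs t ht _ hx.2).1, φ.left_inv hx.1]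
  · refine HasDerivWithinAt.hasVelocityWithinAt x₀
      (hflow s hs t ht _ hx.2).2.2.1.hasDerivWithinAt (hcur s hs t ht x hx).1 ?_
    rw [A.ρ_eq (hcur s hs t ht x hx).1 (hcur s hs t ht x hx).2]
    have h1 := hXc _ (hflow s hs t ht _ hx.2).2.1
    exact congrArg _ h1.symm
  -- With `Y = ∑ dᵢ Gᵢ` near the image point, transport of the anchor shows that the field with
  -- coefficients `𝒜 s t (d ∘ Ψ)` is related to `Y`; it is a section because its coefficients are
  -- smooth.
  · obtain ⟨U₁, hU₁, hU₁U, d, hd, hYd⟩ := A.gen (U ⊓ A.V) inf_le_right Y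
      (F.restrict U _ inf_le_left hY) _ ⟨hU, (hcur s hs t ht x hx).2⟩
    have hst : ContMDiffOn (𝓡 n) (𝓡 n) ∞ (fun z => φ.symm (Ψ s t (φ z))) V :=
      (hsmooth s hs).comp (f := fun z : M => (t, z))
        (ContMDiffOn.prodMk contMDiffOn_const contMDiffOn_id) fun z hz => ⟨ht, hz⟩
    let W : Opens M := ⟨V ∩ (fun z => φ.symm (Ψ s t (φ z))) ⁻¹' U₁,
      hst.continuousOn.isOpen_inter_preimage V.isOpen U₁.isOpen⟩
    refine ⟨W, ⟨hx, hU₁⟩, fun z => ∑ i, (𝒜 s t (φ z) fun k => d k (φ.symm (Ψ s t (φ z)))) i • A.G i z,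
      F.sum_mem W _ A.G (fun i => ?_) (fun i => F.restrict A.V W (fun z hz => hVA z hz.1) (A.G_mem i)),
      fun z hz => ⟨(hU₁U hz.2).1, ?_⟩⟩
    · have h1 : ContMDiffOn (𝓡 n) 𝓘(ℝ, (Fin A.m → ℝ) →L[ℝ] (Fin A.m → ℝ)) ∞
          (fun z => 𝒜 s t (φ z)) W :=
        ContMDiffOn.comp (h𝒜 s hs t ht).contMDiffOn
          ((contMDiffOn_chart (x := x₀)).mono fun z hz => hz.1.1) fun z hz => hz.1.2
      have h2 : ContMDiffOn (𝓡 n) 𝓘(ℝ, Fin A.m → ℝ) ∞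
          (fun z => fun k => d k (φ.symm (Ψ s t (φ z)))) W :=
        contMDiffOn_pi_space.2 fun k =>
          ContMDiffOn.comp (hd k) (hst.mono fun z hz => hz.1) fun z hz => hz.2
      exact contMDiffOn_pi_space.1 (h1.clm_apply h2) i
    · have hzV : z ∈ V := hz.1
      have hz1 := hcur s hs t ht z hzV
      have hdiff : DifferentiableAt ℝ (Ψ s t) (φ z) :=
        ((hsl s hs t ht).contDiffAt (Metric.isOpen_ball.mem_nhds hzV.2)).differentiableAt (by simp)
      rw [mfderiv_of_charts x₀ x₀ hzV.1 hdiff hz1.1, ← A.ρ_apply z (hVA z hzV),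
        ← (hflow s hs t ht _ hzV.2).2.2.2, A.mfderiv_symm_ρ hz1.1 hz1.2]
      exact (hYd _ hz.2).symm
  · exact fun z hz => ⟨hz.1, Metric.ball_subset_ball ((min_le_left _ _).trans hδ₁δ) hz.2⟩
  · exact ⟨hxφ, Metric.mem_ball_self (lt_min hδ₁ hδ₂)⟩
  · intro s hs t ht x hx
    have hs' := Metric.ball_subset_ball (min_le_left _ _) hs
    have ht' := Metric.ball_subset_ball (min_le_left _ _) ht
    have hx' := Metric.ball_subset_ball (min_le_left _ _) hx.2
    have h1 := hinv s hs' t ht' _ hx'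
    have h2 : Ψ s t (φ x) ∈ φ.target := (hcur s (Metric.ball_subset_ball hδ₁δ hs') t
      (Metric.ball_subset_ball hδ₁δ ht') x ⟨hx.1, Metric.ball_subset_ball hδ₁δ hx'⟩).1
    refine ⟨⟨φ.map_target h2, ?_⟩, ?_⟩
    · rw [mem_preimage, φ.right_inv h2]
      exact h1.1
    · simp only [φ.right_inv h2, h1.2, φ.left_inv hx.1]
  · intro s hs t ht hst q hq
    have hs' := Metric.ball_subset_ball (min_le_right _ _) hs
    have ht' := Metric.ball_subset_ball (min_le_right _ _) ht
    have hτ : ∀ τ ∈ Icc s t, τ ∈ Metric.ball t₀ δ := fun τ hτ => by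
      have h1 := Metric.ball_subset_ball hδ₂δ hs'
      have h2 := Metric.ball_subset_ball hδ₂δ ht'
      rw [Metric.mem_ball, Real.dist_eq, abs_lt] at *
      constructor <;> linarith [hτ.1, hτ.2, h1.1, h1.2, h2.1, h2.2]
    have hqO : ∀ τ ∈ Icc s t, (φ (q τ), τ) ∈ O := fun τ h => by
      have h1 := hflow τ (hτ τ h) τ (hτ τ h) (φ (q τ))
        (Metric.ball_subset_ball ((min_le_left _ _).trans hδ₁δ) (hq τ h).1.2)
      have h2 := h1.2.1
      rwa [h1.1] at h2
    have h1 := huniq s hs' t ht' hst (fun τ => φ (q τ)) (fun τ h => ⟨Metric.ball_subset_ball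
      (min_le_right _ _) (hq τ h).1.2, ?_⟩)
    · change q t = φ.symm (Ψ s t (φ (q s)))
      rw [← h1, φ.left_inv (hq t ⟨hst, le_rfl⟩).1.1]
    · have h2 := (hq τ h).2.chart (hq τ h).1.1
      -- The type of `X τ z` depends on `z`, so the point is generalised before substitution.
      have hcast : ∀ z, z = q τ → X τ z = ∑ i, c (φ (q τ), τ) i • A.G i z →
          X τ (q τ) = ∑ i, c (φ (q τ), τ) i • A.G i (q τ) := by
        rintro _ rfl h'
        exact h'
      have h3 := hcast _ (φ.left_inv (hq τ h).1.1) (hXc _ (hqO τ h))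
      have h4 := hOV _ (hqO τ h)
      have h5 := A.ρ_apply (q τ) (by
        have := h4.2
        rwa [mem_preimage, φ.left_inv (hq τ h).1.1] at this) (c (φ (q τ), τ))
      rw [h5]
      exact h3 ▸ h2

end Evolution

/-! ### Concatenation and uniqueness of integral curves. -/

section FlowRel

variable {n : ℕ} {M : Type*} [TopologicalSpace M]
  [ChartedSpace (EuclideanSpace ℝ (Fin n)) M]

/-- The graph of the evolution from time `s` to time `t`. -/
def FlowRel (X : ℝ → VField n M) (s t : ℝ) (y z : M) : Prop :=
  ∃ q : ℝ → M, q s = y ∧ q t = z ∧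
    ∀ τ ∈ Icc s t, HasVelocityWithinAt n q (Icc s t) τ (X τ (q τ))

theorem HasVelocityWithinAt.congr_curve {X : VField n M} {q q' : ℝ → M} {J : Set ℝ} {τ : ℝ}
    (h : HasVelocityWithinAt n q J τ (X (q τ))) (heq : EqOn q' q J) (hτ : q' τ = q τ) :
    HasVelocityWithinAt n q' J τ (X (q' τ)) := by
  have h1 : (X (q τ) : EuclideanSpace ℝ (Fin n)) = X (q' τ) :=
    congrArg (fun z => (X z : EuclideanSpace ℝ (Fin n))) hτ.symm
  have h2 : ((1 : ℝ →L[ℝ] ℝ).smulRight (X (q τ) : EuclideanSpace ℝ (Fin n))) =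
    (1 : ℝ →L[ℝ] ℝ).smulRight (X (q' τ) : EuclideanSpace ℝ (Fin n)) :=
    congrArg (fun w : EuclideanSpace ℝ (Fin n) => (1 : ℝ →L[ℝ] ℝ).smulRight w) h1
  exact (HasMFDerivWithinAt.congr_of_eventuallyEq h
    (eventually_nhdsWithin_of_forall heq) hτ).congr_mfderiv h2

theorem FlowRel.trans {X : ℝ → VField n M} {r s t : ℝ} {x y z : M} (hrs : r ≤ s) (hst : s ≤ t)
    (h₁ : FlowRel X r s x y) (h₂ : FlowRel X s t y z) : FlowRel X r t x z := by
  obtain ⟨q₁, h1r, h1s, h1⟩ := h₁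
  obtain ⟨q₂, h2s, h2t, h2⟩ := h₂
  set q : ℝ → M := fun τ => if τ ≤ s then q₁ τ else q₂ τ with hq
  have e1 : EqOn q q₁ (Icc r s) := fun τ hτ => if_pos hτ.2
  have e2 : EqOn q q₂ (Icc s t) := fun τ hτ => by
    by_cases h : τ ≤ s
    · have : τ = s := le_antisymm h hτ.1
      subst this
      simp only [hq, le_rfl, if_true, h1s, h2s]
    · exact if_neg h
  refine ⟨q, (e1 ⟨le_rfl, hrs⟩).trans h1r, (e2 ⟨hst, le_rfl⟩).trans h2t, fun τ hτ => ?_⟩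
  have k1 : ∀ τ ∈ Icc r s, HasVelocityWithinAt n q (Icc r s) τ (X τ (q τ)) := fun τ hτ =>
    (h1 τ hτ).congr_curve e1 (e1 hτ)
  have k2 : ∀ τ ∈ Icc s t, HasVelocityWithinAt n q (Icc s t) τ (X τ (q τ)) := fun τ hτ =>
    (h2 τ hτ).congr_curve e2 (e2 hτ)
  rcases lt_trichotomy τ s with h | h | h
  · refine (k1 τ ⟨hτ.1, h.le⟩).mono_of_mem_nhdsWithin ?_
    filter_upwards [self_mem_nhdsWithin, mem_nhdsWithin_of_mem_nhds (Iio_mem_nhds h)] with σ h3 h4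
    exact ⟨h3.1, le_of_lt h4⟩
  · subst h
    rw [← Icc_union_Icc_eq_Icc hrs hst]
    exact HasMFDerivWithinAt.union (k1 τ ⟨hrs, le_rfl⟩) (k2 τ ⟨le_rfl, hst⟩)
  · refine (k2 τ ⟨h.le, hτ.2⟩).mono_of_mem_nhdsWithin ?_
    filter_upwards [self_mem_nhdsWithin, mem_nhdsWithin_of_mem_nhds (Ioi_mem_nhds h)] with σ h3 h4
    exact ⟨le_of_lt h4, h3.2⟩

/-- Uniqueness of integral curves forward in time. -/
theorem eqOn_of_isCurve [IsManifold (𝓡 n) ∞ M] [T2Space M] (F : SingularFoliation n M)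
    {X : ℝ → VField n M} (hX : IsPlot F.toVFSheaf X) {s t : ℝ} {q q' : ℝ → M} (h₀ : q s = q' s)
    (hq : ∀ τ ∈ Icc s t, HasVelocityWithinAt n q (Icc s t) τ (X τ (q τ)))
    (hq' : ∀ τ ∈ Icc s t, HasVelocityWithinAt n q' (Icc s t) τ (X τ (q' τ))) :
    ∀ τ ∈ Icc s t, q τ = q' τ := by
  have hc : ContinuousOn q (Icc s t) := fun τ hτ => (hq τ hτ).continuousWithinAt
  have hc' : ContinuousOn q' (Icc s t) := fun τ hτ => (hq' τ hτ).continuousWithinAt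
  have hcl : IsClosed ({τ | q τ = q' τ} ∩ Icc s t) := by
    have := (hc.prodMk hc').preimage_isClosed_of_isClosed isClosed_Icc isClosed_diagonal
    rwa [inter_comm] at this
  -- Continuation: the set of agreement is closed and contains `s`, and local uniqueness extends it
  -- to the right of each of its points.
  refine fun τ hτ => hcl.Icc_subset_of_forall_mem_nhdsWithin h₀ (fun x hx => ?_) hτ
  obtain ⟨δ, hδ, V, hxV, Ψ, -, -, δ', hδ', -, V', -, hxV', -, huniq⟩ := F.exists_evolution hX x (q x)
  have hxI : x ∈ Icc s t := Ico_subset_Icc_self hx.2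
  have h1 : ∀ᶠ τ in 𝓝[Icc s t] x, q τ ∈ V' ∧ q' τ ∈ V' :=
    Filter.Eventually.and (hc x hxI (V'.isOpen.mem_nhds hxV'))
      (hc' x hxI (V'.isOpen.mem_nhds (by rw [← show q x = q' x from hx.1]; exact hxV')))
  obtain ⟨ε, hε, hε1⟩ := Metric.mem_nhdsWithin_iff.1 h1
  have h2 : Ioo x (min (x + min ε δ') t) ∈ 𝓝[>] x :=
    Ioo_mem_nhdsGT (lt_min (by have := lt_min hε hδ'; linarith) hx.2.2)
  filter_upwards [h2] with τ hτ'
  have hτ1 : τ < x + min ε δ' := hτ'.2.trans_le (min_le_left _ _)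
  have hτ2 : τ < t := hτ'.2.trans_le (min_le_right _ _)
  have hball : ∀ σ ∈ Icc x τ, σ ∈ Metric.ball x ε ∧ σ ∈ Metric.ball x δ' ∧ σ ∈ Icc s t := by
    intro σ hσ
    have h3 : |σ - x| < min ε δ' := by
      rw [abs_lt]; constructor <;> linarith [hσ.1, hσ.2, lt_min hε hδ']
    exact ⟨by rw [Metric.mem_ball, Real.dist_eq]; exact h3.trans_le (min_le_left _ _),
      by rw [Metric.mem_ball, Real.dist_eq]; exact h3.trans_le (min_le_right _ _),
      ⟨hxI.1.trans hσ.1, hσ.2.trans hτ2.le⟩⟩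
  have hsub : Icc x τ ⊆ Icc s t := fun σ hσ => (hball σ hσ).2.2
  have hx' : x ∈ Icc x τ := ⟨le_rfl, hτ'.1.le⟩
  have hττ : τ ∈ Icc x τ := ⟨hτ'.1.le, le_rfl⟩
  have k1 := huniq x (hball x hx').2.1 τ (hball τ hττ).2.1 hτ'.1.le q fun σ hσ =>
    ⟨(hε1 ⟨(hball σ hσ).1, (hball σ hσ).2.2⟩).1, (hq σ (hsub hσ)).mono hsub⟩
  have k2 := huniq x (hball x hx').2.1 τ (hball τ hττ).2.1 hτ'.1.le q' fun σ hσ =>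
    ⟨(hε1 ⟨(hball σ hσ).1, (hball σ hσ).2.2⟩).2, (hq' σ (hsub hσ)).mono hsub⟩
  change q τ = q' τ
  rw [k1, k2, show q x = q' x from hx.1]

theorem FlowRel.unique [IsManifold (𝓡 n) ∞ M] [T2Space M] (F : SingularFoliation n M)
    {X : ℝ → VField n M} (hX : IsPlot F.toVFSheaf X) {s t : ℝ} (hst : s ≤ t) {y z z' : M}
    (h : FlowRel X s t y z) (h' : FlowRel X s t y z') : z = z' := by
  obtain ⟨q, h1, h2, h3⟩ := h
  obtain ⟨q', h1', h2', h3'⟩ := h'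
  rw [← h2, ← h2']
  exact eqOn_of_isCurve F hX (h1.trans h1'.symm) h3 h3' t ⟨hst, le_rfl⟩

end FlowRel

/-! ### Maps under which sections pull back. -/

section PullsBack

variable {l m n : ℕ} {L M N : Type*} [TopologicalSpace L]
  [ChartedSpace (EuclideanSpace ℝ (Fin l)) L] [IsManifold (𝓡 l) ∞ L]
  [TopologicalSpace M]
  [ChartedSpace (EuclideanSpace ℝ (Fin m)) M] [IsManifold (𝓡 m) ∞ M] [TopologicalSpace N]
  [ChartedSpace (EuclideanSpace ℝ (Fin n)) N] [IsManifold (𝓡 n) ∞ N]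

/-- Near `x`, sections of `G` are locally `θ`-related to sections of `F`. -/
def PullsBackAt (F : VFSheaf m M) (G : VFSheaf n N) (θ : M → N) (x : M) : Prop :=
  ∀ᶠ x' in 𝓝 x, ∀ U : Opens N, θ x' ∈ U → ∀ Y ∈ G.sections U, ∃ U' : Opens M, x' ∈ U' ∧
    ∃ Y' ∈ F.sections U', ∀ z ∈ U', θ z ∈ U ∧ mfderiv (𝓡 m) (𝓡 n) θ z (Y' z) = Y (θ z)

theorem PullsBackAt.comp {E : VFSheaf l L} {F : VFSheaf m M} {G : VFSheaf n N} {θ : L → M}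
    {η : M → N} {x : L} {y : M} (hη : PullsBackAt F G η y) (hθ : PullsBackAt E F θ x)
    (hxy : θ x = y) (hθs : ∀ᶠ z in 𝓝 x, ContMDiffAt (𝓡 l) (𝓡 m) ∞ θ z)
    (hηs : ∀ᶠ z in 𝓝 y, ContMDiffAt (𝓡 m) (𝓡 n) ∞ η z) : PullsBackAt E G (η ∘ θ) x := by
  have hc : Tendsto θ (𝓝 x) (𝓝 y) := by
    rw [← hxy]; exact hθs.self_of_nhds.continuousAt
  filter_upwards [hθ, hc.eventually hη, eventually_eventually_nhds.2 hθs,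
    (hc.eventually (eventually_eventually_nhds.2 hηs))] with x' h1 h2 h3 h4 U hU Y hY
  obtain ⟨U₁, hxU₁, Y₁, hY₁, h5⟩ := h2 U hU Y hY
  obtain ⟨W, hW, hWo, hxW⟩ := eventually_nhds_iff.1 h4
  have hd : (fun z : M => Y₁ z) ∈ F.sections (U₁ ⊓ ⟨W, hWo⟩) :=
    F.restrict U₁ _ inf_le_left hY₁
  obtain ⟨U₂, hxU₂, Y₂, hY₂, h6⟩ := h1 (U₁ ⊓ ⟨W, hWo⟩) ⟨hxU₁, hxW⟩ Y₁ hd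
  obtain ⟨W', hW', hWo', hxW'⟩ := eventually_nhds_iff.1 h3
  refine ⟨U₂ ⊓ ⟨W', hWo'⟩, ⟨hxU₂, hxW'⟩, Y₂, E.restrict U₂ _ inf_le_left hY₂, fun z hz => ?_⟩
  have h7 := h6 z hz.1
  have h8 := h5 (θ z) h7.1.1
  refine ⟨h8.1, ?_⟩
  have h9 : mfderiv (𝓡 l) (𝓡 n) (η ∘ θ) z = _ := mfderiv_comp z
    ((hW _ h7.1.2).mdifferentiableAt (by simp)) ((hW' z hz.2).mdifferentiableAt (by simp))
  rw [h9]
  change mfderiv (𝓡 m) (𝓡 n) η (θ z) (mfderiv (𝓡 l) (𝓡 m) θ z (Y₂ z)) = _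
  rw [h7.2, h8.2]
  rfl

end PullsBack

/-! ### Local diffeomorphisms from local inverses. -/

section Inverse

variable {m n : ℕ} {M N : Type*} [TopologicalSpace M]
  [ChartedSpace (EuclideanSpace ℝ (Fin m)) M] [TopologicalSpace N]
  [ChartedSpace (EuclideanSpace ℝ (Fin n)) N]

/-- The sets `A ∩ f ⁻¹' B` and `B ∩ g ⁻¹' A` are open and exchanged by `f` and `g`. `P` and `Q`
allow further local properties to be imposed on the whole source and target. -/
theorem exists_partialDiffeomorph {f : M → N} {g : N → M} {x : M} {P : M → Prop} {Q : N → Prop}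
    (hf : ∀ᶠ z in 𝓝 x, ContMDiffAt (𝓡 m) (𝓡 n) ∞ f z)
    (hg : ∀ᶠ z in 𝓝 (f x), ContMDiffAt (𝓡 n) (𝓡 m) ∞ g z)
    (hgf : ∀ᶠ z in 𝓝 x, g (f z) = z) (hfg : ∀ᶠ z in 𝓝 (f x), f (g z) = z)
    (hP : ∀ᶠ z in 𝓝 x, P z) (hQ : ∀ᶠ z in 𝓝 (f x), Q z) :
    ∃ Φ : PartialDiffeomorph (𝓡 m) (𝓡 n) M N ∞, Φ.toFun = f ∧ Φ.invFun = g ∧ x ∈ Φ.source ∧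
      (∀ z ∈ Φ.source, P z) ∧ ∀ z ∈ Φ.target, Q z := by
  obtain ⟨A, hA, hAo, hxA⟩ := eventually_nhds_iff.1 (hf.and (hgf.and hP))
  obtain ⟨B, hB, hBo, hxB⟩ := eventually_nhds_iff.1 (hg.and (hfg.and hQ))
  have hfA : ContMDiffOn (𝓡 m) (𝓡 n) ∞ f A := fun z hz => (hA z hz).1.contMDiffWithinAt
  have hgB : ContMDiffOn (𝓡 n) (𝓡 m) ∞ g B := fun z hz => (hB z hz).1.contMDiffWithinAt
  refine ⟨{ toFun := f, invFun := g, source := A ∩ f ⁻¹' B, target := B ∩ g ⁻¹' A,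
            map_source' := fun z hz => ⟨hz.2, ?_⟩, map_target' := fun z hz => ⟨hz.2, ?_⟩,
            left_inv' := fun z hz => (hA z hz.1).2.1, right_inv' := fun z hz => (hB z hz.1).2.1,
            open_source := hfA.continuousOn.isOpen_inter_preimage hAo hBo,
            open_target := hgB.continuousOn.isOpen_inter_preimage hBo hAo,
            contMDiffOn_toFun := hfA.mono inter_subset_left,
            contMDiffOn_invFun := hgB.mono inter_subset_left }, rfl, rfl, ⟨hxA, hxB⟩,
            fun z hz => (hA z hz.1).2.2, fun z hz => (hB z hz.1).2.2⟩
  · rw [mem_preimage, (hA z hz.1).2.1]; exact hz.1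
  · rw [mem_preimage, (hB z hz.1).2.1]; exact hz.1

theorem isLocalDiffeomorphAt_of_inverse {f : M → N} {g : N → M} {x : M}
    (hf : ∀ᶠ z in 𝓝 x, ContMDiffAt (𝓡 m) (𝓡 n) ∞ f z)
    (hg : ∀ᶠ z in 𝓝 (f x), ContMDiffAt (𝓡 n) (𝓡 m) ∞ g z)
    (hgf : ∀ᶠ z in 𝓝 x, g (f z) = z) (hfg : ∀ᶠ z in 𝓝 (f x), f (g z) = z) :
    IsLocalDiffeomorphAt (𝓡 m) (𝓡 n) ∞ f x := by
  obtain ⟨Φ, h1, -, hx, -, -⟩ := exists_partialDiffeomorph hf hg hgf hfg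
    (P := fun _ => True) (Q := fun _ => True) (by simp) (by simp)
  exact ⟨Φ, hx, fun z _ => congrFun h1.symm z⟩

theorem IsLocalDiffeomorphAt.eventually_contMDiffAt {f : M → N} {x : M}
    (hf : IsLocalDiffeomorphAt (𝓡 m) (𝓡 n) ∞ f x) :
    ∀ᶠ z in 𝓝 x, ContMDiffAt (𝓡 m) (𝓡 n) ∞ f z := by
  obtain ⟨Φ, hx, h⟩ := hf
  filter_upwards [Φ.open_source.mem_nhds hx] with z hz
  exact IsLocalDiffeomorphAt.contMDiffAt ⟨Φ, hz, h⟩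

end Inverse

/-! ### Evolution along an integral curve. -/

section Transport

variable {n : ℕ} {M : Type*} [TopologicalSpace M]
  [ChartedSpace (EuclideanSpace ℝ (Fin n)) M] [IsManifold (𝓡 n) ∞ M]

/-- `θ` is the evolution of `X` from time `s` to time `t` near `y`, with local inverse `θ'`, and both
preserve `F`. -/
structure IsTransport (F : VFSheaf n M) (X : ℝ → VField n M) (s t : ℝ) (y z : M)
    (θ θ' : M → M) : Prop where
  map : θ y = z
  map' : θ' z = y
  smooth : ∀ᶠ u in 𝓝 y, ContMDiffAt (𝓡 n) (𝓡 n) ∞ θ u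
  smooth' : ∀ᶠ u in 𝓝 z, ContMDiffAt (𝓡 n) (𝓡 n) ∞ θ' u
  left_inv : ∀ᶠ u in 𝓝 y, θ' (θ u) = u
  right_inv : ∀ᶠ u in 𝓝 z, θ (θ' u) = u
  flow : ∀ᶠ u in 𝓝 y, FlowRel X s t u (θ u)
  pulls : PullsBackAt F F θ y
  pulls' : PullsBackAt F F θ' z

theorem IsTransport.tendsto {F : VFSheaf n M} {X : ℝ → VField n M} {s t : ℝ} {y z : M}
    {θ θ' : M → M} (h : IsTransport F X s t y z θ θ') : Tendsto θ (𝓝 y) (𝓝 z) := by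
  have := h.smooth.self_of_nhds.continuousAt
  rwa [ContinuousAt, h.map] at this

theorem IsTransport.tendsto' {F : VFSheaf n M} {X : ℝ → VField n M} {s t : ℝ} {y z : M}
    {θ θ' : M → M} (h : IsTransport F X s t y z θ θ') : Tendsto θ' (𝓝 z) (𝓝 y) := by
  have := h.smooth'.self_of_nhds.continuousAt
  rwa [ContinuousAt, h.map'] at this

theorem IsTransport.trans {F : VFSheaf n M} {X : ℝ → VField n M} {r s t : ℝ} {x y z : M}
    {θ θ' η η' : M → M} (hrs : r ≤ s) (hst : s ≤ t) (h₁ : IsTransport F X r s x y θ θ')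
    (h₂ : IsTransport F X s t y z η η') : IsTransport F X r t x z (η ∘ θ) (θ' ∘ η') where
  map := by simp [h₁.map, h₂.map]
  map' := by simp [h₁.map', h₂.map']
  smooth := by
    filter_upwards [h₁.smooth, h₁.tendsto.eventually h₂.smooth] with u h3 h4
    exact h4.comp u h3
  smooth' := by
    filter_upwards [h₂.smooth', h₂.tendsto'.eventually h₁.smooth'] with u h3 h4
    exact h4.comp u h3
  left_inv := by
    filter_upwards [h₁.left_inv, h₁.tendsto.eventually h₂.left_inv] with u h3 h4
    simp only [Function.comp_apply, h4, h3]
  right_inv := by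
    filter_upwards [h₂.right_inv, h₂.tendsto'.eventually h₁.right_inv] with u h3 h4
    simp only [Function.comp_apply, h4, h3]
  flow := by
    filter_upwards [h₁.flow, h₁.tendsto.eventually h₂.flow] with u h3 h4
    exact h3.trans hrs hst h4
  pulls := h₂.pulls.comp h₁.pulls h₁.map h₁.smooth h₂.smooth
  pulls' := h₁.pulls'.comp h₂.pulls' h₂.map' h₂.smooth' h₁.smooth'

variable [T2Space M] (F : SingularFoliation n M) {X : ℝ → VField n M}

/-- Near `t₀` the curve stays in the box of the local evolution at `q t₀`. There `Ψ s t` and `Ψ t s`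
are mutually inverse, and the curve itself is a flow line by uniqueness. -/
theorem exists_transport_short (hX : IsPlot F.toVFSheaf X) {a b : ℝ} {q : ℝ → M}
    (hq : ∀ τ ∈ Icc a b, HasVelocityWithinAt n q (Icc a b) τ (X τ (q τ))) {t₀ : ℝ}
    (ht₀ : t₀ ∈ Icc a b) :
    ∃ ε > 0, ∀ s ∈ Metric.ball t₀ ε ∩ Icc a b, ∀ t ∈ Metric.ball t₀ ε ∩ Icc a b, s ≤ t →
      ∃ θ θ', IsTransport F.toVFSheaf X s t (q s) (q t) θ θ' := by
  obtain ⟨δ, hδ, V, hxV, Ψ, hΨ, hflow, δ', hδ', hδδ, V', hVV, hxV', hinv, huniq⟩ :=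
    F.exists_evolution hX t₀ (q t₀)
  have hc : ContinuousWithinAt q (Icc a b) t₀ := (hq t₀ ht₀).continuousWithinAt
  obtain ⟨ε, hε, hεV⟩ := Metric.mem_nhdsWithin_iff.1 (hc (V'.isOpen.mem_nhds hxV'))
  refine ⟨min ε δ', lt_min hε hδ', fun s hs t ht hst => ?_⟩
  have hI : ∀ τ ∈ Icc s t, τ ∈ Metric.ball t₀ (min ε δ') ∩ Icc a b := fun τ hτ => by
    have h1 := hs.1
    have h2 := ht.1
    refine ⟨?_, hs.2.1.trans hτ.1, hτ.2.trans ht.2.2⟩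
    rw [Metric.mem_ball, Real.dist_eq, abs_lt] at *
    constructor <;> linarith [hτ.1, hτ.2, h1.1, h1.2, h2.1, h2.2]
  have hqV : ∀ τ ∈ Icc s t, q τ ∈ V' := fun τ hτ =>
    hεV ⟨Metric.ball_subset_ball (min_le_left _ _) (hI τ hτ).1, (hI τ hτ).2⟩
  have hs' : s ∈ Metric.ball t₀ δ' := Metric.ball_subset_ball (min_le_right _ _) hs.1
  have ht' : t ∈ Metric.ball t₀ δ' := Metric.ball_subset_ball (min_le_right _ _) ht.1
  have hsδ := Metric.ball_subset_ball hδδ hs'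
  have htδ := Metric.ball_subset_ball hδδ ht'
  have hsub : Icc s t ⊆ Icc a b := fun τ hτ => (hI τ hτ).2
  have hqt : q t = Ψ s t (q s) := huniq s hs' t ht' hst q fun τ hτ =>
    ⟨hqV τ hτ, (hq τ (hsub hτ)).mono hsub⟩
  have hqs := hqV s ⟨le_rfl, hst⟩
  have hqt' := hqV t ⟨hst, le_rfl⟩
  have hVs : ∀ᶠ u in 𝓝 (q s), u ∈ V' := V'.isOpen.mem_nhds hqs
  have hVt : ∀ᶠ u in 𝓝 (q t), u ∈ V' := V'.isOpen.mem_nhds hqt'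
  have hsm : ∀ s ∈ Metric.ball t₀ δ, ∀ t ∈ Metric.ball t₀ δ, ∀ u ∈ V,
      ContMDiffAt (𝓡 n) (𝓡 n) ∞ (Ψ s t) u := by
    intro s hs t ht u hu
    have h1 := (hΨ s hs (t, u) ⟨ht, hu⟩).contMDiffAt
      ((Metric.isOpen_ball.prod V.isOpen).mem_nhds ⟨ht, hu⟩)
    exact ContMDiffAt.comp (f := fun u : M => (t, u)) u h1
      (contMDiffAt_const.prodMk contMDiffAt_id)
  refine ⟨Ψ s t, Ψ t s, hqt.symm, ?_, ?_, ?_, ?_, ?_, ?_, ?_, ?_⟩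
  · rw [hqt]
    exact (hinv s hs' t ht' _ hqs).2
  · filter_upwards [hVs] with u hu using hsm s hsδ t htδ u (hVV hu)
  · filter_upwards [hVt] with u hu using hsm t htδ s hsδ u (hVV hu)
  · filter_upwards [hVs] with u hu using (hinv s hs' t ht' u hu).2
  · filter_upwards [hVt] with u hu using (hinv t ht' s hs' u hu).2
  · filter_upwards [hVs] with u hu
    refine ⟨fun τ => Ψ s τ u, (hflow s hsδ s hsδ u (hVV hu)).1, rfl, fun τ hτ => ?_⟩
    exact HasMFDerivWithinAt.mono (hflow s hsδ τ (Metric.ball_subset_ball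
      ((min_le_right _ _).trans hδδ) (hI τ hτ).1) u (hVV hu)).2.1 (subset_univ _)
  · filter_upwards [hVs] with u hu using (hflow s hsδ t htδ u (hVV hu)).2.2
  · filter_upwards [hVt] with u hu using (hflow t htδ s hsδ u (hVV hu)).2.2

/-- The evolution along an integral curve exists near the initial point and preserves `F`. -/
theorem exists_transport (hX : IsPlot F.toVFSheaf X) {a b : ℝ} (hab : a ≤ b) {q : ℝ → M}
    (hq : ∀ τ ∈ Icc a b, HasVelocityWithinAt n q (Icc a b) τ (X τ (q τ))) :
    ∃ θ θ', IsTransport F.toVFSheaf X a b (q a) (q b) θ θ' := by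
  choose! ε hε h using fun t₀ (ht₀ : t₀ ∈ Icc a b) => exists_transport_short F hX hq ht₀
  let c : Icc a b → Set (Icc a b) := fun t₀ => {τ | (τ : ℝ) ∈ Metric.ball (t₀ : ℝ) (ε t₀)}
  -- By compactness `[a, b]` has a finite monotone subdivision whose steps are short enough for
  -- `exists_transport_short`; the pieces are composed.
  obtain ⟨t, ht0, htm, ⟨m, hm⟩, ht⟩ := exists_monotone_Icc_subset_open_cover_Icc hab (c := c)
    (fun t₀ => Metric.isOpen_ball.preimage continuous_subtype_val)
    (fun τ _ => mem_iUnion.2 ⟨τ, Metric.mem_ball_self (hε τ τ.2)⟩)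
  have key : ∀ k, ∃ θ θ', IsTransport F.toVFSheaf X a (t k) (q a) (q (t k)) θ θ' := by
    intro k
    induction k with
    | zero =>
      rw [ht0]
      have ha : a ∈ Icc a b := ⟨le_rfl, hab⟩
      exact h a ha a ⟨Metric.mem_ball_self (hε a ha), ha⟩ a ⟨Metric.mem_ball_self (hε a ha), ha⟩
        le_rfl
    | succ k ih =>
      obtain ⟨θ, θ', h1⟩ := ih
      obtain ⟨i, hi⟩ := ht k
      have hle : t k ≤ t (k + 1) := htm (Nat.le_succ k)
      obtain ⟨η, η', h2⟩ := h i i.2 (t k) ⟨hi ⟨le_rfl, hle⟩, (t k).2⟩ (t (k + 1))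
        ⟨hi ⟨hle, le_rfl⟩, (t (k + 1)).2⟩ hle
      exact ⟨_, _, h1.trans (t k).2.1 hle h2⟩
  have := key m
  rwa [hm m le_rfl] at this

end Transport

/-! ### A smooth time change from the line to the unit interval. -/

section TimeChange

/-- A smooth map `ℝ → [0,1]` which restricts to a homeomorphism of `[0,1]`. -/
noncomputable def timeChange (τ : ℝ) : ℝ := (1 - Real.cos (Real.pi * τ)) / 2

/-- The derivative of `timeChange`. -/
noncomputable def timeSpeed (τ : ℝ) : ℝ := Real.pi * Real.sin (Real.pi * τ) / 2

theorem timeChange_mem (τ : ℝ) : timeChange τ ∈ Icc (0 : ℝ) 1 := by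
  have h1 := Real.neg_one_le_cos (Real.pi * τ)
  have h2 := Real.cos_le_one (Real.pi * τ)
  constructor <;> rw [timeChange] <;> linarith

theorem hasDerivAt_timeChange (τ : ℝ) : HasDerivAt timeChange (timeSpeed τ) τ := by
  have h1 : HasDerivAt (fun τ : ℝ => Real.pi * τ) Real.pi τ := by
    simpa using (hasDerivAt_id τ).const_mul Real.pi
  have h2 := (((Real.hasDerivAt_cos (Real.pi * τ)).comp τ h1).const_sub 1).div_const 2
  have h3 : timeSpeed τ = -(-Real.sin (Real.pi * τ) * Real.pi) / 2 := by
    unfold timeSpeed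
    ring
  rw [h3]
  exact h2

theorem contDiff_timeChange : ContDiff ℝ ∞ timeChange := by
  unfold timeChange
  fun_prop

theorem contDiff_timeSpeed : ContDiff ℝ ∞ timeSpeed := by
  unfold timeSpeed
  fun_prop

theorem timeChange_zero : timeChange 0 = 0 := by simp [timeChange]

theorem timeChange_one : timeChange 1 = 1 := by
  simp [timeChange]

/-- The inverse of `timeChange` on `[0,1]`. -/
noncomputable def timeInv (t : ℝ) : ℝ := Real.arccos (1 - 2 * t) / Real.pi

theorem continuous_timeInv : Continuous timeInv := by
  unfold timeInv
  exact (Real.continuous_arccos.comp (by fun_prop)).div_const _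

theorem timeInv_mem (t : ℝ) : timeInv t ∈ Icc (0 : ℝ) 1 :=
  ⟨div_nonneg (Real.arccos_nonneg _) Real.pi_pos.le,
    (div_le_one Real.pi_pos).2 (Real.arccos_le_pi _)⟩

theorem timeChange_timeInv {t : ℝ} (ht : t ∈ Icc (0 : ℝ) 1) : timeChange (timeInv t) = t := by
  rw [timeChange, timeInv, mul_div_cancel₀ _ Real.pi_ne_zero,
    Real.cos_arccos (by linarith [ht.2]) (by linarith [ht.1])]
  ring

theorem timeInv_zero : timeInv 0 = 0 := by simp [timeInv]

theorem timeInv_one : timeInv 1 = 1 := by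
  rw [timeInv, show (1 : ℝ) - 2 * 1 = -1 by norm_num, Real.arccos_neg_one,
    div_self Real.pi_ne_zero]

theorem timeSpeed_timeInv {t : ℝ} (ht : t ∈ Ioo (0 : ℝ) 1) : timeSpeed (timeInv t) ≠ 0 := by
  rw [timeSpeed, timeInv, mul_div_cancel₀ _ Real.pi_ne_zero, Real.sin_arccos]
  have h : 0 < 1 - (1 - 2 * t) ^ 2 := by nlinarith [ht.1, ht.2]
  have := Real.sqrt_pos.2 h
  have := Real.pi_pos
  positivity

theorem hasDerivAt_timeInv {t : ℝ} (ht : t ∈ Ioo (0 : ℝ) 1) :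
    HasDerivAt timeInv (timeSpeed (timeInv t))⁻¹ t :=
  HasDerivAt.of_local_left_inverse continuous_timeInv.continuousAt
    (hasDerivAt_timeChange (timeInv t)) (timeSpeed_timeInv ht) (by
      filter_upwards [Ioo_mem_nhds ht.1 ht.2] with s hs
      exact timeChange_timeInv (Ioo_subset_Icc_self hs))

end TimeChange

/-! ### Time-dependent elements over the unit interval as plots over the line. -/

section Reparam

variable {n : ℕ} {M : Type*} [TopologicalSpace M]
  [ChartedSpace (EuclideanSpace ℝ (Fin n)) M]

theorem HasVelocityWithinAt.comp_time {q : ℝ → M} {J J' : Set ℝ} {g : ℝ → ℝ} {τ g' : ℝ}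
    {v : TangentSpace (𝓡 n) (q (g τ))} (hq : HasVelocityWithinAt n q J (g τ) v)
    (hg : HasDerivWithinAt g g' J' τ) (hJ : MapsTo g J' J) :
    HasVelocityWithinAt n (q ∘ g) J' τ (g' • v) := by
  have h1 := HasMFDerivWithinAt.comp τ hq hg.hasFDerivWithinAt.hasMFDerivWithinAt hJ
  have hL : ∀ v : EuclideanSpace ℝ (Fin n), ((1 : ℝ →L[ℝ] ℝ).smulRight v).comp
      (ContinuousLinearMap.toSpanSingleton ℝ g') = (1 : ℝ →L[ℝ] ℝ).smulRight (g' • v) := fun v => by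
    ext; simp
  exact h1.congr_mfderiv (hL v)

theorem timeOneFlow_of_curve {X : unitInterval → VField n M} {p : ℝ → M}
    (h : ∀ t : unitInterval, HasVelocityWithinAt n p (Icc 0 1) t (X t (p t))) :
    TimeOneFlow X (p 0) (p 1) := by
  refine ⟨fun t => p t, fun t => ?_, rfl, rfl⟩
  have he : EqOn (IccExtend zero_le_one fun t : unitInterval => p t) p (Icc 0 1) := fun s hs =>
    IccExtend_of_mem _ _ hs
  exact (h t).congr_curve he (he t.2)

/-- The time-dependent vector field reparametrized by `timeChange`. -/
noncomputable def reparam (X : unitInterval → VField n M) (τ : ℝ) : VField n M := fun x =>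
  timeSpeed τ • X ⟨timeChange τ, timeChange_mem τ⟩ x

theorem TimeOneFlow.flowRel {X : unitInterval → VField n M} {y z : M} (h : TimeOneFlow X y z) :
    FlowRel (reparam X) 0 1 y z := by
  obtain ⟨p, hp, h0, h1⟩ := h
  refine ⟨IccExtend zero_le_one p ∘ timeChange, ?_, ?_, fun τ _ => ?_⟩
  · rw [Function.comp_apply, timeChange_zero, IccExtend_left, ← h0]
    rfl
  · rw [Function.comp_apply, timeChange_one, IccExtend_right, ← h1]
    rfl
  · exact HasVelocityWithinAt.comp_time (hp ⟨timeChange τ, timeChange_mem τ⟩)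
      (hasDerivAt_timeChange τ).hasDerivWithinAt fun σ _ => timeChange_mem σ

variable [IsManifold (𝓡 n) ∞ M]

/-- A time-dependent element is given only on `[0,1]`, while the flow theorems use open time
intervals. Since `timeChange` maps all of `ℝ` smoothly into `[0,1]`, precomposing with it gives a
family over `ℝ` without extending any coefficient; `timeSpeed` is the chain rule factor. -/
theorem TimeDep.isPlot_reparam {F : VFSheaf n M} (X : TimeDep F) :
    IsPlot F (reparam X.toFun) := by
  intro t₀ x₀
  obtain ⟨J, hJ, htJ, V, hxV, m, c, Y, hc, hX⟩ :=
    X.plot ⟨timeChange t₀, timeChange_mem t₀⟩ x₀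
  have hcont : Continuous timeChange := contDiff_timeChange.continuous
  refine ⟨timeChange ⁻¹' J, hJ.preimage hcont, htJ, V, hxV, m,
    fun i p => timeSpeed p.1 * c i (timeChange p.1, p.2), Y, fun i => ⟨?_, (hc i).2⟩, ?_⟩
  · refine ContMDiffOn.mul ?_ ?_
    · exact (contDiff_timeSpeed.contMDiff.comp contMDiff_fst).contMDiffOn
    · refine ContMDiffOn.comp (hc i).1 (ContMDiff.prodMk
        (contDiff_timeChange.contMDiff.comp contMDiff_fst) contMDiff_snd).contMDiffOn ?_
      exact fun p hp => ⟨⟨hp.1, timeChange_mem p.1⟩, hp.2⟩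
  · intro t ht y hy
    rw [reparam, hX ⟨timeChange t, timeChange_mem t⟩ ht y hy, Finset.smul_sum]
    simp only [mul_smul]

theorem IsPlot.of_vanishing {F : VFSheaf n M} {x : M} {X : ℝ → VField n M}
    (hX : IsPlot (F.vanishing x) X) : IsPlot F X := by
  intro t₀ x₀
  obtain ⟨J, hJ, htJ, V, hxV, m, c, Y, hc, hX⟩ := hX t₀ x₀
  exact ⟨J, hJ, htJ, V, hxV, m, c, Y, fun i => ⟨(hc i).1, F.vanishing_le x V (hc i).2⟩, hX⟩

/-- `timeSpeed` vanishes at `0` and `1`, so the chain rule for `timeInv` works only in the interior.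
At the end points the one-sided derivative is recovered as the limit of interior derivatives. -/
theorem hasDerivWithinAt_Icc_of_tendsto {E : Type*} [NormedAddCommGroup E] [NormedSpace ℝ E]
    {f w : ℝ → E} {t₀ : ℝ} (ht₀ : t₀ ∈ Icc (0 : ℝ) 1) (hc : ContinuousWithinAt f (Icc 0 1) t₀)
    (hd : ∀ᶠ t in 𝓝[Icc 0 1] t₀, t ∈ Ioo (0 : ℝ) 1 → HasDerivAt f (w t) t)
    (hw : ContinuousWithinAt w (Icc 0 1) t₀) : HasDerivWithinAt f (w t₀) (Icc 0 1) t₀ := by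
  rcases eq_or_ne t₀ 0 with h0 | h0
  · subst h0
    have hle : 𝓝[>] (0 : ℝ) ≤ 𝓝[Icc 0 1] 0 :=
      nhdsWithin_le_of_mem (mem_of_superset (Ioo_mem_nhdsGT one_pos) Ioo_subset_Icc_self)
    have h1 : {t : ℝ | t ∈ Ioo (0 : ℝ) 1 ∧ HasDerivAt f (w t) t} ∈ 𝓝[>] (0 : ℝ) := by
      filter_upwards [hle hd, Ioo_mem_nhdsGT one_pos] with t ht ht' using ⟨ht', ht ht'⟩
    refine (hasDerivWithinAt_Ici_of_tendsto_deriv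
      (fun t ht => ht.2.differentiableAt.differentiableWithinAt)
      (hc.mono fun t ht => Ioo_subset_Icc_self ht.1) h1 ?_).mono Icc_subset_Ici_self
    refine (hw.tendsto.mono_left hle).congr' ?_
    filter_upwards [h1] with t ht using ht.2.deriv.symm
  rcases eq_or_ne t₀ 1 with h1 | h1
  · subst h1
    have hle : 𝓝[<] (1 : ℝ) ≤ 𝓝[Icc 0 1] 1 :=
      nhdsWithin_le_of_mem (mem_of_superset (Ioo_mem_nhdsLT one_pos) Ioo_subset_Icc_self)
    have h1 : {t : ℝ | t ∈ Ioo (0 : ℝ) 1 ∧ HasDerivAt f (w t) t} ∈ 𝓝[<] (1 : ℝ) := by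
      filter_upwards [hle hd, Ioo_mem_nhdsLT one_pos] with t ht ht' using ⟨ht', ht ht'⟩
    refine (hasDerivWithinAt_Iic_of_tendsto_deriv
      (fun t ht => ht.2.differentiableAt.differentiableWithinAt)
      (hc.mono fun t ht => Ioo_subset_Icc_self ht.1) h1 ?_).mono Icc_subset_Iic_self
    refine (hw.tendsto.mono_left hle).congr' ?_
    filter_upwards [h1] with t ht using ht.2.deriv.symm
  · have h2 : t₀ ∈ Ioo (0 : ℝ) 1 := ⟨lt_of_le_of_ne ht₀.1 h0.symm, lt_of_le_of_ne ht₀.2 h1⟩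
    exact (hd.self_of_nhdsWithin ht₀ h2).hasDerivWithinAt

/-- Integral curves of the reparametrized field give integral curves of the field. -/
theorem FlowRel.timeOneFlow {F : VFSheaf n M} (X : TimeDep F) {y z : M}
    (h : FlowRel (reparam X.toFun) 0 1 y z) : TimeOneFlow X.toFun y z := by
  obtain ⟨q, h0, h1, hq⟩ := h
  set p : ℝ → M := q ∘ timeInv with hp
  have hp0 : p 0 = y := by rw [hp, Function.comp_apply, timeInv_zero, h0]
  have hp1 : p 1 = z := by rw [hp, Function.comp_apply, timeInv_one, h1]
  have hpc : ContinuousOn p (Icc 0 1) :=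
    ContinuousOn.comp (fun τ hτ => (hq τ hτ).continuousWithinAt) continuous_timeInv.continuousOn
      fun t _ => timeInv_mem t
  have hint : ∀ t : unitInterval, (t : ℝ) ∈ Ioo (0 : ℝ) 1 →
      HasVelocityWithinAt n p (Icc 0 1) t (X.toFun t (p t)) := by
    intro t ht
    have k1 := (hq (timeInv t) (timeInv_mem t)).comp_time
      (hasDerivAt_timeInv ht).hasDerivWithinAt (J' := Icc 0 1) fun s _ => timeInv_mem s
    have k2 : (timeSpeed (timeInv t))⁻¹ • reparam X.toFun (timeInv t) (q (timeInv t)) =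
        X.toFun t (p t) := by
      have k3 : (⟨timeChange (timeInv t), timeChange_mem _⟩ : unitInterval) = t :=
        Subtype.ext (timeChange_timeInv t.2)
      rw [reparam, smul_smul, inv_mul_cancel₀ (timeSpeed_timeInv ht), one_smul, k3]
      rfl
    exact k2 ▸ k1
  rw [← hp0, ← hp1]
  refine timeOneFlow_of_curve fun t₀ => ?_
  set φ := chartAt (EuclideanSpace ℝ (Fin n)) (p t₀) with hφ
  obtain ⟨J, hJ, htJ, V, hxV, m, c, Y, hc, hX⟩ := X.plot t₀ (p t₀)
  have hpt : ContinuousWithinAt p (Icc 0 1) t₀ := hpc t₀ t₀.2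
  have hφs : p t₀ ∈ φ.source := mem_chart_source _ _
  have hev : ∀ᶠ t in 𝓝[Icc 0 1] (t₀ : ℝ), t ∈ Icc (0 : ℝ) 1 ∧ t ∈ J ∧ p t ∈ V ∧ p t ∈ φ.source := by
    filter_upwards [self_mem_nhdsWithin, mem_nhdsWithin_of_mem_nhds (hJ.mem_nhds htJ),
      hpt (V.isOpen.mem_nhds hxV), hpt (φ.open_source.mem_nhds hφs)] with t k1 k2 k3 k4
    exact ⟨k1, k2, k3, k4⟩
  -- The expected velocity in the chart. It is continuous up to the end points because the
  -- coefficients `c i` are, and supplies the limit required by `hasDerivWithinAt_Icc_of_tendsto`.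
  set w : ℝ → EuclideanSpace ℝ (Fin n) := fun t =>
    ∑ i, c i (t, p t) • coordField (p t₀) (Y i) (φ (p t)) with hw
  have hwc : ContinuousWithinAt w (Icc 0 1) t₀ := by
    refine tendsto_finsetSum _ fun i _ => Tendsto.smul ?_ ?_
    · have k1 : ContinuousWithinAt (c i) ((J ∩ Icc 0 1) ×ˢ (V : Set M)) ((t₀ : ℝ), p t₀) :=
        (hc i).1.continuousOn _ ⟨⟨htJ, t₀.2⟩, hxV⟩
      refine k1.tendsto.comp (tendsto_nhdsWithin_iff.2 ⟨?_, ?_⟩)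
      · exact (tendsto_nhdsWithin_of_tendsto_nhds tendsto_id).prodMk_nhds hpt
      · filter_upwards [hev] with t ht using ⟨⟨ht.2.1, ht.1⟩, ht.2.2.1⟩
    · have k1 : ContinuousAt (coordField (p t₀) (Y i)) (φ (p t₀)) := by
        refine ((contDiffOn_coordField (p t₀) V.isOpen
          (F.smooth V _ (hc i).2)).contDiffAt ?_).continuousAt
        refine (φ.symm.isOpen_inter_preimage V.isOpen).mem_nhds ⟨φ.map_source hφs, ?_⟩
        rw [mem_preimage, φ.left_inv hφs]
        exact hxV
      exact k1.tendsto.comp ((φ.continuousAt hφs).tendsto.comp hpt)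
  have hwv : ∀ t : unitInterval, (t : ℝ) ∈ J → p t ∈ V → p t ∈ φ.source →
      w t = mfderiv (𝓡 n) (𝓡 n) φ (p t) (X.toFun t (p t)) := by
    intro t k1 k2 k3
    rw [← coordField_chart (p t₀) (X.toFun t) k3]
    refine (coordField_eq_sum (p t₀) ?_).symm
    rw [φ.left_inv k3]
    exact hX t k1 _ k2
  have hder := hasDerivWithinAt_Icc_of_tendsto (f := fun t => φ (p t)) t₀.2
    ((φ.continuousAt hφs).tendsto.comp hpt) (w := w) (by
      filter_upwards [hev] with t ht ht'
      have k1 := (hint ⟨t, ht.1⟩ ht').chart (y := p t₀) ht.2.2.2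
      rw [hwv ⟨t, ht.1⟩ ht.2.1 ht.2.2.1 ht.2.2.2]
      exact k1.hasDerivAt (Icc_mem_nhds ht'.1 ht'.2)) hwc
  have hcast : ∀ u, u = φ (p t₀) → ∀ x, x = φ.symm u → x = p t₀ →
      w t₀ = mfderiv (𝓡 n) (𝓡 n) φ x (X.toFun t₀ x) := by
    rintro _ - x - rfl
    exact hwv t₀ htJ hxV hφs
  have k1 := hder.hasVelocityWithinAt (p t₀) (φ.map_source hφs)
    (hcast _ rfl _ rfl (φ.left_inv hφs))
  have k2 : HasVelocityWithinAt n p (Icc 0 1 ∩ p ⁻¹' φ.source) t₀ (X.toFun t₀ (p t₀)) :=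
    HasVelocityWithinAt.congr_curve (q := fun τ => φ.symm (φ (p τ)))
      (HasMFDerivWithinAt.mono k1 inter_subset_left) (fun t ht => (φ.left_inv ht.2).symm)
      (φ.left_inv hφs).symm
  exact HasMFDerivWithinAt.mono_of_mem_nhdsWithin k2
    (inter_mem self_mem_nhdsWithin (hpt (φ.open_source.mem_nhds hφs)))

end Reparam

/-! ### Immersions and the inverse function theorem on manifolds. -/

section InverseFunction

variable {m n : ℕ} {M N : Type*} [TopologicalSpace M]
  [ChartedSpace (EuclideanSpace ℝ (Fin m)) M] [IsManifold (𝓡 m) ∞ M] [TopologicalSpace N]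
  [ChartedSpace (EuclideanSpace ℝ (Fin n)) N] [IsManifold (𝓡 n) ∞ N]

omit [IsManifold (𝓡 m) ∞ M] [IsManifold (𝓡 n) ∞ N] in
/-- An immersion has an injective derivative. -/
theorem mfderiv_injective_of_isImmersionAt {f : M → N} {x : M}
    (h : IsImmersionAt (𝓡 m) (𝓡 n) ∞ f x) : Function.Injective (mfderiv (𝓡 m) (𝓡 n) f x) := by
  set d := h.domChart with hd
  set c := h.codChart with hc
  have hdx : x ∈ d.source := h.mem_domChart_source
  have hcx : f x ∈ c.source := h.mem_codChart_source
  have hds : ContMDiffOn (𝓡 m) (𝓡 m) ∞ d.symm d.target :=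
    contMDiffOn_symm_of_mem_maximalAtlas h.domChart_mem_maximalAtlas
  have hcs : ContMDiffOn (𝓡 n) (𝓡 n) ∞ c c.source :=
    contMDiffOn_of_mem_maximalAtlas h.codChart_mem_maximalAtlas
  -- In adapted charts an immersion is `u ↦ (u, 0)`. Projecting to the first factor gives a
  -- differentiable local left inverse, which forces injectivity.
  set L : EuclideanSpace ℝ (Fin n) →L[ℝ] EuclideanSpace ℝ (Fin m) :=
    (ContinuousLinearMap.fst ℝ (EuclideanSpace ℝ (Fin m)) h.complement).comp
      (h.equiv.symm : EuclideanSpace ℝ (Fin n) →L[ℝ] (EuclideanSpace ℝ (Fin m) × h.complement))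
    with hL
  have hw : ∀ z ∈ d.source, L (c (f z)) = d z := by
    intro z hz
    have hmem : d z ∈ (h.domChart.extend (𝓡 m)).target := by
      rw [OpenPartialHomeomorph.extend_target]
      simpa using d.map_source hz
    have h1 := h.writtenInCharts hmem
    have h2 : c (f z) = h.equiv (d z, 0) := by
      have h3 : c (f (d.symm (d z))) = h.equiv (d z, 0) := h1
      rwa [d.left_inv hz] at h3
    rw [h2, hL]
    simp
  have hg : MDifferentiableAt (𝓡 n) (𝓡 m) (fun w => d.symm (L (c w))) (f x) := by
    have h1 : MDifferentiableAt (𝓡 n) (𝓡 n) c (f x) :=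
      ((hcs _ hcx).contMDiffAt (c.open_source.mem_nhds hcx)).mdifferentiableAt (by simp)
    have h2 : MDifferentiableAt (𝓡 n) (𝓡 m) L (c (f x)) :=
      L.differentiableAt.mdifferentiableAt
    have h3 : MDifferentiableAt (𝓡 m) (𝓡 m) d.symm (L (c (f x))) := by
      rw [hw x hdx]
      exact ((hds _ (d.map_source hdx)).contMDiffAt
        (d.open_target.mem_nhds (d.map_source hdx))).mdifferentiableAt (by simp)
    exact h3.comp (f x) (h2.comp (f x) h1)
  have hf : MDifferentiableAt (𝓡 m) (𝓡 n) f x := h.contMDiffAt.mdifferentiableAt (by simp)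
  refine Function.LeftInverse.injective
    (g := mfderiv (𝓡 n) (𝓡 m) (fun w => d.symm (L (c w))) (f x)) fun v => ?_
  refine mfderiv_apply_of_leftInverse hg hf ?_ v
  filter_upwards [d.open_source.mem_nhds hdx] with z hz
  rw [hw z hz, d.left_inv hz]

/-- The inverse function theorem on manifolds. -/
theorem isLocalDiffeomorphAt_of_bijective {f : M → N} {x : M}
    (hf : ∀ᶠ z in 𝓝 x, ContMDiffAt (𝓡 m) (𝓡 n) ∞ f z)
    (hb : Function.Bijective (mfderiv (𝓡 m) (𝓡 n) f x)) :
    IsLocalDiffeomorphAt (𝓡 m) (𝓡 n) ∞ f x := by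
  set φ := chartAt (EuclideanSpace ℝ (Fin m)) x with hφ
  set ψ := chartAt (EuclideanSpace ℝ (Fin n)) (f x) with hψ
  have hxφ : x ∈ φ.source := mem_chart_source _ x
  have hxψ : f x ∈ ψ.source := mem_chart_source _ (f x)
  obtain ⟨A, hA, hAo, hxA⟩ := eventually_nhds_iff.1
    (hf.and (hf.self_of_nhds.continuousAt (ψ.open_source.mem_nhds hxψ)))
  have hfA : ContMDiffOn (𝓡 m) (𝓡 n) ∞ f A := fun z hz => (hA z hz).1.contMDiffWithinAt
  set U := φ.target ∩ φ.symm ⁻¹' A with hU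
  have hUo : IsOpen U := φ.symm.isOpen_inter_preimage hAo
  have hxU : φ x ∈ U := ⟨φ.map_source hxφ, by rw [mem_preimage, φ.left_inv hxφ]; exact hxA⟩
  set G : EuclideanSpace ℝ (Fin m) → EuclideanSpace ℝ (Fin n) := fun u => ψ (f (φ.symm u)) with hG
  have hGs : ContDiffOn ℝ ∞ G U := by
    refine contMDiffOn_iff_contDiffOn.1 ?_
    have h1 : ContMDiffOn (𝓡 m) (𝓡 n) ∞ (fun u => f (φ.symm u)) U :=
      hfA.comp (contMDiffOn_chart_symm.mono inter_subset_left) fun u hu => hu.2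
    exact ContMDiffOn.comp (contMDiffOn_chart (x := f x)) h1 fun u hu => (hA _ hu.2).2
  have hd : DifferentiableAt ℝ G (φ x) :=
    (hGs.contDiffAt (hUo.mem_nhds hxU)).differentiableAt (by simp)
  have hfd : MDifferentiableAt (𝓡 m) (𝓡 n) f x := hf.self_of_nhds.mdifferentiableAt (by simp)
  have hGd : ∀ v, fderiv ℝ G (φ x) (mfderiv (𝓡 m) (𝓡 m) φ x v) =
      mfderiv (𝓡 n) (𝓡 n) ψ (f x) (mfderiv (𝓡 m) (𝓡 n) f x v) := by
    intro v
    have h1 := hd.hasFDerivAt.hasMFDerivAt.comp x (chart_mdifferentiableAt x hxφ).hasMFDerivAt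
    have h2 := (chart_mdifferentiableAt (f x) hxψ).hasMFDerivAt.comp x hfd.hasMFDerivAt
    have h3 : G ∘ φ =ᶠ[𝓝 x] ψ ∘ f := by
      filter_upwards [φ.open_source.mem_nhds hxφ] with z hz
      simp only [hG, Function.comp_apply, φ.left_inv hz]
    have h4 := (h1.congr_of_eventuallyEq h3.symm).mfderiv.symm.trans h2.mfderiv
    exact congrArg (fun L : EuclideanSpace ℝ (Fin m) →L[ℝ] EuclideanSpace ℝ (Fin n) => L v) h4
  have hφb : Function.Bijective (mfderiv (𝓡 m) (𝓡 m) φ x) :=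
    (mdifferentiable_chart x).mfderiv_bijective hxφ
  have hψb : Function.Bijective (mfderiv (𝓡 n) (𝓡 n) ψ (f x)) :=
    (mdifferentiable_chart (f x)).mfderiv_bijective hxψ
  have hGb : Function.Bijective (fderiv ℝ G (φ x)) := by
    have h1 : Function.Bijective (fun v => fderiv ℝ G (φ x) (mfderiv (𝓡 m) (𝓡 m) φ x v)) := by
      have h2 : (fun v => fderiv ℝ G (φ x) (mfderiv (𝓡 m) (𝓡 m) φ x v)) =
          fun v => mfderiv (𝓡 n) (𝓡 n) ψ (f x) (mfderiv (𝓡 m) (𝓡 n) f x v) := funext hGd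
      rw [h2]
      exact hψb.comp hb
    exact (Function.Bijective.of_comp_iff (fderiv ℝ G (φ x)) hφb).1 h1
  let e' : EuclideanSpace ℝ (Fin m) ≃L[ℝ] EuclideanSpace ℝ (Fin n) :=
    (LinearEquiv.ofBijective (fderiv ℝ G (φ x) : _ →ₗ[ℝ] _) hGb).toContinuousLinearEquiv
  obtain ⟨e, hxe, heU, heG, hes⟩ := hGs.exists_openPartialHomeomorph hUo hxU e' hd.hasFDerivAt
  have hGx : G (φ x) = ψ (f x) := by simp only [hG, φ.left_inv hxφ]
  have het : ψ (f x) ∈ e.target := by rw [← hGx, ← heG]; exact e.map_source hxe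
  refine isLocalDiffeomorphAt_of_inverse (g := fun w => φ.symm (e.symm (ψ w))) hf ?_ ?_ ?_
  · filter_upwards [ψ.open_source.mem_nhds hxψ,
      (ψ.continuousAt hxψ) (e.open_target.mem_nhds het)] with w hw hw'
    have h1 := (contMDiffOn_chart (n := ∞) (I := 𝓡 n) w hw).contMDiffAt (ψ.open_source.mem_nhds hw)
    have h2 := (hes.contDiffAt (e.open_target.mem_nhds hw')).contMDiffAt
    have h3 := heU (e.map_target hw')
    have h4 := (contMDiffOn_chart_symm (n := ∞) (I := 𝓡 m) _ h3.1).contMDiffAt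
      (φ.open_target.mem_nhds h3.1)
    exact h4.comp w (h2.comp w h1)
  · filter_upwards [φ.open_source.mem_nhds hxφ,
      (φ.continuousAt hxφ) (e.open_source.mem_nhds hxe)] with z hz hz'
    have h1 : e (φ z) = ψ (f z) := by rw [heG]; simp only [hG, φ.left_inv hz]
    rw [← h1, e.left_inv hz', φ.left_inv hz]
  · filter_upwards [ψ.open_source.mem_nhds hxψ,
      (ψ.continuousAt hxψ) (e.open_target.mem_nhds het)] with w hw hw'
    have h3 := heU (e.map_target hw')
    have h4 : ψ (f (φ.symm (e.symm (ψ w)))) = ψ w := by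
      have : G (e.symm (ψ w)) = ψ w := by rw [← heG]; exact e.right_inv hw'
      exact this
    exact ψ.injOn (hA _ h3.2).2 hw h4

end InverseFunction

/-! ### Time-one flows of time-dependent elements. -/

section TimeOne

variable {n : ℕ} {M : Type*} [TopologicalSpace M] [T2Space M]
  [ChartedSpace (EuclideanSpace ℝ (Fin n)) M] [IsManifold (𝓡 n) ∞ M] (F : SingularFoliation n M)

theorem TimeOneFlow.exists_transport {X : unitInterval → VField n M}
    (hX : IsPlot F.toVFSheaf (reparam X)) {y z : M} (h : TimeOneFlow X y z) :
    ∃ θ θ', IsTransport F.toVFSheaf (reparam X) 0 1 y z θ θ' := by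
  obtain ⟨q, rfl, rfl, hq⟩ := h.flowRel
  exact _root_.exists_transport F hX zero_le_one hq

theorem TimeOneFlow.unique {X : unitInterval → VField n M}
    (hX : IsPlot F.toVFSheaf (reparam X)) {y z z' : M} (h : TimeOneFlow X y z)
    (h' : TimeOneFlow X y z') : z = z' :=
  h.flowRel.unique F hX zero_le_one h'.flowRel

variable {F}

omit [T2Space M] in
theorem TimeDep.timeOneFlow_self {G : VFSheaf n M} {y : M} (Z : TimeDep (G.vanishing y)) :
    TimeOneFlow Z.toFun y y := by
  refine timeOneFlow_of_curve (p := fun _ => y) fun t => ?_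
  have h0 : Z.toFun t y = 0 := G.vanishing_apply (Z.mem t) trivial
  have h1 : ((1 : ℝ →L[ℝ] ℝ).smulRight (Z.toFun t y) : ℝ →L[ℝ] TangentSpace (𝓡 n) y) = 0 := by
    rw [h0]
    ext
    simp
  exact (hasMFDerivAt_const y (t : ℝ)).hasMFDerivWithinAt.congr_mfderiv h1.symm

end TimeOne

/-! ### Slices in charts and the data of a projection along the leaves. -/

section SliceProjection

variable {n : ℕ} {M : Type*} [TopologicalSpace M]
  [ChartedSpace (EuclideanSpace ℝ (Fin n)) M] [IsManifold (𝓡 n) ∞ M] {F : SingularFoliation n M}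

/-- A projection along the leaves onto a slice, defined near its base point. -/
structure SliceProjection {y : M} (S : Slice F y) where
  /-- generators near the base point -/
  A : AnchorChart F y
  /-- the domain of the projection -/
  W : Opens M
  mem : y ∈ W
  le : W ≤ A.V
  /-- a domain in the slice -/
  O : Opens S.carrier
  base_mem : S.base ∈ O
  /-- the projection -/
  pr : M → S.carrier
  smooth : ContMDiffOn (𝓡 n) (𝓡 S.dim) ∞ pr W
  pr_val : ∀ s ∈ O, pr s = s
  /-- the coefficients of the vector fields which move a point to its projection -/
  a : Fin A.m → M → ℝ
  a_smooth : ∀ i, SmoothFunOn n (a i) W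
  a_base : ∀ i, a i y = 0
  /-- vector fields on the slice -/
  Y : Fin A.m → VField S.dim S.carrier
  Y_mem : ∀ k, Y k ∈ S.foliation.sections O
  /-- the coefficients of the projected generators -/
  g : Fin A.m → Fin A.m → M → ℝ
  g_smooth : ∀ i k, SmoothFunOn n (g i k) W
  related : ∀ z ∈ W, ∀ i, mfderiv (𝓡 n) (𝓡 S.dim) pr z (A.G i z) = ∑ k, g i k z • Y k (pr z)
  -- The coefficients `a i z` are frozen at the starting point `z`. The neighbourhood `N` makes it
  -- possible to keep the curve where a cut-off function equals one.
  curve : ∀ N ∈ 𝓝 y, ∀ᶠ z in 𝓝 y, ∃ γ : ℝ → M, γ 0 = z ∧ γ 1 = pr z ∧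
    ∀ t ∈ Icc (0 : ℝ) 1, γ t ∈ N ∧ γ t ∈ W ∧ pr (γ t) = pr z ∧
      HasVelocityWithinAt n γ univ t (-∑ i, a i z • A.G i (γ t))

theorem AnchorChart.exists_of_mem_leafTangent {y : M} (A : AnchorChart F y)
    {v : TangentSpace (𝓡 n) y} (hv : v ∈ F.leafTangent y) :
    ∃ b : Fin A.m → ℝ, v = ∑ i, b i • A.G i y := by
  obtain ⟨X, hX, rfl⟩ := hv
  obtain ⟨U, hyU, -, d, -, -, h⟩ := A.generates_self ⊤ trivial X hX
  exact ⟨fun i => d i y, h y hyU⟩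

variable [T2Space M]

theorem AnchorChart.sum_mem_leafTangent {y : M} (A : AnchorChart F y) (b : Fin A.m → ℝ) :
    ∑ i, b i • A.G i y ∈ F.leafTangent y :=
  Submodule.sum_mem _ fun i _ => Submodule.smul_mem _ _ (F.mem_leafTangent (A.G_mem i) A.mem)

/-- The inclusion of a slice in charts. -/
noncomputable def Slice.chartInclusion {y : M} (S : Slice F y)
    (u : EuclideanSpace ℝ (Fin S.dim)) : EuclideanSpace ℝ (Fin n) :=
  chartAt (EuclideanSpace ℝ (Fin n)) y ((chartAt (EuclideanSpace ℝ (Fin S.dim)) S.base).symm u : M)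

omit [T2Space M] in
theorem Slice.contMDiff_val {y : M} (S : Slice F y) :
    ContMDiff (𝓡 S.dim) (𝓡 n) ∞ (Subtype.val : S.carrier → M) :=
  S.embedded.contMDiff

omit [T2Space M] in
theorem Slice.mdifferentiableAt_val {y : M} (S : Slice F y) (s : S.carrier) :
    MDifferentiableAt (𝓡 S.dim) (𝓡 n) (Subtype.val : S.carrier → M) s :=
  (S.contMDiff_val s).mdifferentiableAt (by simp)

omit [T2Space M] in
theorem Slice.mfderiv_val_injective {y : M} (S : Slice F y) (s : S.carrier) :
    Function.Injective (mfderiv (𝓡 S.dim) (𝓡 n) (Subtype.val : S.carrier → M) s) :=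
  mfderiv_injective_of_isImmersionAt (S.embedded.isImmersion.isImmersionAt s)

omit [T2Space M] in
theorem Slice.fderiv_chartInclusion {y : M} (S : Slice F y) {s : S.carrier}
    (hs : s ∈ (chartAt (EuclideanSpace ℝ (Fin S.dim)) S.base).source)
    (hy : (s : M) ∈ (chartAt (EuclideanSpace ℝ (Fin n)) y).source)
    (v : EuclideanSpace ℝ (Fin S.dim)) :
    fderiv ℝ S.chartInclusion (chartAt (EuclideanSpace ℝ (Fin S.dim)) S.base s) v =
      mfderiv (𝓡 n) (𝓡 n) (chartAt (EuclideanSpace ℝ (Fin n)) y) (s : M)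
        (mfderiv (𝓡 S.dim) (𝓡 n) (Subtype.val : S.carrier → M) s
          (mfderiv (𝓡 S.dim) (𝓡 S.dim) (chartAt (EuclideanSpace ℝ (Fin S.dim)) S.base).symm
            (chartAt (EuclideanSpace ℝ (Fin S.dim)) S.base s) v)) := by
  set ψ := chartAt (EuclideanSpace ℝ (Fin S.dim)) S.base with hψ
  have hu : ψ s ∈ ψ.target := ψ.map_source hs
  have h1 := (chart_symm_mdifferentiableAt S.base hu).hasMFDerivAt
  have key : ∀ s' : S.carrier, s' = s → HasMFDerivAt (𝓡 S.dim) (𝓡 n)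
      (fun s : S.carrier => chartAt (EuclideanSpace ℝ (Fin n)) y (s : M)) s'
      ((mfderiv (𝓡 n) (𝓡 n) (chartAt (EuclideanSpace ℝ (Fin n)) y) (s : M)).comp
        (mfderiv (𝓡 S.dim) (𝓡 n) (Subtype.val : S.carrier → M) s)) := by
    rintro _ rfl
    exact (chart_mdifferentiableAt y hy).hasMFDerivAt.comp _ (S.mdifferentiableAt_val _).hasMFDerivAt
  have h2 := (key _ (ψ.left_inv hs)).comp (ψ s) h1
  have h3 : mfderiv (𝓡 S.dim) (𝓡 n) S.chartInclusion (ψ s) = _ := h2.mfderiv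
  rw [mfderiv_eq_fderiv] at h3
  exact congrArg (fun L : EuclideanSpace ℝ (Fin S.dim) →L[ℝ] EuclideanSpace ℝ (Fin n) => L v) h3

/-- The derivative at the base point of the inclusion of a slice. -/
noncomputable def Slice.baseTangent {y : M} (S : Slice F y) :
    TangentSpace (𝓡 S.dim) S.base →L[ℝ] TangentSpace (𝓡 n) y :=
  mfderiv (𝓡 S.dim) (𝓡 n) (Subtype.val : S.carrier → M) S.base

omit [T2Space M] in
theorem Slice.eq_zero_of_mem_leafTangent {y : M} (S : Slice F y)
    {v : TangentSpace (𝓡 S.dim) S.base} (hv : S.baseTangent v ∈ F.leafTangent y) : v = 0 := by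
  have h : S.baseTangent v ∈ (⊥ : Submodule ℝ (TangentSpace (𝓡 n) y)) :=
    S.complementary ▸ ⟨⟨v, rfl⟩, hv⟩
  exact S.mfderiv_val_injective S.base
    (((Submodule.mem_bot ℝ).1 h).trans (map_zero S.baseTangent).symm)

omit [T2Space M] in
theorem Slice.exists_add_eq {y : M} (S : Slice F y) (v : TangentSpace (𝓡 n) y) :
    ∃ (v₁ : TangentSpace (𝓡 S.dim) S.base), ∃ v₂ ∈ F.leafTangent y, S.baseTangent v₁ + v₂ = v := by
  have h0 : (S.baseTangent : TangentSpace (𝓡 S.dim) S.base →ₗ[ℝ] TangentSpace (𝓡 n) y).range ⊔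
      F.leafTangent y = ⊤ := S.transverse S.base
  have h1 : v ∈ (S.baseTangent : TangentSpace (𝓡 S.dim) S.base →ₗ[ℝ] TangentSpace (𝓡 n) y).range ⊔
      F.leafTangent y := by
    rw [h0]
    trivial
  obtain ⟨_, ⟨v₁, rfl⟩, v₂, hv₂, h2⟩ := Submodule.mem_sup.1 h1
  exact ⟨v₁, v₂, hv₂, h2⟩

omit [T2Space M] in
theorem chart_mfderiv_bijective (y : M) {z : M}
    (hz : z ∈ (chartAt (EuclideanSpace ℝ (Fin n)) y).source) :
    Function.Bijective (mfderiv (𝓡 n) (𝓡 n) (chartAt (EuclideanSpace ℝ (Fin n)) y) z) :=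
  (mdifferentiable_chart y).mfderiv_bijective hz

/-- The chart form of the decomposition of the tangent space at `y` into the slice and leaf
directions, as required by `IsInvolutiveAnchor.exists_splitting`. -/
theorem Slice.isCompl_range {y : M} (S : Slice F y) (A : AnchorChart F y) :
    IsCompl (LinearMap.range (fderiv ℝ S.chartInclusion
        (chartAt (EuclideanSpace ℝ (Fin S.dim)) S.base S.base) :
          EuclideanSpace ℝ (Fin S.dim) →ₗ[ℝ] EuclideanSpace ℝ (Fin n)))
      (LinearMap.range (A.ρ (chartAt (EuclideanSpace ℝ (Fin n)) y y) :
        (Fin A.m → ℝ) →ₗ[ℝ] EuclideanSpace ℝ (Fin n))) := by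
  set ψ := chartAt (EuclideanSpace ℝ (Fin S.dim)) S.base with hψ
  have hb : S.base ∈ ψ.source := mem_chart_source _ _
  have hy : (S.base : M) ∈ (chartAt (EuclideanSpace ℝ (Fin n)) y).source := mem_chart_source _ y
  have hφ := chart_mfderiv_bijective y hy
  constructor
  · rw [Submodule.disjoint_def]
    rintro _ ⟨v, rfl⟩ ⟨b, hb'⟩
    have h1 := S.fderiv_chartInclusion hb hy v
    have h2 := A.ρ_apply y A.mem b
    have h3 := hφ.1 (h1.symm.trans (hb'.symm.trans h2))
    have h4 := S.eq_zero_of_mem_leafTangent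
      (v := mfderiv (𝓡 S.dim) (𝓡 S.dim) ψ.symm (ψ S.base) v) (h3 ▸ A.sum_mem_leafTangent b)
    rw [h4] at h1
    refine h1.trans ?_
    exact (congrArg _ (map_zero _)).trans (map_zero _)
  · rw [codisjoint_iff, eq_top_iff]
    rintro w -
    obtain ⟨v, hv⟩ := hφ.2 w
    obtain ⟨v₁, v₂, hv₂, h2⟩ := S.exists_add_eq v
    obtain ⟨b, hb'⟩ := A.exists_of_mem_leafTangent hv₂
    refine Submodule.mem_sup.2 ⟨_, ⟨mfderiv (𝓡 S.dim) (𝓡 S.dim) ψ S.base v₁, rfl⟩, _, ⟨b, rfl⟩, ?_⟩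
    have h3 := S.fderiv_chartInclusion hb hy (mfderiv (𝓡 S.dim) (𝓡 S.dim) ψ S.base v₁)
    have h4 := chart_mfderiv_symm_apply S.base hb v₁
    have h5 := A.ρ_apply y A.mem b
    rw [← hb'] at h5
    rw [h4] at h3
    refine (congrArg₂ (fun p q : EuclideanSpace ℝ (Fin n) => p + q) h3 h5).trans ?_
    rw [← hv, ← h2]
    exact (map_add (mfderiv (𝓡 n) (𝓡 n) (chartAt (EuclideanSpace ℝ (Fin n)) y) y) _ _).symm

end SliceProjection

/-! ### Existence of the projection onto a slice. -/

section SliceProjectionExists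

variable {n : ℕ} {M : Type*} [TopologicalSpace M] [T2Space M]
  [ChartedSpace (EuclideanSpace ℝ (Fin n)) M] [IsManifold (𝓡 n) ∞ M] {F : SingularFoliation n M}

/-- The splitting theorem for anchors is applied to the slice in charts. Its operator-valued data
become families indexed by the generators through evaluation on the standard basis of `Fin A.m → ℝ`.
-/
theorem Slice.exists_sliceProjection {y : M} (S : Slice F y) : Nonempty (SliceProjection S) := by
  obtain ⟨A⟩ := F.exists_anchorChart y
  set φ := chartAt (EuclideanSpace ℝ (Fin n)) y with hφ
  set ψ := chartAt (EuclideanSpace ℝ (Fin S.dim)) S.base with hψ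
  have hyφ : y ∈ φ.source := mem_chart_source _ y
  have hbψ : S.base ∈ ψ.source := mem_chart_source _ _
  have hOo : IsOpen (ψ.target ∩ ψ.symm ⁻¹' (Subtype.val ⁻¹' (A.V : Set M))) :=
    ψ.symm.isOpen_inter_preimage (A.V.isOpen.preimage continuous_subtype_val)
  have hι : ContDiffOn ℝ ∞ S.chartInclusion
      (ψ.target ∩ ψ.symm ⁻¹' (Subtype.val ⁻¹' (A.V : Set M))) := by
    refine contMDiffOn_iff_contDiffOn.1 ?_
    have h1 : ContMDiffOn (𝓡 S.dim) (𝓡 n) ∞ (fun u => (ψ.symm u : M))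
        (ψ.target ∩ ψ.symm ⁻¹' (Subtype.val ⁻¹' (A.V : Set M))) :=
      S.contMDiff_val.comp_contMDiffOn (contMDiffOn_chart_symm.mono inter_subset_left)
    exact (contMDiffOn_chart (x := y)).comp h1 fun u hu => A.subset_source hu.2
  have hιV : MapsTo S.chartInclusion (ψ.target ∩ ψ.symm ⁻¹' (Subtype.val ⁻¹' (A.V : Set M)))
      (φ.target ∩ φ.symm ⁻¹' (A.V : Set M)) := fun u hu => by
    refine ⟨φ.map_source (A.subset_source hu.2), ?_⟩
    have : φ.symm (S.chartInclusion u) = (ψ.symm u : M) := φ.left_inv (A.subset_source hu.2)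
    rw [mem_preimage, this]
    exact hu.2
  have hs₀ : ψ S.base ∈ ψ.target ∩ ψ.symm ⁻¹' (Subtype.val ⁻¹' (A.V : Set M)) := by
    refine ⟨ψ.map_source hbψ, ?_⟩
    rw [mem_preimage, ψ.left_inv hbψ]
    exact A.mem
  have hι₀ : S.chartInclusion (ψ S.base) = φ y := by
    show φ (ψ.symm (ψ S.base) : M) = φ y
    rw [ψ.left_inv hbψ]
    rfl
  have hψs : Function.Injective (mfderiv (𝓡 S.dim) (𝓡 S.dim) ψ.symm (ψ S.base)) := by
    have h := (chart_symm_mfderiv_isInvertible S.base (ψ.map_source hbψ)).1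
    exact h.injective
  have hinj : Function.Injective (fderiv ℝ S.chartInclusion (ψ S.base)) := by
    intro v w hvw
    have h1 := S.fderiv_chartInclusion hbψ hyφ v
    have h2 := S.fderiv_chartInclusion hbψ hyφ w
    exact hψs (S.mfderiv_val_injective S.base ((chart_mfderiv_bijective y hyφ).1
      (h1.symm.trans (hvw.trans h2))))
  obtain ⟨W, O, pr, a, g, Y, θ, hW, hyW, hWV, hO, hbO, hOO, hpr, hprO, hprι, ha, ha0, hY, hθ, hYθ,
    hg, hgY, hcurve⟩ := A.anchor.exists_splitting hOo hι hιV hs₀ hinj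
      (by rw [hι₀]; exact S.isCompl_range A)
  rw [hι₀] at hyW ha0 hcurve
  have hmaps : ∀ z ∈ φ.source ∩ φ ⁻¹' W, z ∈ A.V := fun z hz => by
    have := (hWV hz.2).2
    rwa [mem_preimage, φ.left_inv hz.1] at this
  have hφs : ContMDiffOn (𝓡 n) (𝓡 n) ∞ φ (φ.source ∩ φ ⁻¹' W) :=
    (contMDiffOn_chart (x := y)).mono inter_subset_left
  have hval : ∀ s ∈ ψ.source ∩ ψ ⁻¹' O, S.chartInclusion (ψ s) = φ (s : M) ∧ (s : M) ∈ A.V := by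
    intro s hs
    have h1 := (hOO hs.2).2
    rw [mem_preimage, ψ.left_inv hs.1] at h1
    refine ⟨?_, h1⟩
    show φ (ψ.symm (ψ s) : M) = φ (s : M)
    rw [ψ.left_inv hs.1]
  have hinvψ : ∀ s ∈ ψ.source, (mfderiv (𝓡 S.dim) (𝓡 S.dim) ψ s).IsInvertible ∧
      (mfderiv (𝓡 S.dim) (𝓡 S.dim) ψ s).inverse =
        mfderiv (𝓡 S.dim) (𝓡 S.dim) ψ.symm (ψ s) := fun s hs =>
    mfderiv_isInvertible_of_inverse
      (chart_symm_mdifferentiableAt S.base (ψ.map_source hs)) (chart_mdifferentiableAt S.base hs)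
      (by filter_upwards [ψ.open_source.mem_nhds hs] with z hz using ψ.left_inv hz)
      (by filter_upwards [ψ.open_target.mem_nhds (ψ.map_source hs)] with z hz using ψ.right_inv hz)
  have hYs : ∀ k, ∀ s ∈ ψ.source, (VectorField.mpullback (𝓡 S.dim) (𝓡 S.dim) ψ
      (fun u => Y u (Pi.single k 1)) s : EuclideanSpace ℝ (Fin S.dim)) =
      mfderiv (𝓡 S.dim) (𝓡 S.dim) ψ.symm (ψ s) (Y (ψ s) (Pi.single k 1)) := fun k s hs =>
    congrArg (fun L : EuclideanSpace ℝ (Fin S.dim) →L[ℝ] EuclideanSpace ℝ (Fin S.dim) =>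
      L (Y (ψ s) (Pi.single k 1))) (hinvψ s hs).2
  have hsum : ∀ {D : Type _} [NormedAddCommGroup D] [NormedSpace ℝ D]
      (L : (Fin A.m → ℝ) →L[ℝ] D) (b : Fin A.m → ℝ), L b = ∑ k, b k • L (Pi.single k 1) := by
    intro D _ _ L b
    conv_lhs => rw [pi_eq_sum_univ' b]
    simp [map_sum]
  refine ⟨{
    A := A
    W := ⟨φ.source ∩ φ ⁻¹' W, isOpen_chart_preimage y hW⟩
    mem := ⟨hyφ, hyW⟩
    le := hmaps
    O := ⟨ψ.source ∩ ψ ⁻¹' O, isOpen_chart_preimage S.base hO⟩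
    base_mem := ⟨hbψ, hbO⟩
    pr := fun z => ψ.symm (pr (φ z))
    smooth := ?_
    pr_val := fun s hs => ?_
    a := fun i z => a (φ z) i
    a_smooth := fun i => ?_
    a_base := fun i => by rw [ha0]; rfl
    Y := fun k => VectorField.mpullback (𝓡 S.dim) (𝓡 S.dim) ψ fun u => Y u (Pi.single k 1)
    Y_mem := fun k => ⟨?_, fun s hs => ?_⟩
    g := fun i k z => g (φ z) (Pi.single i 1) k
    g_smooth := fun i k => ?_
    related := fun z hz i => ?_
    curve := fun N hN => ?_ }⟩
  · exact (contMDiffOn_chart_symm (x := S.base)).comp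
      ((contMDiffOn_iff_contDiffOn.2 hpr).comp hφs fun z hz => hz.2)
      fun z hz => (hOO (hprO hz.2)).1
  · obtain ⟨h1, h2⟩ := hval s hs
    show ψ.symm (pr (φ (s : M))) = s
    rw [← h1, (hprι _ hs.2).2, ψ.left_inv hs.1]
  · exact (contMDiffOn_iff_contDiffOn.2 (contDiffOn_pi.1 ha i)).comp hφs fun z hz => hz.2
  · refine SmoothVFieldOn.mpullback (isOpen_chart_preimage S.base hO) hO
      (contMDiffOn_vectorSpace_iff_contDiffOn.2 (hY.clm_apply contDiffOn_const))
      ((contMDiffOn_chart (x := S.base)).mono inter_subset_left) (fun s hs => hs.2)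
      fun s hs => (hinvψ s hs.1).1
  · refine ⟨_, hs, le_rfl, A.V, fun s hs => (hval s hs).2, A.m,
      fun j s => θ (ψ s) (Pi.single k 1) j, A.G, fun j => ⟨?_, A.G_mem j⟩, fun s hs => ?_⟩
    · exact (contMDiffOn_iff_contDiffOn.2 (contDiffOn_pi.1
        (hθ.clm_apply contDiffOn_const) j)).comp
        ((contMDiffOn_chart (x := S.base)).mono inter_subset_left) fun z hz => hz.2
    · obtain ⟨h1, h2⟩ := hval s hs
      refine (chart_mfderiv_bijective y (A.subset_source h2)).1 ?_
      have h3 := S.fderiv_chartInclusion hs.1 (A.subset_source h2) (Y (ψ s) (Pi.single k 1))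
      have h4 := hYθ _ hs.2 (Pi.single k 1)
      rw [h1] at h4
      have h5 := A.ρ_apply _ h2 (θ (ψ s) (Pi.single k 1))
      refine Eq.trans ?_ (h3.symm.trans (h4.trans h5))
      exact congrArg (fun v : EuclideanSpace ℝ (Fin S.dim) =>
        mfderiv (𝓡 n) (𝓡 n) φ (s : M)
          (mfderiv (𝓡 S.dim) (𝓡 n) (Subtype.val : S.carrier → M) s v)) (hYs k s hs.1)
  · exact (contMDiffOn_iff_contDiffOn.2 (contDiffOn_pi.1
      (hg.clm_apply contDiffOn_const) k)).comp hφs fun z hz => hz.2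
  · have h1 := mfderiv_of_charts y S.base hz.1 ((hpr.contDiffAt
      (hW.mem_nhds hz.2)).differentiableAt (by simp)) (hOO (hprO hz.2)).1 (A.G i z)
    refine h1.trans ?_
    have h2 := A.ρ_apply z (hmaps z hz) (Pi.single i 1)
    have h3 : ∑ j, (Pi.single i (1 : ℝ) : Fin A.m → ℝ) j • A.G j z = A.G i z := by
      rw [Finset.sum_eq_single i] <;> simp +contextual
    rw [h3] at h2
    have hu := (hOO (hprO hz.2)).1
    have h4 : ∀ (L : EuclideanSpace ℝ (Fin S.dim) →L[ℝ] EuclideanSpace ℝ (Fin S.dim)),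
        L (fderiv ℝ pr (φ z) (A.ρ (φ z) (Pi.single i 1))) =
          ∑ k, g (φ z) (Pi.single i 1) k • L (Y (pr (φ z)) (Pi.single k 1)) := by
      intro L
      rw [hgY _ hz.2, hsum (Y (pr (φ z))) (g (φ z) (Pi.single i 1)), map_sum]
      simp
    have h5 := h4 (mfderiv (𝓡 S.dim) (𝓡 S.dim) ψ.symm (pr (φ z)))
    rw [h2] at h5
    refine h5.trans (Finset.sum_congr rfl fun k _ => ?_)
    have h6 := hYs k _ (ψ.map_target hu)
    rw [ψ.right_inv hu] at h6
    exact congrArg (fun v : EuclideanSpace ℝ (Fin S.dim) => g (φ z) (Pi.single i 1) k • v) h6.symm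
  · have h1 : φ.target ∩ φ.symm ⁻¹' N ∈ 𝓝 (φ y) := by
      refine inter_mem (φ.open_target.mem_nhds (φ.map_source hyφ)) ?_
      have := φ.continuousAt_symm (φ.map_source hyφ)
      rw [ContinuousAt, φ.left_inv hyφ] at this
      exact this hN
    filter_upwards [(φ.continuousAt hyφ).eventually (hcurve _ h1), φ.open_source.mem_nhds hyφ]
      with z hz hzs
    obtain ⟨γ, hγ0, hγ1, hγ⟩ := hz
    have hprz := hprO (show φ z ∈ W from by
      have := (hγ 0 ⟨le_rfl, zero_le_one⟩).2.1
      rwa [hγ0] at this)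
    refine ⟨fun t => φ.symm (γ t), ?_, ?_, fun t ht => ?_⟩
    · simp only [hγ0, φ.left_inv hzs]
    · have h2 := (hOO hprz).2
      simp only [hγ1]
      exact φ.left_inv (A.subset_source h2)
    · obtain ⟨h2, h3, h4, h5⟩ := hγ t ht
      have h6 : φ (φ.symm (γ t)) = γ t := φ.right_inv h2.1
      refine ⟨h2.2, ⟨φ.map_target h2.1, ?_⟩, ?_, ?_⟩
      · rw [mem_preimage, h6]
        exact h3
      · simp only [h6, h4]
      · refine (h5.hasDerivWithinAt (s := univ)).hasVelocityWithinAt y h2.1 ?_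
        rw [map_neg]
        exact congrArg Neg.neg (A.ρ_eq h2.1 (hWV h3).2 (a (φ z)))

end SliceProjectionExists

/-! ### Local diffeomorphisms preserving the foliation. -/

section Foliated

variable {n : ℕ} {M : Type*} [TopologicalSpace M]
  [ChartedSpace (EuclideanSpace ℝ (Fin n)) M] [IsManifold (𝓡 n) ∞ M]

/-- `θ` is a local diffeomorphism at `y`, with local inverse `θ'`, which preserves `F`. -/
structure IsFoliated (F : VFSheaf n M) (y z : M) (θ θ' : M → M) : Prop where
  map : θ y = z
  map' : θ' z = y
  smooth : ∀ᶠ u in 𝓝 y, ContMDiffAt (𝓡 n) (𝓡 n) ∞ θ u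
  smooth' : ∀ᶠ u in 𝓝 z, ContMDiffAt (𝓡 n) (𝓡 n) ∞ θ' u
  left_inv : ∀ᶠ u in 𝓝 y, θ' (θ u) = u
  right_inv : ∀ᶠ u in 𝓝 z, θ (θ' u) = u
  pulls : PullsBackAt F F θ y
  pulls' : PullsBackAt F F θ' z

theorem IsTransport.isFoliated {F : VFSheaf n M} {X : ℝ → VField n M} {s t : ℝ} {y z : M}
    {θ θ' : M → M} (h : IsTransport F X s t y z θ θ') : IsFoliated F y z θ θ' :=
  ⟨h.map, h.map', h.smooth, h.smooth', h.left_inv, h.right_inv, h.pulls, h.pulls'⟩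

namespace IsFoliated

variable {F : VFSheaf n M} {x y z : M} {θ θ' η η' : M → M}

theorem symm (h : IsFoliated F y z θ θ') : IsFoliated F z y θ' θ :=
  ⟨h.map', h.map, h.smooth', h.smooth, h.right_inv, h.left_inv, h.pulls', h.pulls⟩

theorem tendsto (h : IsFoliated F y z θ θ') : Tendsto θ (𝓝 y) (𝓝 z) := by
  have := h.smooth.self_of_nhds.continuousAt
  rwa [ContinuousAt, h.map] at this

theorem trans (h₁ : IsFoliated F x y θ θ') (h₂ : IsFoliated F y z η η') :
    IsFoliated F x z (η ∘ θ) (θ' ∘ η') where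
  map := by simp [h₁.map, h₂.map]
  map' := by simp [h₁.map', h₂.map']
  smooth := by
    filter_upwards [h₁.smooth, h₁.tendsto.eventually h₂.smooth] with u h3 h4
    exact h4.comp u h3
  smooth' := by
    filter_upwards [h₂.smooth', h₂.symm.tendsto.eventually h₁.smooth'] with u h3 h4
    exact h4.comp u h3
  left_inv := by
    filter_upwards [h₁.left_inv, h₁.tendsto.eventually h₂.left_inv] with u h3 h4
    simp only [Function.comp_apply, h4, h3]
  right_inv := by
    filter_upwards [h₂.right_inv, h₂.symm.tendsto.eventually h₁.right_inv] with u h3 h4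
    simp only [Function.comp_apply, h4, h3]
  pulls := h₂.pulls.comp h₁.pulls h₁.map h₁.smooth h₂.smooth
  pulls' := h₁.pulls'.comp h₂.pulls' h₂.map' h₂.smooth' h₁.smooth'

theorem eventually_isInvertible (h : IsFoliated F y z θ θ') :
    ∀ᶠ u in 𝓝 y, (mfderiv (𝓡 n) (𝓡 n) θ u).IsInvertible ∧
      (mfderiv (𝓡 n) (𝓡 n) θ u).inverse = mfderiv (𝓡 n) (𝓡 n) θ' (θ u) := by
  filter_upwards [h.smooth, eventually_eventually_nhds.2 h.left_inv,
    h.tendsto.eventually h.smooth', h.tendsto.eventually (eventually_eventually_nhds.2 h.right_inv)]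
    with u h1 h2 h3 h4
  exact mfderiv_isInvertible_of_inverse (h3.mdifferentiableAt (by simp))
    (h1.mdifferentiableAt (by simp)) h2 h4

/-- One implication pulls a section back by `θ`, the other by `θ'`, whose derivative is inverse to
that of `θ`. -/
theorem mem_leafTangent_iff [T2Space M] (h : IsFoliated F y (θ y) θ θ') (v : TangentSpace (𝓡 n) y) :
    mfderiv (𝓡 n) (𝓡 n) θ y v ∈ F.leafTangent (θ y) ↔ v ∈ F.leafTangent y := by
  obtain ⟨h1, h2⟩ := h.eventually_isInvertible.self_of_nhds
  constructor
  · rintro ⟨Y, hY, hv⟩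
    obtain ⟨U, hyU, Y', hY', h3⟩ := h.pulls.self_of_nhds ⊤ trivial Y hY
    have h4 := h1.injective ((h3 y hyU).2.trans hv)
    rw [← h4]
    exact F.mem_leafTangent hY' hyU
  · rintro ⟨Y, hY, rfl⟩
    obtain ⟨U, hyU, Y', hY', h3⟩ := h.pulls'.self_of_nhds ⊤ trivial Y hY
    have h4 := (h3 _ hyU).2
    have h5 : ∀ w, w = y → (Y w : EuclideanSpace ℝ (Fin n)) = Y y := by rintro _ rfl; rfl
    have h6 : (mfderiv (𝓡 n) (𝓡 n) θ y).inverse (Y' (θ y)) = Y y := by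
      rw [h2]
      exact h4.trans (h5 _ h.map')
    rw [← h6, h1.self_apply_inverse]
    exact F.mem_leafTangent hY' hyU

end IsFoliated

end Foliated

/-! ### The projection restricted to images of slices. -/

section Projection

variable {n : ℕ} {M : Type*} [TopologicalSpace M] [T2Space M]
  [ChartedSpace (EuclideanSpace ℝ (Fin n)) M] [IsManifold (𝓡 n) ∞ M] {F : SingularFoliation n M}
  {y : M} {S : Slice F y}

namespace SliceProjection

omit [T2Space M] in
theorem pr_base (π : SliceProjection S) : π.pr y = S.base := π.pr_val _ π.base_mem

omit [T2Space M] in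
theorem contMDiffAt_pr (π : SliceProjection S) {z : M} (hz : z ∈ π.W) :
    ContMDiffAt (𝓡 n) (𝓡 S.dim) ∞ π.pr z :=
  (π.smooth z hz).contMDiffAt (π.W.isOpen.mem_nhds hz)

omit [T2Space M] in
theorem mdifferentiableAt_pr (π : SliceProjection S) {z : M} (hz : z ∈ π.W) :
    MDifferentiableAt (𝓡 n) (𝓡 S.dim) π.pr z :=
  (π.contMDiffAt_pr hz).mdifferentiableAt (by simp)

omit [T2Space M] in
theorem mfderiv_pr_baseTangent (π : SliceProjection S) (v : TangentSpace (𝓡 S.dim) S.base) :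
    mfderiv (𝓡 n) (𝓡 S.dim) π.pr y (S.baseTangent v) = v :=
  mfderiv_apply_of_leftInverse (f := (Subtype.val : S.carrier → M)) (g := π.pr) (x := S.base)
    (π.mdifferentiableAt_pr π.mem) (S.mdifferentiableAt_val _)
    (by filter_upwards [π.O.isOpen.mem_nhds π.base_mem] with s hs using π.pr_val s hs) v

/-- The value at the base point is tangent to both the slice and the leaf, and these meet only in
zero there. -/
theorem _root_.Slice.foliation_apply_base (S : Slice F y) {U : Opens S.carrier} (hU : S.base ∈ U)
    {Y : VField S.dim S.carrier} (hY : Y ∈ S.foliation.sections U) : Y S.base = 0 := by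
  obtain ⟨W, hbW, -, V, hV, m, g, X, hX, h⟩ := hY.2 _ hU
  refine S.eq_zero_of_mem_leafTangent ?_
  have h1 : S.baseTangent (Y S.base) = ∑ i, g i S.base • X i y := h _ hbW
  rw [h1]
  exact Submodule.sum_mem _ fun i _ => Submodule.smul_mem _ _ (F.mem_leafTangent (hX i).2 (hV hbW))

/-- The projections of the generators are combinations of the fields `Y k`, which vanish at the base
point. -/
theorem mfderiv_pr_eq_zero (π : SliceProjection S) {v : TangentSpace (𝓡 n) y}
    (hv : v ∈ F.leafTangent y) : mfderiv (𝓡 n) (𝓡 S.dim) π.pr y v = 0 := by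
  obtain ⟨b, rfl⟩ := π.A.exists_of_mem_leafTangent hv
  have h1 : ∀ k, ∀ s, s = S.base → π.Y k s = 0 := by
    rintro k _ rfl
    exact S.foliation_apply_base π.base_mem (π.Y_mem k)
  rw [map_sum]
  refine Finset.sum_eq_zero fun i _ => ?_
  rw [map_smul, π.related y π.mem i, Finset.sum_eq_zero, smul_zero]
  intro k _
  rw [h1 k _ π.pr_base, smul_zero]

/-- The derivative of `pr` is the identity on slice directions and zero on the complementary leaf
directions, so its kernel is exactly the leaf tangent. -/
theorem mem_leafTangent_of_mfderiv_pr (π : SliceProjection S) {v : TangentSpace (𝓡 n) y}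
    (hv : mfderiv (𝓡 n) (𝓡 S.dim) π.pr y v = 0) : v ∈ F.leafTangent y := by
  obtain ⟨v₁, v₂, hv₂, rfl⟩ := S.exists_add_eq v
  have h1 : mfderiv (𝓡 n) (𝓡 S.dim) π.pr y (S.baseTangent v₁) = 0 := by
    have := π.mfderiv_pr_eq_zero hv₂
    rwa [map_add, this, add_zero] at hv
  have h2 : v₁ = 0 := (π.mfderiv_pr_baseTangent v₁).symm.trans h1
  rw [h2, map_zero, zero_add]
  exact hv₂

/-- The projection of the image of a slice under a foliated local diffeomorphism is a local
diffeomorphism between the slices. -/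
theorem isLocalDiffeomorphAt {x : M} {S₀ : Slice F x} (π : SliceProjection S) {θ θ' : M → M}
    (h : IsFoliated F.toVFSheaf x y θ θ') :
    IsLocalDiffeomorphAt (𝓡 S₀.dim) (𝓡 S.dim) ∞ (fun s : S₀.carrier => π.pr (θ s)) S₀.base := by
  obtain rfl := h.map
  have hc : Tendsto (Subtype.val : S₀.carrier → M) (𝓝 S₀.base) (𝓝 x) :=
    continuous_subtype_val.tendsto S₀.base
  have hθ : MDifferentiableAt (𝓡 n) (𝓡 n) θ x := h.smooth.self_of_nhds.mdifferentiableAt (by simp)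
  obtain ⟨h1, h2⟩ := h.eventually_isInvertible.self_of_nhds
  have hd : ∀ v, mfderiv (𝓡 S₀.dim) (𝓡 S.dim) (fun s : S₀.carrier => π.pr (θ s)) S₀.base v =
      mfderiv (𝓡 n) (𝓡 S.dim) π.pr (θ x) (mfderiv (𝓡 n) (𝓡 n) θ x (S₀.baseTangent v)) := by
    intro v
    have h3 := (π.mdifferentiableAt_pr π.mem).hasMFDerivAt.comp x hθ.hasMFDerivAt
    have h4 := h3.comp S₀.base (S₀.mdifferentiableAt_val S₀.base).hasMFDerivAt
    exact congrArg (fun L : EuclideanSpace ℝ (Fin S₀.dim) →L[ℝ] EuclideanSpace ℝ (Fin S.dim) => L v)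
      h4.mfderiv
  -- `Dθ` is an isomorphism matching the leaf tangents, so it carries the tangent space of `S₀` to a
  -- complement of the leaf tangent, on which `D pr` is an isomorphism. Equality of the dimensions
  -- of the slices is a consequence and not needed beforehand.
  refine isLocalDiffeomorphAt_of_bijective ?_ ⟨?_, ?_⟩
  · filter_upwards [hc.eventually h.smooth,
      hc.eventually (h.tendsto.eventually (π.W.isOpen.mem_nhds π.mem))] with s hs hs'
    exact (π.contMDiffAt_pr hs').comp s (hs.comp s (S₀.contMDiff_val s))
  · refine (injective_iff_map_eq_zero _).2 fun v hv => ?_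
    have h3 := π.mem_leafTangent_of_mfderiv_pr ((hd v).symm.trans hv)
    exact S₀.eq_zero_of_mem_leafTangent ((h.mem_leafTangent_iff _).1 h3)
  · intro u
    have hu : ∃ u' : TangentSpace (𝓡 S.dim) S.base, mfderiv (𝓡 n) (𝓡 S.dim) π.pr (θ x)
      (S.baseTangent u') = u := ⟨u, π.mfderiv_pr_baseTangent u⟩
    obtain ⟨u', hu'⟩ := hu
    obtain ⟨v, hv⟩ := h1.surjective (S.baseTangent u')
    obtain ⟨v₁, v₂, hv₂, rfl⟩ := S₀.exists_add_eq v
    refine ⟨v₁, (hd v₁).trans ?_⟩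
    have h3 := π.mfderiv_pr_eq_zero ((h.mem_leafTangent_iff v₂).2 hv₂)
    rw [map_add] at hv
    rw [← hu', ← hv, map_add, h3, add_zero]

end SliceProjection

end Projection

/-! ### From pulling back in both directions to preservation of foliations. -/

section Preserves

variable {m n : ℕ} {M N : Type*} [TopologicalSpace M]
  [ChartedSpace (EuclideanSpace ℝ (Fin m)) M] [IsManifold (𝓡 m) ∞ M] [TopologicalSpace N]
  [ChartedSpace (EuclideanSpace ℝ (Fin n)) N] [IsManifold (𝓡 n) ∞ N]

omit [IsManifold (𝓡 m) ∞ M] [IsManifold (𝓡 n) ∞ N] in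
theorem LocalDiffeo.eventually_contMDiffAt {x : M} {y : N} (f : LocalDiffeo m n x y) :
    ∀ᶠ z in 𝓝 x, ContMDiffAt (𝓡 m) (𝓡 n) ∞ f.toFun z :=
  f.isLocalDiffeo.eventually_contMDiffAt

omit [IsManifold (𝓡 m) ∞ M] [IsManifold (𝓡 n) ∞ N] in
theorem LocalDiffeo.eventually_isInvertible {x : M} {y : N} (f : LocalDiffeo m n x y) :
    ∀ᶠ z in 𝓝 x, (mfderiv (𝓡 m) (𝓡 n) f.toFun z).IsInvertible ∧
      (mfderiv (𝓡 m) (𝓡 n) f.toFun z).inverse =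
        mfderiv (𝓡 n) (𝓡 m) f.inv.toFun (f.toFun z) := by
  filter_upwards [f.eventually_contMDiffAt, eventually_eventually_nhds.2 f.inv_left,
    f.tendsto.eventually f.inv.eventually_contMDiffAt,
    f.tendsto.eventually (eventually_eventually_nhds.2 f.inv_right)] with z h1 h2 h3 h4
  exact mfderiv_isInvertible_of_inverse (h3.mdifferentiableAt (by simp))
    (h1.mdifferentiableAt (by simp)) h2 h4

/-- Both implications are local. For a section `Y`, its pullback agrees with the related section
supplied by `h`, as the derivative is invertible. Conversely `h'`, applied to the pullback of `Y`,
returns a section which must be `Y`. -/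
theorem LocalDiffeo.preserves {F : VFSheaf m M} {G : VFSheaf n N} {x : M} {y : N}
    (f : LocalDiffeo m n x y) (h : PullsBackAt F G f.toFun x) (h' : PullsBackAt G F f.inv.toFun y) :
    f.germ.Preserves F G := by
  obtain ⟨Φ, hΦ, hΦ', hx, hP, hQ⟩ := exists_partialDiffeomorph f.eventually_contMDiffAt
    (by rw [f.map_base]; exact f.inv.eventually_contMDiffAt) f.inv_left
    (by rw [f.map_base]; exact f.inv_right) (h.and f.eventually_isInvertible)
    (by rw [f.map_base]; exact h'.and f.inv.eventually_isInvertible)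
  refine ⟨f, Φ, rfl, hx, fun z _ => congrFun hΦ.symm z, fun U V hV hU Y => ?_⟩
  have hΦf : (Φ : M → N) = f.toFun := hΦ
  have hl : ∀ z ∈ Φ.source, f.inv.toFun (f.toFun z) = z := fun z hz => by
    rw [← hΦ, ← hΦ']
    exact Φ.left_inv' hz
  have hr : ∀ z ∈ Φ.target, f.toFun (f.inv.toFun z) = z := fun z hz => by
    rw [← hΦ, ← hΦ']
    exact Φ.right_inv' hz
  have hmt : ∀ z ∈ Φ.target, f.inv.toFun z ∈ Φ.source := fun z hz => by
    rw [← hΦ']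
    exact Φ.map_target' hz
  rw [hΦf] at hU ⊢
  have hU' : ∀ z, z ∈ U ↔ z ∈ Φ.source ∧ f.toFun z ∈ V := fun z => Set.ext_iff.1 hU z
  constructor
  · refine fun hY => F.glue U _ fun z hz => ?_
    obtain ⟨hzs, hzV⟩ := (hU' z).1 hz
    obtain ⟨U₁, hzU₁, Y₁, hY₁, h1⟩ := (hP z hzs).1 V hzV Y hY
    refine ⟨U₁ ⊓ U, ⟨hzU₁, hz⟩, inf_le_right, F.congr _ _ (F.restrict _ _ inf_le_left hY₁) _ ?_⟩
    intro w hw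
    have h2 := (hP w ((hU' w).1 hw.2).1).2.1
    rw [VectorField.mpullback_apply, ← (h1 w hw.1).2, h2.inverse_apply_self]
  · refine fun hY => G.glue V _ fun w hw => ?_
    have hwU : f.inv.toFun w ∈ U := (hU' _).2 ⟨hmt w (hV hw), by rwa [hr w (hV hw)]⟩
    obtain ⟨V₁, hwV₁, Y₁, hY₁, h1⟩ := (hQ w (hV hw)).1 U hwU _ hY
    refine ⟨V₁ ⊓ V, ⟨hwV₁, hw⟩, inf_le_right, G.congr _ _ (G.restrict _ _ inf_le_left hY₁) _ ?_⟩
    intro u hu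
    have h2 := (h1 u hu.1).2
    have h3 := (hP _ (hmt u (hV hu.2))).2
    -- The point `f (f⁻¹ u)` is generalised to `u'`, because the type of `Y u'` depends on it.
    have h4 : ∀ u', u' = u → ∀ L : EuclideanSpace ℝ (Fin m) →L[ℝ] EuclideanSpace ℝ (Fin n),
        L.IsInvertible → L.inverse = mfderiv (𝓡 n) (𝓡 m) f.inv.toFun u' →
        mfderiv (𝓡 n) (𝓡 m) f.inv.toFun u (Y₁ u) = L.inverse (Y u') → Y u = Y₁ u := by
      rintro _ rfl L hL hL' he
      rw [← hL'] at he
      have := congrArg L he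
      exact ((hL.self_apply_inverse _).symm.trans (this.trans (hL.self_apply_inverse _))).symm
    exact h4 _ (hr u (hV hu.2)) _ h3.1 h3.2 h2

end Preserves

/-! ### Restriction of foliated diffeomorphisms to slices. -/

section SliceDiffeo

variable {n : ℕ} {M : Type*} [TopologicalSpace M]
  [ChartedSpace (EuclideanSpace ℝ (Fin n)) M] [IsManifold (𝓡 n) ∞ M] {F : SingularFoliation n M}
  {x y : M} {S : Slice F x} {S' : Slice F y}

/-- A local diffeomorphism between slices which is the restriction of a foliated local
diffeomorphism pulls back the induced foliations. -/
theorem pullsBackAt_slice {θ θ' : M → M} (h : IsFoliated F.toVFSheaf x y θ θ')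
    (f : LocalDiffeo S.dim S'.dim S.base S'.base)
    (hf : ∀ᶠ s in 𝓝 S.base, (f.toFun s : M) = θ s) :
    PullsBackAt S.foliation S'.foliation f.toFun S.base := by
  have hc : Tendsto (Subtype.val : S.carrier → M) (𝓝 S.base) (𝓝 x) :=
    continuous_subtype_val.tendsto S.base
  filter_upwards [eventually_eventually_nhds.2 f.eventually_contMDiffAt,
    eventually_eventually_nhds.2 f.eventually_isInvertible,
    eventually_eventually_nhds.2 hf, hc.eventually h.pulls,
    eventually_eventually_nhds.2 (hc.eventually h.smooth),
    eventually_eventually_nhds.2 (hc.eventually h.eventually_isInvertible)] with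
    s h1 h2 h3 h4 h5 h6 U hU Y hY
  obtain ⟨W, hsW, hWU, V, hV, m, g, X, hX, hYX⟩ := hY.2 _ hU
  have hθV : θ s ∈ V := by
    rw [← h3.self_of_nhds]
    exact hV hsW
  -- The sections of `F` extending `Y` are pulled back by `θ`; with the coefficients `g i ∘ f` they
  -- will extend the pullback of `Y` by `f`.
  choose U' hsU' X' hX' hXX' using fun i => h4 V hθV (X i) (hX i).2
  have hU'n : ∀ᶠ s' : S.carrier in 𝓝 s, ∀ i, (s' : M) ∈ U' i :=
    eventually_all.2 fun i => continuous_subtype_val.continuousAt.eventually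
      ((U' i).isOpen.mem_nhds (hsU' i))
  obtain ⟨A, hA, hAo, hsA⟩ := eventually_nhds_iff.1 (h1.and (h2.and ((eventually_eventually_nhds.2 h3).and
    (h5.and (h6.and (hU'n.and (h1.self_of_nhds.continuousAt.eventually
      (W.isOpen.mem_nhds hsW))))))))
  have hfA : ContMDiffOn (𝓡 S.dim) (𝓡 S'.dim) ∞ f.toFun A := fun z hz =>
    (hA z hz).1.contMDiffWithinAt
  refine ⟨⟨A, hAo⟩, hsA, VectorField.mpullback (𝓡 S.dim) (𝓡 S'.dim) f.toFun Y, ⟨?_, ?_⟩, ?_⟩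
  · exact SmoothVFieldOn.mpullback hAo W.isOpen (hY.1.mono hWU) hfA (fun z hz => (hA z hz).2.2.2.2.2.2)
      fun z hz => (hA z hz).2.1.1
  · refine fun s' hs' => ⟨⟨A, hAo⟩, hs', le_rfl, ⟨⋂ i, (U' i : Set M),
      isOpen_iInter_of_finite fun i => (U' i).isOpen⟩, fun z hz => mem_iInter.2
        (hA z hz).2.2.2.2.2.1, m, fun i z => g i (f.toFun z), X', fun i => ⟨?_, ?_⟩, fun z hz => ?_⟩
    · exact ContMDiffOn.comp (hX i).1 hfA fun z hz => (hA z hz).2.2.2.2.2.2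
    · exact F.restrict _ _ (fun z hz => mem_iInter.1 hz i) (hX' i)
    · obtain ⟨hz1, hz2, hz3, hz4, hz5, hz6, hz7⟩ := hA z hz
      -- The two sides are compared after applying the injective `Dθ`, where the identity `f = θ` on
      -- the slice, differentiated, reduces the claim to the expression of `Y` through the `X i`.
      refine hz5.1.injective ?_
      have e1 := hYX _ hz7
      have e2 := (hz4.mdifferentiableAt (by simp)).hasMFDerivAt.comp z
        (S.mdifferentiableAt_val z).hasMFDerivAt
      have e3 := (S'.mdifferentiableAt_val (f.toFun z)).hasMFDerivAt.comp z
        (hz1.mdifferentiableAt (by simp)).hasMFDerivAt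
      have e4 := (e3.congr_of_eventuallyEq (hz3.mono fun w hw => hw.symm)).mfderiv.symm.trans
        e2.mfderiv
      have e5 := congrArg (fun L : EuclideanSpace ℝ (Fin S.dim) →L[ℝ] EuclideanSpace ℝ (Fin n) =>
        L (VectorField.mpullback (𝓡 S.dim) (𝓡 S'.dim) f.toFun Y z)) e4.symm
      refine Eq.trans e5 ?_
      have e6 : mfderiv (𝓡 S.dim) (𝓡 S'.dim) f.toFun z
          (VectorField.mpullback (𝓡 S.dim) (𝓡 S'.dim) f.toFun Y z) = Y (f.toFun z) := by
        rw [VectorField.mpullback_apply, hz2.1.self_apply_inverse]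
      have e7 : ∀ i, (mfderiv (𝓡 n) (𝓡 n) θ (z : M) (X' i z) : EuclideanSpace ℝ (Fin n)) =
          X i (f.toFun z) := fun i => by
        have hcast : ∀ w w' : M, w = w' → (X i w : EuclideanSpace ℝ (Fin n)) = X i w' := by
          rintro w _ rfl; rfl
        exact ((hXX' i z (hz6 i)).2).trans (hcast _ _ hz3.self_of_nhds.symm)
      refine Eq.trans (congrArg (fun v : EuclideanSpace ℝ (Fin S'.dim) =>
        mfderiv (𝓡 S'.dim) (𝓡 n) (Subtype.val : S'.carrier → M) (f.toFun z) v) e6) ?_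
      refine Eq.trans e1 ?_
      have e8 : ∀ (L : EuclideanSpace ℝ (Fin n) →L[ℝ] EuclideanSpace ℝ (Fin n))
          (c : Fin m → ℝ) (v w : Fin m → EuclideanSpace ℝ (Fin n)), (∀ i, L (v i) = w i) →
          ∑ i, c i • w i = L (∑ i, c i • v i) := fun L c v w hL => by
        simp only [map_sum, map_smul, hL]
      exact e8 _ (fun i => g i (f.toFun z)) _ _ e7
  · intro z hz
    obtain ⟨hz1, hz2, hz3, hz4, hz5, hz6, hz7⟩ := hA z hz
    exact ⟨hWU hz7, by rw [VectorField.mpullback_apply, hz2.1.self_apply_inverse]⟩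

theorem LocalDiffeo.preserves_slice {θ θ' : M → M} (h : IsFoliated F.toVFSheaf x y θ θ')
    (f : LocalDiffeo S.dim S'.dim S.base S'.base)
    (hf : ∀ᶠ s in 𝓝 S.base, (f.toFun s : M) = θ s) :
    f.germ.Preserves S.foliation S'.foliation := by
  refine f.preserves (pullsBackAt_slice h f hf) (pullsBackAt_slice h.symm f.inv ?_)
  have hc : Tendsto (Subtype.val : S.carrier → M) (𝓝 S.base) (𝓝 x) :=
    continuous_subtype_val.tendsto S.base
  filter_upwards [f.inv.tendsto.eventually hf, f.inv_right,
    f.inv.tendsto.eventually (hc.eventually h.left_inv)] with s h1 h2 h3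
  rw [h2] at h1
  rw [h1, h3]

end SliceDiffeo

/-! ### Constant time-dependent elements and sections of the vanishing sheaf. -/

section Autonomous

variable {n : ℕ} {M : Type*} [TopologicalSpace M]
  [ChartedSpace (EuclideanSpace ℝ (Fin n)) M] [IsManifold (𝓡 n) ∞ M]

/-- A section, as a time-dependent element which is constant in time. -/
def TimeDep.const {F : VFSheaf n M} (Z : VField n M) (hZ : Z ∈ F.sections ⊤) : TimeDep F where
  toFun _ := Z
  mem _ := hZ
  plot _ _ := ⟨univ, isOpen_univ, mem_univ _, ⊤, trivial, 1, fun _ _ => 1, fun _ => Z,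
    fun _ => ⟨contMDiffOn_const, hZ⟩, fun _ _ y _ => by simp⟩

theorem VFSheaf.sum_smul_mem_vanishing (F : VFSheaf n M) {x : M} {U : Opens M} {m : ℕ}
    {f : Fin m → M → ℝ} {Y : Fin m → VField n M} (hf : ∀ i, SmoothFunOn n (f i) U)
    (hfx : ∀ i, f i x = 0) (hY : ∀ i, Y i ∈ F.sections U) :
    (fun z => ∑ i, f i z • Y i z) ∈ (F.vanishing x).sections U := fun _ hy =>
  ⟨U, hy, le_rfl, m, f, Y, fun i => ⟨hf i, fun _ => hfx i, hY i⟩, fun _ _ => rfl⟩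

end Autonomous

/-! ### Existence of the correction and of the holonomy germ. -/

section Holonomy

variable {n : ℕ} {M : Type*} [TopologicalSpace M] [T2Space M]
  [ChartedSpace (EuclideanSpace ℝ (Fin n)) M] [IsManifold (𝓡 n) ∞ M] {F : SingularFoliation n M}

omit [T2Space M] in
theorem FPath.timeOneFlow {G : VFSheaf n M} (P : FPath G) :
    TimeOneFlow P.X.toFun P.source P.target :=
  ⟨P.p, P.integral, rfl, rfl⟩

-- The slice carries the subspace topology, so the neighbourhood `O` of its base point contains the
-- trace of a neighbourhood in `M`.
omit [T2Space M] in
theorem SliceProjection.eventually_pr_eq {y : M} {S : Slice F y} (π : SliceProjection S) :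
    ∀ᶠ z in 𝓝 y, ∀ h : z ∈ S.carrier, π.pr z = ⟨z, h⟩ := by
  have h1 := π.O.isOpen.mem_nhds π.base_mem
  rw [nhds_subtype_eq_comap] at h1
  obtain ⟨A, hA, hAO⟩ := h1
  filter_upwards [hA] with z hz h
  exact π.pr_val ⟨z, h⟩ (hAO hz)

/-- The flow of an `I_y F`-field which moves the image of a slice onto another slice. -/
theorem SliceProjection.exists_correction {x y : M} {S₀ : Slice F x} {S : Slice F y}
    (π : SliceProjection S) {θ θ' : M → M} (h : IsFoliated F.toVFSheaf x y θ θ') :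
    ∃ Z : TimeDep (F.vanishing y), ∀ᶠ s : S₀.carrier in 𝓝 S₀.base,
      TimeOneFlow Z.toFun (θ s) (π.pr (θ s)) := by
  have hbase : π.pr (θ S₀.base) = S.base := by
    have : θ S₀.base = y := h.map
    rw [this, π.pr_base]
  set f : LocalDiffeo S₀.dim S.dim S₀.base S.base :=
    ⟨fun s => π.pr (θ s), π.isLocalDiffeomorphAt h, hbase⟩ with hf
  -- The curve from `θ s` to its projection has coefficients frozen at `θ s`. As `pr` is constant
  -- along it and `f = pr ∘ θ` is invertible on the slice, `θ s` equals `θ (f⁻¹ (pr z))` at every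
  -- point `z` of the curve. The coefficients thus become functions of `z`, and one autonomous field
  -- serves all `s`.
  set α : Fin π.A.m → M → ℝ := fun i z => -π.a i (θ (f.inv.toFun (π.pr z))) with hα
  have hc : Tendsto (Subtype.val : S₀.carrier → M) (𝓝 S₀.base) (𝓝 x) :=
    continuous_subtype_val.tendsto S₀.base
  have hprc : Tendsto π.pr (𝓝 y) (𝓝 S.base) := by
    have := (π.contMDiffAt_pr π.mem).continuousAt
    rwa [ContinuousAt, π.pr_base] at this
  have hθc : Tendsto (fun s : S₀.carrier => θ s) (𝓝 S₀.base) (𝓝 y) := h.tendsto.comp hc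
  have hk : Tendsto (fun z => f.inv.toFun (π.pr z)) (𝓝 y) (𝓝 S₀.base) := f.inv.tendsto.comp hprc
  have hαs : ∀ᶠ z in 𝓝 y, ∀ i, ContMDiffAt (𝓡 n) 𝓘(ℝ, ℝ) ∞ (α i) z := by
    filter_upwards [π.W.isOpen.mem_nhds π.mem, hprc.eventually f.inv.eventually_contMDiffAt,
      hk.eventually (hc.eventually h.smooth), hk.eventually (hθc.eventually
        (π.W.isOpen.mem_nhds π.mem))] with z h1 h2 h3 h4 i
    have h5 : ContMDiffAt (𝓡 n) 𝓘(ℝ, ℝ) ∞ (π.a i) (θ (f.inv.toFun (π.pr z))) :=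
      (π.a_smooth i _ h4).contMDiffAt (π.W.isOpen.mem_nhds h4)
    have h6 := h2.comp z (π.contMDiffAt_pr h1)
    have h7 := h3.comp z ((S₀.contMDiff_val _).comp z h6)
    exact ContMDiffAt.neg (h5.comp z h7)
  have hαy : ∀ i, α i y = 0 := fun i => by
    have h1 : θ (f.inv.toFun (π.pr y)) = y := by
      rw [π.pr_base, f.inv.map_base]
      exact h.map
    simp only [hα, h1, π.a_base, neg_zero]
  obtain ⟨B, hB, hBo, hyB⟩ := eventually_nhds_iff.1 (hαs.and (π.W.isOpen.mem_nhds π.mem))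
  -- The cut-off makes the field global. It equals one near `y`, where the curves are kept by the
  -- choice of `N` in `π.curve`.
  obtain ⟨χ, hχ, hχB, hχ1⟩ := exists_cutoff (n := n) (hBo.mem_nhds hyB)
  have hZ₀ : (fun z => ∑ i, α i z • π.A.G i z) ∈ (F.vanishing y).sections ⟨B, hBo⟩ :=
    F.sum_smul_mem_vanishing (fun i z hz => ((hB z hz).1 i).contMDiffWithinAt) hαy
      fun i => F.restrict _ _ (fun z hz => π.le (hB z hz).2) (π.A.G_mem i)
  refine ⟨TimeDep.const _ ((F.vanishing y).smul_mem_top hZ₀ hχ hχB), ?_⟩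
  filter_upwards [hθc.eventually (π.curve _ hχ1), f.inv_left] with s hs hs'
  obtain ⟨γ, h0, h1, hγ⟩ := hs
  rw [← h1]
  have key : TimeOneFlow (TimeDep.const _ ((F.vanishing y).smul_mem_top hZ₀ hχ hχB)).toFun
      (γ 0) (γ 1) := by
    refine timeOneFlow_of_curve fun t => ?_
    obtain ⟨h2, h3, h4, h5⟩ := hγ t t.2
    have h6 : (-∑ i, π.a i (θ s) • π.A.G i (γ t)) =
        (TimeDep.const _ ((F.vanishing y).smul_mem_top hZ₀ hχ hχB)).toFun t (γ t) := by
      show _ = χ (γ t) • ∑ i, α i (γ t) • π.A.G i (γ t)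
      have h2' : χ (γ t) = 1 := h2
      rw [h2', one_smul, ← Finset.sum_neg_distrib]
      refine Finset.sum_congr rfl fun i _ => ?_
      have h7 : f.inv.toFun (π.pr (θ s)) = s := hs'
      simp only [hα, h4, h7, neg_smul]
    rw [← h6]
    exact h5.mono (subset_univ _)
  rwa [h0] at key

theorem exists_corrects (S : ∀ x : M, Slice F x) (P : FPath F.toVFSheaf) :
    ∃ Z : TimeDep (F.vanishing P.target), Corrects S P Z := by
  obtain ⟨θ, θ', hθ⟩ := P.timeOneFlow.exists_transport F P.X.isPlot_reparam
  obtain ⟨π⟩ := (S P.target).exists_sliceProjection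
  obtain ⟨Z, hZ⟩ := π.exists_correction (S₀ := S P.source) hθ.isFoliated
  have hc : Tendsto (Subtype.val : (S P.source).carrier → M) (𝓝 (S P.source).base)
    (𝓝 P.source) := continuous_subtype_val.tendsto (S P.source).base
  refine ⟨Z, ?_⟩
  filter_upwards [hZ, hc.eventually hθ.flow] with s h1 h2
  exact ⟨_, _, h2.timeOneFlow P.X, h1, Subtype.coe_prop _⟩

/-- When `η ∘ θ` maps the slice into the other slice, it coincides there with `pr ∘ η ∘ θ`, which is
a local diffeomorphism between slices even without that assumption. The assumption enters to show
that this map is a restriction of `η ∘ θ`, hence preserves the foliations. Uniqueness of the germ is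
uniqueness of integral curves. -/
theorem existsUnique_represents (S : ∀ x : M, Slice F x) (P : FPath F.toVFSheaf)
    (Z : TimeDep (F.vanishing P.target)) (h : Corrects S P Z) :
    ∃! g : FolDiff (S P.source) (S P.target), Represents S P Z g := by
  have hX := P.X.isPlot_reparam
  have hZ : IsPlot F.toVFSheaf (reparam Z.toFun) := Z.isPlot_reparam.of_vanishing
  obtain ⟨θ, θ', hθ⟩ := P.timeOneFlow.exists_transport F hX
  obtain ⟨η, η', hη⟩ := Z.timeOneFlow_self.exists_transport F hZ
  obtain ⟨π⟩ := (S P.target).exists_sliceProjection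
  have hfol := hθ.isFoliated.trans hη.isFoliated
  have hc : Tendsto (Subtype.val : (S P.source).carrier → M) (𝓝 (S P.source).base)
    (𝓝 P.source) := continuous_subtype_val.tendsto (S P.source).base
  have hmap : π.pr ((η ∘ θ) (S P.source).base) = (S P.target).base := by
    rw [← π.pr_base]
    exact congrArg π.pr hfol.map
  have hflow : ∀ᶠ s : (S P.source).carrier in 𝓝 (S P.source).base,
      TimeOneFlow P.X.toFun s (θ s) ∧ TimeOneFlow Z.toFun (θ s) (η (θ s)) := by
    filter_upwards [hc.eventually hθ.flow, (hθ.tendsto.comp hc).eventually hη.flow] with s h1 h2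
    exact ⟨h1.timeOneFlow P.X, h2.timeOneFlow Z⟩
  have huniq : ∀ {s u v : M}, TimeOneFlow P.X.toFun s (θ s) → TimeOneFlow Z.toFun (θ s) (η (θ s)) →
      TimeOneFlow P.X.toFun s u → TimeOneFlow Z.toFun u v → v = η (θ s) := by
    intro s u v h1 h2 h3 h4
    obtain rfl := h3.unique F hX h1
    exact h4.unique F hZ h2
  set f : LocalDiffeo (S P.source).dim (S P.target).dim (S P.source).base (S P.target).base :=
    ⟨fun s => π.pr ((η ∘ θ) s), π.isLocalDiffeomorphAt hfol, hmap⟩ with hf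
  have hfθ : ∀ᶠ s in 𝓝 (S P.source).base, (f.toFun s : M) = (η ∘ θ) s := by
    filter_upwards [h, hflow, (hfol.tendsto.comp hc).eventually π.eventually_pr_eq] with s h1 h2 h3
    obtain ⟨u, v, hu, hv, hvS⟩ := h1
    obtain rfl := huniq h2.1 h2.2 hu hv
    exact congrArg Subtype.val (h3 hvS)
  refine ⟨⟨f.germ, f.preserves_slice hfol hfθ⟩, ⟨f, rfl, ?_⟩, ?_⟩
  · filter_upwards [hfθ, hflow] with s h1 h2
    exact ⟨_, h2.1, by rw [h1]; exact h2.2⟩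
  · rintro ⟨g, hg⟩ ⟨f', hf'g, hf'⟩
    refine Subtype.ext ?_
    rw [← hf'g]
    refine Quotient.sound ?_
    show ∀ᶠ s in 𝓝 (S P.source).base, f'.toFun s = f.toFun s
    filter_upwards [hf', hfθ, hflow] with s h1 h2 h3
    obtain ⟨u, hu, hv⟩ := h1
    exact Subtype.ext ((huniq h3.1 h3.2 hu hv).trans h2.symm)

end Holonomy

/-! ### Hadamard's lemma with a parameter. -/

section Hadamard

/-- Hadamard's lemma with a parameter: a smooth function which vanishes at `u₀` is near `u₀` a
combination of the coordinates. -/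
theorem ContDiffOn.exists_hadamard {d : ℕ} {f : ℝ × EuclideanSpace ℝ (Fin d) → ℝ}
    {O : Set (ℝ × EuclideanSpace ℝ (Fin d))} (hO : IsOpen O) (hf : ContDiffOn ℝ ∞ f O) {t₀ : ℝ}
    {u₀ : EuclideanSpace ℝ (Fin d)} (h₀ : (t₀, u₀) ∈ O) (hf₀ : ∀ᶠ τ in 𝓝 t₀, f (τ, u₀) = 0) :
    ∃ D : Fin d → ℝ × EuclideanSpace ℝ (Fin d) → ℝ, (∀ j, ContDiff ℝ ∞ (D j)) ∧
      ∀ᶠ p in 𝓝 (t₀, u₀), f p = ∑ j, (p.2 j - u₀ j) * D j p := by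
  obtain ⟨g, r, hr, hrO, hg, hgf⟩ := hf.exists_contDiff_eqOn_ball hO h₀
  have hg' : ContDiff ℝ ∞ (fderiv ℝ g) := hg.fderiv_right le_rfl
  set Γ : (ℝ × EuclideanSpace ℝ (Fin d)) → C(Icc (-1 : ℝ) 1, (ℝ × EuclideanSpace ℝ (Fin d))) := fun p =>
    constCurve (ℝ × EuclideanSpace ℝ (Fin d)) (p.1, u₀) + primitiveOp (ℝ × EuclideanSpace ℝ (Fin d)) (constCurve (ℝ × EuclideanSpace ℝ (Fin d)) (0, p.2 - u₀)) with hΓ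
  have hΓs : ContDiff ℝ ∞ Γ := by
    refine ContDiff.add ((constCurve (ℝ × EuclideanSpace ℝ (Fin d))).contDiff.comp (contDiff_fst.prodMk contDiff_const)) ?_
    exact (primitiveOp (ℝ × EuclideanSpace ℝ (Fin d))).contDiff.comp ((constCurve (ℝ × EuclideanSpace ℝ (Fin d))).contDiff.comp
      (contDiff_const.prodMk (contDiff_snd.sub contDiff_const)))
  have hΓa : ∀ p v, Γ p v = (p.1, u₀ + (v : ℝ) • (p.2 - u₀)) := by
    intro p v
    have h1 : primitiveOp (ℝ × EuclideanSpace ℝ (Fin d)) (constCurve (ℝ × EuclideanSpace ℝ (Fin d)) (0, p.2 - u₀)) v = (v : ℝ) • ((0, p.2 - u₀) : (ℝ × EuclideanSpace ℝ (Fin d))) := by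
      rw [primitiveOp_apply]
      have : ∀ s, IccExtend neg_one_le_one_real (constCurve (ℝ × EuclideanSpace ℝ (Fin d)) (0, p.2 - u₀)) s =
        ((0, p.2 - u₀) : (ℝ × EuclideanSpace ℝ (Fin d))) := fun s => rfl
      simp only [this, intervalIntegral.integral_const, sub_zero]
    rw [hΓ]
    simp only [ContinuousMap.add_apply, constCurve_apply, h1]
    simp
  -- `G p` is the average of `fderiv ℝ g` over the segment from `(τ, u₀)` to `p = (τ, u)`. Written
  -- with the primitive and superposition operators on the curve `Γ p`, it is smooth without
  -- differentiation under an integral.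
  set G : (ℝ × EuclideanSpace ℝ (Fin d)) → (ℝ × EuclideanSpace ℝ (Fin d)) →L[ℝ] ℝ := fun p => primitiveOp ((ℝ × EuclideanSpace ℝ (Fin d)) →L[ℝ] ℝ)
    (superposition _ (fderiv ℝ g) hg'.continuous (Γ p)) ⟨1, by norm_num⟩ with hG
  have hGs : ContDiff ℝ ∞ G := by
    have h1 : ContDiff ℝ ∞ (evalCurve ((ℝ × EuclideanSpace ℝ (Fin d)) →L[ℝ] ℝ) ⟨1, by norm_num⟩) :=
      ContinuousLinearMap.contDiff _
    have h2 := (primitiveOp ((ℝ × EuclideanSpace ℝ (Fin d)) →L[ℝ] ℝ)).contDiff.comp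
      ((contDiff_superposition hg').comp hΓs)
    exact h1.comp h2
  have hkey : ∀ p, g p - g (p.1, u₀) = G p (0, p.2 - u₀) := by
    intro p
    have hd : ∀ v ∈ uIcc (0 : ℝ) 1, HasDerivAt (fun v : ℝ => g (p.1, u₀ + v • (p.2 - u₀)))
        (fderiv ℝ g (p.1, u₀ + v • (p.2 - u₀)) (0, p.2 - u₀)) v := by
      intro v _
      have h1 : HasDerivAt (fun v : ℝ => ((p.1, u₀ + v • (p.2 - u₀)) :
          ℝ × EuclideanSpace ℝ (Fin d))) (0, p.2 - u₀) v := by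
        refine (hasDerivAt_const v p.1).prodMk ?_
        simpa using ((hasDerivAt_id v).smul_const (p.2 - u₀)).const_add u₀
      exact ((hg.differentiable (by simp)) _).hasFDerivAt.comp_hasDerivAt v h1
    have hcont : Continuous fun v : ℝ => fderiv ℝ g (p.1, u₀ + v • (p.2 - u₀)) :=
      hg'.continuous.comp (by fun_prop)
    have h2 := intervalIntegral.integral_eq_sub_of_hasDerivAt hd
      ((hcont.clm_apply continuous_const).intervalIntegrable _ _)
    have h3 : G p = ∫ v in (0 : ℝ)..1, fderiv ℝ g (p.1, u₀ + v • (p.2 - u₀)) := by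
      rw [hG]
      simp only [primitiveOp_apply]
      refine intervalIntegral.integral_congr fun v hv => ?_
      rw [uIcc_of_le zero_le_one] at hv
      have hv' : v ∈ Icc (-1 : ℝ) 1 := ⟨by linarith [hv.1], hv.2⟩
      simp only [IccExtend_of_mem _ _ hv', superposition_apply, hΓa]
    rw [h3, ContinuousLinearMap.intervalIntegral_apply (hcont.intervalIntegrable _ _), h2]
    simp
  refine ⟨fun j p => G p (0, EuclideanSpace.single j 1), fun j => hGs.clm_apply contDiff_const, ?_⟩
  filter_upwards [Metric.ball_mem_nhds (t₀, u₀) hr, continuous_fst.continuousAt.eventually hf₀]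
    with p hp hp₀
  have hpu : (p.1, u₀) ∈ Metric.ball (t₀, u₀) r := by
    rw [Metric.mem_ball, Prod.dist_eq, max_lt_iff] at hp ⊢
    exact ⟨hp.1, by simpa using hr⟩
  have h1 : ((0, p.2 - u₀) : (ℝ × EuclideanSpace ℝ (Fin d))) =
      ∑ j, (p.2 j - u₀ j) • ((0, EuclideanSpace.single j 1) : (ℝ × EuclideanSpace ℝ (Fin d))) := by
    refine Prod.ext ?_ ?_
    · simp only [Prod.fst_sum, Prod.smul_fst, smul_zero, Finset.sum_const_zero]
    · simp only [Prod.snd_sum, Prod.smul_snd]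
      ext i
      simp [Pi.single_apply]
  have h2 : f p = G p (0, p.2 - u₀) := by
    rw [← hkey p, hgf hp, hgf hpu, hp₀, sub_zero]
  rw [h2, h1, map_sum]
  exact Finset.sum_congr rfl fun j _ => by rw [map_smul, smul_eq_mul]

end Hadamard

/-! ### Time-dependent elements from local data by cut-off. -/

section Cutoff

variable {k : ℕ} {N : Type*} [TopologicalSpace N]
  [ChartedSpace (EuclideanSpace ℝ (Fin k)) N] [IsManifold (𝓡 k) ∞ N]

theorem exists_timeDep_of_cutoff {G : VFSheaf k N} {U : Opens N} {χ : N → ℝ}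
    (hχ : ContMDiff (𝓡 k) 𝓘(ℝ, ℝ) ∞ χ) (hχU : tsupport χ ⊆ U) {ι : Type*} [Fintype ι]
    {c : ι → ℝ × N → ℝ} {X : ι → VField k N}
    (hc : ∀ i, ContMDiffOn (𝓘(ℝ, ℝ).prod (𝓡 k)) 𝓘(ℝ, ℝ) ∞ (c i) (univ ×ˢ (U : Set N)))
    (hX : ∀ i, X i ∈ G.sections U) :
    ∃ Y : TimeDep G, ∀ t s, Y.toFun t s = χ s • ∑ i, c i ((t : ℝ), s) • X i s := by
  set e := (Fintype.equivFin ι).symm with he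
  have hs : ∀ t s, (∑ i, c i (t, s) • X i s) = ∑ i, c (e i) (t, s) • X (e i) s := fun t s =>
    (e.sum_comp fun i => c i (t, s) • X i s).symm
  refine ⟨⟨fun t s => χ s • ∑ i, c i ((t : ℝ), s) • X i s, fun t => ?_, fun t₀ x₀ => ?_⟩,
    fun t s => rfl⟩
  · refine G.smul_mem_top (X := fun s => ∑ i, c i ((t : ℝ), s) • X i s) ?_ hχ hχU
    refine G.congr U _ (G.sum_mem U (fun i s => c (e i) ((t : ℝ), s)) (fun i => X (e i))
      (fun i => ?_) fun i => hX _) _ fun s _ => hs _ s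
    exact (hc (e i)).comp (contMDiffOn_const.prodMk contMDiffOn_id) fun s hs => ⟨trivial, hs⟩
  · by_cases hx : x₀ ∈ tsupport χ
    · refine ⟨univ, isOpen_univ, trivial, U, hχU hx, Fintype.card ι,
        fun i p => χ p.2 * c (e i) p, fun i => X (e i), fun i => ⟨?_, hX _⟩, fun t _ s _ => ?_⟩
      · refine ContMDiffOn.mul (hχ.comp_contMDiffOn contMDiffOn_snd) ((hc (e i)).mono ?_)
        exact prod_mono (subset_univ _) le_rfl
      · simp only [hs, Finset.smul_sum, mul_smul]
    · refine ⟨univ, isOpen_univ, trivial, ⟨(tsupport χ)ᶜ, (isClosed_tsupport χ).isOpen_compl⟩, hx,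
        0, Fin.elim0, Fin.elim0, fun i => i.elim0, fun t _ s hs' => ?_⟩
      have : χ s = 0 := image_eq_zero_of_notMem_tsupport hs'
      simp [this]

end Cutoff

/-! ### Coefficients as functions of the projected point. -/

section Parametric

variable {n : ℕ} {M : Type*} [TopologicalSpace M]
  [ChartedSpace (EuclideanSpace ℝ (Fin n)) M] [IsManifold (𝓡 n) ∞ M] {F : SingularFoliation n M}
  {y : M} {S : Slice F y}

theorem hasFDerivAt_id_of_slices {D : Type*} [NormedAddCommGroup D] [NormedSpace ℝ D]
    {H : ℝ × D → ℝ × D} {t₀ : ℝ} {u₀ : D} (hH : DifferentiableAt ℝ H (t₀, u₀))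
    (h₁ : ∀ᶠ τ in 𝓝 t₀, H (τ, u₀) = (τ, u₀)) (h₂ : ∀ᶠ u in 𝓝 u₀, H (t₀, u) = (t₀, u)) :
    HasFDerivAt H (ContinuousLinearMap.id ℝ (ℝ × D)) (t₀, u₀) := by
  have e1 : fderiv ℝ H (t₀, u₀) ∘L ContinuousLinearMap.inl ℝ ℝ D =
      ContinuousLinearMap.inl ℝ ℝ D := by
    have h3 : HasFDerivAt (fun τ : ℝ => ((τ, u₀) : ℝ × D)) (ContinuousLinearMap.inl ℝ ℝ D) t₀ :=
      hasFDerivAt_prodMk_left t₀ u₀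
    exact (hH.hasFDerivAt.comp t₀ h3).unique (h3.congr_of_eventuallyEq h₁)
  have e2 : fderiv ℝ H (t₀, u₀) ∘L ContinuousLinearMap.inr ℝ ℝ D =
      ContinuousLinearMap.inr ℝ ℝ D := by
    have h3 : HasFDerivAt (fun u : D => ((t₀, u) : ℝ × D)) (ContinuousLinearMap.inr ℝ ℝ D) u₀ :=
      hasFDerivAt_prodMk_right t₀ u₀
    exact (hH.hasFDerivAt.comp u₀ h3).unique (h3.congr_of_eventuallyEq h₂)
  have e3 : fderiv ℝ H (t₀, u₀) = ContinuousLinearMap.id ℝ (ℝ × D) := by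
    refine ContinuousLinearMap.ext fun p => ?_
    have h4 : p = ContinuousLinearMap.inl ℝ ℝ D p.1 + ContinuousLinearMap.inr ℝ ℝ D p.2 := by
      simp
    rw [h4, map_add]
    exact congrArg₂ (· + ·) (DFunLike.congr_fun e1 p.1) (DFunLike.congr_fun e2 p.2)
  rw [← e3]
  exact hH.hasFDerivAt

/-- A smooth function along a family of sections of the projection, vanishing at the base point,
is a combination of the coordinates of the projected points. -/
theorem SliceProjection.exists_hadamard (π : SliceProjection S) {t₀ : ℝ} {m : ℝ → S.carrier → M}
    (hm : ∀ᶠ p in 𝓝 (t₀, S.base), ContMDiffAt (𝓘(ℝ, ℝ).prod (𝓡 S.dim)) (𝓡 n) ∞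
      (fun q : ℝ × S.carrier => m q.1 q.2) p)
    (hm₀ : ∀ᶠ s in 𝓝 S.base, π.pr (m t₀ s) = s) (hfix : ∀ᶠ τ in 𝓝 t₀, m τ S.base = y)
    {C : ℝ × M → ℝ}
    (hC : ∀ᶠ p in 𝓝 (t₀, y), ContMDiffAt (𝓘(ℝ, ℝ).prod (𝓡 n)) 𝓘(ℝ, ℝ) ∞ C p)
    (hC₀ : ∀ᶠ τ in 𝓝 t₀, C (τ, y) = 0) :
    ∃ D : Fin S.dim → ℝ × EuclideanSpace ℝ (Fin S.dim) → ℝ, (∀ j, ContDiff ℝ ∞ (D j)) ∧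
      ∀ᶠ p in 𝓝 (t₀, S.base), C (p.1, m p.1 p.2) =
        ∑ j, (chartAt (EuclideanSpace ℝ (Fin S.dim)) S.base (π.pr (m p.1 p.2)) j -
          chartAt (EuclideanSpace ℝ (Fin S.dim)) S.base S.base j) *
          D j (p.1, chartAt (EuclideanSpace ℝ (Fin S.dim)) S.base (π.pr (m p.1 p.2))) := by
  set ψ := chartAt (EuclideanSpace ℝ (Fin S.dim)) S.base with hψ
  set u₀ := ψ S.base with hu₀
  have hbψ : S.base ∈ ψ.source := mem_chart_source _ _
  have hut : u₀ ∈ ψ.target := ψ.map_source hbψ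
  have hm₀y : m t₀ S.base = y := hfix.self_of_nhds
  have hmc : Tendsto (fun q : ℝ × S.carrier => m q.1 q.2) (𝓝 (t₀, S.base)) (𝓝 y) := by
    have := hm.self_of_nhds.continuousAt
    rwa [ContinuousAt, hm₀y] at this
  have hprc : Tendsto π.pr (𝓝 y) (𝓝 S.base) := by
    have := (π.contMDiffAt_pr π.mem).continuousAt
    rwa [ContinuousAt, π.pr_base] at this
  have hsym : Tendsto (fun p : ℝ × EuclideanSpace ℝ (Fin S.dim) => (p.1, ψ.symm p.2))
      (𝓝 (t₀, u₀)) (𝓝 (t₀, S.base)) := by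
    have h1 : Tendsto ψ.symm (𝓝 u₀) (𝓝 S.base) := by
      have := ψ.continuousAt_symm hut
      rwa [ContinuousAt, ψ.left_inv hbψ] at this
    exact (continuous_fst.tendsto (t₀, u₀)).prodMk_nhds (h1.comp (continuous_snd.tendsto (t₀, u₀)))
  set mm : ℝ × EuclideanSpace ℝ (Fin S.dim) → M := fun p => m p.1 (ψ.symm p.2) with hmm
  have hmmc : Tendsto mm (𝓝 (t₀, u₀)) (𝓝 y) := hmc.comp hsym
  have hmms : ∀ᶠ p in 𝓝 (t₀, u₀), ContMDiffAt 𝓘(ℝ, ℝ × EuclideanSpace ℝ (Fin S.dim)) (𝓡 n) ∞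
      mm p := by
    filter_upwards [hsym.eventually hm, (continuous_snd.tendsto (t₀, u₀)).eventually
      (ψ.open_target.mem_nhds hut)] with p h1 h2
    have h3 : ContMDiffAt 𝓘(ℝ, ℝ × EuclideanSpace ℝ (Fin S.dim)) (𝓘(ℝ, ℝ).prod (𝓡 S.dim)) ∞
        (fun p : ℝ × EuclideanSpace ℝ (Fin S.dim) => (p.1, ψ.symm p.2)) p := by
      refine (contDiff_fst.contMDiff p).prodMk ?_
      have h4 := (contMDiffOn_chart_symm (n := ∞) (I := 𝓡 S.dim) p.2 h2).contMDiffAt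
        (ψ.open_target.mem_nhds h2)
      have h5 : ContMDiffAt 𝓘(ℝ, ℝ × EuclideanSpace ℝ (Fin S.dim)) (𝓡 S.dim) ∞
        (fun p : ℝ × EuclideanSpace ℝ (Fin S.dim) => p.2) p := contDiff_snd.contMDiff p
      exact ContMDiffAt.comp p h4 h5
    exact ContMDiffAt.comp p h1 h3
  -- `H` is the identity for `τ = t₀`, as `m t₀` is a section of `pr`, and on the line `u = u₀`, as
  -- the base point is fixed. So its derivative at `(t₀, u₀)` is the identity and `H` is locally
  -- invertible. Then `C' ∘ H⁻¹` depends on time and the projected point and vanishes at `u₀`: the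
  -- setting of Hadamard's lemma.
  set H : ℝ × EuclideanSpace ℝ (Fin S.dim) → ℝ × EuclideanSpace ℝ (Fin S.dim) := fun p =>
    (p.1, ψ (π.pr (mm p))) with hH
  set C' : ℝ × EuclideanSpace ℝ (Fin S.dim) → ℝ := fun p => C (p.1, mm p) with hC'
  have hHs : ∀ᶠ p in 𝓝 (t₀, u₀), ContDiffAt ℝ ∞ H p := by
    filter_upwards [hmms, hmmc.eventually (π.W.isOpen.mem_nhds π.mem),
      (hprc.comp hmmc).eventually (ψ.open_source.mem_nhds hbψ)] with p h1 h2 h3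
    have h4 := (contMDiffOn_chart (n := ∞) (I := 𝓡 S.dim) (π.pr (mm p)) h3).contMDiffAt
      (ψ.open_source.mem_nhds h3)
    have h5 : ContMDiffAt 𝓘(ℝ, ℝ × EuclideanSpace ℝ (Fin S.dim)) (𝓡 S.dim) ∞
      (fun p => ψ (π.pr (mm p))) p := ContMDiffAt.comp p h4 (ContMDiffAt.comp p (π.contMDiffAt_pr h2) h1)
    exact contDiffAt_fst.prodMk (contMDiffAt_iff_contDiffAt.1 h5)
  have hC's : ∀ᶠ p in 𝓝 (t₀, u₀), ContDiffAt ℝ ∞ C' p := by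
    have h1 : Tendsto (fun p : ℝ × EuclideanSpace ℝ (Fin S.dim) => (p.1, mm p)) (𝓝 (t₀, u₀))
      (𝓝 (t₀, y)) := (continuous_fst.tendsto (t₀, u₀)).prodMk_nhds hmmc
    filter_upwards [hmms, h1.eventually hC] with p h2 h3
    refine contMDiffAt_iff_contDiffAt.1 (ContMDiffAt.comp p h3 ?_)
    exact (contDiff_fst.contMDiff p).prodMk h2
  have hH₁ : ∀ᶠ τ in 𝓝 t₀, H (τ, u₀) = (τ, u₀) := by
    filter_upwards [hfix] with τ hτ
    simp only [hH, hmm, hu₀, ψ.left_inv hbψ, hτ, π.pr_base]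
  have hH₂ : ∀ᶠ u in 𝓝 u₀, H (t₀, u) = (t₀, u) := by
    have h1 : Tendsto ψ.symm (𝓝 u₀) (𝓝 S.base) := by
      have := ψ.continuousAt_symm hut
      rwa [ContinuousAt, ψ.left_inv hbψ] at this
    filter_upwards [h1.eventually hm₀, ψ.open_target.mem_nhds hut] with u h2 h3
    simp only [hH, hmm, h2, ψ.right_inv h3]
  have hH₀ : H (t₀, u₀) = (t₀, u₀) := hH₂.self_of_nhds
  obtain ⟨N, hN, hNo, h0N⟩ := eventually_nhds_iff.1 (hHs.and hC's)
  obtain ⟨e, h0e, heN, heH, hes⟩ := ContDiffOn.exists_openPartialHomeomorph hNo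
    (fun p hp => (hN p hp).1.contDiffWithinAt) h0N
    (ContinuousLinearEquiv.refl ℝ (ℝ × EuclideanSpace ℝ (Fin S.dim)))
    (hasFDerivAt_id_of_slices (hHs.self_of_nhds.differentiableAt (by simp)) hH₁ hH₂)
  have h0t : (t₀, u₀) ∈ e.target := by
    rw [← hH₀, ← heH]
    exact e.map_source h0e
  have hCs : ContDiffOn ℝ ∞ (C' ∘ e.symm) e.target :=
    ContDiffOn.comp (fun p hp => (hN p hp).2.contDiffWithinAt) hes
      fun p hp => heN (e.map_target hp)
  have hC₀' : ∀ᶠ τ in 𝓝 t₀, (C' ∘ e.symm) (τ, u₀) = 0 := by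
    have h1 : Tendsto (fun τ : ℝ => (τ, u₀)) (𝓝 t₀) (𝓝 (t₀, u₀)) :=
      (continuous_id.prodMk continuous_const).tendsto t₀
    filter_upwards [hH₁, h1.eventually (e.open_source.mem_nhds h0e), hC₀, hfix] with τ h2 h3 h4 h5
    have h6 : e.symm (τ, u₀) = (τ, u₀) := by
      conv_lhs => rw [← h2, ← heH]
      exact e.left_inv h3
    rw [Function.comp_apply, h6]
    simp only [hC', hmm, hu₀, ψ.left_inv hbψ, h5, h4]
  obtain ⟨D, hD, hDe⟩ := hCs.exists_hadamard e.open_target h0t hC₀'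
  refine ⟨D, hD, ?_⟩
  have hHc : Tendsto H (𝓝 (t₀, u₀)) (𝓝 (t₀, u₀)) := by
    have := hHs.self_of_nhds.continuousAt
    rwa [ContinuousAt, hH₀] at this
  have hψc : Tendsto (fun p : ℝ × S.carrier => (p.1, ψ p.2)) (𝓝 (t₀, S.base)) (𝓝 (t₀, u₀)) :=
    (continuous_fst.tendsto (t₀, S.base)).prodMk_nhds
      ((ψ.continuousAt hbψ).tendsto.comp (continuous_snd.tendsto (t₀, S.base)))
  filter_upwards [hψc.eventually (hHc.eventually hDe), hψc.eventually (e.open_source.mem_nhds h0e),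
    (continuous_snd.tendsto (t₀, S.base)).eventually (ψ.open_source.mem_nhds hbψ)] with p h1 h2 h3
  have h4 : e.symm (H (p.1, ψ p.2)) = (p.1, ψ p.2) := by
    rw [← heH]
    exact e.left_inv h2
  rw [Function.comp_apply, h4] at h1
  simpa only [hC', hmm, hH, ψ.left_inv h3] using h1

end Parametric

/-! ### Projected flows as flows on the slice. -/

section FlowStep

variable {n : ℕ} {M : Type*} [TopologicalSpace M] [T2Space M]
  [ChartedSpace (EuclideanSpace ℝ (Fin n)) M] [IsManifold (𝓡 n) ∞ M] {F : SingularFoliation n M}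
  {y : M} {S : Slice F y}

omit [T2Space M] in
/-- The projection of an integral curve to a slice. -/
theorem SliceProjection.hasVelocityWithinAt (π : SliceProjection S) {q : ℝ → M} {τ : ℝ}
    {v : TangentSpace (𝓡 n) (q τ)} (hq : HasVelocityWithinAt n q univ τ v) (hW : q τ ∈ π.W)
    {c : Fin π.A.m → ℝ} (hv : v = ∑ i, c i • π.A.G i (q τ)) :
    HasVelocityWithinAt S.dim (fun τ => π.pr (q τ)) univ τ
      (∑ k, (∑ i, c i * π.g i k (q τ)) • π.Y k (π.pr (q τ))) := by
  have h1 := hq.comp (π.mdifferentiableAt_pr hW)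
  have h2 : mfderiv (𝓡 n) (𝓡 S.dim) π.pr (q τ) v =
      ∑ k, (∑ i, c i * π.g i k (q τ)) • π.Y k (π.pr (q τ)) := by
    rw [hv, map_sum]
    simp only [map_smul, π.related _ hW, Finset.smul_sum, smul_smul, Finset.sum_smul]
    exact Finset.sum_comm
  exact h2 ▸ h1

/-- The curve `τ ↦ pr (Ψ τ (j s))` has velocity `∑ C k • Y k`, where `C k` is evaluated upstairs and
vanishes at `y` because `X` takes values in `I_y F`. For `τ` near `t₀` the point upstairs is
determined by its projection, so `C k` becomes a function on the slice. Hadamard's lemma separates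
it into smooth time-dependent coefficients and coordinate differences vanishing at the base point,
as required of a time-dependent element of `I_y F_S`. -/
theorem SliceProjection.exists_timeDep (π : SliceProjection S) {X : ℝ → VField n M}
    (hX : IsPlot (F.vanishing y) X) {t₀ δ : ℝ} (hδ : 0 < δ) {V : Opens M} (hyV : y ∈ V)
    {Ψ : ℝ → M → M}
    (hΨ : ContMDiffOn (𝓘(ℝ, ℝ).prod (𝓡 n)) (𝓡 n) ∞ (fun q : ℝ × M => Ψ q.1 q.2)
      (Metric.ball t₀ δ ×ˢ (V : Set M)))
    (hΨ₀ : ∀ x ∈ V, Ψ t₀ x = x)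
    (hflow : ∀ t ∈ Metric.ball t₀ δ, ∀ x ∈ V,
      HasVelocityWithinAt n (fun t => Ψ t x) univ t (X t (Ψ t x)))
    (hfix : ∀ᶠ t in 𝓝 t₀, Ψ t y = y) {j : S.carrier → M}
    (hj : ∀ᶠ s in 𝓝 S.base, ContMDiffAt (𝓡 S.dim) (𝓡 n) ∞ j s) (hj₀ : j S.base = y)
    (hpj : ∀ᶠ s in 𝓝 S.base, π.pr (j s) = s) :
    ∀ᶠ t in 𝓝 t₀, ∃ Y : TimeDep (S.foliation.vanishing S.base),
      ∀ᶠ s in 𝓝 S.base, TimeOneFlow Y.toFun s (π.pr (Ψ t (j s))) := by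
  set φ := chartAt (EuclideanSpace ℝ (Fin n)) y with hφ
  set ψ := chartAt (EuclideanSpace ℝ (Fin S.dim)) S.base with hψ
  have hyφ : y ∈ φ.source := mem_chart_source _ y
  have hbψ : S.base ∈ ψ.source := mem_chart_source _ _
  obtain ⟨O, c, hO, h0O, hOV, hc, hXc, hcv⟩ :=
    π.A.exists_coefficients π.A.generates_vanishing hX t₀
  have hjc : Tendsto j (𝓝 S.base) (𝓝 y) := by
    have := hj.self_of_nhds.continuousAt
    rwa [ContinuousAt, hj₀] at this
  have hjV : ∀ᶠ s in 𝓝 S.base, j s ∈ V := hjc.eventually (V.isOpen.mem_nhds hyV)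
  have hm : ∀ᶠ p in 𝓝 (t₀, S.base), ContMDiffAt (𝓘(ℝ, ℝ).prod (𝓡 S.dim)) (𝓡 n) ∞
      (fun q : ℝ × S.carrier => Ψ q.1 (j q.2)) p := by
    filter_upwards [(continuous_fst.tendsto (t₀, S.base)).eventually (Metric.ball_mem_nhds t₀ hδ),
      (continuous_snd.tendsto (t₀, S.base)).eventually (hj.and hjV)] with p h1 h2
    have h3 := (hΨ (p.1, j p.2) ⟨h1, h2.2⟩).contMDiffAt
      ((Metric.isOpen_ball.prod V.isOpen).mem_nhds ⟨h1, h2.2⟩)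
    have h4 : ContMDiffAt (𝓘(ℝ, ℝ).prod (𝓡 S.dim)) (𝓘(ℝ, ℝ).prod (𝓡 n)) ∞
        (fun q : ℝ × S.carrier => (q.1, j q.2)) p :=
      contMDiffAt_fst.prodMk (ContMDiffAt.comp p h2.1 contMDiffAt_snd)
    exact ContMDiffAt.comp p h3 h4
  have hm₀ : ∀ᶠ s in 𝓝 S.base, π.pr (Ψ t₀ (j s)) = s := by
    filter_upwards [hpj, hjV] with s h1 h2
    rw [hΨ₀ _ h2, h1]
  have hfix' : ∀ᶠ τ in 𝓝 t₀, Ψ τ (j S.base) = y := by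
    rw [hj₀]
    exact hfix
  have hmc : Tendsto (fun q : ℝ × S.carrier => Ψ q.1 (j q.2)) (𝓝 (t₀, S.base)) (𝓝 y) := by
    have := hm.self_of_nhds.continuousAt
    rwa [ContinuousAt, hfix'.self_of_nhds] at this
  set C : Fin π.A.m → ℝ × M → ℝ := fun k p => ∑ i, c (φ p.2, p.1) i * π.g i k p.2 with hC
  have hCO : ∀ᶠ p in 𝓝 (t₀, y), (φ p.2, p.1) ∈ O := by
    have h1 : Tendsto (fun p : ℝ × M => (φ p.2, p.1)) (𝓝 (t₀, y)) (𝓝 (φ y, t₀)) :=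
      ((φ.continuousAt hyφ).tendsto.comp (continuous_snd.tendsto (t₀, y))).prodMk_nhds
        (continuous_fst.tendsto (t₀, y))
    exact h1.eventually (hO.mem_nhds h0O)
  have hCs : ∀ k, ∀ᶠ p in 𝓝 (t₀, y),
      ContMDiffAt (𝓘(ℝ, ℝ).prod (𝓡 n)) 𝓘(ℝ, ℝ) ∞ (C k) p := by
    intro k
    filter_upwards [hCO, (continuous_snd.tendsto (t₀, y)).eventually (π.W.isOpen.mem_nhds π.mem)]
      with p h1 h2
    have h3 : p.2 ∈ φ.source := π.A.subset_source (π.le h2)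
    have h4 : ContMDiffAt (𝓘(ℝ, ℝ).prod (𝓡 n)) (𝓡 n) ∞ (fun p : ℝ × M => φ p.2) p :=
      ContMDiffAt.comp p ((contMDiffOn_chart (n := ∞) (I := 𝓡 n) p.2 h3).contMDiffAt
        (φ.open_source.mem_nhds h3)) contMDiffAt_snd
    have h5 : ContMDiffAt (𝓘(ℝ, ℝ).prod (𝓡 n)) 𝓘(ℝ, EuclideanSpace ℝ (Fin n) × ℝ) ∞
        (fun p : ℝ × M => (φ p.2, p.1)) p := h4.prodMk_space contMDiffAt_fst
    refine contMDiffAt_finsetSum fun i _ => ContMDiffAt.mul ?_ ?_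
    · have h6 : ContDiffAt ℝ ∞ (fun q => c q i) (φ p.2, p.1) :=
        contDiffAt_pi.1 (hc.contDiffAt (hO.mem_nhds h1)) i
      exact ContMDiffAt.comp p h6.contMDiffAt h5
    · exact ContMDiffAt.comp p ((π.g_smooth i k p.2 h2).contMDiffAt (π.W.isOpen.mem_nhds h2))
        contMDiffAt_snd
  have hC₀ : ∀ k, ∀ᶠ τ in 𝓝 t₀, C k (τ, y) = 0 := fun k => Eventually.of_forall fun τ => by
    have h1 : c (φ y, τ) = 0 := hcv trivial τ
    simp only [hC, h1, Pi.zero_apply, zero_mul, Finset.sum_const_zero]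
  choose D hD hDe using fun k =>
    π.exists_hadamard (m := fun τ s => Ψ τ (j s)) hm hm₀ hfix' (hCs k) (hC₀ k)
  obtain ⟨χ, hχ, hχU, hχ1⟩ := exists_cutoff (n := S.dim)
    ((π.O ⊓ ⟨ψ.source, ψ.open_source⟩).isOpen.mem_nhds ⟨π.base_mem, hbψ⟩)
  have hprc : Tendsto π.pr (𝓝 y) (𝓝 S.base) := by
    have := (π.contMDiffAt_pr π.mem).continuousAt
    rwa [ContinuousAt, π.pr_base] at this
  -- A product neighbourhood is needed: for a fixed `s` the conditions must hold at all times
  -- between `t₀` and `t` simultaneously.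
  have hgood : ∀ᶠ p in 𝓝 t₀ ×ˢ 𝓝 S.base, p.1 ∈ Metric.ball t₀ δ ∧ j p.2 ∈ V ∧
      Ψ p.1 (j p.2) ∈ π.W ∧ (φ (Ψ p.1 (j p.2)), p.1) ∈ O ∧ χ (π.pr (Ψ p.1 (j p.2))) = 1 ∧
      ∀ k, C k (p.1, Ψ p.1 (j p.2)) =
        ∑ i, (ψ (π.pr (Ψ p.1 (j p.2))) i - ψ S.base i) *
          D k i (p.1, ψ (π.pr (Ψ p.1 (j p.2)))) := by
    rw [← nhds_prod_eq]
    filter_upwards [(continuous_fst.tendsto (t₀, S.base)).eventually (Metric.ball_mem_nhds t₀ hδ),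
      (continuous_snd.tendsto (t₀, S.base)).eventually hjV,
      hmc.eventually (π.W.isOpen.mem_nhds π.mem),
      ((continuous_fst.tendsto (t₀, S.base)).prodMk_nhds hmc).eventually hCO,
      (hprc.comp hmc).eventually hχ1, eventually_all.2 hDe] with p h1 h2 h3 h4 h5 h6
    exact ⟨h1, h2, h3, h4, h5, h6⟩
  obtain ⟨P, hP, Q, hQ, hPQ⟩ := eventually_prod_iff.1 hgood
  obtain ⟨ε, hε, hεP⟩ := Metric.eventually_nhds_iff_ball.1 hP
  filter_upwards [Metric.ball_mem_nhds t₀ hε] with t ht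
  have htime : ∀ σ : unitInterval, t₀ + (σ : ℝ) * (t - t₀) ∈ Metric.ball t₀ ε := fun σ => by
    rw [Metric.mem_ball, Real.dist_eq] at ht ⊢
    rw [add_sub_cancel_left, abs_mul]
    refine lt_of_le_of_lt ?_ ht
    have h1 : |(σ : ℝ)| ≤ 1 := by
      rw [abs_of_nonneg σ.2.1]
      exact σ.2.2
    exact mul_le_of_le_one_left (abs_nonneg _) h1
  -- The times from `t₀` to `t` are rescaled to `[0,1]`, which gives the factor `t - t₀`.
  have hcs : ∀ i : Fin π.A.m × Fin S.dim, ContMDiffOn (𝓘(ℝ, ℝ).prod (𝓡 S.dim)) 𝓘(ℝ, ℝ) ∞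
      (fun p : ℝ × S.carrier => (t - t₀) * D i.1 i.2 (t₀ + p.1 * (t - t₀), ψ p.2))
      (univ ×ˢ ((π.O ⊓ ⟨ψ.source, ψ.open_source⟩ : Opens S.carrier) : Set S.carrier)) := by
    intro i
    refine contMDiffOn_const.mul ?_
    have h1 : ContMDiffOn (𝓘(ℝ, ℝ).prod (𝓡 S.dim)) 𝓘(ℝ, ℝ) ∞
        (fun p : ℝ × S.carrier => t₀ + p.1 * (t - t₀))
        (univ ×ˢ ((π.O ⊓ ⟨ψ.source, ψ.open_source⟩ : Opens S.carrier) : Set S.carrier)) :=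
      contMDiffOn_const.add (contMDiffOn_fst.mul contMDiffOn_const)
    have h2 : ContMDiffOn (𝓘(ℝ, ℝ).prod (𝓡 S.dim)) (𝓡 S.dim) ∞
        (fun p : ℝ × S.carrier => ψ p.2)
        (univ ×ˢ ((π.O ⊓ ⟨ψ.source, ψ.open_source⟩ : Opens S.carrier) : Set S.carrier)) :=
      (contMDiffOn_chart (x := S.base)).comp contMDiffOn_snd fun p hp => hp.2.2
    exact (hD i.1 i.2).contMDiff.comp_contMDiffOn (h1.prodMk_space h2)
  have hXs : ∀ i : Fin π.A.m × Fin S.dim, (fun s => (ψ s i.2 - ψ S.base i.2) • π.Y i.1 s) ∈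
      (S.foliation.vanishing S.base).sections (π.O ⊓ ⟨ψ.source, ψ.open_source⟩) := by
    intro i s hs
    refine ⟨_, hs, le_rfl, 1, fun _ s => ψ s i.2 - ψ S.base i.2, fun _ => π.Y i.1,
      fun _ => ⟨?_, fun _ => sub_self _, S.foliation.restrict _ _ inf_le_left (π.Y_mem i.1)⟩,
      fun s _ => by simp⟩
    refine ContMDiffOn.sub ?_ contMDiffOn_const
    have h1 : ContMDiff (𝓡 S.dim) 𝓘(ℝ, ℝ) ∞ (fun u : EuclideanSpace ℝ (Fin S.dim) => u i.2) :=
      (EuclideanSpace.proj (𝕜 := ℝ) i.2).contDiff.contMDiff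
    exact h1.comp_contMDiffOn ((contMDiffOn_chart (x := S.base)).mono fun s hs => hs.2)
  obtain ⟨Y, hY⟩ := exists_timeDep_of_cutoff hχ hχU hcs hXs
  refine ⟨Y, ?_⟩
  filter_upwards [hQ, hm₀] with s hs hs₀
  have key : TimeOneFlow Y.toFun ((fun σ : ℝ => π.pr (Ψ (t₀ + σ * (t - t₀)) (j s))) 0)
      ((fun σ : ℝ => π.pr (Ψ (t₀ + σ * (t - t₀)) (j s))) 1) := by
    refine timeOneFlow_of_curve (p := fun σ : ℝ => π.pr (Ψ (t₀ + σ * (t - t₀)) (j s))) ?_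
    intro σ
    set τ := t₀ + (σ : ℝ) * (t - t₀) with hτ
    obtain ⟨h1, h2, h3, h4, h5, h6⟩ := hPQ (hεP _ (htime σ)) hs
    have h7 : X τ (Ψ τ (j s)) = ∑ i, c (φ (Ψ τ (j s)), τ) i • π.A.G i (Ψ τ (j s)) := by
      have := hXc _ h4
      rwa [φ.left_inv (π.A.subset_source (π.le h3))] at this
    have h8 := π.hasVelocityWithinAt (hflow τ h1 _ h2) h3 h7
    have h9 : HasDerivWithinAt (fun σ : ℝ => t₀ + σ * (t - t₀)) (t - t₀) (Icc 0 1) σ := by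
      simpa using (((hasDerivAt_id (σ : ℝ)).mul_const (t - t₀)).const_add t₀).hasDerivWithinAt
    have h10 := HasVelocityWithinAt.comp_time (g := fun σ : ℝ => t₀ + σ * (t - t₀)) (τ := (σ : ℝ))
      h8 h9 (mapsTo_univ _ _)
    have h11 : (t - t₀) • ∑ k, (∑ i, c (φ (Ψ τ (j s)), τ) i * π.g i k (Ψ τ (j s))) •
        π.Y k (π.pr (Ψ τ (j s))) = Y.toFun σ (π.pr (Ψ τ (j s))) := by
      rw [hY, h5, one_smul, Fintype.sum_prod_type, Finset.smul_sum]
      refine Finset.sum_congr rfl fun k _ => ?_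
      have h12 := h6 k
      simp only [hC] at h12
      rw [h12, smul_smul, Finset.mul_sum, Finset.sum_smul]
      refine Finset.sum_congr rfl fun i _ => ?_
      rw [smul_smul]
      congr 1
      ring
    exact h11 ▸ h10
  simp only [zero_mul, add_zero, one_mul, add_sub_cancel, hs₀] at key
  exact key

end FlowStep

/-! ### Fields vanishing at a point fix it. -/

section FixedPoint

variable {n : ℕ} {M : Type*} [TopologicalSpace M]
  [ChartedSpace (EuclideanSpace ℝ (Fin n)) M] [IsManifold (𝓡 n) ∞ M]

theorem IsPlot.apply_eq_zero {G : VFSheaf n M} {y : M} {X : ℝ → VField n M}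
    (hX : IsPlot (G.vanishing y) X) (t : ℝ) : X t y = 0 := by
  obtain ⟨J, -, htJ, V, hyV, m, c, Y, hc, h⟩ := hX t y
  rw [h t htJ y hyV]
  exact Finset.sum_eq_zero fun i _ => by rw [G.vanishing_apply (hc i).2 hyV, smul_zero]

theorem IsPlot.hasVelocityWithinAt_const {G : VFSheaf n M} {y : M} {X : ℝ → VField n M}
    (hX : IsPlot (G.vanishing y) X) (J : Set ℝ) (t : ℝ) :
    HasVelocityWithinAt n (fun _ => y) J t (X t y) := by
  have h1 : ((1 : ℝ →L[ℝ] ℝ).smulRight (X t y) : ℝ →L[ℝ] TangentSpace (𝓡 n) y) = 0 := by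
    rw [hX.apply_eq_zero t]
    ext
    simp
  exact (hasMFDerivAt_const y t).hasMFDerivWithinAt.congr_mfderiv h1.symm

end FixedPoint

/-! ### Independence of the correction. -/

section Independence

variable {n : ℕ} {M : Type*} [TopologicalSpace M] [T2Space M]
  [ChartedSpace (EuclideanSpace ℝ (Fin n)) M] [IsManifold (𝓡 n) ∞ M] {F : SingularFoliation n M}
  {x y : M} {S₀ : Slice F x} {S : Slice F y}

/-- The local diffeomorphism between slices induced by a foliated local diffeomorphism. -/
noncomputable def SliceProjection.localDiffeo (S₀ : Slice F x) (π : SliceProjection S)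
    {θ θ' : M → M} (h : IsFoliated F.toVFSheaf x y θ θ') :
    LocalDiffeo S₀.dim S.dim S₀.base S.base where
  toFun s := π.pr (θ s)
  isLocalDiffeo := π.isLocalDiffeomorphAt h
  map_base := (congrArg π.pr h.map).trans π.pr_base

/-- Germs of maps between slices given by the flow of an `I_y F`-field at close times differ by an
element of the exponential group. -/
theorem SliceProjection.eventually_germ_eq (π : SliceProjection S) {X : ℝ → VField n M}
    (hX : IsPlot (F.vanishing y) X) {θ θ' : M → M} (h : IsFoliated F.toVFSheaf x y θ θ')
    {η η' : ℝ → M → M}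
    (hη : ∀ t ∈ Icc (0 : ℝ) 1, IsTransport F.toVFSheaf X 0 t y y (η t) (η' t)) {t₀ : ℝ}
    (ht₀ : t₀ ∈ Icc (0 : ℝ) 1) :
    ∀ᶠ t in 𝓝 t₀, ∀ ht : t ∈ Icc (0 : ℝ) 1, ∃ e ∈ expGroup S.foliation S.base,
      (π.localDiffeo S₀ (h.trans (hη t ht).isFoliated)).germ =
        e • (π.localDiffeo S₀ (h.trans (hη t₀ ht₀).isFoliated)).germ := by
  obtain ⟨δ, hδ, V, hyV, Ψ, hΨ, hflow, δ', hδ', hδδ, V', hVV, hyV', hinv, huniq⟩ :=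
    F.exists_evolution hX.of_vanishing t₀ y
  have h0δ : t₀ ∈ Metric.ball t₀ δ := Metric.mem_ball_self hδ
  have h0δ' : t₀ ∈ Metric.ball t₀ δ' := Metric.mem_ball_self hδ'
  -- Uniqueness is available forward in time only; for `t < t₀` it is applied to the evolution from
  -- `t` to `t₀`, which is then inverted.
  have hfix : ∀ᶠ t in 𝓝 t₀, Ψ t₀ t y = y := by
    filter_upwards [Metric.ball_mem_nhds t₀ hδ'] with t ht
    rcases le_total t₀ t with hle | hle
    · exact (huniq t₀ h0δ' t ht hle (fun _ => y) fun τ _ =>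
        ⟨hyV', hX.hasVelocityWithinAt_const _ τ⟩).symm
    · have h1 : y = Ψ t t₀ y := huniq t ht t₀ h0δ' hle (fun _ => y) fun τ _ =>
        ⟨hyV', hX.hasVelocityWithinAt_const _ τ⟩
      have h2 := (hinv t ht t₀ h0δ' y hyV').2
      rwa [← h1] at h2
  set f₀ := π.localDiffeo S₀ (h.trans (hη t₀ ht₀).isFoliated) with hf₀
  have hc : Tendsto (Subtype.val : S₀.carrier → M) (𝓝 S₀.base) (𝓝 x) :=
    continuous_subtype_val.tendsto S₀.base
  have hθc : Tendsto (fun s => θ (f₀.inv.toFun s)) (𝓝 S.base) (𝓝 y) :=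
    h.tendsto.comp (hc.comp f₀.inv.tendsto)
  have hstep := π.exists_timeDep hX hδ hyV (hΨ t₀ h0δ)
    (fun u hu => (hflow t₀ h0δ t₀ h0δ u hu).1) (fun t ht u hu => (hflow t₀ h0δ t ht u hu).2.1) hfix
    -- Since `f₀ = pr ∘ η t₀ ∘ θ` on the slice, this `j` is a section of `pr`. Continuing the flow
    -- from `t₀` to `t` and projecting gives `f ∘ f₀⁻¹`.
    (j := fun s => η t₀ (θ (f₀.inv.toFun s)))
    (by
      filter_upwards [f₀.inv.eventually_contMDiffAt,
        (hc.comp f₀.inv.tendsto).eventually h.smooth, hθc.eventually (hη t₀ ht₀).smooth]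
        with s h1 h2 h3
      exact ContMDiffAt.comp s h3 (ContMDiffAt.comp s h2
        (ContMDiffAt.comp s (S₀.contMDiff_val _) h1)))
    (by
      have h1 : θ (f₀.inv.toFun S.base) = y := by
        rw [f₀.inv.map_base]
        exact h.map
      rw [h1]
      exact (hη t₀ ht₀).map)
    f₀.inv_right
  filter_upwards [hstep, Metric.ball_mem_nhds t₀ hδ'] with t hY htδ' ht
  have htδ : t ∈ Metric.ball t₀ δ := Metric.ball_subset_ball hδδ htδ'
  obtain ⟨Y, hY⟩ := hY
  -- The evolution up to `t` factors through `t₀`; when `t ≤ t₀` the evolution up to `t₀` factors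
  -- through `t` instead, and the second factor is inverted.
  have hev : ∀ᶠ u in 𝓝 y, η t u = Ψ t₀ t (η t₀ u) := by
    have hrel : ∀ a ∈ Metric.ball t₀ δ, ∀ b ∈ Metric.ball t₀ δ, ∀ w ∈ V,
        FlowRel X a b w (Ψ a b w) := fun a ha b hb w hw =>
      ⟨fun τ => Ψ a τ w, (hflow a ha b hb w hw).1, rfl, fun τ hτ => by
        have hτb : τ ∈ Metric.ball t₀ δ := by
          rw [Real.ball_eq_Ioo] at ha hb ⊢
          exact ⟨ha.1.trans_le hτ.1, hτ.2.trans_lt hb.2⟩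
        exact (hflow a ha τ hτb w hw).2.1.mono (subset_univ _)⟩
    rcases le_total t₀ t with hle | hle
    · filter_upwards [(hη t ht).flow, (hη t₀ ht₀).flow,
        (hη t₀ ht₀).tendsto.eventually (V.isOpen.mem_nhds hyV)] with u h1 h2 h3
      exact h1.unique F hX.of_vanishing ht.1
        (h2.trans ht₀.1 hle (hrel t₀ h0δ t htδ _ h3))
    · filter_upwards [(hη t ht).flow, (hη t₀ ht₀).flow,
        (hη t ht).tendsto.eventually (V'.isOpen.mem_nhds hyV')] with u h1 h2 h3
      have h4 := h2.unique F hX.of_vanishing ht₀.1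
        (h1.trans ht.1 hle (hrel t htδ t₀ h0δ _ (hVV h3)))
      rw [h4, (hinv t htδ' t₀ h0δ' _ h3).2]
  set f := π.localDiffeo S₀ (h.trans (hη t ht).isFoliated) with hf
  refine ⟨(f.comp f₀.inv).germ, Subgroup.subset_closure ⟨Y, f.comp f₀.inv, rfl, ?_⟩, ?_⟩
  · filter_upwards [hY, hθc.eventually hev] with s h1 h2
    have h3 : (f.comp f₀.inv).toFun s = π.pr (Ψ t₀ t (η t₀ (θ (f₀.inv.toFun s)))) :=
      congrArg π.pr h2
    rw [h3]
    exact h1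
  · refine Quotient.sound ?_
    show ∀ᶠ s in 𝓝 S₀.base, f.toFun s = f.toFun (f₀.inv.toFun (f₀.toFun s))
    filter_upwards [f₀.inv_left] with s hs
    rw [hs]

/-- The germs of `pr ∘ η t ∘ θ` join `pr ∘ θ` at `t = 0` to `f` at `t = 1`; at the end no projection
takes place because `f` already has values in the slice. By `eventually_germ_eq` the orbit is
locally constant in `t`. -/
theorem SliceProjection.germ_mem_orbit (π : SliceProjection S) (Z : TimeDep (F.vanishing y))
    {θ θ' : M → M} (h : IsFoliated F.toVFSheaf x y θ θ')
    (f : LocalDiffeo S₀.dim S.dim S₀.base S.base)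
    (hf : ∀ᶠ s : S₀.carrier in 𝓝 S₀.base, TimeOneFlow Z.toFun (θ s) (f.toFun s)) :
    ∃ e ∈ expGroup S.foliation S.base, f.germ = e • (π.localDiffeo S₀ h).germ := by
  have hX := Z.isPlot_reparam
  have hη : ∀ t ∈ Icc (0 : ℝ) 1, ∃ η η', IsTransport F.toVFSheaf (reparam Z.toFun) 0 t y y η η' :=
    fun t ht => exists_transport F hX.of_vanishing ht.1 (q := fun _ => y)
      fun τ _ => hX.hasVelocityWithinAt_const _ τ
  have : Nonempty M := ⟨y⟩
  choose! η η' hη using hη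
  have h0 : (0 : ℝ) ∈ Icc (0 : ℝ) 1 := ⟨le_rfl, zero_le_one⟩
  have h1 : (1 : ℝ) ∈ Icc (0 : ℝ) 1 := ⟨zero_le_one, le_rfl⟩
  -- Lying in one orbit is a local condition on pairs of times, transitive by products and symmetric
  -- by inverses in the group; connectedness of `[0,1]` makes it hold for `0` and `1`.
  have key := isPreconnected_Icc.induction₂ (fun s t : ℝ => ∀ (hs : s ∈ Icc (0 : ℝ) 1)
    (ht : t ∈ Icc (0 : ℝ) 1), ∃ e ∈ expGroup S.foliation S.base,
      (π.localDiffeo S₀ (h.trans (hη t ht).isFoliated)).germ =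
        e • (π.localDiffeo S₀ (h.trans (hη s hs).isFoliated)).germ)
    (fun s hs => by
      refine nhdsWithin_le_nhds ?_
      filter_upwards [π.eventually_germ_eq (S₀ := S₀) hX h hη hs] with t ht hs' ht'
      exact ht ht')
    (fun r s t hr hs ht hrs hst hr' ht' => by
      obtain ⟨e, he, h2⟩ := hrs hr hs
      obtain ⟨e', he', h3⟩ := hst hs ht
      exact ⟨e' * e, mul_mem he' he, by rw [h3, h2, mul_smul]⟩)
    (fun s t hs ht hst ht' hs' => by
      obtain ⟨e, he, h2⟩ := hst hs ht
      exact ⟨e⁻¹, inv_mem he, by rw [h2, inv_smul_smul]⟩) h0 h1 h0 h1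
  obtain ⟨e, he, h2⟩ := key
  have hc : Tendsto (Subtype.val : S₀.carrier → M) (𝓝 S₀.base) (𝓝 x) :=
    continuous_subtype_val.tendsto S₀.base
  have h3 : (π.localDiffeo S₀ (h.trans (hη 0 h0).isFoliated)).germ = (π.localDiffeo S₀ h).germ := by
    refine Quotient.sound ?_
    show ∀ᶠ s : S₀.carrier in 𝓝 S₀.base, π.pr (η 0 (θ s)) = π.pr (θ s)
    filter_upwards [(h.tendsto.comp hc).eventually (hη 0 h0).flow] with s hs
    obtain ⟨q, hq, hq', -⟩ := hs
    exact congrArg π.pr (hq'.symm.trans hq)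
  have h4 : (π.localDiffeo S₀ (h.trans (hη 1 h1).isFoliated)).germ = f.germ := by
    refine Quotient.sound ?_
    show ∀ᶠ s : S₀.carrier in 𝓝 S₀.base, π.pr (η 1 (θ s)) = f.toFun s
    filter_upwards [hf, (h.tendsto.comp hc).eventually (hη 1 h1).flow,
      ((hη 1 h1).tendsto.comp (h.tendsto.comp hc)).eventually π.eventually_pr_eq] with s h5 h6 h7
    have h8 : η 1 (θ s) = f.toFun s :=
      FlowRel.unique F hX.of_vanishing zero_le_one h6 h5.flowRel
    have h9 := h7 (by
      show η 1 (θ s) ∈ S.carrier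
      rw [h8]
      exact Subtype.coe_prop _)
    exact h9.trans (Subtype.ext h8)
  exact ⟨e, he, by rw [← h4, h2, h3]⟩

/-- Both germs lie in the orbit of the germ of `pr ∘ θ`, which depends on the path and on a chosen
projection but not on the correcting element. -/
theorem toHT_eq_of_represents (S : ∀ x : M, Slice F x) (P : FPath F.toVFSheaf)
    (Z Z' : TimeDep (F.vanishing P.target)) (g g' : FolDiff (S P.source) (S P.target))
    (hg : Represents S P Z g) (hg' : Represents S P Z' g') : g.toHT S = g'.toHT S := by
  have hX := P.X.isPlot_reparam
  obtain ⟨θ, θ', hθ⟩ := P.timeOneFlow.exists_transport F hX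
  obtain ⟨π⟩ := (S P.target).exists_sliceProjection
  have hc : Tendsto (Subtype.val : (S P.source).carrier → M) (𝓝 (S P.source).base)
    (𝓝 P.source) := continuous_subtype_val.tendsto (S P.source).base
  have horb : ∀ (Z : TimeDep (F.vanishing P.target)) (g : FolDiff (S P.source) (S P.target)),
      Represents S P Z g → ∃ e ∈ expGroup (S P.target).foliation (S P.target).base,
        g.val = e • (π.localDiffeo (S P.source) hθ.isFoliated).germ := by
    rintro Z g ⟨f, hfg, hf⟩
    rw [← hfg]
    refine π.germ_mem_orbit Z hθ.isFoliated f ?_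
    filter_upwards [hf, hc.eventually hθ.flow] with s h1 h2
    obtain ⟨u, hu, hu'⟩ := h1
    obtain rfl := hu.unique F hX (h2.timeOneFlow P.X)
    exact hu'
  obtain ⟨e, he, h1⟩ := horb Z g hg
  obtain ⟨e', he', h2⟩ := horb Z' g' hg'
  refine congrArg (fun q => (⟨P.source, P.target, q⟩ : HT S)) (Quotient.sound ?_)
  refine ⟨⟨e * e'⁻¹, mul_mem he (inv_mem he')⟩, ?_⟩
  show (e * e'⁻¹) • g'.val = g.val
  rw [h1, h2, mul_smul, inv_smul_smul]

end Independence

theorem mainTheorem6 {n : ℕ} {M : Type*} [TopologicalSpace M] [T2Space M]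
    [SecondCountableTopology M] [ChartedSpace (EuclideanSpace ℝ (Fin n)) M]
    [IsManifold (𝓡 n) ∞ M] (F : SingularFoliation n M) (S : ∀ x : M, Slice F x) :
    -- every `F`-path admits a correcting time-dependent element of `I_{p(1)} F`
    (∀ P : FPath F.toVFSheaf, ∃ Z : TimeDep (F.vanishing P.target), Corrects S P Z) ∧
    -- each of them defines a unique germ in `Diff_F(S_{p(0)}, S_{p(1)})`
    (∀ (P : FPath F.toVFSheaf) (Z : TimeDep (F.vanishing P.target)), Corrects S P Z →
      ∃! g : FolDiff (S P.source) (S P.target), Represents S P Z g) ∧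
    -- the class of that germ does not depend on the correcting element
    (∀ (P : FPath F.toVFSheaf) (Z Z' : TimeDep (F.vanishing P.target))
      (g g' : FolDiff (S P.source) (S P.target)),
      Represents S P Z g → Represents S P Z' g' → g.toHT S = g'.toHT S) ∧
    -- hence there is exactly one map `Hol` with the defining property
    (∃! Hol : FPath F.toVFSheaf → HT S,
      ∀ (P : FPath F.toVFSheaf) (Z : TimeDep (F.vanishing P.target))
        (g : FolDiff (S P.source) (S P.target)), Represents S P Z g → Hol P = g.toHT S) := by
  refine ⟨exists_corrects S, existsUnique_represents S, toHT_eq_of_represents S, ?_⟩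
  choose Z hZ using exists_corrects S
  choose g hg _ using fun P => existsUnique_represents S P (Z P) (hZ P)
  refine ⟨fun P => (g P).toHT S, fun P Z' g' hg' =>
    toHT_eq_of_represents S P (Z P) Z' (g P) g' (hg P) hg', fun Hol hHol => ?_⟩
  exact funext fun P => hHol P (Z P) (g P) (hg P)
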